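/- **Setting.** Let $X$ be a (Hausdorff, second countable) complex manifold of dimension $n\ge 1$, and let $r:X\to\mathbb R$ be a smooth function such that $D=\{r<0\}$ is relatively compact, $\partial D=\{r=0\}$, $r$ is strictly plurisubharmonic in a neighbourhood $U$ of $\partial D$, $r$ has only non-degenerate critical points in $\overline D$, and the critical points of $r$ in $U$ lie on $\partial D$ ($dr$ may vanish on $\partial D$). Such a $D$ is a Henkin–Leiterer domain with Morse defining function $r$. Let $X$ carry a smooth Hermitian metric which near $\partial D$ equals $\sum \frac{\partial^2 r}{\partial\zeta_j\partial\bar\zeta_k}d\zeta_jd\bar\zeta_k$, with volume $dV$. Let $\rho(\zeta,z)\ge 0$ be symmetric, vanishing exactly on the diagonal, equal to the geodesic distance near the diagonal, with $\rho^2$ smooth on $X\times X$. Let $\chi$ be smooth on $X\times X$ with $\chi=1$ where $\rho^2\le c/2$ and $\chi=0$ where $\rho^2\ge 3c/4$, for some $c>0$. Put $\gamma=|\partial r|$, $r_\epsilon=r+\epsilon$, $D_\epsilon=\{r_\epsilon<0\}$, $$P_\epsilon(\zeta,z)=\rho^2(\zeta,z)+2\,\frac{r_\epsilon(\zeta)}{\gamma(\zeta)}\frac{r_\epsilon(z)}{\gamma(z)},\qquad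 \phi_\epsilon=\chi\,(F(\zeta,z)-r_\epsilon(\zeta))+(1-\chi)\rho^2,$$ $$F(\zeta,z)=\sum_j\frac{\partial r}{\partial\zeta_j}(\zeta)(\zeta_j-z_j)-\frac12\sum_{j,k}\frac{\partial^2r}{\partial\zeta_j\partial\zeta_k}(\zeta)(\zeta_j-z_j)(\zeta_k-z_k)$$ in local holomorphic coordinates. For a function $g(\zeta,z)$ let $g^*(\zeta,z)=g(z,\zeta)$; functions of one variable are taken at $\zeta$, and at $z$ if they carry a star. **Kernels of type $\tau$.** For $j\ge0$, $\alpha\in\mathbb Z$, $\mathscr E_{j,\alpha}$ denotes smooth double forms (possibly depending on $\epsilon$) with $|\mathscr E_{j,\alpha}(\zeta,z)|\le C|\xi_\alpha(\zeta)||\zeta-z|^j$, where $\xi_\alpha$ is smooth with $\gamma^m|D^m\xi_\alpha|\lesssim\gamma^\alpha$ for all $m\ge 0$ and $\xi_\alpha$, $C$ do not depend on $\epsilon$ (all this off the critical points of $r$). $R_N$ is a finite sum of $N$-fold products of first derivatives of $r$, with constant coefficients. A family $\mathscr A^\epsilon$ ($0<\epsilon<\epsilon_0$) of double forms on $\overline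 D_\epsilon\times\overline D_\epsilon$ is admissible of type $\tau\in\mathbb Z$ if 1. each $\mathscr A^\epsilon$ is smooth on $\overline D_\epsilon\times\overline D_\epsilon$ off the diagonal, and the family is bounded, uniformly in $\epsilon$, near every point of $\overline D\times\overline D$ off the diagonal; 2. every $\zeta_0\in\overline D$ has a coordinate neighbourhood $U$ such that for all $\epsilon\in(0,\epsilon_0)$, on $(U\cap\overline D_\epsilon)^2$, off the diagonal and the critical points of $r$, $\mathscr A^\epsilon$ or $\overline{\mathscr A^\epsilon}$ has the form $$R_NR_M^*\,\mathscr E_{j,\alpha}\mathscr E_{k,\beta}^*\,P_\epsilon^{-t_0}\phi_\epsilon^{t_1}\bar\phi_\epsilon^{t_2}\phi_\epsilon^{*t_3}\bar\phi_\epsilon^{*t_4}r_\epsilon^{l}r_\epsilon^{*m}$$ (the product $\mathscr E_{j,\alpha}\mathscr E^*_{k,\beta}$ may be a finite sum of products), with integers independent of $\epsilon$ satisfying $N,M,j,k,t_0,l,m\ge0$, $t:=-(t_1+t_2+t_3+t_4)\ge0$, $N+\alpha\ge0$, $M+\beta\ge0$, and with $\sigma-\max\{0,2-N-M-\alpha-\beta\}\ge\tau$,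 where $\sigma=2n+j+\min\{2,t-l-m\}-2(t_0+t-l-m)$. A double form $\mathscr A$ on $D\times D$ is a kernel of type $\tau$ if off the diagonal it is the pointwise limit as $\epsilon\to0^+$ of an admissible family of type $\tau$. Its operator is $(Af)(z)=\int_D\langle f(\zeta),\mathscr A(\zeta,z)\rangle\,dV(\zeta)$ on forms $f$, with the inner product of forms in the variable $\zeta$. **Statement.** Let $j\ge1$ be an integer and let $A_j$ be an operator of type $j$, i.e. with a kernel $\mathscr A_j$ of type $j$. If $1\le p,s\le\infty$ and $$\frac1s>\frac1p-\frac{j}{2n+2},$$ then $A_j$ maps $L^p(D)$ boundedly to $L^s(D)$: for every form $f\in L^p(D)$ the integral defining $A_jf(z)$ converges absolutely for almost every $z\in D$, $A_jf\in L^s(D)$, and $\|A_jf\|_{L^s(D)}\le C\|f\|_{L^p(D)}$ with $C$ independent of $f$. -/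

import Mathlib

open scoped Manifold ContDiff Topology Bundle ENNReal
open Set Filter MeasureTheory Bundle

noncomputable section

namespace HenkinLeiterer

/-- The model space `ℂⁿ` with its Euclidean norm. -/
abbrev Cn (n : ℕ) : Type := EuclideanSpace ℂ (Fin n)

/-- A complex manifold is in particular a smooth real manifold. -/
instance isManifold_real {n : ℕ} {X : Type*} [TopologicalSpace X] [ChartedSpace (Cn n) X]
    [h : IsManifold 𝓘(ℂ, Cn n) ω X] : IsManifold 𝓘(ℝ, Cn n) ∞ X := by
  refine isManifold_of_contDiffOn 𝓘(ℝ, Cn n) ∞ X fun e e' he he' => ?_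
  have := (contDiffGroupoid ω 𝓘(ℂ, Cn n)).mem_of_eqOnSource
    (HasGroupoid.compatible (G := contDiffGroupoid ω 𝓘(ℂ, Cn n)) he he') (Setoid.refl _)
  rw [contDiffGroupoid, mem_groupoid_of_pregroupoid] at this
  exact (this.1.restrict_scalars ℝ).of_le le_top

section Basic

variable {n : ℕ} {X : Type*} [TopologicalSpace X] [ChartedSpace (Cn n) X]

/-- The real tangent space of `X` at `x`. As everywhere in Mathlib, the underlying vector space is
the model space `ℂⁿ`, a vector being represented by its coordinates in the preferred
(holomorphic) chart `chartAt (Cn n) x`. -/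
abbrev Tan (n : ℕ) {X : Type*} [TopologicalSpace X] [ChartedSpace (Cn n) X] (x : X) : Type :=
  TangentSpace 𝓘(ℝ, Cn n) x

instance finiteDimensional_tan (x : X) : FiniteDimensional ℝ (Tan n x) :=
  inferInstanceAs (FiniteDimensional ℝ (Cn n))

/-- Multiplication by `i` on the tangent space of a complex manifold. -/
def mulI (x : X) (v : Tan n x) : Tan n x :=
  show Cn n from Complex.I • (show Cn n from v)

/-- Real coordinate directions of `ℂⁿ`: `(j, 0)` is `∂/∂x_j` and `(j, 1)` is `∂/∂y_j`. -/
def realDir {n : ℕ} (a : Fin n × Fin 2) : Cn n :=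
  EuclideanSpace.single a.1 (if a.2 = 0 then 1 else Complex.I)

/-- The Wirtinger derivative `∂f/∂z_j` on `ℂⁿ`. -/
def dz {n : ℕ} (j : Fin n) (f : Cn n → ℂ) (u : Cn n) : ℂ :=
  (1 / 2) * (fderiv ℝ f u (realDir (j, 0)) - Complex.I * fderiv ℝ f u (realDir (j, 1)))

/-- The Wirtinger derivative `∂f/∂z̄_j` on `ℂⁿ`. -/
def dzbar {n : ℕ} (j : Fin n) (f : Cn n → ℂ) (u : Cn n) : ℂ :=
  (1 / 2) * (fderiv ℝ f u (realDir (j, 0)) + Complex.I * fderiv ℝ f u (realDir (j, 1)))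

/-- The function `r` written in the chart `e`, as a complex valued function. -/
def inChart (e : OpenPartialHomeomorph X (Cn n)) (r : X → ℝ) (u : Cn n) : ℂ :=
  ((r (e.symm u) : ℝ) : ℂ)

/-- The hermitian Levi form `∑ (∂²r/∂ζ_j∂ζ̄_k) v_j w̄_k` of `r` at `x`. -/
def leviForm (r : X → ℝ) (x : X) (v w : Tan n x) : ℂ :=
  ∑ j, ∑ k, dz j (dzbar k (inChart (chartAt (Cn n) x) r)) (chartAt (Cn n) x x)
    * (show Cn n from v) j * (starRingEnd ℂ) ((show Cn n from w) k)

/-- The `(1,0)`-form `∂r` at `x`: the value `∑ (∂r/∂ζ_j) v_j` on a tangent vector `v`. -/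
def delR (r : X → ℝ) (x : X) (v : Tan n x) : ℂ :=
  ∑ j, dz j (inChart (chartAt (Cn n) x) r) (chartAt (Cn n) x x) * (show Cn n from v) j

/-- `x` is a critical point of `r`. -/
def IsCrit (n : ℕ) {X : Type*} [TopologicalSpace X] [ChartedSpace (Cn n) X]
    (r : X → ℝ) (x : X) : Prop :=
  fderiv ℝ (fun u => r ((chartAt (Cn n) x).symm u)) (chartAt (Cn n) x x) = 0

/-- The real Hessian of `r` in the preferred chart at `x` is nondegenerate. -/
def HasNondegenerateHessian (n : ℕ) {X : Type*} [TopologicalSpace X] [ChartedSpace (Cn n) X]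
    (r : X → ℝ) (x : X) : Prop :=
  ∀ v : Cn n,
    (∀ w : Cn n, fderiv ℝ (fderiv ℝ (fun u => r ((chartAt (Cn n) x).symm u)))
      (chartAt (Cn n) x x) v w = 0) → v = 0

/-- `D` is a Henkin--Leiterer domain with Morse defining function `r`: `D` is relatively compact,
`D = {r < 0}`, `∂D = {r = 0}`, `r` is smooth, strictly plurisubharmonic in a neighbourhood `U` of
`∂D`, all critical points of `r` in the closure of `D` are nondegenerate, and those in `U` lie
on `∂D`. The differential of `r` may vanish on `∂D`. -/
structure IsHenkinLeitererDomain (n : ℕ) {X : Type*} [TopologicalSpace X]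
    [ChartedSpace (Cn n) X] (D : Set X) (r : X → ℝ) : Prop where
  isCompact_closure : IsCompact (closure D)
  smooth : ContMDiff 𝓘(ℝ, Cn n) 𝓘(ℝ, ℝ) ∞ r
  eq_neg : D = {x | r x < 0}
  frontier_eq : frontier D = {x | r x = 0}
  morse : ∀ x ∈ closure D, IsCrit n r x → HasNondegenerateHessian n r x
  near_boundary : ∃ U : Set X, IsOpen U ∧ frontier D ⊆ U ∧
    (∀ x ∈ U, ∀ v : Tan n x, v ≠ 0 → 0 < (leviForm r x v v).re) ∧
    (∀ x ∈ U, IsCrit n r x → x ∈ frontier D)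

/-- The sublevel domain `D_ε = {r + ε < 0}`. -/
def subDomain (r : X → ℝ) (ε : ℝ) : Set X := {x | r x + ε < 0}

/-- The space of `ℂ`-valued alternating real `k`-forms on `ℂⁿ`. A differential form on `X` is a
function `f : X → Form n k`, where `f x` is regarded as an alternating form on `Tan n x`. -/
abbrev Form (n k : ℕ) : Type := Cn n [⋀^Fin k]→L[ℝ] ℂ

/-- Values of double forms: `k`-forms in the first variable with values in `l`-forms in the second
one. A double form on `X × X` is a function `A : X → X → DForm n k l`, where `A ζ z` is regarded as
a `k`-form on `Tan n ζ` with values in `l`-forms on `Tan n z`. -/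
abbrev DForm (n k l : ℕ) : Type := Cn n [⋀^Fin k]→L[ℝ] (Form n l)

/-- Complex conjugation of forms. -/
def conjForm {n l : ℕ} (f : Form n l) : Form n l :=
  (Complex.conjCLE : ℂ →L[ℝ] ℂ).compContinuousAlternatingMap f

/-- Complex conjugation of double forms. -/
def conjDForm {n k l : ℕ} (A : DForm n k l) : DForm n k l :=
  (ContinuousLinearMap.compContinuousAlternatingMapCLM ℝ (Cn n) ℂ ℂ (Fin l)
    (Complex.conjCLE : ℂ →L[ℝ] ℂ)).compContinuousAlternatingMap A

/-- The differential at `u` of the inverse of the chart `e`, mapping coordinate vectors at `u` to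
tangent vectors at `e.symm u`. -/
def coordTan (e : OpenPartialHomeomorph X (Cn n)) (u : Cn n) : Cn n →L[ℝ] Cn n :=
  show TangentSpace 𝓘(ℝ, Cn n) u →L[ℝ] Tan n (e.symm u) from
    mfderiv 𝓘(ℝ, Cn n) 𝓘(ℝ, Cn n) e.symm u

/-- The coordinate expression of a form in the chart `e`. -/
def coordForm {k : ℕ} (e : OpenPartialHomeomorph X (Cn n)) (f : X → Form n k) (u : Cn n) :
    Form n k :=
  (f (e.symm u)).compContinuousLinearMap (coordTan e u)

/-- The coordinate expression of a double form in a pair of charts. -/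
def coordDForm {k l : ℕ} (e e' : OpenPartialHomeomorph X (Cn n)) (A : X → X → DForm n k l)
    (u w : Cn n) : DForm n k l :=
  (ContinuousAlternatingMap.compContinuousLinearMapCLM (coordTan e' w)
    : Form n l →L[ℝ] Form n l).compContinuousAlternatingMap
      ((A (e.symm u) (e'.symm w)).compContinuousLinearMap (coordTan e u))

/-- The double form `A` is smooth, up to the boundary, on `S × S` minus the diagonal. -/
def SmoothOffDiagonal {k l : ℕ} (A : X → X → DForm n k l) (S : Set X) : Prop :=
  ∀ x y : X, ContDiffOn ℝ ∞
    (fun p : Cn n × Cn n =>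
      coordDForm (chartAt (Cn n) x) (chartAt (Cn n) y) A p.1 p.2)
    {p | p.1 ∈ (chartAt (Cn n) x).target ∧ p.2 ∈ (chartAt (Cn n) y).target ∧
      (chartAt (Cn n) x).symm p.1 ∈ S ∧ (chartAt (Cn n) y).symm p.2 ∈ S ∧
      (chartAt (Cn n) x).symm p.1 ≠ (chartAt (Cn n) y).symm p.2}

/-- An `N`-fold product of first derivatives of `r`, or a sum of such products, in the
coordinates `e`; the coefficients of the sum are `c`. -/
def derivProd (e : OpenPartialHomeomorph X (Cn n)) (r : X → ℝ) {N : ℕ}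
    (c : (Fin N → Fin n × Fin 2) → ℂ) (x : X) : ℂ :=
  ∑ σ : Fin N → Fin n × Fin 2,
    c σ * ∏ i, ((fderiv ℝ (fun u => r (e.symm u)) (e x) (realDir (σ i)) : ℝ) : ℂ)

/-- The Levi polynomial of `r` in the coordinates `e`. -/
def leviPolynomial (e : OpenPartialHomeomorph X (Cn n)) (r : X → ℝ) (ζ z : X) : ℂ :=
  (∑ j, dz j (inChart e r) (e ζ) * (e ζ j - e z j)) -
    (1 / 2) * ∑ j, ∑ k, dz j (dz k (inChart e r)) (e ζ) * (e ζ j - e z j) * (e ζ k - e z k)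

/-- The function `φ_ε = χ (F - r_ε(ζ)) + (1 - χ) ρ²` in the coordinates `e`. -/
def phi (e : OpenPartialHomeomorph X (Cn n)) (r : X → ℝ) (ρ χ : X → X → ℝ) (ε : ℝ) (ζ z : X) : ℂ :=
  (χ ζ z : ℂ) * (leviPolynomial e r ζ z - ((r ζ + ε : ℝ) : ℂ)) +
    (1 - (χ ζ z : ℂ)) * ((ρ ζ z ^ 2 : ℝ) : ℂ)

/-- The integers in a local representation of an admissible kernel, see `kernelFactor`. -/
structure Exponents where
  (N M j k t₀ l m : ℕ)
  (α β t₁ t₂ t₃ t₄ : ℤ)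
  t_nonneg : t₁ + t₂ + t₃ + t₄ ≤ 0
  weight_left : 0 ≤ (N : ℤ) + α
  weight_right : 0 ≤ (M : ℤ) + β

namespace Exponents

/-- The number `t = -(t₁ + t₂ + t₃ + t₄)`. -/
def t (q : Exponents) : ℤ := -(q.t₁ + q.t₂ + q.t₃ + q.t₄)

/-- The smooth type `2n + j + min {2, t-l-m} - 2 (t₀+t-l-m)`. -/
def smoothType (n : ℕ) (q : Exponents) : ℤ :=
  2 * n + q.j + min 2 (q.t - q.l - q.m) - 2 * (q.t₀ + q.t - q.l - q.m)

/-- The type: the smooth type minus `max {0, 2-N-M-α-β}`. -/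
def type (n : ℕ) (q : Exponents) : ℤ :=
  q.smoothType n - max 0 (2 - q.N - q.M - q.α - q.β)

end Exponents

/-- A patching function: smooth, equal to `1` where `ρ² ≤ c/2` and to `0` where `ρ² ≥ 3c/4`. -/
def IsPatching (n : ℕ) {X : Type*} [TopologicalSpace X] [ChartedSpace (Cn n) X]
    (ρ χ : X → X → ℝ) : Prop :=
  ContMDiff (𝓘(ℝ, Cn n).prod 𝓘(ℝ, Cn n)) 𝓘(ℝ, ℝ) ∞ (fun p : X × X => χ p.1 p.2) ∧
  ∃ c : ℝ, 0 < c ∧ (∀ x y, ρ x y ^ 2 ≤ c / 2 → χ x y = 1) ∧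
    (∀ x y, 3 / 4 * c ≤ ρ x y ^ 2 → χ x y = 0)

end Basic

section Metric

variable {n : ℕ} {X : Type*} [TopologicalSpace X] [ChartedSpace (Cn n) X]
  [RiemannianBundle (fun x : X => Tan n x)]

/-- The Riemannian metric is Hermitian and, in a neighbourhood of `∂D`, equal to the metric
`ds² = ∑ (∂²r/∂ζ_j∂ζ̄_k) dζ_j dζ̄_k`. -/
def IsLeviMetric (n : ℕ) {X : Type*} [TopologicalSpace X] [ChartedSpace (Cn n) X]
    [RiemannianBundle (fun x : X => Tan n x)] (D : Set X) (r : X → ℝ) : Prop :=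
  (∀ (x : X) (v w : Tan n x), inner ℝ (mulI x v) (mulI x w) = inner ℝ v w) ∧
  ∃ V : Set X, IsOpen V ∧ frontier D ⊆ V ∧
    ∀ x ∈ V, ∀ v w : Tan n x, inner ℝ v w = (leviForm r x v w).re

/-- `ρ` is symmetric, vanishes exactly on the diagonal and is positive elsewhere, coincides with the
geodesic distance near the diagonal, and is smooth (on the diagonal in the sense that `ρ²` is). -/
structure IsDistanceLike (n : ℕ) {X : Type*} [TopologicalSpace X] [ChartedSpace (Cn n) X]
    [RiemannianBundle (fun x : X => Tan n x)] (ρ : X → X → ℝ) : Prop where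
  symm : ∀ x y, ρ x y = ρ y x
  diag : ∀ x, ρ x x = 0
  pos : ∀ x y, x ≠ y → 0 < ρ x y
  smooth_sq : ContMDiff (𝓘(ℝ, Cn n).prod 𝓘(ℝ, Cn n)) 𝓘(ℝ, ℝ) ∞
    (fun p : X × X => ρ p.1 p.2 ^ 2)
  eq_geodesic : ∃ V : Set (X × X), IsOpen V ∧ (∀ x, (x, x) ∈ V) ∧
    ∀ p ∈ V, Manifold.riemannianEDist 𝓘(ℝ, Cn n) p.1 p.2 = ENNReal.ofReal (ρ p.1 p.2)

/-- `γ = |∂r|`, the norm of the covector `∂r`. -/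
def gam (n : ℕ) {X : Type*} [TopologicalSpace X] [ChartedSpace (Cn n) X]
    [RiemannianBundle (fun x : X => Tan n x)] (r : X → ℝ) (x : X) : ℝ :=
  sSup {a : ℝ | ∃ v : Tan n x, ‖v‖ ≤ 1 ∧ a = ‖delR r x v‖}

/-- `P_ε = ρ² + 2 (r_ε(ζ)/γ(ζ)) (r_ε(z)/γ(z))`. -/
def bigP (n : ℕ) {X : Type*} [TopologicalSpace X] [ChartedSpace (Cn n) X]
    [RiemannianBundle (fun x : X => Tan n x)] (r : X → ℝ) (ρ : X → X → ℝ) (ε : ℝ) (ζ z : X) : ℝ :=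
  ρ ζ z ^ 2 + 2 * ((r ζ + ε) / gam n r ζ) * ((r z + ε) / gam n r z)

/-- The Hermitian inner product of `k`-forms at `x` induced by the metric,
`(1/k!) ∑_σ f(b_σ) conj g(b_σ)` for an orthonormal basis `b` of the tangent space. -/
def formInner {k : ℕ} (x : X) (f g : Form n k) : ℂ :=
  ((k.factorial : ℂ))⁻¹ * ∑ σ : Fin k → Fin (Module.finrank ℝ (Tan n x)),
    f (fun i => stdOrthonormalBasis ℝ (Tan n x) (σ i)) *
      (starRingEnd ℂ) (g (fun i => stdOrthonormalBasis ℝ (Tan n x) (σ i)))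

/-- The pointwise norm of a `k`-form at `x`. -/
def formNorm {k : ℕ} (x : X) (f : Form n k) : ℝ := Real.sqrt (formInner x f f).re

/-- The pointwise norm of a double form at `(ζ, z)`. -/
def dformNorm {k l : ℕ} (ζ z : X) (A : DForm n k l) : ℝ :=
  Real.sqrt (((k.factorial : ℝ))⁻¹ * ∑ σ : Fin k → Fin (Module.finrank ℝ (Tan n ζ)),
    formNorm z (A (fun i => stdOrthonormalBasis ℝ (Tan n ζ) (σ i))) ^ 2)

/-- The pairing at `ζ` of a `k`-form `f` with a double form `A`: the inner product of `f` and `A` in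
the first variable, conjugate linear in `A`. The result is an `l`-form in the second variable. -/
def pairing {k l : ℕ} (ζ : X) (f : Form n k) (A : DForm n k l) : Form n l :=
  ((k.factorial : ℂ))⁻¹ • ∑ σ : Fin k → Fin (Module.finrank ℝ (Tan n ζ)),
    f (fun i => stdOrthonormalBasis ℝ (Tan n ζ) (σ i)) •
      conjForm (A (fun i => stdOrthonormalBasis ℝ (Tan n ζ) (σ i)))

/-- The square root of the Gram determinant of the metric in the coordinates `e` at `u`. -/
def volumeDensity (e : OpenPartialHomeomorph X (Cn n)) (u : Cn n) : ℝ :=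
  Real.sqrt (Matrix.det (Matrix.of fun a b : Fin n × Fin 2 =>
    inner ℝ (show Tan n (e.symm u) from coordTan e u (realDir a))
      (show Tan n (e.symm u) from coordTan e u (realDir b))))

/-- The Riemannian volume of the chart domain `e.source`, as a measure on `X`. -/
def chartVolume [MeasurableSpace X] (e : OpenPartialHomeomorph X (Cn n)) : Measure X :=
  ((volume.withDensity fun u => ENNReal.ofReal (volumeDensity e u)).restrict e.target).map e.symm

/-- The Riemannian volume measure `dV` of `X`. The measures of the chart domains agree on overlaps,
and `dV`, the measure that restricts to each of them, is their supremum. -/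
def riemVolume (n : ℕ) (X : Type*) [TopologicalSpace X] [ChartedSpace (Cn n) X]
    [RiemannianBundle (fun x : X => Tan n x)] [MeasurableSpace X] : Measure X :=
  ⨆ x : X, chartVolume (chartAt (Cn n) x)

/-- A form on `D` is measurable if its coordinate expressions are (almost everywhere). -/
def MeasurableForm {k : ℕ} (D : Set X) (f : X → Form n k) : Prop :=
  ∀ x : X, AEStronglyMeasurable (coordForm (chartAt (Cn n) x) f)
    (volume.restrict ((chartAt (Cn n) x).target ∩ (chartAt (Cn n) x).symm ⁻¹' D))

/-- The `L^p(D)` norm of a form. -/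
def lpNorm {k : ℕ} [MeasurableSpace X] (D : Set X) (p : ℝ≥0∞) (f : X → Form n k) : ℝ≥0∞ :=
  eLpNorm (fun x => formNorm x (f x)) p ((riemVolume n X).restrict D)

/-- The form `f` belongs to `L^p(D)`. -/
def MemLpForm {k : ℕ} [MeasurableSpace X] (D : Set X) (p : ℝ≥0∞) (f : X → Form n k) : Prop :=
  MeasurableForm D f ∧ lpNorm D p f < ⊤

/-- The operator with kernel `A`: `(A f)(z) = (f, A(·, z)) = ∫_D ⟨f(ζ), A(ζ, z)⟩ dV(ζ)`. -/
def kernelOp {k l : ℕ} [MeasurableSpace X] (D : Set X) (A : X → X → DForm n k l)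
    (f : X → Form n k) (z : X) : Form n l :=
  ∫ ζ in D, pairing ζ (f ζ) (A ζ z) ∂(riemVolume n X)

/-- Weight functions `ξ_k` on `U ∩ D`, outside of the critical points of `r`, in the coordinates
`e`: `γ^m |D^m ξ| ≲ γ^k` for every order `m` of differentiation. -/
def IsWeight (e : OpenPartialHomeomorph X (Cn n)) (U D : Set X) (r : X → ℝ) (k : ℤ)
    (ξ : X → ℝ) : Prop :=
  ContDiffOn ℝ ∞ (fun u => ξ (e.symm u)) (e '' {x | x ∈ U ∩ D ∧ ¬ IsCrit n r x}) ∧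
  ∀ m : ℕ, ∃ C : ℝ, ∀ x ∈ U ∩ D, ¬ IsCrit n r x →
    gam n r x ^ m * ‖iteratedFDeriv ℝ m (fun u => ξ (e.symm u)) (e x)‖ ≤ C * gam n r x ^ k

/-- The class `𝓔_{j,k}` of smooth coefficients with `|a(ζ,z)| ≲ ξ_k(ζ) |ζ - z|^j` on `U`,
in the coordinates `e`; the coefficients may depend on `ε`, the weight `ξ_k` and the constant
may not. -/
def IsClassE {V : Type*} [NormedAddCommGroup V] [NormedSpace ℝ V]
    (e : OpenPartialHomeomorph X (Cn n)) (U D : Set X) (r : X → ℝ) (ε₀ : ℝ) (j : ℕ) (k : ℤ)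
    (a : ℝ → X → X → V) : Prop :=
  ∃ ξ : X → ℝ, IsWeight e U D r k ξ ∧ ∃ C : ℝ, ∀ ε ∈ Ioo 0 ε₀,
    (let W : Set X := {x | x ∈ U ∩ closure (subDomain r ε) ∧ ¬ IsCrit n r x}
     ContDiffOn ℝ ∞ (fun p : Cn n × Cn n => a ε (e.symm p.1) (e.symm p.2))
        ((e '' W) ×ˢ (e '' W)) ∧
      ∀ ζ ∈ W, ∀ z ∈ W, ‖a ε ζ z‖ ≤ C * |ξ ζ| * ‖e ζ - e z‖ ^ j)

/-- The scalar factor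
`R_N R_M^* P_ε^{-t₀} φ_ε^{t₁} (φ̄_ε)^{t₂} (φ_ε^*)^{t₃} (φ̄_ε^*)^{t₄} r_ε^l (r_ε^*)^m`, where
`g^*(ζ, z) = g(z, ζ)` and functions of one variable are taken at `ζ`, those with a star at `z`. -/
def kernelFactor (e : OpenPartialHomeomorph X (Cn n)) (r : X → ℝ) (ρ χ : X → X → ℝ)
    (q : Exponents) (cN : (Fin q.N → Fin n × Fin 2) → ℂ) (cM : (Fin q.M → Fin n × Fin 2) → ℂ)
    (ε : ℝ) (ζ z : X) : ℂ :=
  derivProd e r cN ζ * derivProd e r cM z * (((bigP n r ρ ε ζ z)⁻¹ ^ q.t₀ : ℝ) : ℂ) *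
    phi e r ρ χ ε ζ z ^ q.t₁ * (starRingEnd ℂ) (phi e r ρ χ ε ζ z) ^ q.t₂ *
    phi e r ρ χ ε z ζ ^ q.t₃ * (starRingEnd ℂ) (phi e r ρ χ ε z ζ) ^ q.t₄ *
    (((r ζ + ε) ^ q.l : ℝ) : ℂ) * (((r z + ε) ^ q.m : ℝ) : ℂ)

/-- Near `(ζ₀, ζ₀)`, the family `A` or its conjugate is represented, in holomorphic coordinates and
uniformly for `0 < ε < ε₀`, as
`R_N R_M^* 𝓔_{j,α} 𝓔_{k,β}^* P_ε^{-t₀} φ_ε^{t₁} ⋯ r_ε^l (r_ε^*)^m` with type at least `τ`. The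
product `𝓔_{j,α} 𝓔_{k,β}^*` of double forms is written as a finite sum of products of scalar
coefficients in `𝓔_{j,α}` and double forms in `𝓔_{k,β}^*`; this covers the wedge product. -/
def HasLocalRep {k l : ℕ} (D : Set X) (r : X → ℝ) (ρ χ : X → X → ℝ) (ε₀ : ℝ) (τ : ℤ)
    (A : ℝ → X → X → DForm n k l) (ζ₀ : X) : Prop :=
  ∃ e ∈ IsManifold.maximalAtlas 𝓘(ℂ, Cn n) ω X, ∃ U : Set X, IsOpen U ∧ ζ₀ ∈ U ∧ U ⊆ e.source ∧
  ∃ q : Exponents, τ ≤ q.type n ∧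
  ∃ (cN : (Fin q.N → Fin n × Fin 2) → ℂ) (cM : (Fin q.M → Fin n × Fin 2) → ℂ)
    (d : ℕ) (a : Fin d → ℝ → X → X → ℂ) (b : Fin d → ℝ → X → X → DForm n k l),
    (∀ i, IsClassE e U D r ε₀ q.j q.α (a i)) ∧
    (∀ i, IsClassE e U D r ε₀ q.k q.β (b i)) ∧
    ∃ B : ℝ → X → X → DForm n k l,
      ((∀ ε ζ z, B ε ζ z = A ε ζ z) ∨ (∀ ε ζ z, B ε ζ z = conjDForm (A ε ζ z))) ∧
      ∀ ε ∈ Ioo 0 ε₀, ∀ ζ ∈ U ∩ closure (subDomain r ε), ∀ z ∈ U ∩ closure (subDomain r ε),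
        ζ ≠ z → ¬ IsCrit n r ζ → ¬ IsCrit n r z →
        coordDForm e e (B ε) (e ζ) (e z) =
          kernelFactor e r ρ χ q cN cM ε ζ z • ∑ i, a i ε ζ z • b i ε z ζ

/-- The family of double forms `A ε` on `closure D_ε × closure D_ε`, `ε` small, is an admissible
family of kernels of type (at least) `τ`: smooth off the diagonal, bounded uniformly in `ε` locally
off the diagonal, and with local representations of type at least `τ` at the diagonal. -/
structure IsAdmissibleFamily {k l : ℕ} (D : Set X) (r : X → ℝ) (ρ χ : X → X → ℝ) (τ : ℤ)
    (ε₀ : ℝ) (A : ℝ → X → X → DForm n k l) : Prop where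
  pos : 0 < ε₀
  smooth : ∀ ε ∈ Ioo 0 ε₀, SmoothOffDiagonal (A ε) (closure (subDomain r ε))
  bounded : ∀ ζ₀ ∈ closure D, ∀ z₀ ∈ closure D, ζ₀ ≠ z₀ →
    ∃ U ∈ 𝓝 ζ₀, ∃ V ∈ 𝓝 z₀, ∃ C : ℝ, ∀ ε ∈ Ioo 0 ε₀,
      ∀ ζ ∈ U ∩ closure (subDomain r ε), ∀ z ∈ V ∩ closure (subDomain r ε),
        dformNorm ζ z (A ε ζ z) ≤ C
  rep : ∀ ζ₀ ∈ closure D, HasLocalRep D r ρ χ ε₀ τ A ζ₀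

/-- `A` is a kernel of type `τ` on `D × D`: the pointwise limit, off the diagonal, of an admissible
family of kernels of type `τ` on the domains `D_ε` as `ε → 0`. -/
def IsKernelOfType {k l : ℕ} (D : Set X) (r : X → ℝ) (ρ χ : X → X → ℝ) (τ : ℤ)
    (A : X → X → DForm n k l) : Prop :=
  ∃ (ε₀ : ℝ) (F : ℝ → X → X → DForm n k l), IsAdmissibleFamily D r ρ χ τ ε₀ F ∧
    ∀ ζ ∈ D, ∀ z ∈ D, ζ ≠ z → Tendsto (fun ε => F ε ζ z) (𝓝[>] 0) (𝓝 (A ζ z))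

end Metric

end HenkinLeiterer

end

open HenkinLeiterer

/-! A pointwise bound of the kernel, uniform integrability of its powers in each variable, and an
inequality of Young type together give the theorem.

Pointwise bound. In coordinates near a point of the closure of `D` put h = ζ - z, let v be the
gradient ∂r at one of the two points, and Ψ = |⟨v,h⟩|/|v| + |h|². Off the critical points |A(ζ,z)| ≲
1 + |h|^(τ-2n+2) Ψ^(-2), with v taken at either point (`IsKernelOfType.exists_diagonal_bound`). This
comes from relations that are uniform in ε. Near a boundary point let Φ = |∂r(ζ)h| + |r_ε(ζ)| +
|r_ε(z)| + |h|², near an interior point Φ = 1. Strict plurisubharmonicity, or r < 0 at an interior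
point, makes |φ_ε| and |φ_ε^*| comparable with Φ; the term with r_ε/γ in P_ε gives Φ² ≲ P_ε; and,
decisively, (γ + |h|) Ψ ≲ Φ (`HasLocalData`, `PreKernelData`, `KernelData`). In
`exists_kernel_bound`, when t - l - m ≥ 2, two gradient factors, or powers of |h| in their place,
turn Φ^(-2) into Ψ^(-2); the term max{0, 2-N-M-α-β} of the type is the price of the missing gradient
factors. The other powers of Φ and P_ε are exchanged for powers of |h|. The constants do not depend
on ε, so the bound survives the limit.

Integration. Take a unitary basis whose distinguished vector is v/|v|, and put θ = 2 -
min(τ,2n+2)/(n+1). Then ∏|h_i|^θ times the pointwise bound is bounded (`exists_prod_rpow_mul_le`),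
so the q-th power of the kernel is dominated by ∏|h_i|^(-qθ), a product of planar singularities that
is integrable for qθ < 2. Unitary invariance of Lebesgue measure makes the integral independent of
v. Off the diagonal the kernel is bounded, the critical points are isolated by the Morse condition
and hence null, and compactness of the closure gives bounds of ∫|A|^q in one variable, uniform in
the other (`exists_lintegral_rpow_le`).

Conclusion. With 1/q = 1 - (1/p - 1/s), such bounds in both variables give L^p → L^s for p ≤ s
(`exists_eLpNorm_schur_le`), and qθ < 2 is the hypothesis on p and s. The case s < p uses the finite
volume of `D`; L^1 → L^∞ uses that the kernel is bounded once τ ≥ 2n+2.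

Measurability needs separate care, because forms are paired by means of orthonormal bases chosen
point by point. The pairing is rewritten with the inverse Gram matrix of a chart
(`pairing_comp_eq`), and finitely many charts are selected measurably (`exists_isFrameChoice`). -/

noncomputable section

namespace HenkinLeiterer

set_option linter.unusedSectionVars false

/-! ### Holomorphic charts, their differentials, and comparison with the metric. -/

section Charts

variable {n : ℕ} {X : Type*} [TopologicalSpace X] [ChartedSpace (Cn n) X]

/-- The holomorphic charts of `X`. -/
abbrev HolCharts (n : ℕ) (X : Type*) [TopologicalSpace X] [ChartedSpace (Cn n) X] :
    Set (OpenPartialHomeomorph X (Cn n)) :=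
  IsManifold.maximalAtlas 𝓘(ℂ, Cn n) ω X

variable {e e' : OpenPartialHomeomorph X (Cn n)}

theorem contDiffAt_transition (he : e ∈ HolCharts n X)
    (he' : e' ∈ HolCharts n X) {u : Cn n} (hu : u ∈ e.target) (hu' : e.symm u ∈ e'.source) :
    ContDiffAt ℂ ω (e' ∘ e.symm) u := by
  have := (contDiffGroupoid ω 𝓘(ℂ, Cn n)).mem_of_eqOnSource
    (IsManifold.compatible_of_mem_maximalAtlas he he') (Setoid.refl _)
  rw [contDiffGroupoid, mem_groupoid_of_pregroupoid] at this
  have h := this.1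
  simp only [contDiffPregroupoid] at h
  have h2 : ContDiffOn ℂ ω (e' ∘ e.symm) (e.symm.trans e').source := by
    simpa [Function.comp_def] using h
  exact h2.contDiffAt ((e.symm.trans e').open_source.mem_nhds (by simp [hu, hu']))

variable [IsManifold 𝓘(ℂ, Cn n) ω X]

theorem chartAt_mem_holCharts (x : X) : chartAt (Cn n) x ∈ HolCharts n X :=
  IsManifold.chart_mem_maximalAtlas x

/-- Allows real differential calculus in every holomorphic chart; local representations of kernels
are given in charts that need not be preferred ones. -/
theorem mem_real_maximalAtlas (he : e ∈ HolCharts n X) :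
    e ∈ IsManifold.maximalAtlas 𝓘(ℝ, Cn n) ∞ X := by
  rw [IsManifold.mem_maximalAtlas_iff]
  intro e' he'
  have H : ∀ {a b : OpenPartialHomeomorph X (Cn n)}, a ∈ HolCharts n X → b ∈ HolCharts n X →
      ContDiffOn ℝ ∞ (b ∘ a.symm) (a.symm.trans b).source := by
    intro a b ha hb u hu
    simp only [OpenPartialHomeomorph.trans_source, OpenPartialHomeomorph.symm_source,
      mem_inter_iff, mem_preimage] at hu
    exact (((contDiffAt_transition ha hb hu.1 hu.2).restrict_scalars ℝ).of_le
      le_top).contDiffWithinAt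
  have h' := IsManifold.subset_maximalAtlas (I := 𝓘(ℂ, Cn n)) (n := ω) he'
  constructor
  · rw [contDiffGroupoid, mem_groupoid_of_pregroupoid]
    constructor
    · simpa [contDiffPregroupoid, Function.comp_def] using H he h'
    · simpa [contDiffPregroupoid, Function.comp_def] using H h' he
  · rw [contDiffGroupoid, mem_groupoid_of_pregroupoid]
    constructor
    · simpa [contDiffPregroupoid, Function.comp_def] using H h' he
    · simpa [contDiffPregroupoid, Function.comp_def] using H he h'

theorem contDiffAt_real_transition (he : e ∈ HolCharts n X)
    (he' : e' ∈ HolCharts n X) {u : Cn n} (hu : u ∈ e.target) (hu' : e.symm u ∈ e'.source) :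
    ContDiffAt ℝ ∞ (e' ∘ e.symm) u :=
  ((contDiffAt_transition he he' hu hu').restrict_scalars ℝ).of_le le_top

theorem fderiv_transition_smul_I (he : e ∈ HolCharts n X)
    (he' : e' ∈ HolCharts n X) {u : Cn n} (hu : u ∈ e.target) (hu' : e.symm u ∈ e'.source)
    (v : Cn n) : fderiv ℝ (e' ∘ e.symm) u (Complex.I • v) =
      Complex.I • fderiv ℝ (e' ∘ e.symm) u v := by
  have h := (contDiffAt_transition he he' hu hu').differentiableAt (by simp)
  rw [h.fderiv_restrictScalars ℝ]
  simp

/-- A tangent vector at x is recorded in the preferred chart at x, so the differential of `e.symm`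
is the derivative of a transition map into a chart that moves with the base point. -/
theorem coordTan_eq_fderiv (he : e ∈ HolCharts n X) {u : Cn n} (hu : u ∈ e.target) :
    coordTan e u = fderiv ℝ (chartAt (Cn n) (e.symm u) ∘ e.symm) u := by
  have h1 : MDifferentiableAt 𝓘(ℝ, Cn n) 𝓘(ℝ, Cn n) e.symm u :=
    (contMDiffAt_symm_of_mem_maximalAtlas (mem_real_maximalAtlas he) hu).mdifferentiableAt
      (by simp)
  have h2 : (fderivWithin ℝ (writtenInExtChartAt 𝓘(ℝ, Cn n) 𝓘(ℝ, Cn n) u e.symm)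
      (range 𝓘(ℝ, Cn n)) (extChartAt 𝓘(ℝ, Cn n) u u)) =
      fderiv ℝ (chartAt (Cn n) (e.symm u) ∘ e.symm) u := by
    simp [writtenInExtChartAt, fderivWithin_univ, Function.comp_def]
    rfl
  exact h1.mfderiv.trans h2

theorem coordTan_smul_I (he : e ∈ HolCharts n X) {u : Cn n} (hu : u ∈ e.target) (v : Cn n) :
    coordTan e u (Complex.I • v) = Complex.I • coordTan e u v := by
  rw [coordTan_eq_fderiv he hu]
  exact fderiv_transition_smul_I he (chartAt_mem_holCharts _) hu (mem_chart_source _ _) v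

theorem coordTan_comp_transition (he : e ∈ HolCharts n X) (he' : e' ∈ HolCharts n X)
    {x : X} (hx : x ∈ e.source) (hx' : x ∈ e'.source) :
    coordTan e' (e' x) = (coordTan e (e x)).comp (fderiv ℝ (e ∘ e'.symm) (e' x)) := by
  have hu := e.map_source hx
  have hu' := e'.map_source hx'
  have c : e'.symm (e' x) = x := e'.left_inv hx'
  have c1 : e.symm (e x) = x := e.left_inv hx
  rw [coordTan_eq_fderiv he hu, coordTan_eq_fderiv he' hu', c, c1]
  have h1 : DifferentiableAt ℝ (e ∘ e'.symm) (e' x) :=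
    (contDiffAt_real_transition he' he hu' (by rwa [c])).differentiableAt (by simp)
  have h2 : DifferentiableAt ℝ (chartAt (Cn n) x ∘ e.symm) ((e ∘ e'.symm) (e' x)) := by
    have : (e ∘ e'.symm) (e' x) = e x := by simp [c]
    rw [this]
    exact (contDiffAt_real_transition he (chartAt_mem_holCharts x) hu
      (by rw [c1]; exact mem_chart_source _ _)).differentiableAt (by simp)
  have h3 : (chartAt (Cn n) x ∘ e'.symm) =ᶠ[𝓝 (e' x)]
      ((chartAt (Cn n) x ∘ e.symm) ∘ (e ∘ e'.symm)) := by
    have : e'.symm ⁻¹' e.source ∈ 𝓝 (e' x) :=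
      (e'.continuousAt_symm hu').preimage_mem_nhds
        (by rw [c]; exact e.open_source.mem_nhds hx)
    filter_upwards [this] with v hv
    simp [e.left_inv hv]
  rw [h3.fderiv_eq, fderiv_comp _ h2 h1]
  simp [c]

theorem fderiv_transition_comp (he : e ∈ HolCharts n X) (he' : e' ∈ HolCharts n X)
    {x : X} (hx : x ∈ e.source) (hx' : x ∈ e'.source) :
    (fderiv ℝ (e ∘ e'.symm) (e' x)).comp (fderiv ℝ (e' ∘ e.symm) (e x)) =
      ContinuousLinearMap.id ℝ (Cn n) := by
  have hu := e.map_source hx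
  have hu' := e'.map_source hx'
  have c : e'.symm (e' x) = x := e'.left_inv hx'
  have c1 : e.symm (e x) = x := e.left_inv hx
  have h1 : DifferentiableAt ℝ (e ∘ e'.symm) ((e' ∘ e.symm) (e x)) := by
    have : (e' ∘ e.symm) (e x) = e' x := by simp [c1]
    rw [this]
    exact (contDiffAt_real_transition he' he hu' (by rwa [c])).differentiableAt (by simp)
  have h2 : DifferentiableAt ℝ (e' ∘ e.symm) (e x) :=
    (contDiffAt_real_transition he he' hu (by rwa [c1])).differentiableAt (by simp)
  have h3 : ((e ∘ e'.symm) ∘ (e' ∘ e.symm)) =ᶠ[𝓝 (e x)] id := by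
    have : e.symm ⁻¹' e'.source ∈ 𝓝 (e x) :=
      (e.continuousAt_symm hu).preimage_mem_nhds
        (by rw [c1]; exact e'.open_source.mem_nhds hx')
    filter_upwards [this, e.open_target.mem_nhds hu] with v hv hv'
    simp [e'.left_inv hv, e.right_inv hv']
  have := h3.fderiv_eq (𝕜 := ℝ)
  rw [fderiv_comp _ h1 h2, fderiv_id] at this
  simpa [c1] using this

theorem coordTan_bijective (he : e ∈ HolCharts n X) {u : Cn n} (hu : u ∈ e.target) :
    Function.Bijective (coordTan e u) := by
  rw [coordTan_eq_fderiv he hu]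
  have hx := e.symm.map_source hu
  have A := fderiv_transition_comp he (chartAt_mem_holCharts (e.symm u)) hx (mem_chart_source _ _)
  have B := fderiv_transition_comp (chartAt_mem_holCharts (e.symm u)) he
    (mem_chart_source _ _) hx
  rw [e.right_inv hu] at A B
  exact ⟨Function.LeftInverse.injective (g := fderiv ℝ (e ∘ (chartAt (Cn n) (e.symm u)).symm)
      (chartAt (Cn n) (e.symm u) (e.symm u))) fun v => by
      simpa using congrArg (fun L : Cn n →L[ℝ] Cn n => L v) A,
    Function.RightInverse.surjective (g := fderiv ℝ (e ∘ (chartAt (Cn n) (e.symm u)).symm)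
      (chartAt (Cn n) (e.symm u) (e.symm u))) fun v => by
      simpa using congrArg (fun L : Cn n →L[ℝ] Cn n => L v) B⟩

section Riemannian

variable [RiemannianBundle (fun x : X => Tan n x)]

/-- The linear map `L`, regarded as a map to the tangent space at `x`, distorts norms by at most
the factor `C`. -/
def IsFrame (x : X) (L : Cn n →L[ℝ] Cn n) (C : ℝ) : Prop :=
  ∀ v : Cn n, ‖v‖ ≤ C * ‖(show Tan n x from L v)‖ ∧ ‖(show Tan n x from L v)‖ ≤ C * ‖v‖

theorem IsFrame.mono {x : X} {L : Cn n →L[ℝ] Cn n} {C C' : ℝ} (h : IsFrame x L C) (hC : C ≤ C') :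
    IsFrame x L C' := fun v =>
  ⟨(h v).1.trans (by gcongr), (h v).2.trans (by gcongr)⟩

variable [IsContMDiffRiemannianBundle 𝓘(ℝ, Cn n) ∞ (Cn n) (fun x : X => Tan n x)]

/-- `coordTan` is written in preferred charts that jump with the base point, so its continuity makes
sense only in the total space of the tangent bundle. There the tangent map of `e.symm` and the
metric are both continuous. -/
theorem continuousOn_inner_coordTan (he : e ∈ HolCharts n X) :
    ContinuousOn (fun p : Cn n × Cn n × Cn n =>
      inner ℝ (show Tan n (e.symm p.1) from coordTan e p.1 p.2.1)
        (show Tan n (e.symm p.1) from coordTan e p.1 p.2.2)) (e.target ×ˢ univ) := by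
  have hc : IsContinuousRiemannianBundle (Cn n) (fun x : X => Tan n x) := by
    obtain ⟨g, hg, h⟩ := IsContMDiffRiemannianBundle.exists_contMDiff (IB := 𝓘(ℝ, Cn n)) (n := ∞)
      (F := Cn n) (E := fun x : X => Tan n x)
    exact ⟨g, hg.continuous, h⟩
  have h1 : ContinuousOn (tangentMapWithin 𝓘(ℝ, Cn n) 𝓘(ℝ, Cn n) e.symm e.target)
      (TotalSpace.proj ⁻¹' e.target) :=
    (contMDiffOn_symm_of_mem_maximalAtlas (mem_real_maximalAtlas he)).continuousOn_tangentMapWithin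
      (by simp) e.open_target.uniqueMDiffOn
  have h2 : ∀ f : Cn n × Cn n × Cn n → Cn n, Continuous f →
      ContinuousOn (fun p : Cn n × Cn n × Cn n =>
        (⟨e.symm p.1, coordTan e p.1 (f p)⟩ : TotalSpace (Cn n) (fun x : X => Tan n x)))
        (e.target ×ˢ univ) := by
    intro f hf
    have h3 : Continuous (fun p : Cn n × Cn n × Cn n =>
        (⟨p.1, f p⟩ : TangentBundle 𝓘(ℝ, Cn n) (Cn n))) :=
      (tangentBundleModelSpaceHomeomorph 𝓘(ℝ, Cn n)).symm.continuous.comp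
        (continuous_fst.prodMk hf)
    refine ((h1.comp h3.continuousOn ?_).congr ?_)
    · intro p hp; exact hp.1
    · intro p hp
      simp only [Function.comp, tangentMapWithin, coordTan]
      rw [mfderivWithin_of_isOpen e.open_target hp.1]
      rfl
  exact (h2 _ continuous_snd.fst).inner_bundle (h2 _ continuous_snd.snd)

/-- On a closed ball times the unit sphere the length of the image vector is continuous, and
positive by injectivity; compactness pinches it between positive constants and homogeneity removes
the restriction to unit vectors. -/
theorem eventually_isFrame_coordTan (he : e ∈ HolCharts n X) {x₀ : X} (hx₀ : x₀ ∈ e.source) :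
    ∃ C > 0, ∀ᶠ x in 𝓝 x₀, IsFrame x (coordTan e (e x)) C := by
  have hu := e.map_source hx₀
  obtain ⟨R, hR, hball⟩ := Metric.nhds_basis_closedBall.mem_iff.1 (e.open_target.mem_nhds hu)
  have hcont := continuousOn_inner_coordTan (n := n) (X := X) he
  let q : Cn n × Cn n → ℝ := fun p =>
    ‖(show Tan n (e.symm p.1) from coordTan e p.1 p.2)‖
  have hq : ContinuousOn q (e.target ×ˢ univ) := by
    have h1 : ContinuousOn (fun p : Cn n × Cn n => Real.sqrt
      (inner ℝ (show Tan n (e.symm p.1) from coordTan e p.1 p.2)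
        (show Tan n (e.symm p.1) from coordTan e p.1 p.2))) (e.target ×ˢ univ) :=
      (hcont.comp (f := fun p : Cn n × Cn n => (p.1, p.2, p.2)) (by fun_prop)
        (fun p hp => ⟨hp.1, trivial⟩)).sqrt
    refine h1.congr fun p _ => ?_
    exact norm_eq_sqrt_real_inner _
  have hK : IsCompact (Metric.closedBall (e x₀) R ×ˢ Metric.sphere (0 : Cn n) 1) :=
    (isCompact_closedBall _ _).prod (isCompact_sphere _ _)
  have hsub : Metric.closedBall (e x₀) R ×ˢ Metric.sphere (0 : Cn n) 1 ⊆ e.target ×ˢ univ :=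
    prod_mono hball (subset_univ _)
  have hpos : ∀ p ∈ Metric.closedBall (e x₀) R ×ˢ Metric.sphere (0 : Cn n) 1, 0 < q p := by
    rintro ⟨u, v⟩ ⟨hu, hv⟩
    refine norm_pos_iff.2 fun h0 => ?_
    have : v = 0 := (coordTan_bijective he (hball hu)).1 (h0.trans (map_zero (coordTan e u)).symm)
    simp [this] at hv
  obtain ⟨C₁, hC₁⟩ := (hK.image_of_continuousOn (hq.mono hsub)).isBounded.exists_norm_le
  have hinv : ContinuousOn (fun p => (q p)⁻¹)
      (Metric.closedBall (e x₀) R ×ˢ Metric.sphere (0 : Cn n) 1) :=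
    (hq.mono hsub).inv₀ fun p hp => (hpos p hp).ne'
  obtain ⟨C₂, hC₂⟩ := (hK.image_of_continuousOn hinv).isBounded.exists_norm_le
  refine ⟨max 1 (max C₁ C₂), by positivity, ?_⟩
  have hev : ∀ᶠ x in 𝓝 x₀, x ∈ e.source ∧ e x ∈ Metric.closedBall (e x₀) R :=
    Filter.Eventually.and (e.open_source.mem_nhds hx₀)
      ((e.continuousAt hx₀).preimage_mem_nhds (Metric.closedBall_mem_nhds _ hR))
  filter_upwards [hev] with x ⟨hxs, hx⟩ v
  by_cases hv : v = 0
  · subst hv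
    have h0 : ‖(show Tan n x from coordTan e (e x) 0)‖ = 0 := by
      rw [map_zero]; exact norm_zero (E := Tan n x)
    rw [h0]; simp
  have hvn : 0 < ‖v‖ := norm_pos_iff.2 hv
  have hw : (‖v‖⁻¹ : ℝ) • v ∈ Metric.sphere (0 : Cn n) 1 := by
    simp [norm_smul, hvn.ne']
  have hp : (e x, (‖v‖⁻¹ : ℝ) • v) ∈ Metric.closedBall (e x₀) R ×ˢ Metric.sphere (0 : Cn n) 1 :=
    ⟨hx, hw⟩
  have e1 : q (e x, (‖v‖⁻¹ : ℝ) • v) = ‖v‖⁻¹ * ‖(show Tan n x from coordTan e (e x) v)‖ := by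
    simp only [q]
    rw [e.left_inv hxs, map_smul]
    exact (norm_smul (‖v‖⁻¹ : ℝ) (show Tan n x from coordTan e (e x) v)).trans (by simp)
  have b1 := hC₁ _ ⟨_, hp, rfl⟩
  have b2 := hC₂ _ ⟨_, hp, rfl⟩
  have hp0 := hpos _ hp
  simp only [e1, Real.norm_eq_abs] at b1 b2
  rw [e1] at hp0
  rw [abs_of_pos hp0] at b1
  rw [abs_of_pos (inv_pos.2 hp0)] at b2
  have hN : 0 < ‖(show Tan n x from coordTan e (e x) v)‖ := by
    by_contra hcon
    have : ‖v‖⁻¹ * ‖(show Tan n x from coordTan e (e x) v)‖ ≤ 0 :=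
      mul_nonpos_of_nonneg_of_nonpos (by positivity) (not_lt.1 hcon)
    linarith
  constructor
  · have : ‖v‖ ≤ C₂ * ‖(show Tan n x from coordTan e (e x) v)‖ := by
      rw [mul_inv, inv_inv] at b2
      rwa [← div_le_iff₀ hN, div_eq_mul_inv]
    exact this.trans (by gcongr; exact (le_max_right _ _).trans (le_max_right _ _))
  · have : ‖(show Tan n x from coordTan e (e x) v)‖ ≤ C₁ * ‖v‖ := by
      rwa [← div_le_iff₀ hvn, div_eq_inv_mul]
    exact this.trans (by gcongr; exact (le_max_left _ _).trans (le_max_right _ _))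

end Riemannian

end Charts

/-! ### Real coordinates on `ℂⁿ`. -/

/-- The real coordinates `(x_j, y_j)` on `ℂⁿ`. -/
def realCoordEquiv (n : ℕ) : Cn n ≃ₗ[ℝ] (Fin n × Fin 2 → ℝ) where
  toFun v a := if a.2 = 0 then (v a.1).re else (v a.1).im
  invFun c := WithLp.toLp 2 fun j => (⟨c (j, 0), c (j, 1)⟩ : ℂ)
  map_add' v w := by
    ext ⟨j, a⟩; fin_cases a <;> simp
  map_smul' c v := by
    ext ⟨j, a⟩; fin_cases a <;> simp
  left_inv v := by
    ext j; simp
  right_inv c := by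
    ext ⟨j, a⟩; fin_cases a <;> simp

/-- The basis of `ℂⁿ` over `ℝ` consisting of the real coordinate directions. -/
def realBasis (n : ℕ) : Module.Basis (Fin n × Fin 2) ℝ (Cn n) :=
  Module.Basis.ofEquivFun (realCoordEquiv n)

theorem realBasis_apply {n : ℕ} (a : Fin n × Fin 2) : realBasis n a = realDir a := by
  rw [realBasis, Module.Basis.coe_ofEquivFun]
  obtain ⟨j, b⟩ := a
  change (realCoordEquiv n).symm _ = _
  ext i
  fin_cases b
  · by_cases h : i = j
    · subst h; simp [realCoordEquiv, realDir, Complex.ext_iff]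
    · simp [realCoordEquiv, realDir, Complex.ext_iff, h]
  · by_cases h : i = j
    · subst h; simp [realCoordEquiv, realDir, Complex.ext_iff]
    · simp [realCoordEquiv, realDir, Complex.ext_iff, h]

/-! ### The Riemannian volume against Lebesgue measure in charts. -/

section Volume

variable {n : ℕ} {X : Type*} [TopologicalSpace X] [ChartedSpace (Cn n) X]
  [RiemannianBundle (fun x : X => Tan n x)]

/-- The Gram matrix of the metric in the coordinates `e`. -/
def gramMatrix (x : X) (L : Cn n →L[ℝ] Cn n) : Matrix (Fin n × Fin 2) (Fin n × Fin 2) ℝ :=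
  Matrix.of fun a b => inner ℝ (show Tan n x from L (realDir a)) (show Tan n x from L (realDir b))

theorem gram_comp {T : Type*} [NormedAddCommGroup T] [InnerProductSpace ℝ T] (L : Cn n →ₗ[ℝ] T)
    (J : Cn n →ₗ[ℝ] Cn n) :
    Matrix.gram ℝ (fun a => L (J (realDir a))) =
      (LinearMap.toMatrix (realBasis n) (realBasis n) J).transpose *
        Matrix.gram ℝ (fun a => L (realDir a)) *
        LinearMap.toMatrix (realBasis n) (realBasis n) J := by
  set M := LinearMap.toMatrix (realBasis n) (realBasis n) J with hM
  have hJ : ∀ a, L (J (realDir a)) = ∑ i, M i a • L (realDir i) := by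
    intro a
    have : J (realDir a) = ∑ i, M i a • realDir i := by
      have := (realBasis n).sum_repr (J (realDir a))
      rw [← this]
      refine Finset.sum_congr rfl fun i _ => ?_
      rw [hM, LinearMap.toMatrix_apply, realBasis_apply, realBasis_apply]
    rw [this, map_sum]
    exact Finset.sum_congr rfl fun i _ => map_smul L _ _
  ext a b
  simp only [Matrix.gram_apply, Matrix.mul_apply, Matrix.transpose_apply]
  rw [hJ a, hJ b]
  simp only [sum_inner, inner_sum, inner_smul_left, inner_smul_right]
  refine Finset.sum_congr rfl fun i _ => ?_
  rw [mul_comm]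
  rfl

/-- A linear map of `ℂⁿ`, regarded as a map to the tangent space at `x`. -/
def tanLin (x : X) (L : Cn n →L[ℝ] Cn n) : Cn n →ₗ[ℝ] Tan n x := L.toLinearMap

theorem gramMatrix_eq_gram (x : X) (L : Cn n →L[ℝ] Cn n) :
    gramMatrix x L = Matrix.gram ℝ fun a => tanLin x L (realDir a) := rfl

theorem gramMatrix_comp (x : X) (L J : Cn n →L[ℝ] Cn n) :
    gramMatrix x (L.comp J) =
      (LinearMap.toMatrix (realBasis n) (realBasis n) J.toLinearMap).transpose *
        gramMatrix x L * LinearMap.toMatrix (realBasis n) (realBasis n) J.toLinearMap :=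
  gram_comp (tanLin x L) J.toLinearMap

theorem det_gramMatrix_pos (x : X) {L : Cn n →L[ℝ] Cn n} (hL : Function.Injective L) :
    0 < (gramMatrix x L).det := by
  rw [gramMatrix_eq_gram]
  refine (Matrix.posDef_gram_of_linearIndependent ?_).det_pos
  have h := (realBasis n).linearIndependent.map' (tanLin x L) (LinearMap.ker_eq_bot.2 hL)
  have h2 : tanLin x L ∘ realBasis n = fun a => tanLin x L (realDir a) := by
    ext1 a
    simp [realBasis_apply]
  rwa [h2] at h

theorem volumeDensity_eq (e : OpenPartialHomeomorph X (Cn n)) (u : Cn n) :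
    volumeDensity e u = Real.sqrt (gramMatrix (e.symm u) (coordTan e u)).det := rfl

variable [IsManifold 𝓘(ℂ, Cn n) ω X]
  {e e' : OpenPartialHomeomorph X (Cn n)}

theorem volumeDensity_pos (he : e ∈ HolCharts n X) {u : Cn n} (hu : u ∈ e.target) :
    0 < volumeDensity e u :=
  Real.sqrt_pos.2 (det_gramMatrix_pos _ (coordTan_bijective he hu).1)

/-- The Gram matrix `G` becomes `Jᵀ G J`, and the square root of the determinant picks up `|det J|`,
which cancels the Jacobian in the change of variables. -/
theorem volumeDensity_transition (he : e ∈ HolCharts n X) (he' : e' ∈ HolCharts n X)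
    {x : X} (hx : x ∈ e.source) (hx' : x ∈ e'.source) :
    volumeDensity e' (e' x) =
      |(fderiv ℝ (e ∘ e'.symm) (e' x)).det| * volumeDensity e (e x) := by
  rw [volumeDensity_eq, volumeDensity_eq, coordTan_comp_transition he he' hx hx',
    e.left_inv hx, e'.left_inv hx', gramMatrix_comp, Matrix.det_mul, Matrix.det_mul,
    Matrix.det_transpose, LinearMap.det_toMatrix, mul_right_comm, Real.sqrt_mul (mul_self_nonneg _),
    Real.sqrt_mul_self_eq_abs]

variable [IsContMDiffRiemannianBundle 𝓘(ℝ, Cn n) ∞ (Cn n) (fun x : X => Tan n x)]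

theorem continuousOn_volumeDensity (he : e ∈ HolCharts n X) :
    ContinuousOn (volumeDensity e) e.target := by
  refine ContinuousOn.sqrt ?_
  have : ContinuousOn (fun u => gramMatrix (e.symm u) (coordTan e u)) e.target :=
    continuousOn_pi.2 fun a => continuousOn_pi.2 fun b =>
      (continuousOn_inner_coordTan he).comp (f := fun u : Cn n => (u, realDir a, realDir b))
        (by fun_prop) fun u hu => ⟨hu, trivial⟩
  exact (continuous_id.matrix_det).comp_continuousOn this

variable [MeasurableSpace X] [BorelSpace X]

omit [RiemannianBundle fun x : X => Tan n x] [IsManifold 𝓘(ℂ, Cn n) ω X]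
  [IsContMDiffRiemannianBundle 𝓘(ℝ, Cn n) ∞ (Cn n) (fun x : X => Tan n x)] in
theorem measurableSet_target_inter_preimage (e : OpenPartialHomeomorph X (Cn n)) {B : Set X}
    (hB : MeasurableSet B) : MeasurableSet (e.target ∩ e.symm ⁻¹' B) := by
  have h := e.continuousOn_symm.domRestrict.measurable hB
  have := e.open_target.measurableSet.subtype_image h
  convert this using 1
  ext u; simp [and_comm]

theorem chartVolume_apply {B : Set X} (hB : MeasurableSet B) :
    chartVolume e B = ∫⁻ u in e.target ∩ e.symm ⁻¹' B, ENNReal.ofReal (volumeDensity e u) := by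
  have hm := e.open_target.measurableSet
  have h1 : AEMeasurable e.symm
      ((volume.withDensity fun u => ENNReal.ofReal (volumeDensity e u)).restrict e.target) :=
    e.continuousOn_symm.aemeasurable hm
  rw [chartVolume, Measure.map_apply_of_aemeasurable h1 hB, Measure.restrict_apply' hm,
    inter_comm, withDensity_apply _ (measurableSet_target_inter_preimage e hB)]

theorem chartVolume_apply_of_subset (he : e ∈ HolCharts n X) (he' : e' ∈ HolCharts n X) {B : Set X}
    (hB : MeasurableSet B) (h : B ⊆ e.source) (h' : B ⊆ e'.source) :
    chartVolume e' B = chartVolume e B := by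
  rw [chartVolume_apply hB, chartVolume_apply hB]
  set S := e'.target ∩ e'.symm ⁻¹' B with hS
  have hSm := measurableSet_target_inter_preimage e' hB
  have him : e.target ∩ e.symm ⁻¹' B = (e ∘ e'.symm) '' S := by
    ext u
    constructor
    · rintro ⟨hu, hu'⟩
      refine ⟨e' (e.symm u), ⟨e'.map_source (h' hu'), ?_⟩, ?_⟩
      · rw [mem_preimage, e'.left_inv (h' hu')]; exact hu'
      · simp [e'.left_inv (h' hu'), e.right_inv hu]
    · rintro ⟨v, ⟨hv, hv'⟩, rfl⟩
      refine ⟨e.map_source (h hv'), ?_⟩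
      simp only [Function.comp, mem_preimage, e.left_inv (h hv')]; exact hv'
  have hinj : InjOn (e ∘ e'.symm) S := by
    intro u hu v hv huv
    exact e'.symm.injOn hu.1 hv.1 (e.injOn (h hu.2) (h hv.2) huv)
  rw [him, lintegral_image_eq_lintegral_abs_det_fderiv_mul volume hSm
    (f' := fun u => fderiv ℝ (e ∘ e'.symm) u) (fun u hu =>
      ((contDiffAt_real_transition he' he hu.1 (h hu.2)).differentiableAt
        (by simp)).hasFDerivAt.hasFDerivWithinAt) hinj]
  refine setLIntegral_congr_fun hSm fun u hu => ?_
  have := volumeDensity_transition he he' (h hu.2) (h' hu.2)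
  rw [e'.right_inv hu.1] at this
  simp only [this, Function.comp]
  rw [ENNReal.ofReal_mul (abs_nonneg _)]

theorem chartVolume_source_compl (e : OpenPartialHomeomorph X (Cn n)) : chartVolume e e.sourceᶜ = 0 := by
  rw [chartVolume_apply e.open_source.measurableSet.compl]
  have : e.target ∩ e.symm ⁻¹' e.sourceᶜ = ∅ := by
    ext u; simp only [mem_inter_iff, mem_preimage, mem_compl_iff, mem_empty_iff_false, iff_false]
    exact fun h => h.2 (e.map_target h.1)
  rw [this, setLIntegral_empty]

theorem chartVolume_restrict_le (he : e ∈ HolCharts n X) (he' : e' ∈ HolCharts n X) :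
    (chartVolume e').restrict e.source ≤ chartVolume e := by
  refine Measure.le_iff.2 fun B hB => ?_
  rw [Measure.restrict_apply hB]
  calc chartVolume e' (B ∩ e.source)
      ≤ chartVolume e' ((B ∩ e.source) ∩ e'.source ∪ e'.sourceᶜ) := by
        refine measure_mono fun x hx => ?_
        by_cases h : x ∈ e'.source
        · exact Or.inl ⟨hx, h⟩
        · exact Or.inr h
    _ ≤ chartVolume e' ((B ∩ e.source) ∩ e'.source) + chartVolume e' e'.sourceᶜ :=
        measure_union_le _ _
    _ = chartVolume e ((B ∩ e.source) ∩ e'.source) := by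
        rw [chartVolume_source_compl e', add_zero]
        exact chartVolume_apply_of_subset he he'
          ((hB.inter e.open_source.measurableSet).inter e'.open_source.measurableSet)
          (fun x hx => hx.1.2) (fun x hx => hx.2)
    _ ≤ chartVolume e B := measure_mono fun x hx => hx.1.1

/-- Chart volumes agree on overlaps, so taking the supremum adds nothing on a chart domain, even
when `e` is not among the preferred charts of the supremum. -/
theorem riemVolume_restrict_le (he : e ∈ HolCharts n X) :
    (riemVolume n X).restrict e.source ≤ chartVolume e := by
  have hm := e.open_source.measurableSet
  -- The right side dominates each chart volume separately, on `e.source` by the overlap estimate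
  -- and on the complement trivially; hence it dominates their supremum.
  have key : riemVolume n X ≤ chartVolume e + (riemVolume n X).restrict e.sourceᶜ := by
    refine iSup_le fun x => ?_
    rw [← Measure.restrict_add_restrict_compl (μ := chartVolume (chartAt (Cn n) x)) hm]
    refine add_le_add (chartVolume_restrict_le he (chartAt_mem_holCharts x)) ?_
    exact Measure.restrict_mono_measure (le_iSup (fun x : X => chartVolume (chartAt (Cn n) x)) x) _
  refine Measure.le_iff.2 fun B hB => ?_
  rw [Measure.restrict_apply hB]
  refine (key _).trans ?_
  rw [Measure.add_apply, Measure.restrict_apply (hB.inter hm)]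
  have : B ∩ e.source ∩ e.sourceᶜ = ∅ := by ext; simp
  rw [this, measure_empty, add_zero]
  exact measure_mono inter_subset_left

theorem chartVolume_le_riemVolume (x : X) : chartVolume (chartAt (Cn n) x) ≤ riemVolume n X :=
  le_iSup (fun x : X => chartVolume (chartAt (Cn n) x)) x

/-- Locally, the Riemannian volume is bounded by a multiple of the Lebesgue measure in a chart. -/
theorem exists_riemVolume_le (he : e ∈ HolCharts n X) {x₀ : X} (hx₀ : x₀ ∈ e.source) :
    ∃ C : NNReal, ∃ O : Set X, IsOpen O ∧ x₀ ∈ O ∧ O ⊆ e.source ∧ ∀ B ⊆ O, MeasurableSet B →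
      ∀ f : X → ℝ≥0∞, ∫⁻ x in B, f x ∂(riemVolume n X) ≤
        C * ∫⁻ u in e.target ∩ e.symm ⁻¹' B, f (e.symm u) := by
  have hu := e.map_source hx₀
  have hc := (continuousOn_volumeDensity he).continuousAt (e.open_target.mem_nhds hu)
  have hev : ∀ᶠ x in 𝓝 x₀, volumeDensity e (e x) < volumeDensity e (e x₀) + 1 :=
    (e.continuousAt hx₀).eventually (hc.eventually_lt_const (lt_add_one _))
  obtain ⟨O, hO, hOo, hxO⟩ := eventually_nhds_iff.1 (hev.and (e.open_source.mem_nhds hx₀))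
  refine ⟨(volumeDensity e (e x₀) + 1).toNNReal, O, hOo, hxO, fun x hx => (hO x hx).2, ?_⟩
  intro B hBO hB f
  have hS := measurableSet_target_inter_preimage e hB
  set K : NNReal := (volumeDensity e (e x₀) + 1).toNNReal
  have haem : AEMeasurable e.symm (volume.restrict (e.target ∩ e.symm ⁻¹' B)) :=
    (e.continuousOn_symm.mono inter_subset_left).aemeasurable hS
  have hle : (riemVolume n X).restrict B ≤
      ((K : ℝ≥0∞) • (volume.restrict (e.target ∩ e.symm ⁻¹' B))).map e.symm := by
    refine Measure.le_iff.2 fun A hA => ?_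
    rw [Measure.map_smul, Measure.smul_apply, Measure.map_apply_of_aemeasurable haem hA,
      Measure.restrict_apply hA, Measure.restrict_apply' hS]
    have h1 : riemVolume n X (A ∩ B) ≤ chartVolume e (A ∩ B) := by
      have := riemVolume_restrict_le he (A ∩ B)
      rwa [Measure.restrict_apply (hA.inter hB),
        inter_eq_left.2 fun x hx => (hO x (hBO hx.2)).2] at this
    refine h1.trans ?_
    rw [chartVolume_apply (hA.inter hB)]
    have h2 : ∀ u ∈ e.target ∩ e.symm ⁻¹' (A ∩ B),
        ENNReal.ofReal (volumeDensity e u) ≤ (K : ℝ≥0∞) := by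
      intro u hu
      have := (hO _ (hBO hu.2.2)).1
      rw [e.right_inv hu.1] at this
      exact ENNReal.ofReal_le_ofReal this.le
    refine (setLIntegral_mono' (measurableSet_target_inter_preimage e (hA.inter hB)) h2).trans ?_
    rw [setLIntegral_const, smul_eq_mul]
    refine mul_le_mul_right (measure_mono ?_) _
    intro u hu
    exact ⟨hu.2.1, hu.1, hu.2.2⟩
  calc ∫⁻ x in B, f x ∂(riemVolume n X)
      ≤ ∫⁻ x, f x ∂((K : ℝ≥0∞) • (volume.restrict (e.target ∩ e.symm ⁻¹' B))).map e.symm :=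
        lintegral_mono' hle le_rfl
    -- This inequality holds for every `f`, measurable or not, so the estimate may be used for
    -- kernel norms before their measurability is known.
    _ ≤ ∫⁻ u, f (e.symm u) ∂((K : ℝ≥0∞) • (volume.restrict (e.target ∩ e.symm ⁻¹' B))) :=
        lintegral_map_le _ _
    _ = _ := by rw [lintegral_smul_measure, smul_eq_mul]

instance isLocallyFiniteMeasure_riemVolume : IsLocallyFiniteMeasure (riemVolume n X) := by
  refine ⟨fun x₀ => ?_⟩
  have hx₀ := mem_chart_source (Cn n) x₀
  obtain ⟨C, O, hO, hxO, hOs, h⟩ := exists_riemVolume_le (chartAt_mem_holCharts x₀) hx₀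
  set e := chartAt (Cn n) x₀
  let B := O ∩ (e.source ∩ e ⁻¹' Metric.ball (e x₀) 1)
  have hBo : IsOpen B := hO.inter (e.isOpen_inter_preimage Metric.isOpen_ball)
  refine ⟨B, hBo.mem_nhds ⟨hxO, hx₀, by simp⟩, ?_⟩
  have := h B inter_subset_left hBo.measurableSet fun _ => 1
  rw [setLIntegral_one, setLIntegral_one] at this
  refine this.trans_lt (ENNReal.mul_lt_top ENNReal.coe_lt_top ?_)
  refine (measure_mono ?_).trans_lt (measure_ball_lt_top (x := e x₀) (r := 1))
  rintro u ⟨hu, hu2⟩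
  have := hu2.2.2
  rwa [mem_preimage, e.right_inv hu] at this

/-- A point is Lebesgue null in a chart because `0 < n`. It serves to discard both the diagonal and
the critical points. -/
theorem riemVolume_singleton [T2Space X] (hn : 0 < n) (x : X) : riemVolume n X {x} = 0 := by
  have hx₀ := mem_chart_source (Cn n) x
  have : Nonempty (Fin n) := ⟨⟨0, hn⟩⟩
  obtain ⟨C, O, hO, hxO, hOs, h⟩ := exists_riemVolume_le (chartAt_mem_holCharts x) hx₀
  have := h {x} (singleton_subset_iff.2 hxO) (measurableSet_singleton x) fun _ => 1
  rw [setLIntegral_one, setLIntegral_one] at this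
  refine le_antisymm (this.trans ?_) zero_le
  have h2 : (chartAt (Cn n) x).target ∩ (chartAt (Cn n) x).symm ⁻¹' {x} ⊆
      {chartAt (Cn n) x x} := by
    rintro u ⟨hu, hu2⟩
    exact ((chartAt (Cn n) x).right_inv hu).symm.trans
      (congrArg _ (hu2 : (chartAt (Cn n) x).symm u = x))
  rw [measure_mono_null h2 (measure_singleton _), mul_zero]

/-- Measurability in a chart implies measurability on `X`. -/
theorem aestronglyMeasurable_comp_chart {V : Type*} [TopologicalSpace V]
    (he : e ∈ HolCharts n X) {D : Set X} (hD : MeasurableSet D) {g : Cn n → V}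
    (hg : AEStronglyMeasurable g (volume.restrict (e.target ∩ e.symm ⁻¹' D))) :
    AEStronglyMeasurable (g ∘ e) ((riemVolume n X).restrict (D ∩ e.source)) := by
  have hDs := hD.inter e.open_source.measurableSet
  have haem : AEMeasurable e ((riemVolume n X).restrict (D ∩ e.source)) :=
    (e.continuousOn.mono inter_subset_right).aemeasurable hDs
  refine AEStronglyMeasurable.comp_aemeasurable (hg.mono_ac ?_) haem
  refine Measure.AbsolutelyContinuous.mk fun S hS h0 => ?_
  rw [Measure.restrict_apply hS] at h0
  rw [Measure.map_apply_of_aemeasurable haem hS, Measure.restrict_apply' hDs]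
  have hBm : MeasurableSet (e.source ∩ e ⁻¹' S) :=
    by
    have h := e.continuousOn.domRestrict.measurable hS
    have := e.open_source.measurableSet.subtype_image h
    convert this using 1
    ext u; simp [and_comm]
  have hB : MeasurableSet (e.source ∩ e ⁻¹' S ∩ D) := hBm.inter hD
  have : e ⁻¹' S ∩ (D ∩ e.source) = e.source ∩ e ⁻¹' S ∩ D := by ext; simp; tauto
  rw [this]
  have h1 := riemVolume_restrict_le he (e.source ∩ e ⁻¹' S ∩ D)
  rw [Measure.restrict_apply hB, inter_eq_left.2 fun x hx => hx.1.1] at h1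
  refine le_antisymm (h1.trans ?_) zero_le
  rw [chartVolume_apply hB]
  refine (setLIntegral_measure_zero _ _ (measure_mono_null ?_ h0)).le
  rintro u ⟨hu, hu2⟩
  have h3 : e (e.symm u) ∈ S := hu2.1.2
  rw [e.right_inv hu] at h3
  exact ⟨h3, hu, hu2.2⟩

/-- Measurability on `X` implies measurability in the preferred charts. -/
theorem aestronglyMeasurable_comp_chart_symm {V : Type*} [TopologicalSpace V]
    (x : X) {D : Set X} (hD : MeasurableSet D) {g : X → V}
    (hg : AEStronglyMeasurable g ((riemVolume n X).restrict D)) :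
    AEStronglyMeasurable (g ∘ (chartAt (Cn n) x).symm)
      (volume.restrict ((chartAt (Cn n) x).target ∩ (chartAt (Cn n) x).symm ⁻¹' D)) := by
  set e := chartAt (Cn n) x with he_def
  have he : e ∈ HolCharts n X := chartAt_mem_holCharts x
  have hS := measurableSet_target_inter_preimage e hD
  have haem : AEMeasurable e.symm (volume.restrict (e.target ∩ e.symm ⁻¹' D)) :=
    (e.continuousOn_symm.mono inter_subset_left).aemeasurable hS
  refine AEStronglyMeasurable.comp_aemeasurable (hg.mono_ac ?_) haem
  refine Measure.AbsolutelyContinuous.mk fun B hB h0 => ?_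
  rw [Measure.restrict_apply hB] at h0
  rw [Measure.map_apply_of_aemeasurable haem hB, Measure.restrict_apply' hS]
  have h1 : chartVolume e (B ∩ D) = 0 :=
    le_antisymm ((chartVolume_le_riemVolume x _).trans h0.le) zero_le
  rw [chartVolume_apply (hB.inter hD)] at h1
  have hT := measurableSet_target_inter_preimage e (hB.inter hD)
  have hmeas : AEMeasurable (fun u => ENNReal.ofReal (volumeDensity e u))
      (volume.restrict (e.target ∩ e.symm ⁻¹' (B ∩ D))) :=
    (((continuousOn_volumeDensity he).mono inter_subset_left).aemeasurable hT).ennreal_ofReal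
  rw [lintegral_eq_zero_iff' hmeas] at h1
  -- The density is strictly positive, so a set of zero Riemannian volume has a Lebesgue null image
  -- in the chart.
  have h2 : ∀ᵐ u ∂(volume.restrict (e.target ∩ e.symm ⁻¹' (B ∩ D))), False := by
    filter_upwards [h1, ae_restrict_mem hT] with u hu hu2
    have := volumeDensity_pos he hu2.1
    simp only [Pi.zero_apply, ENNReal.ofReal_eq_zero] at hu
    linarith
  rw [ae_iff] at h2
  simp only [not_false_eq_true, Set.ofPred_true, Measure.restrict_apply_univ] at h2
  refine measure_mono_null ?_ h2
  intro u hu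
  exact ⟨hu.2.1, hu.1, hu.2.2⟩

end Volume

/-! ### Expansion of alternating maps in a spanning family. -/

section Multilinear

variable {n k : ℕ} {V : Type*} [NormedAddCommGroup V] [NormedSpace ℝ V] {ι : Type*} [Fintype ι]

theorem alternating_map_sum_smul (g : Cn n [⋀^Fin k]→L[ℝ] V) (B : ι → Cn n)
    (m : Fin k → ι → ℝ) :
    g (fun i => ∑ a, m i a • B a) =
      ∑ σ : Fin k → ι, (∏ i, m i (σ i)) • g (fun i => B (σ i)) := by
  classical
  have h := (g.toMultilinearMap).map_sum (fun i a => m i a • B a)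
  refine h.trans (Finset.sum_congr rfl fun σ _ => ?_)
  exact (g.toMultilinearMap).map_smul_univ (fun i => m i (σ i)) (fun i => B (σ i))

/-- Multilinear expansion produces `(card ι) ^ k` terms, each carrying `k` coefficients of size at
most `C ‖v i‖`. -/
theorem norm_comp_le_of_expansion (g : Cn n [⋀^Fin k]→L[ℝ] V) (L : Cn n →L[ℝ] Cn n)
    (B : ι → Cn n) (m : ι → Cn n → ℝ) {C K : ℝ} (hK0 : 0 ≤ K) (hC : 0 ≤ C)
    (hL : ∀ v, L v = ∑ a, m a v • B a)
    (hm : ∀ a v, |m a v| ≤ C * ‖v‖) (hK : ∀ σ : Fin k → ι, ‖g (fun i => B (σ i))‖ ≤ K) :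
    ‖g.compContinuousLinearMap L‖ ≤ (Fintype.card ι : ℝ) ^ k * C ^ k * K := by
  refine ContinuousAlternatingMap.opNorm_le_bound _ (by positivity) fun v => ?_
  have : (g.compContinuousLinearMap L) v = g (fun i => ∑ a, m a (v i) • B a) := by
    simp only [ContinuousAlternatingMap.compContinuousLinearMap_apply]
    congr 1; ext1 i; exact hL _
  rw [this, alternating_map_sum_smul g B fun i a => m a (v i)]
  refine (norm_sum_le _ _).trans ?_
  have hb : ∀ σ ∈ (Finset.univ : Finset (Fin k → ι)),
      ‖(∏ i, m (σ i) (v i)) • g (fun i => B (σ i))‖ ≤ (C ^ k * ∏ i, ‖v i‖) * K := by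
    intro σ _
    rw [norm_smul, Real.norm_eq_abs, Finset.abs_prod]
    refine mul_le_mul ?_ (hK σ) (norm_nonneg _) (by positivity)
    calc ∏ i, |m (σ i) (v i)| ≤ ∏ i, (C * ‖v i‖) :=
          Finset.prod_le_prod (fun _ _ => abs_nonneg _) fun i _ => hm _ _
      _ = C ^ k * ∏ i, ‖v i‖ := by simp [Finset.prod_mul_distrib]
  refine (Finset.sum_le_card_nsmul _ _ _ hb).trans (le_of_eq ?_)
  simp
  ring

theorem norm_apply_le_comp (g : Cn n [⋀^Fin k]→L[ℝ] V) (L : Cn n →L[ℝ] Cn n)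
    (B : ι → Cn n) {C : ℝ} (hB : ∀ a, ∃ v, L v = B a ∧ ‖v‖ ≤ C)
    (σ : Fin k → ι) :
    ‖g (fun i => B (σ i))‖ ≤ C ^ k * ‖g.compContinuousLinearMap L‖ := by
  choose w hw hwC using hB
  have : g (fun i => B (σ i)) = (g.compContinuousLinearMap L) (fun i => w (σ i)) := by
    simp only [ContinuousAlternatingMap.compContinuousLinearMap_apply]
    congr 1; ext1 i; exact (hw _).symm
  rw [this, mul_comm]
  refine (ContinuousAlternatingMap.le_opNorm _ _).trans ?_
  gcongr
  calc ∏ i, ‖w (σ i)‖ ≤ ∏ _i : Fin k, C :=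
        Finset.prod_le_prod (fun _ _ => norm_nonneg _) fun i _ => hwC _
    _ = C ^ k := by simp

/-- The pull back of a double form by a pair of linear maps. -/
def pullD {l : ℕ} (L L' : Cn n →L[ℝ] Cn n) (A : DForm n k l) : DForm n k l :=
  (ContinuousAlternatingMap.compContinuousLinearMapCLM L'
    : Form n l →L[ℝ] Form n l).compContinuousAlternatingMap (A.compContinuousLinearMap L)

theorem pullD_apply {l : ℕ} (L L' : Cn n →L[ℝ] Cn n) (A : DForm n k l) (v : Fin k → Cn n) :
    pullD L L' A v = (A (fun i => L (v i))).compContinuousLinearMap L' := rfl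

end Multilinear

/-! ### Metric norms of forms and double forms against norms of coordinate expressions. -/

section Norms

variable {n : ℕ} {X : Type*} [TopologicalSpace X] [ChartedSpace (Cn n) X]
  [RiemannianBundle (fun x : X => Tan n x)]

/-- The standard orthonormal basis of the tangent space at `x`, as a family in `ℂⁿ`. -/
def stdB (x : X) (a : Fin (Module.finrank ℝ (Tan n x))) : Cn n :=
  stdOrthonormalBasis ℝ (Tan n x) a

theorem card_stdB (x : X) : Fintype.card (Fin (Module.finrank ℝ (Tan n x))) = 2 * n := by
  rw [Fintype.card_fin]
  have : Module.finrank ℝ (Cn n) = 2 * n := by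
    rw [Module.finrank_eq_card_basis (realBasis n)]; simp [mul_comm]
  exact this

/-- The coordinates of a tangent vector in the standard orthonormal basis. -/
def stdCoord (x : X) (a : Fin (Module.finrank ℝ (Tan n x))) (v : Cn n) : ℝ :=
  inner ℝ (stdOrthonormalBasis ℝ (Tan n x) a) (show Tan n x from v)

theorem stdB_expansion (x : X) (v : Cn n) : v = ∑ a, stdCoord x a v • stdB x a :=
  ((stdOrthonormalBasis ℝ (Tan n x)).sum_repr' (show Tan n x from v)).symm

theorem abs_stdCoord_le (x : X) (a : Fin (Module.finrank ℝ (Tan n x))) (v : Cn n) :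
    |stdCoord x a v| ≤ ‖(show Tan n x from v)‖ := by
  refine (abs_real_inner_le_norm _ _).trans ?_
  rw [(stdOrthonormalBasis ℝ (Tan n x)).norm_eq_one a, one_mul]

theorem IsFrame.injective {x : X} {L : Cn n →L[ℝ] Cn n} {C : ℝ} (h : IsFrame x L C) :
    Function.Injective L := by
  refine (injective_iff_map_eq_zero L).2 fun v hv => ?_
  have := (h v).1
  rw [hv] at this
  have h0 : ‖(show Tan n x from (0 : Cn n))‖ = 0 := norm_zero (E := Tan n x)
  rw [h0, mul_zero] at this
  exact norm_le_zero_iff.1 this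

theorem IsFrame.surjective {x : X} {L : Cn n →L[ℝ] Cn n} {C : ℝ} (h : IsFrame x L C) :
    Function.Surjective L :=
  (LinearMap.injective_iff_surjective (f := L.toLinearMap)).1 h.injective

theorem IsFrame.exists_preimage {x : X} {L : Cn n →L[ℝ] Cn n} {C : ℝ} (h : IsFrame x L C)
    (a : Fin (Module.finrank ℝ (Tan n x))) : ∃ v, L v = stdB x a ∧ ‖v‖ ≤ C := by
  obtain ⟨v, hv⟩ := h.surjective (stdB x a)
  refine ⟨v, hv, ?_⟩
  have := (h v).1
  rw [hv] at this
  have h1 : ‖(show Tan n x from stdB x a)‖ = 1 :=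
    (stdOrthonormalBasis ℝ (Tan n x)).norm_eq_one a
  rwa [h1, mul_one] at this

variable {k l : ℕ}

theorem formNorm_eq (x : X) (f : Form n k) : formNorm x f =
    Real.sqrt ((k.factorial : ℝ)⁻¹ * ∑ σ : Fin k → Fin (Module.finrank ℝ (Tan n x)),
      ‖f (fun i => stdB x (σ i))‖ ^ 2) := by
  rw [formNorm, formInner]
  congr 1
  have : ∀ σ : Fin k → Fin (Module.finrank ℝ (Tan n x)),
      f (fun i => stdOrthonormalBasis ℝ (Tan n x) (σ i)) *
      (starRingEnd ℂ) (f (fun i => stdOrthonormalBasis ℝ (Tan n x) (σ i))) =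
      ((‖f (fun i => stdB x (σ i))‖ ^ 2 : ℝ) : ℂ) := by
    intro σ
    rw [Complex.mul_conj, Complex.normSq_eq_norm_sq]; rfl
  rw [Finset.sum_congr rfl fun σ _ => this σ, ← Complex.ofReal_sum, ← Complex.ofReal_natCast,
    ← Complex.ofReal_inv, ← Complex.ofReal_mul, Complex.ofReal_re]

theorem dformNorm_eq (ζ z : X) (A : DForm n k l) : dformNorm ζ z A =
    Real.sqrt ((k.factorial : ℝ)⁻¹ * ∑ σ : Fin k → Fin (Module.finrank ℝ (Tan n ζ)),
      formNorm z (A (fun i => stdB ζ (σ i))) ^ 2) := rfl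

theorem formNorm_nonneg (x : X) (f : Form n k) : 0 ≤ formNorm x f := Real.sqrt_nonneg _

theorem dformNorm_nonneg (ζ z : X) (A : DForm n k l) : 0 ≤ dformNorm ζ z A := Real.sqrt_nonneg _

theorem le_sqrt_factorial_mul {ι : Type*} [Fintype ι] (y : ι → ℝ) (i : ι) :
    y i ≤ Real.sqrt (k.factorial) * Real.sqrt ((k.factorial : ℝ)⁻¹ * ∑ i, y i ^ 2) := by
  have hk : (0 : ℝ) < k.factorial := by exact_mod_cast k.factorial_pos
  rw [← Real.sqrt_mul hk.le, ← mul_assoc, mul_inv_cancel₀ hk.ne', one_mul]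
  refine Real.le_sqrt_of_sq_le ?_
  exact Finset.single_le_sum (f := fun i => y i ^ 2) (fun j _ => sq_nonneg _) (Finset.mem_univ i)

theorem sqrt_factorial_inv_mul_le {ι : Type*} [Fintype ι] (y : ι → ℝ) (hy : ∀ i, 0 ≤ y i) {K : ℝ}
    (hK : 0 ≤ K) (h : ∀ i, y i ≤ K) :
    Real.sqrt ((k.factorial : ℝ)⁻¹ * ∑ i, y i ^ 2) ≤ Real.sqrt (Fintype.card ι) * K := by
  have h1 : ∑ i, y i ^ 2 ≤ Fintype.card ι * K ^ 2 := by
    have := Finset.sum_le_card_nsmul Finset.univ (fun i => y i ^ 2) (K ^ 2)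
      fun i _ => pow_le_pow_left₀ (hy i) (h i) 2
    simpa using this
  have h2 : (k.factorial : ℝ)⁻¹ ≤ 1 := by
    refine inv_le_one_of_one_le₀ ?_
    exact_mod_cast k.factorial_pos
  have h3 : (k.factorial : ℝ)⁻¹ * ∑ i, y i ^ 2 ≤ Fintype.card ι * K ^ 2 :=
    (mul_le_of_le_one_left (Finset.sum_nonneg fun i _ => sq_nonneg _) h2).trans h1
  refine (Real.sqrt_le_sqrt h3).trans ?_
  rw [Real.sqrt_mul (by positivity), Real.sqrt_sq hK]

/-- A constant comparing the norm of a form with the norm of its coordinate expression. -/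
def frameConst (n k : ℕ) (C : ℝ) : ℝ :=
  ((2 * n : ℕ) : ℝ) ^ k * C ^ k * Real.sqrt (k.factorial) +
    Real.sqrt (((2 * n : ℕ) : ℝ) ^ k) * C ^ k

theorem frameConst_nonneg {C : ℝ} (hC : 0 ≤ C) : 0 ≤ frameConst n k C := by
  unfold frameConst; positivity

variable {V : Type*} [NormedAddCommGroup V] [NormedSpace ℝ V]

theorem IsFrame.norm_comp_le {x : X} {L : Cn n →L[ℝ] Cn n} {C : ℝ} (hC : 0 ≤ C)
    (h : IsFrame x L C) (g : Cn n [⋀^Fin k]→L[ℝ] V) {K : ℝ} (hK0 : 0 ≤ K)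
    (hK : ∀ σ : Fin k → Fin (Module.finrank ℝ (Tan n x)), ‖g (fun i => stdB x (σ i))‖ ≤ K) :
    ‖g.compContinuousLinearMap L‖ ≤ ((2 * n : ℕ) : ℝ) ^ k * C ^ k * K := by
  have := norm_comp_le_of_expansion g L (stdB x) (fun a v => stdCoord x a (L v)) hK0 hC
    (fun v => stdB_expansion x (L v)) (fun a v => (abs_stdCoord_le x a (L v)).trans (h v).2) hK
  rwa [card_stdB] at this

theorem IsFrame.norm_apply_le {x : X} {L : Cn n →L[ℝ] Cn n} {C : ℝ}
    (h : IsFrame x L C) (g : Cn n [⋀^Fin k]→L[ℝ] V)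
    (σ : Fin k → Fin (Module.finrank ℝ (Tan n x))) :
    ‖g (fun i => stdB x (σ i))‖ ≤ C ^ k * ‖g.compContinuousLinearMap L‖ :=
  norm_apply_le_comp g L (stdB x) h.exists_preimage σ

theorem IsFrame.norm_comp_le_formNorm {x : X} {L : Cn n →L[ℝ] Cn n} {C : ℝ} (hC : 0 ≤ C)
    (h : IsFrame x L C) (f : Form n k) :
    ‖f.compContinuousLinearMap L‖ ≤ frameConst n k C * formNorm x f := by
  have := h.norm_comp_le hC f (mul_nonneg (Real.sqrt_nonneg (k.factorial)) (formNorm_nonneg x f))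
    fun σ => by
      rw [formNorm_eq]
      exact le_sqrt_factorial_mul (k := k) (fun σ => ‖f (fun i => stdB x (σ i))‖) σ
  refine this.trans ?_
  rw [← mul_assoc]
  have := formNorm_nonneg x f
  gcongr
  exact le_add_of_nonneg_right (by positivity)

theorem IsFrame.formNorm_le {x : X} {L : Cn n →L[ℝ] Cn n} {C : ℝ} (hC : 0 ≤ C)
    (h : IsFrame x L C) (f : Form n k) :
    formNorm x f ≤ frameConst n k C * ‖f.compContinuousLinearMap L‖ := by
  rw [formNorm_eq]
  refine (sqrt_factorial_inv_mul_le _ (fun _ => norm_nonneg _)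
    (by positivity) fun σ => h.norm_apply_le f σ).trans ?_
  rw [← mul_assoc]
  have hc : ((Fintype.card (Fin k → Fin (Module.finrank ℝ (Tan n x))) : ℕ) : ℝ) =
      ((2 * n : ℕ) : ℝ) ^ k := by
    rw [Fintype.card_fun, card_stdB, Fintype.card_fin]; push_cast; rfl
  rw [hc]
  gcongr
  exact le_add_of_nonneg_left (by positivity)

/-- The variables are treated one at a time: the values are first compared as forms at z, and the
result is then a form at ζ with values in a normed space. -/
theorem IsFrame.norm_pullD_le {ζ z : X} {L L' : Cn n →L[ℝ] Cn n} {C : ℝ} (hC : 0 ≤ C)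
    (h : IsFrame ζ L C) (h' : IsFrame z L' C) (A : DForm n k l) :
    ‖pullD L L' A‖ ≤ frameConst n k C * (frameConst n l C * dformNorm ζ z A) := by
  let g : DForm n k l := (ContinuousAlternatingMap.compContinuousLinearMapCLM L'
    : Form n l →L[ℝ] Form n l).compContinuousAlternatingMap A
  have hd := dformNorm_nonneg ζ z A
  have hc := frameConst_nonneg (n := n) (k := l) hC
  have hb : ∀ σ : Fin k → Fin (Module.finrank ℝ (Tan n ζ)), ‖g (fun i => stdB ζ (σ i))‖ ≤
      Real.sqrt (k.factorial) * (frameConst n l C * dformNorm ζ z A) := by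
    intro σ
    have h1 : ‖g (fun i => stdB ζ (σ i))‖ ≤
        frameConst n l C * formNorm z (A (fun i => stdB ζ (σ i))) :=
      h'.norm_comp_le_formNorm hC _
    refine h1.trans ?_
    rw [mul_left_comm]
    refine mul_le_mul_of_nonneg_left ?_ hc
    rw [dformNorm_eq]
    have h2 := le_sqrt_factorial_mul (k := k) (fun σ : Fin k → Fin (Module.finrank ℝ (Tan n ζ)) =>
      formNorm z (A (fun i => stdB ζ (σ i)))) σ
    exact h2
  have : pullD L L' A = g.compContinuousLinearMap L := rfl
  rw [this]
  refine (h.norm_comp_le hC g (by positivity) hb).trans ?_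
  rw [← mul_assoc]
  refine mul_le_mul_of_nonneg_right ?_ (by positivity)
  exact le_add_of_nonneg_right (by positivity)

theorem IsFrame.dformNorm_le {ζ z : X} {L L' : Cn n →L[ℝ] Cn n} {C : ℝ} (hC : 0 ≤ C)
    (h : IsFrame ζ L C) (h' : IsFrame z L' C) (A : DForm n k l) :
    dformNorm ζ z A ≤ frameConst n k C * (frameConst n l C * ‖pullD L L' A‖) := by
  let g : DForm n k l := (ContinuousAlternatingMap.compContinuousLinearMapCLM L'
    : Form n l →L[ℝ] Form n l).compContinuousAlternatingMap A
  have hgL : pullD L L' A = g.compContinuousLinearMap L := rfl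
  have hc := frameConst_nonneg (n := n) (k := l) hC
  have hb : ∀ σ : Fin k → Fin (Module.finrank ℝ (Tan n ζ)),
      formNorm z (A (fun i => stdB ζ (σ i))) ≤ C ^ k * (frameConst n l C * ‖pullD L L' A‖) := by
    intro σ
    refine (h'.formNorm_le hC _).trans ?_
    rw [mul_left_comm]
    refine mul_le_mul_of_nonneg_left ?_ hc
    exact h.norm_apply_le g σ
  rw [dformNorm_eq]
  refine (sqrt_factorial_inv_mul_le _ (fun _ => formNorm_nonneg _ _) (by positivity) hb).trans ?_
  have hcard : ((Fintype.card (Fin k → Fin (Module.finrank ℝ (Tan n ζ))) : ℕ) : ℝ) =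
      ((2 * n : ℕ) : ℝ) ^ k := by
    rw [Fintype.card_fun, card_stdB, Fintype.card_fin]; push_cast; rfl
  rw [hcard, ← mul_assoc]
  refine mul_le_mul_of_nonneg_right ?_ (by positivity)
  exact le_add_of_nonneg_left (by positivity)

theorem pairing_eq (ζ : X) (f : Form n k) (A : DForm n k l) : pairing ζ f A =
    ((k.factorial : ℂ))⁻¹ • ∑ σ : Fin k → Fin (Module.finrank ℝ (Tan n ζ)),
      f (fun i => stdB ζ (σ i)) • conjForm (A (fun i => stdB ζ (σ i))) := rfl

theorem conjForm_comp (g : Form n l) (L : Cn n →L[ℝ] Cn n) :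
    (conjForm g).compContinuousLinearMap L = conjForm (g.compContinuousLinearMap L) := rfl

theorem norm_conjForm_le (g : Form n l) : ‖conjForm g‖ ≤ ‖g‖ := by
  refine ContinuousAlternatingMap.opNorm_le_bound _ (norm_nonneg _) fun v => ?_
  have : ‖conjForm g v‖ = ‖g v‖ := by
    change ‖(starRingEnd ℂ) (g v)‖ = _
    simp
  rw [this]
  exact g.le_opNorm v

/-- The inverse of the Gram matrix is the matrix of the dual metric. -/
theorem gramMatrix_inv {x : X} {L : Cn n →L[ℝ] Cn n} (hL : Function.Bijective L) :
    ∃ c : Fin (Module.finrank ℝ (Tan n x)) → Fin n × Fin 2 → ℝ,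
      (∀ a, stdB x a = L (∑ i, c a i • realDir i)) ∧
      ∀ i j, ∑ a, c a i * c a j = (gramMatrix x L)⁻¹ i j := by
  let LE : Cn n ≃ₗ[ℝ] Cn n := LinearEquiv.ofBijective L.toLinearMap hL
  have hLE : ∀ v, L (LE.symm v) = v := fun v => LE.apply_symm_apply v
  have hLE' : ∀ v, LE.symm (L v) = v := fun v => LE.symm_apply_apply v
  let c : Fin (Module.finrank ℝ (Tan n x)) → Fin n × Fin 2 → ℝ :=
    fun a i => (realBasis n).repr (LE.symm (stdB x a)) i
  let c' : Matrix (Fin n × Fin 2) (Fin (Module.finrank ℝ (Tan n x))) ℝ := fun i a => c a i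
  let M : Matrix (Fin (Module.finrank ℝ (Tan n x))) (Fin n × Fin 2) ℝ :=
    fun a i => stdCoord x a (L (realDir i))
  -- `M` holds the orthonormal coordinates of the frame vectors and `c'` the frame coordinates of
  -- the orthonormal basis, so they are mutually inverse, while the Gram matrix is `Mᵀ M`.
  have h1 : c' * M = 1 := by
    ext i j
    rw [Matrix.mul_apply]
    have e1 : realDir j = ∑ a, M a j • LE.symm (stdB x a) := by
      rw [← hLE' (realDir j)]
      conv_lhs => rw [stdB_expansion x (L (realDir j))]
      rw [map_sum]
      exact Finset.sum_congr rfl fun a _ => map_smul _ _ _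
    have e2 := congrArg (fun v => (realBasis n).repr v i) e1
    simp only [map_sum, map_smul, Finsupp.coe_finsetSum, Finset.sum_apply, Finsupp.smul_apply,
      smul_eq_mul] at e2
    rw [← realBasis_apply, Module.Basis.repr_self] at e2
    rw [Matrix.one_apply, Finset.sum_congr rfl fun a _ => mul_comm (c' i a) (M a j)]
    exact e2.symm.trans (by simp [Finsupp.single_apply, eq_comm])
  have h2 : gramMatrix x L = M.transpose * M := by
    ext i j
    rw [Matrix.mul_apply]
    exact ((stdOrthonormalBasis ℝ (Tan n x)).sum_inner_mul_inner
      (show Tan n x from L (realDir i)) (show Tan n x from L (realDir j))).symm.trans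
      (Finset.sum_congr rfl fun a _ => by
        rw [real_inner_comm]; rfl)
  have hcard : Fintype.card (Fin n × Fin 2) = Fintype.card (Fin (Module.finrank ℝ (Tan n x))) := by
    rw [card_stdB]; simp [mul_comm]
  have h3 : M * c' = 1 :=
    (Matrix.mul_eq_one_comm_of_equiv (Fintype.equivOfCardEq hcard)).1 h1
  have h4 : gramMatrix x L * (c' * c'.transpose) = 1 := by
    rw [h2, Matrix.mul_assoc, ← Matrix.mul_assoc M, h3, Matrix.one_mul, ← Matrix.transpose_mul, h1,
      Matrix.transpose_one]
  refine ⟨c, fun a => ?_, fun i j => ?_⟩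
  · have := (realBasis n).sum_repr (LE.symm (stdB x a))
    simp only [realBasis_apply] at this
    rw [this, hLE]
  · rw [Matrix.inv_eq_right_inv h4, Matrix.mul_apply]
    rfl

theorem sum_smul_sum_smul {W ι : Type*} [Fintype ι] [AddCommGroup W] [Module ℂ W] [Module ℝ W]
    [IsScalarTower ℝ ℂ W] [SMulCommClass ℝ ℂ W] (m m' : ι → ℝ) (x : ι → ℂ) (y : ι → W) :
    (∑ τ, m τ • x τ) • ∑ τ, m' τ • y τ = ∑ τ, ∑ τ', (m τ * m' τ') • (x τ • y τ') := by
  rw [Finset.sum_smul]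
  refine Finset.sum_congr rfl fun τ _ => ?_
  rw [Finset.smul_sum]
  refine Finset.sum_congr rfl fun τ' _ => ?_
  rw [mul_smul, smul_assoc, smul_comm (x τ)]

/-- The pairing of forms in terms of a frame and the dual metric. -/
theorem pairing_comp_eq {ζ : X} {L : Cn n →L[ℝ] Cn n} (hL : Function.Bijective L)
    (L' : Cn n →L[ℝ] Cn n) (f : Form n k) (A : DForm n k l) :
    (pairing ζ f A).compContinuousLinearMap L' =
      ((k.factorial : ℂ))⁻¹ • ∑ τ : Fin k → Fin n × Fin 2, ∑ τ' : Fin k → Fin n × Fin 2,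
        (∏ i, (gramMatrix ζ L)⁻¹ (τ i) (τ' i)) •
          ((f.compContinuousLinearMap L) (fun i => realDir (τ i)) •
            conjForm (pullD L L' A (fun i => realDir (τ' i)))) := by
  -- After both arguments are expanded in the frame, the orthonormal basis enters only through the
  -- sums `∑ a, c a i * c a j`, the entries of the inverse Gram matrix. These vary continuously with
  -- the point, which the chosen orthonormal basis need not do.
  obtain ⟨c, hc1, hc2⟩ := gramMatrix_inv (x := ζ) hL
  have e1 : ∀ σ : Fin k → Fin (Module.finrank ℝ (Tan n ζ)), f (fun i => stdB ζ (σ i)) =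
      ∑ τ : Fin k → Fin n × Fin 2, (∏ i, c (σ i) (τ i)) •
        (f.compContinuousLinearMap L) (fun i => realDir (τ i)) := by
    intro σ
    rw [← alternating_map_sum_smul (f.compContinuousLinearMap L) realDir fun i a => c (σ i) a]
    simp only [ContinuousAlternatingMap.compContinuousLinearMap_apply]
    congr 1; ext1 i; exact hc1 _
  have e2 : ∀ σ : Fin k → Fin (Module.finrank ℝ (Tan n ζ)),
      (conjForm (A (fun i => stdB ζ (σ i)))).compContinuousLinearMap L' =
      ∑ τ : Fin k → Fin n × Fin 2, (∏ i, c (σ i) (τ i)) •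
        conjForm (pullD L L' A (fun i => realDir (τ i))) := by
    intro σ
    have h := alternating_map_sum_smul (pullD L L' A) realDir fun i a => c (σ i) a
    have h' : pullD L L' A (fun i => ∑ a, c (σ i) a • realDir a) =
        (A (fun i => stdB ζ (σ i))).compContinuousLinearMap L' := by
      rw [pullD_apply]
      congr 2; ext1 i; exact (hc1 _).symm
    rw [conjForm_comp, ← h', h]
    exact map_sum (ContinuousLinearMap.compContinuousAlternatingMapCLM ℝ (Cn n) ℂ ℂ (Fin l)
      (Complex.conjCLE : ℂ →L[ℝ] ℂ)) _ _ |>.trans (Finset.sum_congr rfl fun τ _ =>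
        map_smul (ContinuousLinearMap.compContinuousAlternatingMapCLM ℝ (Cn n) ℂ ℂ (Fin l)
      (Complex.conjCLE : ℂ →L[ℝ] ℂ)) _ _)
  have e3 : (pairing ζ f A).compContinuousLinearMap L' =
      ((k.factorial : ℂ))⁻¹ • ∑ σ : Fin k → Fin (Module.finrank ℝ (Tan n ζ)),
      f (fun i => stdB ζ (σ i)) •
        (conjForm (A (fun i => stdB ζ (σ i)))).compContinuousLinearMap L' := by
    rw [pairing_eq]
    ext v
    simp
  rw [e3]
  congr 1
  calc _ = ∑ σ : Fin k → Fin (Module.finrank ℝ (Tan n ζ)),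
        ∑ τ : Fin k → Fin n × Fin 2, ∑ τ' : Fin k → Fin n × Fin 2,
        (∏ i, c (σ i) (τ i) * c (σ i) (τ' i)) •
          ((f.compContinuousLinearMap L) (fun i => realDir (τ i)) •
            conjForm (pullD L L' A (fun i => realDir (τ' i)))) := by
        refine Finset.sum_congr rfl fun σ _ => ?_
        rw [e1, e2]
        refine (sum_smul_sum_smul _ _ _ _).trans ?_
        refine Finset.sum_congr rfl fun τ _ => Finset.sum_congr rfl fun τ' _ => ?_
        rw [Finset.prod_mul_distrib]
    _ = _ := by
        rw [Finset.sum_comm]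
        refine Finset.sum_congr rfl fun τ _ => ?_
        rw [Finset.sum_comm]
        refine Finset.sum_congr rfl fun τ' _ => ?_
        rw [← Finset.sum_smul]
        congr 1
        have := Finset.prod_univ_sum (fun _ : Fin k =>
          (Finset.univ : Finset (Fin (Module.finrank ℝ (Tan n ζ)))))
          (fun i a => c a (τ i) * c a (τ' i))
        rw [Finset.prod_congr rfl fun i _ => (hc2 (τ i) (τ' i)).symm, this]
        simp

theorem IsFrame.norm_pairing_comp_le {ζ : X} {L : Cn n →L[ℝ] Cn n} {C : ℝ} (hC : 0 ≤ C)
    (h : IsFrame ζ L C) (L' : Cn n →L[ℝ] Cn n) (f : Form n k) (A : DForm n k l) :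
    ‖(pairing ζ f A).compContinuousLinearMap L'‖ ≤
      ((2 * n : ℕ) : ℝ) ^ k * (C ^ k * C ^ k) *
        (‖f.compContinuousLinearMap L‖ * ‖pullD L L' A‖) := by
  let g : DForm n k l := (ContinuousAlternatingMap.compContinuousLinearMapCLM L'
    : Form n l →L[ℝ] Form n l).compContinuousAlternatingMap A
  have e3 : (pairing ζ f A).compContinuousLinearMap L' =
      ((k.factorial : ℂ))⁻¹ • ∑ σ : Fin k → Fin (Module.finrank ℝ (Tan n ζ)),
      f (fun i => stdB ζ (σ i)) • conjForm (g (fun i => stdB ζ (σ i))) := by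
    rw [pairing_eq]
    ext v
    simp only [ContinuousAlternatingMap.compContinuousLinearMap_apply,
      ContinuousAlternatingMap.smul_apply, ContinuousAlternatingMap.sum_apply]
    rfl
  have h1 : ‖((k.factorial : ℂ))⁻¹‖ ≤ 1 := by
    rw [norm_inv]
    refine inv_le_one_of_one_le₀ ?_
    simp only [Complex.norm_natCast]
    exact_mod_cast k.factorial_pos
  rw [e3, norm_smul]
  refine (mul_le_of_le_one_left (norm_nonneg _) h1).trans ((norm_sum_le _ _).trans ?_)
  have hb : ∀ σ ∈ (Finset.univ : Finset (Fin k → Fin (Module.finrank ℝ (Tan n ζ)))),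
      ‖f (fun i => stdB ζ (σ i)) • conjForm (g (fun i => stdB ζ (σ i)))‖ ≤
      (C ^ k * ‖f.compContinuousLinearMap L‖) * (C ^ k * ‖pullD L L' A‖) := by
    intro σ _
    rw [norm_smul]
    refine mul_le_mul (h.norm_apply_le f σ) ((norm_conjForm_le _).trans ?_) (norm_nonneg _)
      (by positivity)
    exact h.norm_apply_le g σ
  refine (Finset.sum_le_card_nsmul _ _ _ hb).trans (le_of_eq ?_)
  rw [Finset.card_univ, Fintype.card_fun, card_stdB, Fintype.card_fin, nsmul_eq_mul]
  push_cast
  ring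

end Norms

/-! ### Coordinate distance against Riemannian distance. -/

section Distance

variable {n : ℕ} {X : Type*} [TopologicalSpace X] [ChartedSpace (Cn n) X]
  [RiemannianBundle (fun x : X => Tan n x)] [IsManifold 𝓘(ℂ, Cn n) ω X]
  [IsContMDiffRiemannianBundle 𝓘(ℝ, Cn n) ∞ (Cn n) (fun x : X => Tan n x)]
  {e : OpenPartialHomeomorph X (Cn n)}

/-- The differential of a chart, as a map from the tangent space to `ℂⁿ`. -/
def chartDeriv (e : OpenPartialHomeomorph X (Cn n)) (x : X) : Cn n →L[ℝ] Cn n :=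
  show Tan n x →L[ℝ] TangentSpace 𝓘(ℝ, Cn n) (e x) from mfderiv 𝓘(ℝ, Cn n) 𝓘(ℝ, Cn n) e x

theorem chartDeriv_coordTan (he : e ∈ HolCharts n X) {x : X} (hx : x ∈ e.source) (v : Cn n) :
    chartDeriv e x (coordTan e (e x) v) = v := by
  have h1 : MDifferentiableAt 𝓘(ℝ, Cn n) 𝓘(ℝ, Cn n) e x :=
    (contMDiffAt_of_mem_maximalAtlas (mem_real_maximalAtlas he) hx).mdifferentiableAt (by simp)
  have h2 : MDifferentiableAt 𝓘(ℝ, Cn n) 𝓘(ℝ, Cn n) e.symm (e x) :=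
    (contMDiffAt_symm_of_mem_maximalAtlas (mem_real_maximalAtlas he)
      (e.map_source hx)).mdifferentiableAt (by simp)
  have hx' : e.symm (e x) = x := e.left_inv hx
  have h1' : MDifferentiableAt 𝓘(ℝ, Cn n) 𝓘(ℝ, Cn n) e (e.symm (e x)) := by rwa [hx']
  have h3 := mfderiv_comp (e x) h1' h2
  have h4 : (e ∘ e.symm) =ᶠ[𝓝 (e x)] id := by
    filter_upwards [e.open_target.mem_nhds (e.map_source hx)] with u hu
    exact e.right_inv hu
  rw [h4.mfderiv_eq, mfderiv_id] at h3
  have h5 := congrArg (fun L : Cn n →L[ℝ] Cn n => L v) h3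
  rw [hx'] at h5
  exact h5.symm

theorem norm_chartDeriv_le (he : e ∈ HolCharts n X) {x : X} (hx : x ∈ e.source) {C : ℝ}
    (hF : IsFrame x (coordTan e (e x)) C) (w : Cn n) :
    ‖chartDeriv e x w‖ ≤ C * ‖(show Tan n x from w)‖ := by
  obtain ⟨v, rfl⟩ := hF.surjective w
  rw [chartDeriv_coordTan he hx]
  exact (hF v).1

/-- A sufficiently short path cannot leave a neighbourhood on which the differential of the chart is
bounded, and inside it the Euclidean displacement is at most a constant times the length. -/
theorem exists_riemannianEDist_ge [T2Space X] (he : e ∈ HolCharts n X) {x₀ : X}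
    (hx₀ : x₀ ∈ e.source) :
    ∃ C : NNReal, 0 < C ∧ ∃ O ∈ 𝓝 x₀, ∀ x ∈ O, ∀ y ∈ O,
      ‖e y - e x‖ₑ ≤ C * Manifold.riemannianEDist 𝓘(ℝ, Cn n) x y := by
  have : LocallyCompactSpace X := ChartedSpace.locallyCompactSpace (Cn n) X
  have : IsManifold 𝓘(ℝ, Cn n) 1 X := IsManifold.of_le (n := ∞) (by simp)
  obtain ⟨C₀, C₀pos, hC₀⟩ := eventually_isFrame_coordTan he hx₀
  lift C₀ to NNReal using C₀pos.le
  set C : NNReal := C₀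
  have C_pos : 0 < C := by exact_mod_cast C₀pos
  obtain ⟨u, u_mem, u_closed, hu, uc⟩ : ∃ u ∈ 𝓝 x₀, IsClosed u
      ∧ u ⊆ {y | IsFrame y (coordTan e (e y)) C} ∧ u ⊆ e.source := by
    have := Filter.inter_mem hC₀ (e.open_source.mem_nhds hx₀)
    rcases exists_mem_nhds_isClosed_subset this with ⟨u, u_mem, u_closed, hu⟩
    exact ⟨u, u_mem, u_closed, fun y hy => (hu hy).1, fun y hy => (hu hy).2⟩
  obtain ⟨v, v_mem, v_open, hv⟩ : ∃ v, v ∈ 𝓝 x₀ ∧ IsOpen v ∧ v ⊆ u := by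
    obtain ⟨v, hv, hvo, hxv⟩ := mem_nhds_iff.1 u_mem
    exact ⟨v, hvo.mem_nhds hxv, hvo, hv⟩
  have hsymm : ContinuousAt e.symm (e x₀) := e.continuousAt_symm (e.map_source hx₀)
  obtain ⟨r, r_pos, hr⟩ : ∃ r > 0, Metric.ball (e x₀) (r + r) ⊆ e.symm ⁻¹' v := by
    have : e.symm ⁻¹' v ∈ 𝓝 (e x₀) := hsymm.preimage_mem_nhds (by rwa [e.left_inv hx₀])
    obtain ⟨r, r_pos, hr⟩ := Metric.mem_nhds_iff.1 this
    exact ⟨r / 2, half_pos r_pos, by simpa using hr⟩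
  lift r to NNReal using r_pos.le
  simp only [gt_iff_lt, NNReal.coe_pos] at r_pos
  refine ⟨2 * C, by positivity, u ∩ (e ⁻¹' Metric.ball (e x₀) r), Filter.inter_mem u_mem
    ((e.continuousAt hx₀).preimage_mem_nhds (Metric.ball_mem_nhds _ (by exact_mod_cast r_pos))), ?_⟩
  rintro x ⟨hxu, hxr⟩ y ⟨hyu, hyr⟩
  -- If the points are far apart there is nothing to do: both images lie in a ball of radius `r`,
  -- and `2 * r = 2 * C * (r / C)`. This is the source of the factor 2 in the constant.
  by_cases hlarge : ((r / C : NNReal) : ℝ≥0∞) ≤ Manifold.riemannianEDist 𝓘(ℝ, Cn n) x y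
  · have h1 : ‖e y - e x‖ₑ ≤ ((2 * r : NNReal) : ℝ≥0∞) := by
      rw [← edist_eq_enorm_sub, edist_dist]
      refine ENNReal.ofReal_le_of_le_toReal ?_
      have := dist_triangle_right (e y) (e x) (e x₀)
      rw [mem_preimage, Metric.mem_ball] at hxr hyr
      simp only [ENNReal.coe_toReal, NNReal.coe_mul, NNReal.coe_ofNat]
      linarith
    refine h1.trans (le_trans ?_ (mul_le_mul_right hlarge _))
    rw [← ENNReal.coe_mul]
    refine ENNReal.coe_le_coe.2 (le_of_eq ?_)
    field_simp
  push Not at hlarge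
  have key : ∀ d : ℝ≥0∞, Manifold.riemannianEDist 𝓘(ℝ, Cn n) x y < d →
      d ≤ ((r / C : NNReal) : ℝ≥0∞) → ‖e y - e x‖ₑ ≤ C * d := by
    intro d hd hdr
    rcases Manifold.exists_lt_locally_constant_of_riemannianEDist_lt hd zero_lt_one
      with ⟨γ, hγx, hγy, γ_smooth, hγ, -⟩
    have length : ∀ t₁, 0 ≤ t₁ → t₁ ≤ 1 → Icc 0 t₁ ⊆ γ ⁻¹' u →
        ‖e (γ t₁) - e (γ 0)‖ₑ ≤ C * d := by
      intro t₁ ht₁0 ht₁1 t₁_mem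
      let γ' := e ∘ γ
      rcases ht₁0.eq_or_lt with rfl | h't'
      · simp
      have hC : ContMDiffOn 𝓘(ℝ, ℝ) 𝓘(ℝ, Cn n) 1 γ' (Icc 0 t₁) :=
        ((contMDiffOn_of_mem_maximalAtlas (mem_real_maximalAtlas he)).of_le (by simp)).comp
          γ_smooth.contMDiffOn (fun t' ht' ↦ uc <| t₁_mem ht')
      calc
        ‖γ' t₁ - γ' 0‖ₑ
      _ ≤ ∫⁻ t' in Icc 0 t₁, ‖derivWithin γ' (Icc 0 t₁) t'‖ₑ := by
        apply enorm_sub_le_lintegral_derivWithin_Icc_of_contDiffOn_Icc _ ht₁0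
        rwa [← contMDiffOn_iff_contDiffOn]
      _ = ∫⁻ t' in Icc 0 t₁, ‖(show Cn n from
            mfderivWithin 𝓘(ℝ, ℝ) 𝓘(ℝ, Cn n) γ' (Icc 0 t₁) t' (1 : ℝ))‖ₑ := by
        simp_rw [← fderivWithin_derivWithin, mfderivWithin_eq_fderivWithin]
        rfl
      _ ≤ ∫⁻ t' in Icc 0 t₁, C * ‖(show Tan n (γ t') from
            mfderivWithin 𝓘(ℝ, ℝ) 𝓘(ℝ, Cn n) γ (Icc 0 t₁) t' (1 : ℝ))‖ₑ := by
        apply setLIntegral_mono' measurableSet_Icc (fun t' ht' ↦ ?_)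
        have h1 : mfderivWithin 𝓘(ℝ, ℝ) 𝓘(ℝ, Cn n) γ' (Icc 0 t₁) t' =
            (mfderiv 𝓘(ℝ, Cn n) 𝓘(ℝ, Cn n) e (γ t')) ∘L
              (mfderivWithin 𝓘(ℝ, ℝ) 𝓘(ℝ, Cn n) γ (Icc 0 t₁) t') := by
          apply mfderiv_comp_mfderivWithin
          · exact (contMDiffAt_of_mem_maximalAtlas (mem_real_maximalAtlas he)
              (uc (t₁_mem ht'))).mdifferentiableAt (by simp)
          · exact (γ_smooth.mdifferentiable one_ne_zero).mdifferentiableOn _ ht'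
          · rw [uniqueMDiffWithinAt_iff_uniqueDiffWithinAt]
            exact uniqueDiffOn_Icc h't' _ ht'
        rw [h1]
        have h2 := norm_chartDeriv_le he (uc (t₁_mem ht')) (hu (t₁_mem ht'))
          (mfderivWithin 𝓘(ℝ, ℝ) 𝓘(ℝ, Cn n) γ (Icc 0 t₁) t' (1 : ℝ))
        have h3 : ∀ (a : Cn n) (b : Tan n (γ t')), ‖a‖ ≤ C * ‖b‖ → ‖a‖ₑ ≤ C * ‖b‖ₑ := by
          intro a b hab
          rw [enorm_eq_nnnorm, enorm_eq_nnnorm, ← ENNReal.coe_mul]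
          exact ENNReal.coe_le_coe.2 (by exact_mod_cast hab)
        exact h3 _ _ h2
      _ = C * Manifold.pathELength 𝓘(ℝ, Cn n) γ 0 t₁ := by
        rw [lintegral_const_mul' _ _ ENNReal.coe_ne_top,
          Manifold.pathELength_eq_lintegral_mfderivWithin_Icc]
        rfl
      _ ≤ C * Manifold.pathELength 𝓘(ℝ, Cn n) γ 0 1 := by
        gcongr
      _ ≤ C * d := by
        gcongr
    let A := γ ⁻¹' u
    have zero_mem : 0 ∈ A := by simpa [hγx, A] using hxu
    have A_closed : IsClosed (A ∩ Icc 0 1) :=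
      (u_closed.preimage γ_smooth.continuous).inter isClosed_Icc
    -- Continuity argument. While the path has stayed in `u`, its image is within `r` of `e x`,
    -- hence within `r + r` of `e x₀`; its current endpoint then lies in the open set `v ⊆ u`, so
    -- the path stays in `u` for a further while.
    have hA : Icc 0 1 ⊆ A := by
      apply A_closed.Icc_subset_of_forall_mem_nhdsGT_of_Icc_subset zero_mem
      rintro t₁ ⟨ht₁0, ht₁1⟩ t₁_mem
      suffices γ t₁ ∈ v from
        γ_smooth.continuous.continuousWithinAt <| mem_of_superset (v_open.mem_nhds this) hv
      have h1 := length t₁ ht₁0 ht₁1.le t₁_mem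
      have h2 : ‖e (γ t₁) - e (γ 0)‖ₑ ≤ (r : ℝ≥0∞) := by
        refine h1.trans ((mul_le_mul_right hdr _).trans ?_)
        rw [← ENNReal.coe_mul]
        refine ENNReal.coe_le_coe.2 (le_of_eq ?_)
        field_simp
      have h3 : e (γ t₁) ∈ Metric.ball (e x₀) (r + r) := by
        rw [enorm_eq_nnnorm, ENNReal.coe_le_coe, hγx] at h2
        have h2' : ‖e (γ t₁) - e x‖ ≤ r := h2
        rw [mem_preimage, Metric.mem_ball] at hxr
        rw [← dist_eq_norm] at h2'
        rw [Metric.mem_ball]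
        have := dist_triangle (e (γ t₁)) (e x) (e x₀)
        linarith
      have h4 := hr h3
      rwa [mem_preimage, e.left_inv (uc (t₁_mem (right_mem_Icc.2 ht₁0)))] at h4
    have := length 1 zero_le_one le_rfl hA
    rwa [hγx, hγy] at this
  refine le_of_forall_gt_imp_ge_of_dense fun b hb => ?_
  have hCt : (C : ℝ≥0∞) ≠ ⊤ := ENNReal.coe_ne_top
  have hC0 : (C : ℝ≥0∞) ≠ 0 := by exact_mod_cast C_pos.ne'
  have h1 : Manifold.riemannianEDist 𝓘(ℝ, Cn n) x y < b / C := by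
    rw [ENNReal.lt_div_iff_mul_lt (Or.inl hC0) (Or.inl hCt), mul_comm]
    refine lt_of_le_of_lt ?_ hb
    gcongr
    exact_mod_cast (le_mul_of_one_le_left C.2 (by norm_num) : C ≤ 2 * C)
  refine (key (min (b / C) ((r / C : NNReal) : ℝ≥0∞)) (lt_min h1 hlarge) (min_le_right _ _)).trans ?_
  refine (mul_le_mul_right (min_le_left _ _) _).trans ?_
  rw [ENNReal.mul_div_cancel hC0 hCt]

end Distance

/-! ### Wirtinger calculus, the real Hessian, and invariance of the Levi form. -/

section Wirtinger

variable {n : ℕ}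

theorem sum_realDir (h : Cn n) :
    h = ∑ j, ((h j).re • realDir (j, 0) + (h j).im • realDir (j, 1)) := by
  have h1 := (realBasis n).sum_repr h
  rw [Fintype.sum_prod_type] at h1
  conv_lhs => rw [← h1]
  refine Finset.sum_congr rfl fun j _ => ?_
  rw [Fin.sum_univ_two, realBasis_apply, realBasis_apply]
  rfl

/-- The complex linear part of the differential. -/
def delPart (f : Cn n → ℂ) (u h : Cn n) : ℂ := ∑ j, dz j f u * h j

theorem fderiv_eq_wirtinger (f : Cn n → ℂ) (u h : Cn n) :
    fderiv ℝ f u h = ∑ j, (dz j f u * h j + dzbar j f u * (starRingEnd ℂ) (h j)) := by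
  conv_lhs => rw [sum_realDir h]
  rw [map_sum]
  refine Finset.sum_congr rfl fun j _ => ?_
  rw [map_add, map_smul, map_smul, dz, dzbar, Complex.real_smul, Complex.real_smul]
  generalize fderiv ℝ f u (realDir (j, 0)) = a
  generalize fderiv ℝ f u (realDir (j, 1)) = b
  generalize h j = p
  apply Complex.ext <;> simp <;> ring

/-- Expresses the `(1,0)` part through the real differential and multiplication by `i` alone, so
that its compatibility with holomorphic transition maps is immediate. -/
theorem delPart_eq (f : Cn n → ℂ) (u h : Cn n) :
    delPart f u h =
      (1 / 2) * (fderiv ℝ f u h - Complex.I * fderiv ℝ f u (Complex.I • h)) := by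
  rw [fderiv_eq_wirtinger, fderiv_eq_wirtinger, Finset.mul_sum, ← Finset.sum_sub_distrib,
    Finset.mul_sum, delPart]
  refine Finset.sum_congr rfl fun j _ => ?_
  have : (Complex.I • h) j = Complex.I * h j := rfl
  rw [this, map_mul, Complex.conj_I]
  linear_combination ((1/2) * dz j f u * h j - (1/2) * dzbar j f u * (starRingEnd ℂ) (h j)) *
    Complex.I_sq

theorem conj_dz (j : Fin n) (f : Cn n → ℂ) (u : Cn n) :
    (starRingEnd ℂ) (dz j f u) = dzbar j (fun v => (starRingEnd ℂ) (f v)) u := by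
  have h : fderiv ℝ (fun v => (starRingEnd ℂ) (f v)) u =
      (Complex.conjCLE : ℂ →L[ℝ] ℂ).comp (fderiv ℝ f u) :=
    Complex.conjCLE.comp_fderiv
  have h2 : (starRingEnd ℂ) (2 : ℂ) = 2 := Complex.conj_ofNat 2
  rw [dz, dzbar, h]
  simp [h2, sub_eq_add_neg]

theorem conj_dzbar (j : Fin n) (f : Cn n → ℂ) (u : Cn n) :
    (starRingEnd ℂ) (dzbar j f u) = dz j (fun v => (starRingEnd ℂ) (f v)) u := by
  have h : fderiv ℝ (fun v => (starRingEnd ℂ) (f v)) u =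
      (Complex.conjCLE : ℂ →L[ℝ] ℂ).comp (fderiv ℝ f u) :=
    Complex.conjCLE.comp_fderiv
  have h2 : (starRingEnd ℂ) (2 : ℂ) = 2 := Complex.conj_ofNat 2
  rw [dz, dzbar, h]
  simp [h2, sub_eq_add_neg]

variable {g : Cn n → ℂ}

/-- The complex Hessian of type `(2,0)`. -/
def hess20 (g : Cn n → ℂ) (u h : Cn n) : ℂ := ∑ j, ∑ k, dz j (dz k g) u * h j * h k

/-- The complex Hessian of type `(1,1)`. -/
def hess11 (g : Cn n → ℂ) (u h : Cn n) : ℂ :=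
  ∑ j, ∑ k, dz j (dzbar k g) u * h j * (starRingEnd ℂ) (h k)

theorem fderiv_re_of_real (hg : ∀ v, (starRingEnd ℂ) (g v) = g v) (u h : Cn n) :
    fderiv ℝ g u h = ((2 * (delPart g u h).re : ℝ) : ℂ) := by
  rw [fderiv_eq_wirtinger, Finset.sum_add_distrib]
  have : ∑ j, dzbar j g u * (starRingEnd ℂ) (h j) = (starRingEnd ℂ) (delPart g u h) := by
    rw [delPart, map_sum]
    refine Finset.sum_congr rfl fun j _ => ?_
    rw [map_mul, conj_dz]; simp only [hg]
  rw [this]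
  change delPart g u h + _ = _
  rw [Complex.add_conj]

theorem contDiffAt_dz {u : Cn n} (hg : ContDiffAt ℝ ∞ g u) (j : Fin n) :
    ContDiffAt ℝ ∞ (dz j g) u := by
  have h : ContDiffAt ℝ ∞ (fderiv ℝ g) u := hg.fderiv_right (by simp)
  unfold dz
  exact contDiffAt_const.mul ((h.clm_apply contDiffAt_const).sub
    (contDiffAt_const.mul (h.clm_apply contDiffAt_const)))

theorem contDiffAt_dzbar {u : Cn n} (hg : ContDiffAt ℝ ∞ g u) (j : Fin n) :
    ContDiffAt ℝ ∞ (dzbar j g) u := by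
  have h : ContDiffAt ℝ ∞ (fderiv ℝ g) u := hg.fderiv_right (by simp)
  unfold dzbar
  exact contDiffAt_const.mul ((h.clm_apply contDiffAt_const).add
    (contDiffAt_const.mul (h.clm_apply contDiffAt_const)))

/-- Differentiating the Wirtinger expansion a second time gives four groups of terms; for real `g`
they form two conjugate pairs. -/
theorem snd_fderiv_of_real (hg : ∀ v, (starRingEnd ℂ) (g v) = g v) {u : Cn n}
    (hs : ContDiffAt ℝ ∞ g u) (h : Cn n) :
    fderiv ℝ (fderiv ℝ g) u h h = ((2 * (hess20 g u h).re + 2 * (hess11 g u h).re : ℝ) : ℂ) := by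
  have hd : DifferentiableAt ℝ (fderiv ℝ g) u :=
    (hs.fderiv_right (m := ∞) (by simp)).differentiableAt (by simp)
  have e1 : fderiv ℝ (fderiv ℝ g) u h h = fderiv ℝ (fun v => fderiv ℝ g v h) u h := by
    rw [fderiv_clm_apply hd (differentiableAt_const h)]
    simp
  have d1 : ∀ k, DifferentiableAt ℝ (dz k g) u := fun k =>
    (contDiffAt_dz hs k).differentiableAt (by simp)
  have d2 : ∀ k, DifferentiableAt ℝ (dzbar k g) u := fun k =>
    (contDiffAt_dzbar hs k).differentiableAt (by simp)
  have e2 : (fun v => fderiv ℝ g v h) =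
      fun v => ∑ k, (dz k g v * h k + dzbar k g v * (starRingEnd ℂ) (h k)) := by
    ext v; exact fderiv_eq_wirtinger g v h
  have e3 : fderiv ℝ (fun v => fderiv ℝ g v h) u h =
      ∑ k, (fderiv ℝ (dz k g) u h * h k + fderiv ℝ (dzbar k g) u h * (starRingEnd ℂ) (h k)) := by
    rw [e2, fderiv_fun_sum (A := fun k v => dz k g v * h k + dzbar k g v * (starRingEnd ℂ) (h k))
      (fun k _ => ((d1 k).mul_const _).fun_add ((d2 k).mul_const _)),
      _root_.sum_apply]
    refine Finset.sum_congr rfl fun k _ => ?_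
    rw [fderiv_fun_add ((d1 k).mul_const _) ((d2 k).mul_const _), fderiv_mul_const (d1 k),
      fderiv_mul_const (d2 k)]
    simp [mul_comm]
  have c1 : ∀ j k, dzbar j (dzbar k g) u = (starRingEnd ℂ) (dz j (dz k g) u) := by
    intro j k; rw [conj_dz]; congr 1; ext v; rw [conj_dz]; simp only [hg]
  have c2 : ∀ j k, dzbar j (dz k g) u = (starRingEnd ℂ) (dz j (dzbar k g) u) := by
    intro j k; rw [conj_dz]; congr 1; ext v; rw [conj_dzbar]; simp only [hg]
  have e4 : fderiv ℝ (fun v => fderiv ℝ g v h) u h =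
      (hess20 g u h + (starRingEnd ℂ) (hess20 g u h)) +
      (hess11 g u h + (starRingEnd ℂ) (hess11 g u h)) := by
    rw [e3]
    simp only [hess20, hess11, map_sum, map_mul, Complex.conj_conj]
    rw [Finset.sum_comm (f := fun j k => dz j (dz k g) u * h j * h k),
      Finset.sum_comm (f := fun j k => (starRingEnd ℂ) (dz j (dz k g) u) * _ * _),
      Finset.sum_comm (f := fun j k => dz j (dzbar k g) u * h j * _),
      Finset.sum_comm (f := fun j k => (starRingEnd ℂ) (dz j (dzbar k g) u) * _ * _)]
    simp only [← Finset.sum_add_distrib]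
    refine Finset.sum_congr rfl fun k _ => ?_
    rw [fderiv_eq_wirtinger, fderiv_eq_wirtinger, Finset.sum_mul, Finset.sum_mul,
      ← Finset.sum_add_distrib]
    refine Finset.sum_congr rfl fun j _ => ?_
    rw [c1, c2]; ring
  rw [e1, e4, Complex.add_conj, Complex.add_conj]
  push_cast; ring

theorem hess20_smul_I (u h : Cn n) : hess20 g u (Complex.I • h) = -hess20 g u h := by
  simp only [hess20, ← Finset.sum_neg_distrib]
  refine Finset.sum_congr rfl fun j _ => Finset.sum_congr rfl fun k _ => ?_
  have : ∀ i, (Complex.I • h) i = Complex.I * h i := fun i => rfl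
  rw [this, this]
  linear_combination (dz j (dz k g) u * h j * h k) * Complex.I_sq

theorem hess11_smul_I (u h : Cn n) : hess11 g u (Complex.I • h) = hess11 g u h := by
  simp only [hess11]
  refine Finset.sum_congr rfl fun j _ => Finset.sum_congr rfl fun k _ => ?_
  have : ∀ i, (Complex.I • h) i = Complex.I * h i := fun i => rfl
  rw [this, this, map_mul, Complex.conj_I]
  linear_combination (-dz j (dzbar k g) u * h j * (starRingEnd ℂ) (h k)) * Complex.I_sq

/-- Replacing `h` by `i h` changes the sign of the `(2,0)` part and fixes the `(1,1)` part, so the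
sum of the two Hessian values isolates the latter. -/
theorem hess11_re_eq (hg : ∀ v, (starRingEnd ℂ) (g v) = g v) {u : Cn n}
    (hs : ContDiffAt ℝ ∞ g u) (h : Cn n) :
    (((hess11 g u h).re : ℝ) : ℂ) = (1 / 4) * (fderiv ℝ (fderiv ℝ g) u h h +
      fderiv ℝ (fderiv ℝ g) u (Complex.I • h) (Complex.I • h)) := by
  rw [snd_fderiv_of_real hg hs, snd_fderiv_of_real hg hs, hess20_smul_I, hess11_smul_I]
  push_cast
  simp only [Complex.neg_re, Complex.ofReal_neg]
  ring

theorem snd_fderiv_comp {T : Cn n → Cn n} {u : Cn n} (hg : ContDiffAt ℝ ∞ g (T u))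
    (hT : ContDiffAt ℝ ∞ T u) (h : Cn n) :
    fderiv ℝ (fderiv ℝ (g ∘ T)) u h h =
      fderiv ℝ (fderiv ℝ g) (T u) (fderiv ℝ T u h) (fderiv ℝ T u h) +
        fderiv ℝ g (T u) (fderiv ℝ (fderiv ℝ T) u h h) := by
  have hgT : ContDiffAt ℝ ∞ (g ∘ T) u := hg.comp u hT
  have dgT : DifferentiableAt ℝ (fderiv ℝ (g ∘ T)) u :=
    (hgT.fderiv_right (m := ∞) (by simp)).differentiableAt (by simp)
  have dg : DifferentiableAt ℝ (fderiv ℝ g) (T u) :=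
    (hg.fderiv_right (m := ∞) (by simp)).differentiableAt (by simp)
  have dT : DifferentiableAt ℝ (fderiv ℝ T) u :=
    (hT.fderiv_right (m := ∞) (by simp)).differentiableAt (by simp)
  have dT0 : DifferentiableAt ℝ T u := hT.differentiableAt (by simp)
  have e1 : fderiv ℝ (fderiv ℝ (g ∘ T)) u h h = fderiv ℝ (fun v => fderiv ℝ (g ∘ T) v h) u h := by
    rw [fderiv_clm_apply dgT (differentiableAt_const h)]
    simp
  have evg : ∀ᶠ v in 𝓝 u, ContDiffAt ℝ 1 g (T v) :=
    hT.continuousAt.eventually ((hg.of_le (m := 1) (by simp)).eventually (by simp))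
  have evT : ∀ᶠ v in 𝓝 u, ContDiffAt ℝ 1 T v := (hT.of_le (m := 1) (by simp)).eventually (by simp)
  have e2 : (fun v => fderiv ℝ (g ∘ T) v h) =ᶠ[𝓝 u]
      fun v => fderiv ℝ g (T v) (fderiv ℝ T v h) := by
    filter_upwards [evg, evT] with v hv hv'
    rw [fderiv_comp v (hv.differentiableAt (by simp)) (hv'.differentiableAt (by simp))]
    rfl
  have hA : HasFDerivAt (fun v => fderiv ℝ g (T v))
      ((fderiv ℝ (fderiv ℝ g) (T u)).comp (fderiv ℝ T u)) u :=
    dg.hasFDerivAt.comp u dT0.hasFDerivAt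
  have hB : HasFDerivAt (fun v => fderiv ℝ T v h) ((fderiv ℝ (fderiv ℝ T) u).flip h) u := by
    have := dT.hasFDerivAt.clm_apply (hasFDerivAt_const h u)
    simpa using this
  rw [e1, e2.fderiv_eq, (hA.clm_apply hB).fderiv]
  simp [add_comm]

/-- Invariance of the Levi form under holomorphic changes of coordinates. -/
theorem hess11_comp (hg : ∀ v, (starRingEnd ℂ) (g v) = g v) {T : Cn n → Cn n} {u : Cn n}
    (hs : ContDiffAt ℝ ∞ g (T u)) (hT : ContDiffAt ℝ ∞ T u)
    (hol : ∀ᶠ v in 𝓝 u, ∀ h : Cn n, fderiv ℝ T v (Complex.I • h) = Complex.I • fderiv ℝ T v h)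
    (h : Cn n) :
    (hess11 (g ∘ T) u h).re = (hess11 g (T u) (fderiv ℝ T u h)).re := by
  have dT : DifferentiableAt ℝ (fderiv ℝ T) u :=
    (hT.fderiv_right (m := ∞) (by simp)).differentiableAt (by simp)
  have hlin : ∀ w h : Cn n, fderiv ℝ (fderiv ℝ T) u w (Complex.I • h) =
      Complex.I • fderiv ℝ (fderiv ℝ T) u w h := by
    intro w h
    have e : (fun v => fderiv ℝ T v (Complex.I • h)) =ᶠ[𝓝 u]
        fun v => Complex.I • fderiv ℝ T v h := by
      filter_upwards [hol] with v hv using hv h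
    have h1 := dT.hasFDerivAt.clm_apply (hasFDerivAt_const (Complex.I • h) u)
    have h2 := dT.hasFDerivAt.clm_apply (hasFDerivAt_const h u)
    have h3 := h1.fderiv.symm.trans (e.fderiv_eq.trans (h2.const_smul Complex.I).fderiv)
    have := congrArg (fun L : Cn n →L[ℝ] Cn n => L w) h3
    simpa using this
  have hsymm : ∀ a b, fderiv ℝ (fderiv ℝ T) u a b = fderiv ℝ (fderiv ℝ T) u b a := by
    have := (hT.of_le (m := 2) (WithTop.coe_le_coe.2 le_top)).isSymmSndFDerivAt
      (by rw [minSmoothness_of_isRCLikeNormedField])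
    exact fun a b => this a b
  -- The second derivative of `T` is complex bilinear, being symmetric and complex linear in one
  -- argument. Its contributions from `h` and `i h` therefore cancel in `hess11_re_eq`, leaving only
  -- the Hessian of `g` on `fderiv ℝ T u h`.
  have hII : fderiv ℝ (fderiv ℝ T) u (Complex.I • h) (Complex.I • h) =
      -fderiv ℝ (fderiv ℝ T) u h h := by
    rw [hlin, hsymm, hlin, smul_smul, Complex.I_mul_I, neg_one_smul]
  have hreal : ∀ v, (starRingEnd ℂ) ((g ∘ T) v) = (g ∘ T) v := fun v => hg _
  have := hess11_re_eq hreal (hs.comp u hT) h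
  rw [snd_fderiv_comp hs hT, snd_fderiv_comp hs hT, hII, hol.self_of_nhds, map_neg] at this
  have h2 := hess11_re_eq hg hs (fderiv ℝ T u h)
  apply Complex.ofReal_injective
  rw [this, h2]
  ring

end Wirtinger

/-! ### Taylor expansion, Levi positivity and the Levi polynomial. -/

section LocalEstimates

variable {n : ℕ} {g : Cn n → ℂ} {u₀ : Cn n}

-- The base point moves as well, so the estimate rests on continuity of the second derivative: it
-- varies by at most `η` over the ball, and the mean value inequality is applied along the segment
-- first to the derivative of the remainder and then to the remainder.
set_option synthInstance.maxHeartbeats 200000 in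
theorem eventually_taylor_two {E F : Type*} [NormedAddCommGroup E] [NormedSpace ℝ E]
    [NormedAddCommGroup F] [NormedSpace ℝ F] {g : E → F} {u₀ : E} (hs : ContDiffAt ℝ ∞ g u₀) {η : ℝ} (hη : 0 < η) :
    ∃ δ > 0, ∀ u ∈ Metric.ball u₀ δ, ∀ w ∈ Metric.ball u₀ δ,
      ‖g w - g u - fderiv ℝ g u (w - u) -
        (1 / 2 : ℝ) • fderiv ℝ (fderiv ℝ g) u (w - u) (w - u)‖ ≤ η * ‖w - u‖ ^ 2 := by
  have hs2 : ContDiffAt ℝ ∞ (fderiv ℝ (fderiv ℝ g)) u₀ :=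
    (hs.fderiv_right (m := ∞) (by simp)).fderiv_right (by simp)
  have ev1 : ∀ᶠ v in 𝓝 u₀, ContDiffAt ℝ 2 g v :=
    (hs.of_le (m := 2) (WithTop.coe_le_coe.2 le_top)).eventually (by simp)
  have ev2 : ∀ᶠ v in 𝓝 u₀, fderiv ℝ (fderiv ℝ g) v ∈
      Metric.ball (fderiv ℝ (fderiv ℝ g) u₀) (η / 2) :=
    hs2.continuousAt.preimage_mem_nhds (Metric.ball_mem_nhds _ (half_pos hη))
  obtain ⟨δ, hδ, hball⟩ := Metric.eventually_nhds_iff_ball.1 (ev1.and ev2)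
  refine ⟨δ, hδ, fun u hu w hw => ?_⟩
  set h := w - u with hh
  have hseg : ∀ t ∈ Icc (0 : ℝ) 1, u + t • h ∈ Metric.ball u₀ δ := by
    intro t ht
    have := (convex_ball u₀ δ).add_smul_sub_mem hu hw ht
    exact this
  have hline : ∀ t : ℝ, HasDerivAt (fun t : ℝ => u + t • h) h t := by
    intro t
    simpa using ((hasDerivAt_id t).smul_const h).const_add u
  set D := fderiv ℝ g u h
  set Q := fderiv ℝ (fderiv ℝ g) u h h
  have hq : ∀ t ∈ Icc (0 : ℝ) 1, HasDerivWithinAt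
      (fun t : ℝ => fderiv ℝ g (u + t • h) h - t • Q)
      (fderiv ℝ (fderiv ℝ g) (u + t • h) h h - Q) (Icc 0 1) t := by
    intro t ht
    have hd : DifferentiableAt ℝ (fderiv ℝ g) (u + t • h) :=
      ((hball _ (hseg t ht)).1.fderiv_right (m := 1) (by norm_num)).differentiableAt (by simp)
    have h1 := hd.hasFDerivAt.comp_hasDerivAt t (hline t)
    have h2 := (h1.clm_apply (hasDerivAt_const t h)).sub ((hasDerivAt_id t).smul_const Q)
    refine (h2.congr_deriv ?_).hasDerivWithinAt
    simp [Q]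
  have hqb : ∀ t ∈ Icc (0 : ℝ) 1,
      ‖fderiv ℝ (fderiv ℝ g) (u + t • h) h h - Q‖ ≤ η * ‖h‖ ^ 2 := by
    intro t ht
    have h1 : ‖fderiv ℝ (fderiv ℝ g) (u + t • h) - fderiv ℝ (fderiv ℝ g) u‖ ≤ η := by
      have a1 := (hball _ (hseg t ht)).2
      have a2 := (hball _ hu).2
      rw [Metric.mem_ball] at a1 a2
      refine (dist_eq_norm (fderiv ℝ (fderiv ℝ g) (u + t • h)) _).symm.trans_le ?_
      have := dist_triangle_right (fderiv ℝ (fderiv ℝ g) (u + t • h)) (fderiv ℝ (fderiv ℝ g) u)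
        (fderiv ℝ (fderiv ℝ g) u₀)
      linarith
    calc ‖fderiv ℝ (fderiv ℝ g) (u + t • h) h h - Q‖
        = ‖(fderiv ℝ (fderiv ℝ g) (u + t • h) - fderiv ℝ (fderiv ℝ g) u) h h‖ := by simp [Q]
      _ ≤ ‖fderiv ℝ (fderiv ℝ g) (u + t • h) - fderiv ℝ (fderiv ℝ g) u‖ * ‖h‖ * ‖h‖ :=
        ContinuousLinearMap.le_opNorm₂ _ _ _
      _ ≤ η * ‖h‖ * ‖h‖ := by gcongr
      _ = η * ‖h‖ ^ 2 := by ring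
  have hs' : ∀ t ∈ Icc (0 : ℝ) 1, HasDerivWithinAt
      (fun t : ℝ => g (u + t • h) - t • D - (t ^ 2 / 2) • Q)
      (fderiv ℝ g (u + t • h) h - D - t • Q) (Icc 0 1) t := by
    intro t ht
    have hd : DifferentiableAt ℝ g (u + t • h) :=
      (hball _ (hseg t ht)).1.differentiableAt (by simp)
    have h1 := hd.hasFDerivAt.comp_hasDerivAt t (hline t)
    have h2 : HasDerivAt (fun t : ℝ => t ^ 2 / 2) t t := by
      refine (((hasDerivAt_id t).pow 2).div_const 2).congr_deriv ?_
      simp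
    have h3 := (h1.sub ((hasDerivAt_id t).smul_const D)).sub (h2.smul_const Q)
    refine (h3.congr_deriv ?_).hasDerivWithinAt
    simp
  have hsb : ∀ t ∈ Icc (0 : ℝ) 1,
      ‖fderiv ℝ g (u + t • h) h - D - t • Q‖ ≤ η * ‖h‖ ^ 2 := by
    intro t ht
    have := (convex_Icc (0 : ℝ) 1).norm_image_sub_le_of_norm_hasDerivWithin_le hq hqb
      (left_mem_Icc.2 zero_le_one) ht
    simp only [zero_smul, add_zero, sub_zero] at this
    have e : fderiv ℝ g (u + t • h) h - t • Q - fderiv ℝ g u h =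
      fderiv ℝ g (u + t • h) h - D - t • Q := by simp only [D]; abel
    rw [e] at this
    refine this.trans ?_
    rw [Real.norm_eq_abs, abs_of_nonneg ht.1]
    exact mul_le_of_le_one_right (by positivity) ht.2
  have := (convex_Icc (0 : ℝ) 1).norm_image_sub_le_of_norm_hasDerivWithin_le hs' hsb
    (left_mem_Icc.2 zero_le_one) (right_mem_Icc.2 zero_le_one)
  have e : u + h = w := by rw [hh]; abel
  simp only [one_smul, zero_smul, add_zero, sub_zero, one_pow, norm_one, mul_one, e,
    ne_eq, OfNat.ofNat_ne_zero, not_false_eq_true, zero_pow, zero_div] at this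
  have e' : g w - D - (1 / 2 : ℝ) • Q - g u = g w - g u - D - (1 / 2 : ℝ) • Q := by abel
  rwa [e'] at this

theorem norm_apply_le (h : Cn n) (j : Fin n) : ‖h j‖ ≤ ‖h‖ := PiLp.norm_apply_le h j

theorem norm_delPart_le (f : Cn n → ℂ) (u h : Cn n) : ‖delPart f u h‖ ≤ ‖fderiv ℝ f u‖ * ‖h‖ := by
  rw [delPart_eq, norm_mul]
  have h1 : ‖fderiv ℝ f u h‖ ≤ ‖fderiv ℝ f u‖ * ‖h‖ := (fderiv ℝ f u).le_opNorm h
  have h2 : ‖fderiv ℝ f u (Complex.I • h)‖ ≤ ‖fderiv ℝ f u‖ * ‖h‖ := by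
    refine ((fderiv ℝ f u).le_opNorm _).trans (le_of_eq ?_)
    rw [norm_smul, Complex.norm_I, one_mul]
  have h3 := norm_sub_le (fderiv ℝ f u h) (Complex.I * fderiv ℝ f u (Complex.I • h))
  rw [norm_mul, Complex.norm_I, one_mul] at h3
  have h4 : ‖(1 / 2 : ℂ)‖ = 1 / 2 := by simp
  rw [h4]
  linarith

theorem norm_delPart_sub_le (f : Cn n → ℂ) (u w h : Cn n) :
    ‖delPart f u h - delPart f w h‖ ≤ ‖fderiv ℝ f u - fderiv ℝ f w‖ * ‖h‖ := by
  have e : delPart f u h - delPart f w h = (1 / 2) * ((fderiv ℝ f u - fderiv ℝ f w) h -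
      Complex.I * (fderiv ℝ f u - fderiv ℝ f w) (Complex.I • h)) := by
    rw [delPart_eq, delPart_eq]; simp only [_root_.sub_apply]; ring
  set L := fderiv ℝ f u - fderiv ℝ f w
  rw [e, norm_mul]
  have h1 : ‖L h‖ ≤ ‖L‖ * ‖h‖ := L.le_opNorm h
  have h2 : ‖L (Complex.I • h)‖ ≤ ‖L‖ * ‖h‖ := by
    refine (L.le_opNorm _).trans (le_of_eq ?_)
    rw [norm_smul, Complex.norm_I, one_mul]
  have h3 := norm_sub_le (L h) (Complex.I * L (Complex.I • h))
  rw [norm_mul, Complex.norm_I, one_mul] at h3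
  have h4 : ‖(1 / 2 : ℂ)‖ = 1 / 2 := by simp
  rw [h4]
  linarith

theorem norm_double_sum_le (a : Fin n → Fin n → ℂ) (h h' : Cn n) :
    ‖∑ j, ∑ k, a j k * h j * h' k‖ ≤ (∑ j, ∑ k, ‖a j k‖) * (‖h‖ * ‖h'‖) := by
  rw [Finset.sum_mul]
  refine (norm_sum_le _ _).trans (Finset.sum_le_sum fun j _ => ?_)
  rw [Finset.sum_mul]
  refine (norm_sum_le _ _).trans (Finset.sum_le_sum fun k _ => ?_)
  rw [norm_mul, norm_mul, mul_assoc]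
  gcongr
  · exact norm_apply_le h j
  · exact norm_apply_le h' k

/-- Lipschitz and boundedness properties of the first derivatives, locally uniformly. -/
theorem eventually_lipschitz_bounds (hs : ContDiffAt ℝ ∞ g u₀) :
    ∃ C > 0, ∃ δ > 0, ∀ u ∈ Metric.ball u₀ δ, ∀ w ∈ Metric.ball u₀ δ,
      ‖g u - g w‖ ≤ C * ‖u - w‖ ∧
      (∀ h, ‖delPart g u h - delPart g w h‖ ≤ C * ‖u - w‖ * ‖h‖) ∧
      (∀ h, ‖delPart g u h‖ ≤ C * ‖h‖) ∧
      (∀ h, ‖hess20 g u h‖ ≤ C * ‖h‖ ^ 2) := by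
  obtain ⟨K₁, t₁, ht₁, hK₁⟩ :=
    (hs.of_le (m := 1) (by simp)).exists_lipschitzOnWith
  obtain ⟨K₂, t₂, ht₂, hK₂⟩ :=
    ((hs.fderiv_right (m := ∞) (by simp)).of_le (m := 1) (by simp)).exists_lipschitzOnWith
  have hc3 : ContinuousAt (fderiv ℝ g) u₀ := (hs.fderiv_right (m := ∞) (by simp)).continuousAt
  have ev3 : ∀ᶠ u in 𝓝 u₀, ‖fderiv ℝ g u‖ < ‖fderiv ℝ g u₀‖ + 1 :=
    hc3.norm.eventually_lt_const (lt_add_one _)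
  have hc4 : ContinuousAt (fun u => ∑ j, ∑ k, ‖dz j (dz k g) u‖) u₀ := by
    refine tendsto_finsetSum _ fun j _ => tendsto_finsetSum _ fun k _ => ?_
    exact (contDiffAt_dz (contDiffAt_dz hs k) j).continuousAt.norm
  have ev4 := hc4.eventually_lt_const (lt_add_one _)
  obtain ⟨δ, hδ, hball⟩ := Metric.eventually_nhds_iff_ball.1
    ((Filter.Eventually.and ht₁ ht₂).and (ev3.and ev4))
  set C₃ := ‖fderiv ℝ g u₀‖ + 1
  set C₄ := ∑ j, ∑ k, ‖dz j (dz k g) u₀‖ + 1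
  have hC₄ : 0 ≤ C₄ := by positivity
  have hC₃ : 0 < C₃ := by positivity
  refine ⟨K₁ + K₂ + C₃ + C₄, by positivity, δ, hδ, fun u hu w hw => ?_⟩
  obtain ⟨⟨u1, u2⟩, u3, u4⟩ := hball u hu
  obtain ⟨⟨w1, w2⟩, w3, w4⟩ := hball w hw
  have hK₁0 : (0 : ℝ) ≤ K₁ := K₁.2
  have hK₂0 : (0 : ℝ) ≤ K₂ := K₂.2
  refine ⟨?_, fun h => ?_, fun h => ?_, fun h => ?_⟩
  · have := hK₁.norm_sub_le u1 w1
    refine this.trans ?_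
    gcongr
    linarith
  · refine (norm_delPart_sub_le g u w h).trans ?_
    have := hK₂.norm_sub_le u2 w2
    gcongr
    refine this.trans ?_
    gcongr
    linarith
  · refine (norm_delPart_le g u h).trans ?_
    gcongr
    linarith
  · refine (norm_double_sum_le (fun j k => dz j (dz k g) u) h h).trans ?_
    rw [← sq]
    gcongr
    linarith

/-- A positive Levi form is locally uniformly positive. -/
theorem eventually_levi_pos (hs : ContDiffAt ℝ ∞ g u₀)
    (hpos : ∀ h : Cn n, h ≠ 0 → 0 < (hess11 g u₀ h).re) :
    ∃ c > 0, ∀ᶠ u in 𝓝 u₀, ∀ h, c * ‖h‖ ^ 2 ≤ (hess11 g u h).re := by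
  obtain ⟨c, hc, hmin⟩ : ∃ c > 0, ∀ h ∈ Metric.sphere (0 : Cn n) 1, c ≤ (hess11 g u₀ h).re := by
    have hcont : Continuous fun h : Cn n => (hess11 g u₀ h).re := by
      unfold hess11
      refine Complex.continuous_re.comp (continuous_finsetSum _ fun j _ =>
        continuous_finsetSum _ fun k _ => ?_)
      have hk : ∀ k : Fin n, Continuous fun h : Cn n => h k := fun k => by fun_prop
      exact (continuous_const.mul (hk j)).mul (Complex.continuous_conj.comp (hk k))
    by_cases hne : (Metric.sphere (0 : Cn n) 1).Nonempty
    · obtain ⟨h₀, hh₀, hm⟩ := (isCompact_sphere (0 : Cn n) 1).exists_isMinOn hne hcont.continuousOn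
      refine ⟨_, hpos h₀ ?_, fun h hh => hm hh⟩
      rintro rfl
      simp at hh₀
    · exact ⟨1, one_pos, fun h hh => (hne ⟨h, hh⟩).elim⟩
  have hc4 : ContinuousAt (fun u => ∑ j, ∑ k, ‖dz j (dzbar k g) u - dz j (dzbar k g) u₀‖) u₀ := by
    refine tendsto_finsetSum _ fun j _ => tendsto_finsetSum _ fun k _ => ?_
    exact ((contDiffAt_dz (contDiffAt_dzbar hs k) j).continuousAt.sub continuousAt_const).norm
  have ev : ∀ᶠ u in 𝓝 u₀, ∑ j, ∑ k, ‖dz j (dzbar k g) u - dz j (dzbar k g) u₀‖ < c / 2 :=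
    hc4.eventually_lt_const (by simpa using half_pos hc)
  refine ⟨c / 2, half_pos hc, ?_⟩
  filter_upwards [ev] with u hu h
  have h1 : c * ‖h‖ ^ 2 ≤ (hess11 g u₀ h).re := by
    by_cases hh : h = 0
    · subst hh; simp [hess11]
    have hn : 0 < ‖h‖ := norm_pos_iff.2 hh
    have := hmin ((‖h‖⁻¹ : ℝ) • h) (by simp [norm_smul, hn.ne'])
    have e : hess11 g u₀ ((‖h‖⁻¹ : ℝ) • h) = ((‖h‖⁻¹ ^ 2 : ℝ) : ℂ) * hess11 g u₀ h := by
      simp only [hess11, Finset.mul_sum]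
      refine Finset.sum_congr rfl fun j _ => Finset.sum_congr rfl fun k _ => ?_
      have : ∀ i, ((‖h‖⁻¹ : ℝ) • h) i = ((‖h‖⁻¹ : ℝ) : ℂ) * h i := fun i => by simp
      rw [this, this, map_mul, Complex.conj_ofReal]
      push_cast; ring
    rw [e, Complex.re_ofReal_mul, inv_pow, inv_mul_eq_div, le_div_iff₀ (by positivity)] at this
    exact this
  have h2 : ‖hess11 g u h - hess11 g u₀ h‖ ≤ c / 2 * ‖h‖ ^ 2 := by
    have e : hess11 g u h - hess11 g u₀ h = ∑ j, ∑ k,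
        (dz j (dzbar k g) u - dz j (dzbar k g) u₀) * h j *
          (WithLp.toLp 2 (fun k => (starRingEnd ℂ) (h k)) : Cn n) k := by
      simp only [hess11, ← Finset.sum_sub_distrib]
      refine Finset.sum_congr rfl fun j _ => Finset.sum_congr rfl fun k _ => ?_
      ring
    rw [e]
    refine (norm_double_sum_le _ h _).trans ?_
    have : ‖(WithLp.toLp 2 (fun k => (starRingEnd ℂ) (h k)) : Cn n)‖ = ‖h‖ := by
      simp [EuclideanSpace.norm_eq]
    rw [this, ← sq]
    gcongr
  have h3 := (Complex.abs_re_le_norm _).trans h2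
  rw [Complex.sub_re, abs_le] at h3
  linarith [h3.1]

/-- The Levi polynomial, in coordinates. -/
def leviPoly (g : Cn n → ℂ) (u w : Cn n) : ℂ :=
  delPart g u (u - w) - (1 / 2) * hess20 g u (u - w)

theorem hess20_neg (u h : Cn n) : hess20 g u (-h) = hess20 g u h := by
  simp [hess20]

theorem delPart_neg (u h : Cn n) : delPart g u (-h) = -delPart g u h := by
  simp [delPart]

/-- The basic estimate of the Levi polynomial at strictly plurisubharmonic points. -/
theorem eventually_leviPoly_re_ge (hg : ∀ v, (starRingEnd ℂ) (g v) = g v)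
    (hs : ∀ᶠ u in 𝓝 u₀, ContDiffAt ℝ ∞ g u)
    (hpos : ∀ h : Cn n, h ≠ 0 → 0 < (hess11 g u₀ h).re) :
    ∃ c > 0, ∃ δ > 0, ∀ u ∈ Metric.ball u₀ δ, ∀ w ∈ Metric.ball u₀ δ,
      (g u).re - (g w).re + c * ‖u - w‖ ^ 2 ≤ 2 * (leviPoly g u w).re := by
  obtain ⟨c, hc, hev⟩ := eventually_levi_pos hs.self_of_nhds hpos
  -- Half of the lower bound `c` of the Levi form pays for the Taylor remainder; the other half is
  -- the constant of the conclusion.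
  obtain ⟨δ₁, hδ₁, htay⟩ := eventually_taylor_two hs.self_of_nhds (half_pos hc)
  obtain ⟨δ₂, hδ₂, hball⟩ := Metric.eventually_nhds_iff_ball.1 (hs.and hev)
  refine ⟨c / 2, half_pos hc, min δ₁ δ₂, lt_min hδ₁ hδ₂, fun u hu w hw => ?_⟩
  have h1 := htay u (Metric.ball_subset_ball (min_le_left _ _) hu) w
    (Metric.ball_subset_ball (min_le_left _ _) hw)
  obtain ⟨h2, h3⟩ := hball u (Metric.ball_subset_ball (min_le_right _ _) hu)
  rw [fderiv_re_of_real hg, snd_fderiv_of_real hg h2] at h1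
  have h4 := (Complex.abs_re_le_norm _).trans h1
  have e : u - w = -(w - u) := by abel
  have h5 := h3 (w - u)
  rw [leviPoly, e, delPart_neg, hess20_neg, norm_neg]
  have e2 : (-delPart g u (w - u) - 1 / 2 * hess20 g u (w - u)).re =
      -(delPart g u (w - u)).re - (1 / 2) * (hess20 g u (w - u)).re := by
    have : (1 / 2 : ℂ) = ((1 / 2 : ℝ) : ℂ) := by push_cast; rfl
    rw [this, Complex.sub_re, Complex.re_ofReal_mul, Complex.neg_re]
  rw [e2]
  rw [Complex.real_smul, Complex.sub_re, Complex.sub_re, Complex.sub_re, Complex.re_ofReal_mul,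
    Complex.ofReal_re, Complex.ofReal_re, abs_le] at h4
  linarith [h4.2]

end LocalEstimates

/-! ### The exponent count that explains the definition of type. -/

section Exponents

theorem zpow_le_mul_zpow {x K : ℝ} (hx : 0 < x) (hxK : x ≤ K) {i i' : ℤ} (h : i' ≤ i) :
    x ^ i ≤ K ^ (i - i').toNat * x ^ i' := by
  have e : i = ((i - i').toNat : ℤ) + i' := by omega
  conv_lhs => rw [e, zpow_add₀ hx.ne', zpow_natCast]
  gcongr

/-- The quantities entering the local estimate of an admissible kernel at a pair of points. -/
structure KernelData (K G G' h Φ P x y Ψ : ℝ) : Prop where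
  -- In the application `G` and `G'` are γ at ζ and z, `h` is the coordinate distance, `Φ` the
  -- common size of `φ_ε` and `φ_ε^*`, `P` is `P_ε`, `x` and `y` are `-r_ε` at ζ and z, and `Ψ` is
  -- the anisotropic size of ζ - z. Among the relations, `mul_le` is the one that carries the
  -- anisotropy.
  one_le : 1 ≤ K
  G_pos : 0 < G
  G'_pos : 0 < G'
  h_pos : 0 < h
  Φ_pos : 0 < Φ
  P_pos : 0 < P
  Ψ_pos : 0 < Ψ
  x_nonneg : 0 ≤ x
  y_nonneg : 0 ≤ y
  G_le : G ≤ K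
  h_le : h ≤ K
  Φ_le : Φ ≤ K
  G'_le_add : G' ≤ K * (G + h)
  sq_le_Φ : h ^ 2 ≤ K * Φ
  x_le : x ≤ K * Φ
  y_le : y ≤ K * Φ
  sq_le_P : h ^ 2 ≤ K * P
  Φ_sq_le : Φ ^ 2 ≤ K * P
  mul_le : (G + h) * Ψ ≤ K * Φ
  Ψ_le : Ψ ≤ K * h

namespace KernelData

variable {K G G' h Φ P x y Ψ : ℝ} (H : KernelData K G G' h Φ P x y Ψ)
include H

theorem K_pos : 0 < K := zero_lt_one.trans_le H.one_le

/-- Each factor `r_ε` is at most `K Φ` and removes one order of singularity, which is why only `t -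
l - m` enters the type. -/
theorem boundary_factor_le (t : ℤ) (l m : ℕ) :
    Φ ^ (-t) * x ^ l * y ^ m ≤ K ^ (l + m) * Φ ^ (-(t - l - m)) := by
  have hK := H.K_pos
  have h1 : x ^ l ≤ (K * Φ) ^ l := pow_le_pow_left₀ H.x_nonneg H.x_le l
  have h2 : y ^ m ≤ (K * Φ) ^ m := pow_le_pow_left₀ H.y_nonneg H.y_le m
  have hΦ := H.Φ_pos
  have hx := H.x_nonneg
  have hy := H.y_nonneg
  calc Φ ^ (-t) * x ^ l * y ^ m ≤ Φ ^ (-t) * (K * Φ) ^ l * (K * Φ) ^ m := by gcongr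
    _ = K ^ (l + m) * Φ ^ (-(t - l - m)) := by
      have e : (-(t - l - m) : ℤ) = -t + (l : ℤ) + (m : ℤ) := by ring
      rw [e, zpow_add₀ hΦ.ne', zpow_add₀ hΦ.ne', zpow_natCast, zpow_natCast, mul_pow, mul_pow,
        pow_add]
      ring

/-- Both gradients are controlled by `G + h`. At most two such factors are kept, since only two can
be spent against `Φ^(-2)`; the others are bounded by `2 * K`. -/
theorem gradient_factor_le (a b : ℕ) :
    G ^ a * G' ^ b ≤ K ^ b * (2 * K) ^ (a + b - min 2 (a + b)) * (G + h) ^ min 2 (a + b) := by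
  have hK := H.K_pos
  have hG := H.G_pos
  have hh := H.h_pos
  have hG' := H.G'_pos
  have h1 : G ^ a ≤ (G + h) ^ a := pow_le_pow_left₀ hG.le (by linarith) a
  have h2 : G' ^ b ≤ (K * (G + h)) ^ b := pow_le_pow_left₀ hG'.le H.G'_le_add b
  have h3 : G + h ≤ 2 * K := by linarith [H.G_le, H.h_le]
  calc G ^ a * G' ^ b ≤ (G + h) ^ a * (K * (G + h)) ^ b := by gcongr
    _ = K ^ b * ((G + h) ^ (a + b - min 2 (a + b)) * (G + h) ^ min 2 (a + b)) := by
      rw [← pow_add, Nat.sub_add_cancel (min_le_right _ _), mul_pow, pow_add]; ring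
    _ ≤ K ^ b * ((2 * K) ^ (a + b - min 2 (a + b)) * (G + h) ^ min 2 (a + b)) := by gcongr
    _ = _ := by ring

theorem distance_factor_le (j t₀ : ℕ) :
    h ^ j * P⁻¹ ^ t₀ ≤ K ^ t₀ * h ^ ((j : ℤ) - 2 * t₀) := by
  have hK := H.K_pos
  have hh := H.h_pos
  have hP := H.P_pos
  have h1 : P⁻¹ ≤ K * (h ^ 2)⁻¹ := by
    rw [← div_eq_mul_inv, le_div_iff₀ (by positivity), inv_mul_le_iff₀ hP]
    linarith [H.sq_le_P]
  calc h ^ j * P⁻¹ ^ t₀ ≤ h ^ j * (K * (h ^ 2)⁻¹) ^ t₀ := by gcongr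
    _ = K ^ t₀ * h ^ ((j : ℤ) - 2 * t₀) := by
      rw [zpow_sub₀ hh.ne', zpow_natCast, mul_pow, inv_pow, ← pow_mul, div_eq_mul_inv,
        ← zpow_natCast h (2 * t₀)]
      push_cast; ring

theorem sq_mul_inv_le : (G + h) ^ 2 * Φ ^ (-2 : ℤ) ≤ K ^ 2 * Ψ ^ (-2 : ℤ) := by
  have hK := H.K_pos
  have hG := H.G_pos
  have hh := H.h_pos
  have hΦ := H.Φ_pos
  have hΨ := H.Ψ_pos
  rw [zpow_neg, zpow_neg, ← div_eq_mul_inv, ← div_eq_mul_inv]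
  rw [div_le_div_iff₀ (by positivity) (by positivity)]
  have : ((G + h) * Ψ) ^ 2 ≤ (K * Φ) ^ 2 := pow_le_pow_left₀ (by positivity) H.mul_le 2
  rw [mul_pow, mul_pow] at this
  exact_mod_cast this

/-- The case `t - l - m ≥ 2`. -/
theorem exists_bound_two (N : ℤ) {s : ℤ} (hs : 2 ≤ s) {m₀ : ℕ} (hm₀ : m₀ ≤ 2) {i : ℤ}
    (hi : N - 2 + 2 * s + (2 - m₀) ≤ i) :
    (G + h) ^ m₀ * h ^ i * Φ ^ (-s) ≤
      K ^ ((i - (N - 2 + 2 * s + (2 - m₀))).toNat + (s - 2).toNat + 2) *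
        (h ^ (N + 2) * Ψ ^ (-2 : ℤ)) := by
  have hK := H.K_pos
  have hG := H.G_pos
  have hh := H.h_pos
  have hΦ := H.Φ_pos
  have hΨ := H.Ψ_pos
  obtain ⟨d, rfl⟩ : ∃ d : ℕ, s = d + 2 := ⟨(s - 2).toNat, by omega⟩
  set A := (i - (N - 2 + 2 * ((d : ℤ) + 2) + (2 - m₀))).toNat
  have hd : ((d : ℤ) + 2 - 2).toNat = d := by omega
  rw [hd]
  have h1 := zpow_le_mul_zpow hh H.h_le hi
  -- The guaranteed power of `h` splits in three: `h^(2-m₀)` stands in for missing gradient factors,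
  -- `h^(2d)` cancels `d` factors `Φ⁻¹`, and `h^(N+2)` remains.
  have h2 : h ^ (N - 2 + 2 * ((d : ℤ) + 2) + (2 - m₀)) =
      h ^ (2 - m₀) * (h ^ 2) ^ d * h ^ (N + 2) := by
    have e : (N - 2 + 2 * ((d : ℤ) + 2) + (2 - m₀)) =
      ((2 - m₀ : ℕ) : ℤ) + ((2 * d : ℕ) : ℤ) + (N + 2) := by
      push_cast [Nat.cast_sub hm₀]; ring
    rw [e, zpow_add₀ hh.ne', zpow_add₀ hh.ne', zpow_natCast, zpow_natCast, pow_mul]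
  have h3 : (h ^ 2) ^ d ≤ (K * Φ) ^ d := pow_le_pow_left₀ (by positivity) H.sq_le_Φ d
  have h4 : Φ ^ (-((d : ℤ) + 2)) = (Φ ^ d)⁻¹ * Φ ^ (-2 : ℤ) := by
    rw [neg_add, zpow_add₀ hΦ.ne', zpow_neg, zpow_natCast]
  have h5 : h ^ (2 - m₀) ≤ (G + h) ^ (2 - m₀) := pow_le_pow_left₀ hh.le (by linarith) _
  calc (G + h) ^ m₀ * h ^ i * Φ ^ (-((d : ℤ) + 2))
      ≤ (G + h) ^ m₀ * (K ^ A * ((G + h) ^ (2 - m₀) * (K * Φ) ^ d * h ^ (N + 2))) *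
          ((Φ ^ d)⁻¹ * Φ ^ (-2 : ℤ)) := by
        rw [h4]
        refine mul_le_mul_of_nonneg_right ?_ (by positivity)
        refine mul_le_mul_of_nonneg_left ?_ (by positivity)
        refine h1.trans ?_
        rw [h2]
        gcongr
    _ = K ^ (A + d) * h ^ (N + 2) * ((G + h) ^ 2 * Φ ^ (-2 : ℤ)) := by
        have : (G + h) ^ 2 = (G + h) ^ m₀ * (G + h) ^ (2 - m₀) := by
          rw [← pow_add]; congr 1; omega
        rw [this, mul_pow, pow_add]
        field_simp
    _ ≤ K ^ (A + d) * h ^ (N + 2) * (K ^ 2 * Ψ ^ (-2 : ℤ)) := by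
        exact mul_le_mul_of_nonneg_left H.sq_mul_inv_le (by positivity)
    _ = _ := by rw [pow_add _ (A + d)]; ring

/-- The case `t - l - m = 1`. -/
theorem exists_bound_one (N : ℤ) {m₀ : ℕ} (hm₀ : m₀ ≤ 2) {i : ℤ}
    (hi : N + 1 + (2 - m₀) ≤ i) :
    (G + h) ^ m₀ * h ^ i * Φ ^ (-1 : ℤ) ≤
      2 * K ^ ((i - (N + 1 + (2 - m₀))).toNat + 3) * (h ^ (N + 2) * Ψ ^ (-2 : ℤ)) := by
  have hK := H.K_pos
  have hG := H.G_pos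
  have hh := H.h_pos
  have hΦ := H.Φ_pos
  have hΨ := H.Ψ_pos
  set A := (i - (N + 1 + (2 - m₀))).toNat
  have h1 := zpow_le_mul_zpow hh H.h_le hi
  have h2 : h ^ (N + 1 + (2 - m₀)) = h ^ (2 - m₀) * h ^ (N + 1) := by
    have e : (N + 1 + (2 - m₀)) = ((2 - m₀ : ℕ) : ℤ) + (N + 1) := by
      push_cast [Nat.cast_sub hm₀]; ring
    rw [e, zpow_add₀ hh.ne', zpow_natCast]
  have h5 : h ^ (2 - m₀) ≤ (G + h) ^ (2 - m₀) := pow_le_pow_left₀ hh.le (by linarith) _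
  have h6 : (G + h) * Φ⁻¹ ≤ K * Ψ⁻¹ := by
    rw [← div_eq_mul_inv, ← div_eq_mul_inv, div_le_div_iff₀ hΦ hΨ]
    exact H.mul_le
  -- A single `Φ⁻¹` uses one factor `G + h` and produces only `Ψ⁻¹`; the second `Ψ⁻¹` is bought with
  -- one power of `h` through `Ψ ≲ h`. The unused gradient factor is merely bounded below in `h8`.
  have h7 : Ψ⁻¹ ≤ K * h * Ψ ^ (-2 : ℤ) := by
    have : Ψ⁻¹ = Ψ * Ψ ^ (-2 : ℤ) := by
      rw [zpow_neg]; field_simp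
    rw [this]
    gcongr
    exact H.Ψ_le
  calc (G + h) ^ m₀ * h ^ i * Φ ^ (-1 : ℤ)
      ≤ (G + h) ^ m₀ * (K ^ A * ((G + h) ^ (2 - m₀) * h ^ (N + 1))) * Φ ^ (-1 : ℤ) := by
        refine mul_le_mul_of_nonneg_right ?_ (by positivity)
        refine mul_le_mul_of_nonneg_left ?_ (by positivity)
        refine h1.trans ?_
        rw [h2]
        gcongr
    _ = K ^ A * h ^ (N + 1) * ((G + h) * ((G + h) * Φ⁻¹)) := by
        have : (G + h) * (G + h) = (G + h) ^ m₀ * (G + h) ^ (2 - m₀) := by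
          rw [← pow_add, ← sq]; congr 1; omega
        rw [← mul_assoc (G + h), this, zpow_neg_one]
        ring
    _ ≤ K ^ A * h ^ (N + 1) * ((2 * K) * (K * (K * h * Ψ ^ (-2 : ℤ)))) := by
        have h8 : G + h ≤ 2 * K := by linarith [H.G_le, H.h_le]
        have h9 : (G + h) * Φ⁻¹ ≤ K * (K * h * Ψ ^ (-2 : ℤ)) := h6.trans (by gcongr)
        gcongr
    _ = _ := by
        have : h ^ (N + 2) = h ^ (N + 1) * h := by
          rw [← zpow_add_one₀ hh.ne']; congr 1; ring
        rw [this, pow_add]; ring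

/-- The case `t - l - m ≤ 0`. -/
theorem exists_bound_zero (N : ℤ) (j p t₀ : ℕ) (hN : N ≤ j + p - 2 * t₀) :
    h ^ j * P⁻¹ ^ t₀ * Φ ^ p ≤ K ^ (j + p + 2 * t₀ + ((j : ℤ) + p - 2 * t₀ - N).toNat + 2) *
      (1 + h ^ (N + 2) * Ψ ^ (-2 : ℤ)) := by
  have hK := H.K_pos
  have hK1 := H.one_le
  have hh := H.h_pos
  have hΦ := H.Φ_pos
  have hΨ := H.Ψ_pos
  have hP := H.P_pos
  set A := ((j : ℤ) + p - 2 * t₀ - N).toNat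
  set q := Real.sqrt P
  have hq : 0 < q := Real.sqrt_pos.2 hP
  have hq2 : q ^ 2 = P := Real.sq_sqrt hP.le
  have hKP : ∀ z : ℝ, 0 < z → z ^ 2 ≤ K * P → z ≤ K * q := by
    intro z hz hzP
    refine le_of_sq_le_sq ?_ (by positivity)
    rw [mul_pow, hq2]
    refine hzP.trans ?_
    gcongr
    nlinarith
  have hmin : ∀ z : ℝ, 0 < z → z ≤ K → z ^ 2 ≤ K * P → z ≤ K * min 1 q := by
    intro z hz hzK hzP
    rw [mul_min_of_nonneg _ _ hK.le, mul_one]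
    exact le_min hzK (hKP z hz hzP)
  -- No upper bound of `P` is available, so powers of `√P` cannot be lowered freely. The truncation
  -- at 1 still dominates `h` and `Φ`, which are bounded, and its powers decrease with the exponent.
  set μ := min 1 q
  have hμ0 : 0 < μ := lt_min one_pos hq
  have hμ1 : μ ≤ 1 := min_le_left _ _
  have hμq : μ ≤ q := min_le_right _ _
  have h1 : h ^ j * Φ ^ p ≤ K ^ (j + p) * μ ^ (j + p) := by
    have a1 : h ^ j ≤ (K * μ) ^ j := pow_le_pow_left₀ hh.le (hmin h hh H.h_le H.sq_le_P) j
    have a2 : Φ ^ p ≤ (K * μ) ^ p := pow_le_pow_left₀ hΦ.le (hmin Φ hΦ H.Φ_le H.Φ_sq_le) p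
    calc h ^ j * Φ ^ p ≤ (K * μ) ^ j * (K * μ) ^ p := by gcongr
      _ = _ := by rw [← pow_add, mul_pow]
  have hPt : P⁻¹ ^ t₀ = (q ^ (2 * t₀))⁻¹ := by rw [pow_mul, hq2, inv_pow]
  have hKK : ∀ {a b : ℕ}, a ≤ b → K ^ a ≤ K ^ b := fun hab => pow_le_pow_right₀ hK1 hab
  have hnn : 0 ≤ h ^ (N + 2) * Ψ ^ (-2 : ℤ) := by positivity
  by_cases hcase : 2 * t₀ ≤ j + p
  · have h2 : μ ^ (j + p) ≤ q ^ (2 * t₀) :=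
      (pow_le_pow_of_le_one hμ0.le hμ1 hcase).trans (pow_le_pow_left₀ hμ0.le hμq _)
    calc h ^ j * P⁻¹ ^ t₀ * Φ ^ p = (h ^ j * Φ ^ p) * (q ^ (2 * t₀))⁻¹ := by rw [hPt]; ring
      _ ≤ (K ^ (j + p) * q ^ (2 * t₀)) * (q ^ (2 * t₀))⁻¹ := by
        refine mul_le_mul_of_nonneg_right (h1.trans ?_) (by positivity)
        gcongr
      _ = K ^ (j + p) := by field_simp
      _ ≤ K ^ (j + p + 2 * t₀ + A + 2) := hKK (by omega)
      _ ≤ _ := le_mul_of_one_le_right (by positivity) (by linarith)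
  -- Here `d` powers of `√P` stay in the denominator. They become `h^(-d)`, hence at most a multiple
  -- of `h^N`, and `Ψ ≲ h` rewrites this as `h^(N+2) Ψ^(-2)`.
  · push Not at hcase
    obtain ⟨d, hd⟩ : ∃ d : ℕ, 2 * t₀ = j + p + d := ⟨2 * t₀ - (j + p), by omega⟩
    have h2 : μ ^ (j + p) ≤ q ^ (j + p) := pow_le_pow_left₀ hμ0.le hμq _
    have h3 : (q ^ d)⁻¹ ≤ K ^ d * (h ^ d)⁻¹ := by
      have : h ^ d ≤ (K * q) ^ d := pow_le_pow_left₀ hh.le (hKP h hh H.sq_le_P) d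
      rw [mul_pow] at this
      rw [← div_eq_mul_inv, le_div_iff₀ (by positivity), inv_mul_le_iff₀ (by positivity)]
      linarith
    have h4 : (h ^ d)⁻¹ ≤ K ^ A * h ^ N := by
      have e : (h ^ d)⁻¹ = h ^ ((j : ℤ) + p - 2 * t₀) := by
        rw [← zpow_natCast, ← zpow_neg]; congr 1; omega
      rw [e]
      exact zpow_le_mul_zpow hh H.h_le hN
    have h5 : h ^ N ≤ K ^ 2 * (h ^ (N + 2) * Ψ ^ (-2 : ℤ)) := by
      have a1 : Ψ ^ 2 ≤ (K * h) ^ 2 := pow_le_pow_left₀ hΨ.le H.Ψ_le 2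
      have a2 : h ^ (N + 2) = h ^ N * h ^ 2 := by
        rw [zpow_add₀ hh.ne']; norm_cast
      have a3 : Ψ ^ (-2 : ℤ) = (Ψ ^ 2)⁻¹ := by rw [zpow_neg]; norm_cast
      rw [a2, a3]
      have : K ^ 2 * (h ^ N * h ^ 2 * (Ψ ^ 2)⁻¹) = h ^ N * ((K * h) ^ 2 * (Ψ ^ 2)⁻¹) := by ring
      rw [this]
      refine le_mul_of_one_le_right (by positivity) ?_
      rw [← div_eq_mul_inv, one_le_div (by positivity)]
      exact a1
    calc h ^ j * P⁻¹ ^ t₀ * Φ ^ p = (h ^ j * Φ ^ p) * ((q ^ (j + p))⁻¹ * (q ^ d)⁻¹) := by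
          rw [hPt, hd, pow_add, mul_inv]; ring
      _ ≤ (K ^ (j + p) * q ^ (j + p)) * ((q ^ (j + p))⁻¹ *
          (K ^ d * (K ^ A * (K ^ 2 * (h ^ (N + 2) * Ψ ^ (-2 : ℤ)))))) := by
        have h6 : (q ^ d)⁻¹ ≤ K ^ d * (K ^ A * (K ^ 2 * (h ^ (N + 2) * Ψ ^ (-2 : ℤ)))) := by
          refine h3.trans ?_
          gcongr
          refine h4.trans ?_
          gcongr
        have h7 : h ^ j * Φ ^ p ≤ K ^ (j + p) * q ^ (j + p) := h1.trans (by gcongr)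
        gcongr
      _ = K ^ (j + p + d + A + 2) * (h ^ (N + 2) * Ψ ^ (-2 : ℤ)) := by
        rw [pow_add, pow_add, pow_add]; field_simp; ring
      _ ≤ _ := by
        have : K ^ (j + p + d + A + 2) ≤ K ^ (j + p + 2 * t₀ + A + 2) := hKK (by omega)
        gcongr
        linarith

end KernelData

/-- The local estimate of an admissible kernel of type `τ`, in terms of numbers. -/
theorem exists_kernel_bound {K : ℝ} (hK : 1 ≤ K) (n : ℕ) (τ t : ℤ) (a b j t₀ l m : ℕ)
    (hτ : τ ≤ 2 * n + j + min 2 (t - l - m) - 2 * (t₀ + t - l - m) -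
      max 0 (2 - (a : ℤ) - b)) :
    ∃ C : ℝ, 0 ≤ C ∧ ∀ G G' h Φ P x y Ψ : ℝ, KernelData K G G' h Φ P x y Ψ →
      G ^ a * G' ^ b * (h ^ j * P⁻¹ ^ t₀) * (Φ ^ (-t) * x ^ l * y ^ m) ≤
        C * (1 + h ^ (τ - 2 * n + 2) * Ψ ^ (-2 : ℤ)) := by
  have hK0 : 0 < K := zero_lt_one.trans_le hK
  set s := t - l - m with hs
  set m₀ := min 2 (a + b) with hm₀
  have hm₀2 : m₀ ≤ 2 := min_le_left _ _
  -- The term subtracted in the type counts how many of the two required gradient factors are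
  -- missing.
  have hm₀' : max 0 (2 - (a : ℤ) - b) = 2 - (m₀ : ℤ) := by omega
  set C₁ := K ^ b * (2 * K) ^ (a + b - m₀) with hC₁
  have hC₁0 : 0 ≤ C₁ := by positivity
  -- the common reduction for `1 ≤ s`
  have red : ∀ G G' h Φ P x y Ψ : ℝ, KernelData K G G' h Φ P x y Ψ →
      G ^ a * G' ^ b * (h ^ j * P⁻¹ ^ t₀) * (Φ ^ (-t) * x ^ l * y ^ m) ≤
        C₁ * K ^ t₀ * K ^ (l + m) * ((G + h) ^ m₀ * h ^ ((j : ℤ) - 2 * t₀) * Φ ^ (-s)) := by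
    intro G G' h Φ P x y Ψ H
    have h1 := H.gradient_factor_le a b
    have h2 := H.distance_factor_le j t₀
    have h3 := H.boundary_factor_le t l m
    have hG := H.G_pos
    have hh := H.h_pos
    have hG' := H.G'_pos
    have hΦ := H.Φ_pos
    have hP := H.P_pos
    have hx := H.x_nonneg
    have hy := H.y_nonneg
    calc G ^ a * G' ^ b * (h ^ j * P⁻¹ ^ t₀) * (Φ ^ (-t) * x ^ l * y ^ m)
        ≤ (C₁ * (G + h) ^ m₀) * (K ^ t₀ * h ^ ((j : ℤ) - 2 * t₀)) *
            (K ^ (l + m) * Φ ^ (-s)) := by gcongr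
      _ = _ := by ring
  rcases le_or_gt s 0 with h0 | h0
  · obtain ⟨p, hp⟩ : ∃ p : ℕ, -s = p := ⟨(-s).toNat, by omega⟩
    refine ⟨C₁ * (2 * K) ^ m₀ * K ^ (l + m) *
      K ^ (j + p + 2 * t₀ + ((j : ℤ) + p - 2 * t₀ - (τ - 2 * n)).toNat + 2), by positivity, ?_⟩
    intro G G' h Φ P x y Ψ H
    have h1 := H.gradient_factor_le a b
    have h3 := H.boundary_factor_le t l m
    rw [← hs, hp, zpow_natCast] at h3
    have h4 := H.exists_bound_zero (τ - 2 * n) j p t₀ (by omega)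
    have hG := H.G_pos
    have hh := H.h_pos
    have hG' := H.G'_pos
    have hΦ := H.Φ_pos
    have hP := H.P_pos
    have hx := H.x_nonneg
    have hy := H.y_nonneg
    have h5 : (G + h) ^ m₀ ≤ (2 * K) ^ m₀ :=
      pow_le_pow_left₀ (by positivity) (by linarith [H.G_le, H.h_le]) _
    calc G ^ a * G' ^ b * (h ^ j * P⁻¹ ^ t₀) * (Φ ^ (-t) * x ^ l * y ^ m)
        ≤ (C₁ * (2 * K) ^ m₀) * (h ^ j * P⁻¹ ^ t₀) * (K ^ (l + m) * Φ ^ p) := by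
          have h6 : G ^ a * G' ^ b ≤ C₁ * (2 * K) ^ m₀ := h1.trans (by gcongr)
          gcongr
      _ = C₁ * (2 * K) ^ m₀ * K ^ (l + m) * (h ^ j * P⁻¹ ^ t₀ * Φ ^ p) := by ring
      _ ≤ _ := by
          rw [mul_assoc (C₁ * (2 * K) ^ m₀ * K ^ (l + m))]
          gcongr
  · rcases (show s = 1 ∨ 2 ≤ s by omega) with h1 | h1
    · refine ⟨C₁ * K ^ t₀ * K ^ (l + m) *
        (2 * K ^ (((j : ℤ) - 2 * t₀ - (τ - 2 * n + 1 + (2 - m₀))).toNat + 3)), by positivity, ?_⟩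
      intro G G' h Φ P x y Ψ H
      refine (red G G' h Φ P x y Ψ H).trans ?_
      have h4 := H.exists_bound_one (τ - 2 * n) hm₀2 (i := (j : ℤ) - 2 * t₀) (by omega)
      rw [h1, mul_assoc (C₁ * K ^ t₀ * K ^ (l + m))]
      refine mul_le_mul_of_nonneg_left (h4.trans ?_) (by positivity)
      gcongr
      linarith
    · refine ⟨C₁ * K ^ t₀ * K ^ (l + m) *
        K ^ (((j : ℤ) - 2 * t₀ - (τ - 2 * n - 2 + 2 * s + (2 - m₀))).toNat + (s - 2).toNat + 2),
        by positivity, ?_⟩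
      intro G G' h Φ P x y Ψ H
      refine (red G G' h Φ P x y Ψ H).trans ?_
      have h4 := H.exists_bound_two (τ - 2 * n) h1 hm₀2 (i := (j : ℤ) - 2 * t₀) (by omega)
      rw [mul_assoc (C₁ * K ^ t₀ * K ^ (l + m))]
      refine mul_le_mul_of_nonneg_left (h4.trans ?_) (by positivity)
      gcongr
      linarith

end Exponents

/-! ### From elementary comparisons in `ℂⁿ` to the relations between the numbers. -/

section KernelDataCn

variable {n : ℕ}

/-- The vector representing the linear form `delPart g u`. -/
def gradV (g : Cn n → ℂ) (u : Cn n) : Cn n := WithLp.toLp 2 fun j => (starRingEnd ℂ) (dz j g u)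

theorem inner_gradV (g : Cn n → ℂ) (u h : Cn n) : inner ℂ (gradV g u) h = delPart g u h := by
  simp [PiLp.inner_apply, gradV, delPart, mul_comm]

/-- The size of `h` weighted anisotropically with respect to the direction `v`. -/
def anisotropic (v h : Cn n) : ℝ := ‖(inner ℂ v h : ℂ)‖ * ‖v‖⁻¹ + ‖h‖ ^ 2

theorem norm_le_of_inner_le {v : Cn n} {C : ℝ} (hC : 0 ≤ C)
    (h : ∀ h : Cn n, ‖(inner ℂ v h : ℂ)‖ ≤ C * ‖h‖) : ‖v‖ ≤ C := by
  rcases eq_or_ne v 0 with rfl | hv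
  · simpa using hC
  · have := h v
    rw [inner_self_eq_norm_sq_to_K] at this
    have hv' := norm_pos_iff.2 hv
    have h2 : ‖v‖ * ‖v‖ ≤ C * ‖v‖ := by
      simpa [sq] using this
    exact le_of_mul_le_mul_right h2 hv'

/-- Elementary comparison estimates which imply `KernelData`. -/
structure PreKernelData (C G G' P x y Φ : ℝ) (v v' h : Cn n) : Prop where
  one_le : 1 ≤ C
  h_ne : h ≠ 0
  G_pos : 0 < G
  G'_pos : 0 < G'
  P_pos : 0 < P
  Φ_pos : 0 < Φ
  x_nonneg : 0 ≤ x
  y_nonneg : 0 ≤ y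
  v_le : ‖v‖ ≤ C
  h_le : ‖h‖ ≤ C
  sub_le : ‖v - v'‖ ≤ C * ‖h‖
  G_le : G ≤ C * ‖v‖
  le_G : ‖v‖ ≤ C * G
  G'_le : G' ≤ C * ‖v'‖
  inner_le : ‖(inner ℂ v h : ℂ)‖ ≤ C * Φ
  sq_le : ‖h‖ ^ 2 ≤ C * Φ
  x_le : x ≤ C * Φ
  y_le : y ≤ C * Φ
  Φ_le : Φ ≤ C
  Φ_sq_le : Φ ^ 2 ≤ C * P
  sq_le_P : ‖h‖ ^ 2 ≤ C * P

namespace PreKernelData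

variable {C G G' P x y Φ : ℝ} {v v' h : Cn n} (H : PreKernelData C G G' P x y Φ v v' h)
include H

/-- Replacing `v` by a vector at distance at most `C ‖h‖` alters the inner product with `h` by at
most `C ‖h‖²`, which `Φ` controls. This freedom gives the estimates with the gradient taken at
either of the two points. -/
theorem kernelData_aux {v₁ : Cn n} (h1 : ‖v - v₁‖ ≤ C * ‖h‖) :
    KernelData (8 * C ^ 4) G G' ‖h‖ Φ P x y (anisotropic v₁ h) := by
  have hC := H.one_le
  have hC0 : 0 < C := by linarith
  have hh : 0 < ‖h‖ := norm_pos_iff.2 H.h_ne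
  have hΦ := H.Φ_pos
  have hP := H.P_pos
  have hG := H.G_pos
  have hCC : C ≤ 8 * C ^ 4 := by
    have : C ^ 1 ≤ C ^ 4 := pow_le_pow_right₀ hC (by norm_num)
    rw [pow_one] at this
    have : 0 < C ^ 4 := by positivity
    linarith
  have hC2 : C ^ 2 ≤ 8 * C ^ 4 := by
    have : C ^ 2 ≤ C ^ 4 := pow_le_pow_right₀ hC (by norm_num)
    have : 0 < C ^ 4 := by positivity
    linarith
  have hC3 : C ^ 3 ≤ C ^ 4 := pow_le_pow_right₀ hC (by norm_num)
  have hC23 : C ^ 2 ≤ C ^ 3 := pow_le_pow_right₀ hC (by norm_num)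
  have hC12 : C ≤ C ^ 2 := by nlinarith
  have mono : ∀ {a b : ℝ}, 0 ≤ b → a ≤ C * b → a ≤ 8 * C ^ 4 * b := fun hb hab =>
    hab.trans (mul_le_mul_of_nonneg_right hCC hb)
  have hL : ‖(inner ℂ v₁ h : ℂ)‖ * ‖v₁‖⁻¹ ≤ ‖h‖ := by
    -- For `v₁ = 0` the first term of `anisotropic` vanishes, with the convention `0⁻¹ = 0`.
    rcases eq_or_ne v₁ 0 with rfl | hv
    · simp
    · rw [← div_eq_mul_inv, div_le_iff₀ (norm_pos_iff.2 hv), mul_comm]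
      exact norm_inner_le_norm _ _
  have hL0 : 0 ≤ ‖(inner ℂ v₁ h : ℂ)‖ * ‖v₁‖⁻¹ := by positivity
  refine
    { one_le := by linarith [H.one_le, hCC]
      G_pos := hG, G'_pos := H.G'_pos, h_pos := hh, Φ_pos := hΦ, P_pos := hP
      Ψ_pos := by unfold anisotropic; positivity
      x_nonneg := H.x_nonneg, y_nonneg := H.y_nonneg
      G_le := ?_, h_le := H.h_le.trans hCC, Φ_le := H.Φ_le.trans hCC
      G'_le_add := ?_
      sq_le_Φ := mono hΦ.le H.sq_le
      x_le := mono hΦ.le H.x_le, y_le := mono hΦ.le H.y_le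
      sq_le_P := mono hP.le H.sq_le_P, Φ_sq_le := mono hP.le H.Φ_sq_le
      mul_le := ?_, Ψ_le := ?_ }
  · calc G ≤ C * ‖v‖ := H.G_le
      _ ≤ C * C := by gcongr; exact H.v_le
      _ = C ^ 2 := by ring
      _ ≤ _ := hC2
  · have h2 : ‖v'‖ ≤ C * G + C * ‖h‖ := by
      have := norm_sub_norm_le v' v
      rw [norm_sub_rev] at this
      linarith [H.sub_le, H.le_G]
    calc G' ≤ C * ‖v'‖ := H.G'_le
      _ ≤ C * (C * G + C * ‖h‖) := by gcongr
      _ = C ^ 2 * (G + ‖h‖) := by ring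
      _ ≤ _ := by gcongr
  · -- `(G + h) Ψ ≤ K Φ`
    have e1 : ‖(inner ℂ v₁ h : ℂ)‖ ≤ C * Φ + C * ‖h‖ ^ 2 := by
      have : (inner ℂ v₁ h : ℂ) = inner ℂ v h - inner ℂ (v - v₁) h := by
        rw [inner_sub_left]; ring
      rw [this]
      refine (norm_sub_le _ _).trans (add_le_add H.inner_le ?_)
      refine (norm_inner_le_norm _ _).trans ?_
      calc ‖v - v₁‖ * ‖h‖ ≤ C * ‖h‖ * ‖h‖ := by gcongr
        _ = _ := by ring
    have e2 : G * (‖(inner ℂ v₁ h : ℂ)‖ * ‖v₁‖⁻¹) ≤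
        C * (C * Φ + C * ‖h‖ ^ 2) + C ^ 2 * ‖h‖ ^ 2 := by
      have h3 : G ≤ C * (‖v₁‖ + C * ‖h‖) := by
        refine H.G_le.trans ?_
        have := norm_sub_norm_le v v₁
        gcongr
        linarith
      have h4 : ‖v₁‖ * (‖(inner ℂ v₁ h : ℂ)‖ * ‖v₁‖⁻¹) ≤ ‖(inner ℂ v₁ h : ℂ)‖ := by
        rcases eq_or_ne v₁ 0 with rfl | hv
        · simp
        · have := norm_pos_iff.2 hv
          field_simp; exact le_rfl
      calc G * (‖(inner ℂ v₁ h : ℂ)‖ * ‖v₁‖⁻¹)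
          ≤ C * (‖v₁‖ + C * ‖h‖) * (‖(inner ℂ v₁ h : ℂ)‖ * ‖v₁‖⁻¹) := by gcongr
        _ = C * (‖v₁‖ * (‖(inner ℂ v₁ h : ℂ)‖ * ‖v₁‖⁻¹)) +
            C ^ 2 * ‖h‖ * (‖(inner ℂ v₁ h : ℂ)‖ * ‖v₁‖⁻¹) := by ring
        _ ≤ C * (C * Φ + C * ‖h‖ ^ 2) + C ^ 2 * ‖h‖ * ‖h‖ := by
          gcongr
          exact h4.trans e1
        _ = _ := by ring
    have e3 : G ≤ C ^ 2 := by
      refine H.G_le.trans ?_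
      rw [sq]; gcongr; exact H.v_le
    have e4 : ‖h‖ * (‖(inner ℂ v₁ h : ℂ)‖ * ‖v₁‖⁻¹) ≤ ‖h‖ ^ 2 := by rw [sq]; gcongr
    have e5 : (G + ‖h‖) * ‖h‖ ^ 2 ≤ (C ^ 2 + C) * ‖h‖ ^ 2 := by
      gcongr
      exact H.h_le
    have hsq := H.sq_le
    calc (G + ‖h‖) * anisotropic v₁ h
        = G * (‖(inner ℂ v₁ h : ℂ)‖ * ‖v₁‖⁻¹) + ‖h‖ * (‖(inner ℂ v₁ h : ℂ)‖ * ‖v₁‖⁻¹) +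
          (G + ‖h‖) * ‖h‖ ^ 2 := by unfold anisotropic; ring
      _ ≤ (C * (C * Φ + C * ‖h‖ ^ 2) + C ^ 2 * ‖h‖ ^ 2) + ‖h‖ ^ 2 + (C ^ 2 + C) * ‖h‖ ^ 2 := by
        gcongr
      _ = C ^ 2 * Φ + (3 * C ^ 2 + 1 + C) * ‖h‖ ^ 2 := by ring
      _ ≤ C ^ 2 * Φ + (3 * C ^ 2 + C ^ 2 + C ^ 2) * (C * Φ) := by
        gcongr
        nlinarith
      _ = (C ^ 2 + 5 * C ^ 3) * Φ := by ring
      _ ≤ 8 * C ^ 4 * Φ := by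
        gcongr
        have : 0 < C ^ 4 := by positivity
        linarith
  · have : ‖h‖ ^ 2 ≤ C * ‖h‖ := by rw [sq]; gcongr; exact H.h_le
    unfold anisotropic
    calc ‖(inner ℂ v₁ h : ℂ)‖ * ‖v₁‖⁻¹ + ‖h‖ ^ 2 ≤ ‖h‖ + C * ‖h‖ := add_le_add hL this
      _ = (1 + C) * ‖h‖ := by ring
      _ ≤ _ := by
        gcongr
        have : 0 < C ^ 4 := by positivity
        linarith

theorem kernelData_left : KernelData (8 * C ^ 4) G G' ‖h‖ Φ P x y (anisotropic v h) :=
  H.kernelData_aux (by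
    have := H.one_le
    rw [sub_self, norm_zero]; positivity)

theorem kernelData_right : KernelData (8 * C ^ 4) G G' ‖h‖ Φ P x y (anisotropic v' h) :=
  H.kernelData_aux H.sub_le

end PreKernelData

/-- A lower bound of `P` by the squared distance to the boundary. -/
theorem sq_le_of_mul_le {C G G' P x y h : ℝ} (hC : 1 ≤ C) (hG : 0 < G) (hG' : 0 < G')
    (hx : 0 ≤ x) (hy : 0 ≤ y) (hGC : G ≤ C) (hGC' : G' ≤ C) (hxy : |x - y| ≤ C * h)
    (hP : 2 * x / G * (y / G') ≤ P) (hhP : h ^ 2 ≤ C * P) : x ^ 2 ≤ 2 * C ^ 3 * P := by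
  have hC0 : 0 < C := by linarith
  have hP0 : 0 ≤ P := le_trans (by positivity) hP
  have h1 : 2 * (x * y) ≤ C ^ 2 * P := by
    have e : 2 * (x * y) = G * G' * (2 * x / G * (y / G')) := by field_simp
    rw [e, sq]
    gcongr
  have h2 : x - y ≤ C * h := (le_abs_self _).trans hxy
  -- Since `x` exceeds `y` by at most `C h`, the product `x y` controls `x²` up to a multiple of
  -- `h²`, and `P` dominates both.
  have h3 : x ^ 2 ≤ 2 * (x * y) + (C * h) ^ 2 := by nlinarith [sq_nonneg (x - C * h)]
  have h4 : C ^ 2 ≤ C ^ 3 := pow_le_pow_right₀ hC (by norm_num)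
  have h5 : (C * h) ^ 2 ≤ C ^ 3 * P := by
    have : (C * h) ^ 2 = C ^ 2 * h ^ 2 := by ring
    rw [this]
    calc C ^ 2 * h ^ 2 ≤ C ^ 2 * (C * P) := by gcongr
      _ = _ := by ring
  nlinarith

end KernelDataCn

/-! ### Size of `φ_ε` and `P_ε` near boundary points and interior points. -/

section LocalData

variable {n : ℕ} {g : Cn n → ℂ} {u₀ : Cn n}

theorem norm_leviPoly_le {C : ℝ} {u w : Cn n} (h : ‖hess20 g u (u - w)‖ ≤ C * ‖u - w‖ ^ 2) :
    ‖leviPoly g u w - delPart g u (u - w)‖ ≤ C * ‖u - w‖ ^ 2 := by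
  have : leviPoly g u w - delPart g u (u - w) = -((1 / 2) * hess20 g u (u - w)) := by
    unfold leviPoly; ring
  rw [this, norm_neg, norm_mul]
  have e : ‖(1 / 2 : ℂ)‖ = 1 / 2 := by simp
  rw [e]
  have := norm_nonneg (hess20 g u (u - w))
  linarith

/-- The comparison estimates at a pair of points near a point of `∂D` or of `D`. -/
def HasLocalData (g : Cn n → ℂ) (u₀ : Cn n) : Prop :=
  ∀ C₁ : ℝ, 1 ≤ C₁ → ∃ C ≥ 1, ∃ δ > 0, ∃ ε₁ > 0, ∀ u ∈ Metric.ball u₀ δ, ∀ w ∈ Metric.ball u₀ δ,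
    u ≠ w → ∀ ε ∈ Ioo 0 ε₁, (g u).re + ε ≤ 0 → (g w).re + ε ≤ 0 → ∀ G G' P : ℝ, 0 < G → 0 < G' →
    0 < P → G ≤ C₁ * ‖gradV g u‖ → ‖gradV g u‖ ≤ C₁ * G → G' ≤ C₁ * ‖gradV g w‖ →
    ‖u - w‖ ^ 2 ≤ C₁ * P → 2 * ((g u).re + ε) / G * (((g w).re + ε) / G') ≤ P →
    ∃ Φ, PreKernelData C G G' P (-((g u).re + ε)) (-((g w).re + ε)) Φ (gradV g u) (gradV g w)
        (u - w) ∧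
      Φ ≤ C * ‖leviPoly g u w - (((g u).re + ε : ℝ) : ℂ)‖ ∧
      ‖leviPoly g u w - (((g u).re + ε : ℝ) : ℂ)‖ ≤ C * Φ ∧
      Φ ≤ C * ‖leviPoly g w u - (((g w).re + ε : ℝ) : ℂ)‖ ∧
      ‖leviPoly g w u - (((g w).re + ε : ℝ) : ℂ)‖ ≤ C * Φ

-- Here `Φ` is |∂r(u)(u-w)| + |r_ε(u)| + |r_ε(w)| + |u-w|². Levi positivity bounds the last three
-- terms by the real part of `φ_ε`, and the first differs from `φ_ε` only by terms of the size of
-- those three.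
set_option maxHeartbeats 1600000 in
theorem hasLocalData_of_levi_pos (hg : ∀ v, (starRingEnd ℂ) (g v) = g v)
    (hs : ∀ᶠ u in 𝓝 u₀, ContDiffAt ℝ ∞ g u)
    (hpos : ∀ h : Cn n, h ≠ 0 → 0 < (hess11 g u₀ h).re) : HasLocalData g u₀ := by
  intro C₁ hC₁
  obtain ⟨A, hA, δ₁, hδ₁, hlip⟩ := eventually_lipschitz_bounds hs.self_of_nhds
  obtain ⟨c, hc, δ₂, hδ₂, hlevi⟩ := eventually_leviPoly_re_ge hg hs hpos
  obtain ⟨B, hB⟩ : ∃ B, B = A + 1 := ⟨_, rfl⟩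
  have hB1 : 1 ≤ B := by linarith
  have hAB : A ≤ B := by linarith
  obtain ⟨m, hm'⟩ : ∃ m, m = ‖g u₀‖ := ⟨_, rfl⟩
  have hm : 0 ≤ m := hm' ▸ norm_nonneg _
  obtain ⟨C₃, hC₃⟩ : ∃ C₃, C₃ = C₁ * B := ⟨_, rfl⟩
  have hC₃1 : 1 ≤ C₃ := hC₃ ▸ one_le_mul_of_one_le_of_one_le hC₁ hB1
  obtain ⟨M, hM⟩ : ∃ M, M = 5 + (4 * B + 2) / c := ⟨_, rfl⟩
  have hMpos : 0 < M := by rw [hM]; positivity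
  obtain ⟨E, hE⟩ : ∃ E, E = 16 * C₃ ^ 3 + 2 * (2 * B + 1) ^ 2 * C₁ := ⟨_, rfl⟩
  have hEpos : 0 < E := by rw [hE]; positivity
  obtain ⟨C, hC⟩ : ∃ C, C = 1 + C₁ + 10 * B + 2 * m + C₃ + M + E := ⟨_, rfl⟩
  have hCpos : 0 < C := by linarith
  have hC1 : 1 + 2 * B ≤ C := by linarith
  have hCM : M ≤ C := by linarith
  have hCE : E ≤ C := by linarith
  have hCC₁ : C₁ ≤ C := by linarith
  have hCm : 10 * B + 2 * m + 1 ≤ C := by linarith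
  -- The radius at most `1 / 2` ensures `‖u - w‖ ≤ 1`, so that the square of the distance is below
  -- the distance itself.
  refine ⟨C, by linarith, min (min δ₁ δ₂) (1 / 2), by positivity, 1,
    one_pos, ?_⟩
  intro u hu w hw huw ε hε hsu hsw G G' P hG hG' hP hGv hvG hGw hhP hPxy
  have sub1 : Metric.ball u₀ (min (min δ₁ δ₂) (1 / 2)) ⊆ Metric.ball u₀ δ₁ :=
    Metric.ball_subset_ball ((min_le_left _ _).trans (min_le_left _ _))
  have sub2 : Metric.ball u₀ (min (min δ₁ δ₂) (1 / 2)) ⊆ Metric.ball u₀ δ₂ :=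
    Metric.ball_subset_ball ((min_le_left _ _).trans (min_le_right _ _))
  have sub3 : Metric.ball u₀ (min (min δ₁ δ₂) (1 / 2)) ⊆ Metric.ball u₀ (1 / 2) :=
    Metric.ball_subset_ball (min_le_right _ _)
  obtain ⟨l1, l2, l3, l4⟩ := hlip u (sub1 hu) w (sub1 hw)
  obtain ⟨l1', l2', l3', l4'⟩ := hlip w (sub1 hw) u (sub1 hu)
  have L1 := hlevi u (sub2 hu) w (sub2 hw)
  have L2 := hlevi w (sub2 hw) u (sub2 hu)
  have hh0 : 0 < ‖u - w‖ := norm_pos_iff.2 (sub_ne_zero.2 huw)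
  have hh1 : ‖u - w‖ ≤ 1 := by
    have a := Metric.mem_ball.1 (sub3 hu)
    have b := Metric.mem_ball.1 (sub3 hw)
    have := dist_triangle_right u w u₀
    rw [← dist_eq_norm]; linarith
  have hu0 : u₀ ∈ Metric.ball u₀ δ₁ := Metric.mem_ball_self hδ₁
  have bd : ∀ v ∈ Metric.ball u₀ (min (min δ₁ δ₂) (1 / 2)), |(g v).re| ≤ m + B := by
    intro v hv
    have a := (hlip v (sub1 hv) u₀ hu0).1
    have b := Metric.mem_ball.1 (sub3 hv)
    rw [dist_eq_norm] at b
    have c1 : ‖g v‖ ≤ ‖g u₀‖ + ‖g v - g u₀‖ := norm_le_norm_add_norm_sub' _ _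
    have c2 : A * ‖v - u₀‖ ≤ A * 1 := by gcongr; linarith
    exact (Complex.abs_re_le_norm _).trans (by linarith)
  have bu := abs_le.1 (bd u hu)
  have bw := abs_le.1 (bd w hw)
  set su := (g u).re + ε with hsu'
  set sw := (g w).re + ε with hsw'
  set h := ‖u - w‖ with hh
  have hwu : ‖w - u‖ = h := norm_sub_rev _ _
  have habs : |-su - -sw| ≤ B * h := by
    have : -su - -sw = -((g u - g w).re) := by simp [su, sw]; ring
    rw [this, abs_neg]
    exact (Complex.abs_re_le_norm _).trans (l1.trans (by gcongr))
  set d := delPart g u (u - w) with hd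
  set d' := delPart g w (w - u) with hd'
  -- The gradient is Lipschitz, so moving its base point from `u` to `w` costs `B h²`. Hence one `Φ`
  -- serves both orders of the arguments.
  have hdd' : ‖d‖ ≤ ‖d'‖ + B * h ^ 2 ∧ ‖d'‖ ≤ ‖d‖ + B * h ^ 2 := by
    have e1 : d' = -delPart g w (u - w) := by rw [hd', ← neg_sub, delPart_neg]
    have e2 : ‖d - delPart g w (u - w)‖ ≤ B * h ^ 2 := by
      refine (l2 (u - w)).trans ?_
      rw [sq, ← mul_assoc]; gcongr
    have e3 : ‖d'‖ = ‖delPart g w (u - w)‖ := by rw [e1, norm_neg]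
    have := abs_le.1 ((abs_norm_sub_norm_le d (delPart g w (u - w))).trans e2)
    constructor <;> linarith
  have hφ1 : ‖leviPoly g u w - d‖ ≤ B * h ^ 2 :=
    (norm_leviPoly_le (l4 _)).trans (by gcongr)
  have hφ2 : ‖leviPoly g w u - d'‖ ≤ B * h ^ 2 := by
    refine (norm_leviPoly_le (l4' _)).trans ?_
    rw [hwu]; gcongr
  set φ₁ := leviPoly g u w - (su : ℂ) with hφ₁
  set φ₂ := leviPoly g w u - (sw : ℂ) with hφ₂
  -- Used for both orders of arguments, with `e` the linear term and `s` the value of `r_ε`: the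
  -- real part of `φ` controls the boundary terms and `h²`, after which the triangle inequality
  -- controls `e`.
  have low : ∀ (φ e : ℂ) (s : ℝ), -su - sw + c * h ^ 2 ≤ 2 * φ.re → ‖φ + s - e‖ ≤ B * h ^ 2 →
      |s| ≤ -su - sw →
      -su - sw ≤ 2 * ‖φ‖ ∧ h ^ 2 ≤ 2 / c * ‖φ‖ ∧ ‖e‖ ≤ (3 + 2 * B / c) * ‖φ‖ := by
    intro φ e s h1 h2 h3
    have h4 : φ.re ≤ ‖φ‖ := Complex.re_le_norm _
    have h5 : 0 ≤ c * h ^ 2 := by positivity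
    have h6 : h ^ 2 ≤ 2 / c * ‖φ‖ := by
      rw [div_mul_eq_mul_div, le_div_iff₀ hc]; linarith
    refine ⟨by linarith, h6, ?_⟩
    have h7 : ‖e‖ ≤ ‖φ‖ + |s| + ‖φ + s - e‖ := by
      have : e = φ + s - (φ + s - e) := by ring
      calc ‖e‖ = ‖φ + s - (φ + s - e)‖ := by rw [← this]
        _ ≤ ‖φ + s‖ + ‖φ + s - e‖ := norm_sub_le _ _
        _ ≤ _ := by
          gcongr
          refine (norm_add_le _ _).trans (le_of_eq ?_)
          simp
    have h8 : B * h ^ 2 ≤ 2 * B / c * ‖φ‖ := by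
      calc B * h ^ 2 ≤ B * (2 / c * ‖φ‖) := by gcongr
        _ = _ := by ring
    linarith
  have re1 : φ₁.re = (leviPoly g u w).re - su := by simp [hφ₁]
  have re2 : φ₂.re = (leviPoly g w u).re - sw := by simp [hφ₂]
  obtain ⟨a1, a2, a3⟩ := low φ₁ d su (by rw [re1]; linarith)
    (by rw [hφ₁, sub_add_cancel]; exact hφ1) (by rw [abs_of_nonpos hsu]; linarith)
  obtain ⟨b1, b2, b3⟩ := low φ₂ d' sw (by rw [re2]; rw [hwu] at L2; linarith)
    (by rw [hφ₂, sub_add_cancel]; exact hφ2) (by rw [abs_of_nonpos hsw]; linarith)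
  have hdle : ‖d‖ ≤ B * h := (l3 _).trans (by gcongr)
  set Φ := ‖d‖ + (-su) + (-sw) + h ^ 2 with hΦ
  have hd0 := norm_nonneg d
  have hsq0 : 0 < h ^ 2 := by positivity
  have hh2 : h ^ 2 ≤ h := by rw [sq]; exact mul_le_of_le_one_left hh0.le hh1
  have hΦpos : 0 < Φ := by linarith
  have habs' := abs_le.1 habs
  have hΦle : Φ ≤ 2 * (-su) + (2 * B + 1) * h := by linarith
  have vle : ‖gradV g u‖ ≤ B := norm_le_of_inner_le (by linarith) fun k => by
    rw [inner_gradV]; exact (l3 k).trans (by gcongr)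
  have wle : ‖gradV g w‖ ≤ B := norm_le_of_inner_le (by linarith) fun k => by
    rw [inner_gradV]; exact (l3' k).trans (by gcongr)
  have vwle : ‖gradV g u - gradV g w‖ ≤ B * h :=
    norm_le_of_inner_le (by positivity) fun k => by
      rw [inner_sub_left, inner_gradV, inner_gradV]; exact (l2 k).trans (by gcongr)
  have up : ∀ {a b : ℝ}, 0 ≤ b → a ≤ C → a * b ≤ C * b := fun hb hab => by gcongr
  -- Together with `hΦle`, which bounds `Φ` by `2 * (-su)` plus a multiple of `h`, this yields `Φ² ≲
  -- P`.
  have hxsq : (-su) ^ 2 ≤ 2 * C₃ ^ 3 * P := by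
    refine sq_le_of_mul_le hC₃1 hG hG' (y := -sw) (h := h) (by linarith) (by linarith)
      (hGv.trans ?_) (hGw.trans ?_) (habs.trans ?_) ?_ (hhP.trans ?_)
    · rw [hC₃]; gcongr
    · rw [hC₃]; gcongr
    · gcongr; rw [hC₃]; exact le_mul_of_one_le_left (by linarith) hC₁
    · refine le_trans (le_of_eq ?_) hPxy
      ring
    · gcongr; rw [hC₃]; exact le_mul_of_one_le_right (by linarith) hB1
  refine ⟨Φ, ⟨by linarith, sub_ne_zero.2 huw, hG, hG', hP, hΦpos, by linarith, by linarith,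
    by linarith, by linarith, vwle.trans (up hh0.le (by linarith)),
    hGv.trans (up (norm_nonneg _) (by linarith)), hvG.trans (up hG.le (by linarith)),
    hGw.trans (up (norm_nonneg _) (by linarith)), ?_, ?_, ?_, ?_, ?_, ?_,
    hhP.trans (up hP.le (by linarith))⟩, ?_, ?_, ?_, ?_⟩
  · rw [inner_gradV]
    calc ‖d‖ ≤ 1 * Φ := by linarith
      _ ≤ C * Φ := up hΦpos.le (by linarith)
  · calc h ^ 2 ≤ 1 * Φ := by linarith
      _ ≤ C * Φ := up hΦpos.le (by linarith)
  · calc -su ≤ 1 * Φ := by linarith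
      _ ≤ C * Φ := up hΦpos.le (by linarith)
  · calc -sw ≤ 1 * Φ := by linarith
      _ ≤ C * Φ := up hΦpos.le (by linarith)
  · have : B * h ≤ B := mul_le_of_le_one_right (by linarith) hh1
    have hε0 := hε.1
    linarith
  · have e1 : Φ ^ 2 ≤ 8 * (-su) ^ 2 + 2 * ((2 * B + 1) * h) ^ 2 := by
      have := pow_le_pow_left₀ hΦpos.le hΦle 2
      exact this.trans (add_sq_le.trans (le_of_eq (by ring)))
    have e2 : 2 * ((2 * B + 1) * h) ^ 2 ≤ 2 * (2 * B + 1) ^ 2 * (C₁ * P) := by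
      rw [mul_pow, ← mul_assoc]; gcongr
    calc Φ ^ 2 ≤ E * P := by rw [hE]; linarith
      _ ≤ C * P := up hP.le (by linarith)
  · calc Φ ≤ M * ‖φ₁‖ := by
          have : M * ‖φ₁‖ = 5 * ‖φ₁‖ + 2 * B / c * ‖φ₁‖ + 2 / c * ‖φ₁‖ + 2 * B / c * ‖φ₁‖ := by
            rw [hM]; field_simp; ring
          have h0 : 0 ≤ 2 * B / c * ‖φ₁‖ := by positivity
          linarith
      _ ≤ C * ‖φ₁‖ := up (norm_nonneg _) (by linarith)
  · calc ‖φ₁‖ ≤ ‖leviPoly g u w - d‖ + ‖d‖ + |su| := by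
          have : φ₁ = (leviPoly g u w - d) + d - su := by rw [hφ₁]; ring
          rw [this]
          refine (norm_sub_le _ _).trans (add_le_add (norm_add_le _ _) (le_of_eq ?_))
          simp
      _ ≤ (1 + B) * Φ := by
          rw [abs_of_nonpos hsu]
          have : B * h ^ 2 ≤ B * Φ := by gcongr; linarith
          linarith
      _ ≤ C * Φ := up hΦpos.le (by linarith)
  · calc Φ ≤ M * ‖φ₂‖ := by
          have : M * ‖φ₂‖ = 5 * ‖φ₂‖ + 2 * B / c * ‖φ₂‖ + 2 / c * ‖φ₂‖ + 2 * B / c * ‖φ₂‖ := by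
            rw [hM]; field_simp; ring
          have h0 : B * h ^ 2 ≤ 2 * B / c * ‖φ₂‖ := by
            calc B * h ^ 2 ≤ B * (2 / c * ‖φ₂‖) := by gcongr
              _ = _ := by ring
          linarith
      _ ≤ C * ‖φ₂‖ := up (norm_nonneg _) (by linarith)
  · calc ‖φ₂‖ ≤ ‖leviPoly g w u - d'‖ + ‖d'‖ + |sw| := by
          have : φ₂ = (leviPoly g w u - d') + d' - sw := by rw [hφ₂]; ring
          rw [this]
          refine (norm_sub_le _ _).trans (add_le_add (norm_add_le _ _) (le_of_eq ?_))
          simp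
      _ ≤ (1 + 2 * B) * Φ := by
          rw [abs_of_nonpos hsw]
          have : B * h ^ 2 ≤ B * Φ := by gcongr; linarith
          linarith
      _ ≤ C * Φ := up hΦpos.le (by linarith)

-- At an interior point `r_ε` stays away from zero while the Levi polynomial is small on a small
-- ball. So `φ_ε` has size one, `Φ = 1` is a valid choice, and no plurisubharmonicity is needed; `P`
-- is bounded below because γ is bounded above.
set_option maxHeartbeats 800000 in
theorem hasLocalData_of_neg (hs : ContDiffAt ℝ ∞ g u₀) (hneg : (g u₀).re < 0) :
    HasLocalData g u₀ := by
  intro C₁ hC₁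
  obtain ⟨A, hA, δ₁, hδ₁, hlip⟩ := eventually_lipschitz_bounds hs
  obtain ⟨B, hB⟩ : ∃ B, B = A + 1 := ⟨_, rfl⟩
  have hB1 : 1 ≤ B := by linarith
  have hAB : A ≤ B := by linarith
  -- With eighths, an oscillation of `g` by at most `c` and `ε < c` leave `-r_ε` between `6 c` and
  -- `9 c`, while the Levi polynomial is at most `2 c`.
  obtain ⟨c, hc⟩ : ∃ c, c = -(g u₀).re / 8 := ⟨_, rfl⟩
  have hc0 : 0 < c := by rw [hc]; linarith
  obtain ⟨C₃, hC₃⟩ : ∃ C₃, C₃ = C₁ * B := ⟨_, rfl⟩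
  have hC₃1 : 1 ≤ C₃ := hC₃ ▸ one_le_mul_of_one_le_of_one_le hC₁ hB1
  obtain ⟨C, hC⟩ : ∃ C, C = 1 + C₁ + 4 * B + 20 * c + c⁻¹ + C₃ ^ 2 / (c ^ 2) := ⟨_, rfl⟩
  have hci : 0 < c⁻¹ := inv_pos.2 hc0
  have hE : 0 < C₃ ^ 2 / (c ^ 2) := by positivity
  have hCpos : 0 < C := by linarith
  have hCB : 4 * B ≤ C := by linarith
  have hC1 : 1 ≤ C := by linarith
  have hcc : 1 ≤ C * c := by
    have : c⁻¹ * c ≤ C * c := by gcongr; linarith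
    rwa [inv_mul_cancel₀ hc0.ne'] at this
  have hCB' : 4 * B + 20 * c ≤ C := by linarith
  have hCC₁ : C₁ ≤ C := by linarith
  have hCE : C₃ ^ 2 / (c ^ 2) ≤ C := by linarith
  have hδ₀ : 0 < c / (2 * B) := by positivity
  refine ⟨C, by linarith, min δ₁ (min (c / (2 * B)) (1 / 2)), by positivity, c, hc0, ?_⟩
  intro u hu w hw huw ε hε hsu hsw G G' P hG hG' hP hGv hvG hGw hhP hPxy
  have sub1 : Metric.ball u₀ (min δ₁ (min (c / (2 * B)) (1 / 2))) ⊆ Metric.ball u₀ δ₁ :=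
    Metric.ball_subset_ball (min_le_left _ _)
  have sub2 : Metric.ball u₀ (min δ₁ (min (c / (2 * B)) (1 / 2))) ⊆
      Metric.ball u₀ (c / (2 * B)) :=
    Metric.ball_subset_ball ((min_le_right _ _).trans (min_le_left _ _))
  have sub3 : Metric.ball u₀ (min δ₁ (min (c / (2 * B)) (1 / 2))) ⊆ Metric.ball u₀ (1 / 2) :=
    Metric.ball_subset_ball ((min_le_right _ _).trans (min_le_right _ _))
  obtain ⟨l1, l2, l3, l4⟩ := hlip u (sub1 hu) w (sub1 hw)
  obtain ⟨l1', l2', l3', l4'⟩ := hlip w (sub1 hw) u (sub1 hu)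
  have hh0 : 0 < ‖u - w‖ := norm_pos_iff.2 (sub_ne_zero.2 huw)
  have hh1 : ‖u - w‖ ≤ 1 := by
    have a := Metric.mem_ball.1 (sub3 hu)
    have b := Metric.mem_ball.1 (sub3 hw)
    have := dist_triangle_right u w u₀
    rw [← dist_eq_norm]; linarith
  have hhc : B * ‖u - w‖ ≤ c := by
    have a := Metric.mem_ball.1 (sub2 hu)
    have b := Metric.mem_ball.1 (sub2 hw)
    have := dist_triangle_right u w u₀
    have h2 : ‖u - w‖ ≤ c / B := by
      rw [← dist_eq_norm]
      have : c / B = c / (2 * B) + c / (2 * B) := by field_simp; ring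
      linarith
    calc B * ‖u - w‖ ≤ B * (c / B) := by gcongr
      _ = c := by field_simp
  have bd : ∀ v ∈ Metric.ball u₀ (min δ₁ (min (c / (2 * B)) (1 / 2))),
      |(g v).re - (g u₀).re| ≤ c := by
    intro v hv
    have a := (hlip v (sub1 hv) u₀ (Metric.mem_ball_self hδ₁)).1
    have b := Metric.mem_ball.1 (sub2 hv)
    rw [dist_eq_norm] at b
    have c2 : A * ‖v - u₀‖ ≤ B * (c / (2 * B)) := by gcongr
    have c3 : B * (c / (2 * B)) = c / 2 := by field_simp
    rw [← Complex.sub_re]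
    exact (Complex.abs_re_le_norm _).trans (by linarith)
  have bu := abs_le.1 (bd u hu)
  have bw := abs_le.1 (bd w hw)
  have hε0 := hε.1
  have hε1 := hε.2
  have hgu : (g u₀).re = -8 * c := by rw [hc]; ring
  obtain ⟨su, hsu'⟩ : ∃ s, s = (g u).re + ε := ⟨_, rfl⟩
  obtain ⟨sw, hsw'⟩ : ∃ s, s = (g w).re + ε := ⟨_, rfl⟩
  rw [← hsu', ← hsw'] at hPxy ⊢
  have su1 : 6 * c ≤ -su := by linarith
  have su2 : -su ≤ 9 * c := by linarith
  have sw1 : 6 * c ≤ -sw := by linarith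
  have sw2 : -sw ≤ 9 * c := by linarith
  have hwu : ‖w - u‖ = ‖u - w‖ := norm_sub_rev _ _
  have hsq : ‖u - w‖ ^ 2 ≤ ‖u - w‖ := by rw [sq]; exact mul_le_of_le_one_left hh0.le hh1
  have hBsq : B * ‖u - w‖ ^ 2 ≤ B * ‖u - w‖ := by gcongr
  have hl1 : ‖leviPoly g u w‖ ≤ 2 * c := by
    have a1 : ‖leviPoly g u w - delPart g u (u - w)‖ ≤ B * ‖u - w‖ ^ 2 :=
      (norm_leviPoly_le (l4 _)).trans (by gcongr)
    have a2 : ‖delPart g u (u - w)‖ ≤ B * ‖u - w‖ := (l3 _).trans (by gcongr)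
    have := norm_le_norm_add_norm_sub' (leviPoly g u w) (delPart g u (u - w))
    linarith
  have hl2 : ‖leviPoly g w u‖ ≤ 2 * c := by
    have a1 : ‖leviPoly g w u - delPart g w (w - u)‖ ≤ B * ‖u - w‖ ^ 2 :=
      (norm_leviPoly_le (l4' _)).trans (by rw [hwu]; gcongr)
    have a2 : ‖delPart g w (w - u)‖ ≤ B * ‖u - w‖ := (l3' _).trans (by rw [hwu]; gcongr)
    have := norm_le_norm_add_norm_sub' (leviPoly g w u) (delPart g w (w - u))
    linarith
  have hφ : ∀ (φ : ℂ) (s : ℝ), ‖φ‖ ≤ 2 * c → 6 * c ≤ -s → -s ≤ 9 * c →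
      1 ≤ C * ‖φ - (s : ℂ)‖ ∧ ‖φ - (s : ℂ)‖ ≤ C * 1 := by
    intro φ s h1 h2 h3
    have hs : ‖(s : ℂ)‖ = -s := by
      rw [Complex.norm_real, Real.norm_eq_abs, abs_of_nonpos (by linarith)]
    have h4 : -s ≤ ‖φ‖ + ‖φ - (s : ℂ)‖ := by
      rw [← hs]; exact norm_le_norm_add_norm_sub _ _
    have h5 : ‖φ - (s : ℂ)‖ ≤ ‖φ‖ + -s := by
      rw [← hs]; exact norm_sub_le _ _
    refine ⟨hcc.trans ?_, ?_⟩
    · gcongr; linarith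
    · rw [mul_one]
      linarith
  have vle : ‖gradV g u‖ ≤ B := norm_le_of_inner_le (by linarith) fun k => by
    rw [inner_gradV]; exact (l3 k).trans (by gcongr)
  have wle : ‖gradV g w‖ ≤ B := norm_le_of_inner_le (by linarith) fun k => by
    rw [inner_gradV]; exact (l3' k).trans (by gcongr)
  have vwle : ‖gradV g u - gradV g w‖ ≤ B * ‖u - w‖ :=
    norm_le_of_inner_le (by positivity) fun k => by
      rw [inner_sub_left, inner_gradV, inner_gradV]; exact (l2 k).trans (by gcongr)
  have hG3 : G ≤ C₃ := hGv.trans (by rw [hC₃]; gcongr)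
  have hG3' : G' ≤ C₃ := hGw.trans (by rw [hC₃]; gcongr)
  have up : ∀ {a b : ℝ}, 0 ≤ b → a ≤ C → a * b ≤ C * b := fun hb hab => by gcongr
  have hP1 : 1 ≤ C * P := by
    have e1 : 2 * su / G * (sw / G') = 2 * (-su) * (-sw) / (G * G') := by
      field_simp
    have e2 : c ^ 2 / (C₃ ^ 2) ≤ 2 * (-su) * (-sw) / (G * G') := by
      have h1 : c ^ 2 ≤ 2 * (-su) * (-sw) := by
        have i1 : c ≤ 2 * (-su) := by linarith
        have i2 : c ≤ -sw := by linarith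
        rw [sq]
        exact mul_le_mul i1 i2 hc0.le (by linarith)
      have h2 : G * G' ≤ C₃ ^ 2 := by rw [sq]; gcongr
      have h3 : 0 ≤ 2 * (-su) * (-sw) := le_trans (by positivity) h1
      gcongr
    have e3 : C₃ ^ 2 / c ^ 2 * (c ^ 2 / C₃ ^ 2) = 1 := by field_simp
    calc (1 : ℝ) = C₃ ^ 2 / c ^ 2 * (c ^ 2 / C₃ ^ 2) := e3.symm
      _ ≤ C * P := by
        have e4 : c ^ 2 / (C₃ ^ 2) ≤ P := e2.trans (e1 ▸ hPxy)
        gcongr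
  refine ⟨1, ⟨hC1, sub_ne_zero.2 huw, hG, hG', hP, one_pos, by linarith, by linarith,
    by linarith, by linarith, vwle.trans (up hh0.le (by linarith)),
    hGv.trans (up (norm_nonneg _) hCC₁), hvG.trans (up hG.le hCC₁),
    hGw.trans (up (norm_nonneg _) hCC₁), ?_, by linarith, by linarith, by linarith, by linarith,
    by rwa [one_pow], hhP.trans (up hP.le hCC₁)⟩, ?_⟩
  · rw [inner_gradV]
    refine (l3 _).trans ?_
    have : A * ‖u - w‖ ≤ B * 1 := by gcongr
    linarith
  · obtain ⟨a1, a2⟩ := hφ _ su hl1 su1 su2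
    obtain ⟨b1, b2⟩ := hφ _ sw hl2 sw1 sw2
    exact ⟨a1, a2, b1, b2⟩

end LocalData

/-! ### The defining function in arbitrary holomorphic charts; γ against the coordinate gradient. -/

section DefiningFunction

variable {n : ℕ} {X : Type*} [TopologicalSpace X] [ChartedSpace (Cn n) X]
  [IsManifold 𝓘(ℂ, Cn n) ω X] {e : OpenPartialHomeomorph X (Cn n)} {r : X → ℝ}

theorem conj_inChart (e : OpenPartialHomeomorph X (Cn n)) (r : X → ℝ) (u : Cn n) :
    (starRingEnd ℂ) (inChart e r u) = inChart e r u := Complex.conj_ofReal _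

theorem contDiffAt_comp_symm (he : e ∈ HolCharts n X) (hr : ContMDiff 𝓘(ℝ, Cn n) 𝓘(ℝ, ℝ) ∞ r)
    {u : Cn n} (hu : u ∈ e.target) : ContDiffAt ℝ ∞ (fun v => r (e.symm v)) u := by
  have h1 : ContMDiffAt 𝓘(ℝ, Cn n) 𝓘(ℝ, Cn n) ∞ e.symm u :=
    contMDiffAt_symm_of_mem_maximalAtlas (mem_real_maximalAtlas he) hu
  exact (hr.contMDiffAt.comp u h1).contDiffAt

theorem contDiffAt_inChart (he : e ∈ HolCharts n X) (hr : ContMDiff 𝓘(ℝ, Cn n) 𝓘(ℝ, ℝ) ∞ r)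
    {u : Cn n} (hu : u ∈ e.target) : ContDiffAt ℝ ∞ (inChart e r) u :=
  (Complex.ofRealCLM.contDiff.contDiffAt).comp u (contDiffAt_comp_symm he hr hu)

theorem eventually_contDiffAt_inChart (he : e ∈ HolCharts n X)
    (hr : ContMDiff 𝓘(ℝ, Cn n) 𝓘(ℝ, ℝ) ∞ r) {u : Cn n} (hu : u ∈ e.target) :
    ∀ᶠ v in 𝓝 u, ContDiffAt ℝ ∞ (inChart e r) v := by
  filter_upwards [e.open_target.mem_nhds hu] with v hv using contDiffAt_inChart he hr hv

theorem inChart_eventuallyEq {e' : OpenPartialHomeomorph X (Cn n)} {x : X} (hx : x ∈ e.source)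
    (hx' : x ∈ e'.source) :
    inChart e r =ᶠ[𝓝 (e x)] inChart e' r ∘ (e' ∘ e.symm) := by
  have h1 : e.symm ⁻¹' e'.source ∈ 𝓝 (e x) :=
    (e.continuousAt_symm (e.map_source hx)).preimage_mem_nhds (by
      rw [e.left_inv hx]; exact e'.open_source.mem_nhds hx')
  filter_upwards [h1] with v hv
  simp only [inChart, Function.comp_apply]
  rw [e'.left_inv hv]

theorem coordTan_eq_fderiv' (he : e ∈ HolCharts n X) {x : X} (hx : x ∈ e.source) :
    coordTan e (e x) = fderiv ℝ (chartAt (Cn n) x ∘ e.symm) (e x) := by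
  rw [coordTan_eq_fderiv he (e.map_source hx), e.left_inv hx]

theorem delR_eq_delPart (r : X → ℝ) (x : X) (v : Cn n) :
    delR r x v = delPart (inChart (chartAt (Cn n) x) r) (chartAt (Cn n) x x) v := rfl

/-- By `delPart_eq` only the real differential and multiplication by `i` matter, and `coordTan`
respects both. -/
theorem delR_coordTan (he : e ∈ HolCharts n X) (hr : ContMDiff 𝓘(ℝ, Cn n) 𝓘(ℝ, ℝ) ∞ r) {x : X}
    (hx : x ∈ e.source) (h : Cn n) :
    delR r x (coordTan e (e x) h) = delPart (inChart e r) (e x) h := by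
  set c := chartAt (Cn n) x
  have hc := chartAt_mem_holCharts (n := n) x
  have hxc : x ∈ c.source := mem_chart_source _ x
  have hu := e.map_source hx
  have hcu : (c ∘ e.symm) (e x) = c x := by simp [e.left_inv hx]
  have hd : fderiv ℝ (inChart e r) (e x) =
      (fderiv ℝ (inChart c r) (c x)).comp (fderiv ℝ (c ∘ e.symm) (e x)) := by
    rw [(inChart_eventuallyEq hx hxc).fderiv_eq, fderiv_comp, hcu]
    · rw [hcu]
      exact (contDiffAt_inChart hc hr (c.map_source hxc)).differentiableAt (by simp)
    · exact (contDiffAt_real_transition he hc hu (by rwa [e.left_inv hx])).differentiableAt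
        (by simp)
  rw [delR_eq_delPart, delPart_eq, delPart_eq, hd, ← coordTan_smul_I he hu, coordTan_eq_fderiv' he hx]
  rfl

theorem fderiv_inChart (he : e ∈ HolCharts n X) (hr : ContMDiff 𝓘(ℝ, Cn n) 𝓘(ℝ, ℝ) ∞ r)
    {u : Cn n} (hu : u ∈ e.target) (h : Cn n) :
    fderiv ℝ (inChart e r) u h = ((fderiv ℝ (fun v => r (e.symm v)) u h : ℝ) : ℂ) := by
  have h1 := ((contDiffAt_comp_symm he hr hu).differentiableAt (by simp)).hasFDerivAt
  have h2 : HasFDerivAt (inChart e r)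
      (Complex.ofRealCLM.comp (fderiv ℝ (fun v => r (e.symm v)) u)) u :=
    Complex.ofRealCLM.hasFDerivAt.comp u h1
  rw [h2.fderiv]; rfl

theorem fderiv_eq_re_delPart (he : e ∈ HolCharts n X) (hr : ContMDiff 𝓘(ℝ, Cn n) 𝓘(ℝ, ℝ) ∞ r)
    {u : Cn n} (hu : u ∈ e.target) (h : Cn n) :
    fderiv ℝ (fun v => r (e.symm v)) u h = 2 * (delPart (inChart e r) u h).re := by
  have h1 := fderiv_re_of_real (conj_inChart e r) u h
  rw [fderiv_inChart he hr hu] at h1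
  exact_mod_cast h1

theorem isCrit_of_gradV_eq_zero (he : e ∈ HolCharts n X)
    (hr : ContMDiff 𝓘(ℝ, Cn n) 𝓘(ℝ, ℝ) ∞ r) {x : X} (hx : x ∈ e.source)
    (h : gradV (inChart e r) (e x) = 0) : IsCrit n r x := by
  refine ContinuousLinearMap.ext fun v => ?_
  rw [fderiv_eq_re_delPart (chartAt_mem_holCharts x) hr (mem_chart_target _ _)]
  obtain ⟨w, rfl⟩ := (coordTan_bijective he (e.map_source hx)).2 v
  have := delR_coordTan he hr hx w
  rw [← inner_gradV, h, inner_zero_left] at this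
  have h2 : delPart (inChart (chartAt (Cn n) x) r) (chartAt (Cn n) x x) (coordTan e (e x) w) = 0 :=
    this
  rw [h2]; simp

theorem hess11_congr {f g : Cn n → ℂ} {u : Cn n} (h : f =ᶠ[𝓝 u] g) (v : Cn n) :
    hess11 f u v = hess11 g u v := by
  have key : ∀ j k, dz j (dzbar k f) u = dz j (dzbar k g) u := by
    intro j k
    have h1 : dzbar k f =ᶠ[𝓝 u] dzbar k g := by
      filter_upwards [h.eventuallyEq_nhds] with w hw
      simp only [dzbar, hw.fderiv_eq]
    simp only [dz, h1.fderiv_eq]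
  simp only [hess11, key]

theorem hess11_inChart_pos (he : e ∈ HolCharts n X) (hr : ContMDiff 𝓘(ℝ, Cn n) 𝓘(ℝ, ℝ) ∞ r)
    {x : X} (hx : x ∈ e.source) (hpos : ∀ v : Tan n x, v ≠ 0 → 0 < (leviForm r x v v).re)
    (h : Cn n) (hh : h ≠ 0) : 0 < (hess11 (inChart e r) (e x) h).re := by
  set c := chartAt (Cn n) x
  have hc := chartAt_mem_holCharts (n := n) x
  have hxc : x ∈ c.source := mem_chart_source _ x
  have hu := e.map_source hx
  have hcu : (c ∘ e.symm) (e x) = c x := by simp [e.left_inv hx]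
  rw [hess11_congr (inChart_eventuallyEq hx hxc), hess11_comp (conj_inChart c r), hcu,
    ← coordTan_eq_fderiv' he hx]
  · refine hpos (coordTan e (e x) h) fun h0 => hh ?_
    exact (coordTan_bijective he hu).1 (h0.trans (map_zero (coordTan e (e x))).symm)
  · rw [hcu]; exact contDiffAt_inChart hc hr (c.map_source hxc)
  · exact contDiffAt_real_transition he hc hu (by rwa [e.left_inv hx])
  · have h1 : e.symm ⁻¹' c.source ∈ 𝓝 (e x) :=
      (e.continuousAt_symm hu).preimage_mem_nhds (by
        rw [e.left_inv hx]; exact c.open_source.mem_nhds hxc)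
    filter_upwards [h1, e.open_target.mem_nhds hu] with v hv hv'
    exact fun h => fderiv_transition_smul_I he hc hv' hv h

section Gradient

variable [RiemannianBundle (fun x : X => Tan n x)]

theorem norm_delR_le (he : e ∈ HolCharts n X) (hr : ContMDiff 𝓘(ℝ, Cn n) 𝓘(ℝ, ℝ) ∞ r) {x : X}
    (hx : x ∈ e.source) {C : ℝ} (hC : IsFrame x (coordTan e (e x)) C) (v : Tan n x) :
    ‖delR r x v‖ ≤ C * ‖gradV (inChart e r) (e x)‖ * ‖v‖ := by
  obtain ⟨w, hw⟩ := (coordTan_bijective he (e.map_source hx)).2 v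
  have h1 := (hC w).1
  have h2 : (show Tan n x from coordTan e (e x) w) = v := hw
  rw [h2] at h1
  have : delR r x v = inner ℂ (gradV (inChart e r) (e x)) w := by
    rw [inner_gradV, ← delR_coordTan he hr hx]; congr 1; exact hw.symm
  rw [this]
  refine (norm_inner_le_norm _ _).trans ?_
  calc ‖gradV (inChart e r) (e x)‖ * ‖w‖ ≤ ‖gradV (inChart e r) (e x)‖ * (C * ‖v‖) := by gcongr
    _ = _ := by ring

theorem gam_le (he : e ∈ HolCharts n X) (hr : ContMDiff 𝓘(ℝ, Cn n) 𝓘(ℝ, ℝ) ∞ r) {x : X}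
    (hx : x ∈ e.source) {C : ℝ} (hC0 : 0 ≤ C) (hC : IsFrame x (coordTan e (e x)) C) :
    gam n r x ≤ C * ‖gradV (inChart e r) (e x)‖ := by
  refine csSup_le ⟨_, 0, by simp, rfl⟩ ?_
  rintro a ⟨v, hv, rfl⟩
  exact (norm_delR_le he hr hx hC v).trans (mul_le_of_le_one_right (by positivity) hv)

theorem norm_gradV_le (he : e ∈ HolCharts n X) (hr : ContMDiff 𝓘(ℝ, Cn n) 𝓘(ℝ, ℝ) ∞ r) {x : X}
    (hx : x ∈ e.source) {C : ℝ} (hC0 : 0 < C) (hC : IsFrame x (coordTan e (e x)) C) :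
    ‖gradV (inChart e r) (e x)‖ ≤ C * gam n r x := by
  set v := gradV (inChart e r) (e x) with hv
  rcases eq_or_ne v 0 with h0 | h0
  · rw [h0, norm_zero]
    refine mul_nonneg hC0.le (Real.sSup_nonneg ?_)
    rintro a ⟨v, hv, rfl⟩
    exact norm_nonneg _
  have hv0 := norm_pos_iff.2 h0
  -- The gradient itself, scaled to metric length at most one, is the test vector for the supremum
  -- that defines `gam`.
  set s : ℝ := (C * ‖v‖)⁻¹ with hs
  have hs0 : 0 < s := by positivity
  have e1 : delR r x (coordTan e (e x) (s • v)) = ((s * ‖v‖ ^ 2 : ℝ) : ℂ) := by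
    rw [delR_coordTan he hr hx, ← inner_gradV, ← hv, inner_smul_right_eq_smul,
      inner_self_eq_norm_sq_to_K]
    simp
  have e2 : ‖(show Tan n x from coordTan e (e x) (s • v))‖ ≤ 1 := by
    refine (hC (s • v)).2.trans ?_
    rw [norm_smul, Real.norm_eq_abs, abs_of_pos hs0, hs]
    apply le_of_eq; field_simp
  have e3 : s * ‖v‖ ^ 2 ≤ gam n r x := by
    refine le_csSup ⟨C * ‖v‖, ?_⟩ ⟨coordTan e (e x) (s • v), e2, ?_⟩
    · rintro a ⟨w, hw, rfl⟩
      exact (norm_delR_le he hr hx hC w).trans (mul_le_of_le_one_right (by positivity) hw)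
    · rw [e1, Complex.norm_real, Real.norm_eq_abs, abs_of_nonneg (by positivity)]
  calc ‖v‖ = C * (s * ‖v‖ ^ 2) := by rw [hs]; field_simp
    _ ≤ _ := by gcongr

theorem gam_pos (he : e ∈ HolCharts n X) (hr : ContMDiff 𝓘(ℝ, Cn n) 𝓘(ℝ, ℝ) ∞ r) {x : X}
    (hx : x ∈ e.source) {C : ℝ} (hC0 : 0 < C) (hC : IsFrame x (coordTan e (e x)) C)
    (hcrit : ¬ IsCrit n r x) : 0 < gam n r x := by
  have h1 := norm_gradV_le he hr hx hC0 hC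
  have h2 : 0 < ‖gradV (inChart e r) (e x)‖ :=
    norm_pos_iff.2 fun h => hcrit (isCrit_of_gradV_eq_zero he hr hx h)
  exact pos_of_mul_pos_right (h2.trans_le h1) hC0.le

/-- Each first derivative of r is twice the real part of ∂r on a unit coordinate vector, hence at
most a multiple of γ. -/
theorem norm_derivProd_le (he : e ∈ HolCharts n X) (hr : ContMDiff 𝓘(ℝ, Cn n) 𝓘(ℝ, ℝ) ∞ r)
    {C : ℝ} (hC0 : 0 < C) {N : ℕ} (c : (Fin N → Fin n × Fin 2) → ℂ) :
    ∃ K, 0 ≤ K ∧ ∀ x ∈ e.source, IsFrame x (coordTan e (e x)) C →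
      ‖derivProd e r c x‖ ≤ K * gam n r x ^ N := by
  refine ⟨∑ σ, ‖c σ‖ * (2 * C) ^ N, by positivity, fun x hx hC => ?_⟩
  unfold derivProd
  rw [Finset.sum_mul]
  refine (norm_sum_le _ _).trans (Finset.sum_le_sum fun σ _ => ?_)
  rw [norm_mul, mul_assoc, ← mul_pow]
  refine mul_le_mul_of_nonneg_left ?_ (norm_nonneg _)
  rw [norm_prod]
  have key : ∀ i : Fin N, ‖((fderiv ℝ (fun u => r (e.symm u)) (e x) (realDir (σ i)) : ℝ) : ℂ)‖ ≤
      2 * C * gam n r x := by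
    intro i
    have h1 : ‖(realDir (σ i) : Cn n)‖ = 1 := by
      unfold realDir
      rw [PiLp.norm_single]
      split_ifs <;> simp
    rw [Complex.norm_real, fderiv_eq_re_delPart he hr (e.map_source hx), ← inner_gradV,
      Real.norm_eq_abs, abs_mul, abs_two, mul_assoc]
    refine mul_le_mul_of_nonneg_left ?_ two_pos.le
    refine (Complex.abs_re_le_norm _).trans ((norm_inner_le_norm _ _).trans ?_)
    rw [h1, mul_one]
    exact norm_gradV_le he hr hx hC0 hC
  calc ∏ i, ‖((fderiv ℝ (fun u => r (e.symm u)) (e x) (realDir (σ i)) : ℝ) : ℂ)‖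
      ≤ ∏ _i : Fin N, (2 * C * gam n r x) :=
        Finset.prod_le_prod (fun i _ => norm_nonneg _) fun i _ => key i
    _ = _ := by simp

end Gradient

end DefiningFunction

/-! ### The comparison estimates on the manifold. -/

section LocalDataManifold

variable {n : ℕ} {X : Type*} [TopologicalSpace X] [ChartedSpace (Cn n) X]
  [IsManifold 𝓘(ℂ, Cn n) ω X] {e : OpenPartialHomeomorph X (Cn n)} {r : X → ℝ}
  {D : Set X} {ρ χ : X → X → ℝ}

theorem leviPolynomial_eq (e : OpenPartialHomeomorph X (Cn n)) (r : X → ℝ) (ζ z : X) :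
    leviPolynomial e r ζ z = leviPoly (inChart e r) (e ζ) (e z) := rfl

theorem IsHenkinLeitererDomain.nonpos_of_mem_closure (hD : IsHenkinLeitererDomain n D r) {x : X}
    (hx : x ∈ closure D) : r x ≤ 0 := by
  have h : closure D ⊆ {x | r x ≤ 0} := by
    refine closure_minimal (fun y hy => ?_) (isClosed_le hD.smooth.continuous continuous_const)
    rw [hD.eq_neg] at hy
    exact le_of_lt (show r y < 0 from hy)
  exact h hx

theorem IsHenkinLeitererDomain.isOpen (hD : IsHenkinLeitererDomain n D r) : IsOpen D := by
  rw [hD.eq_neg]; exact isOpen_lt hD.smooth.continuous continuous_const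

theorem IsHenkinLeitererDomain.hasLocalData (hD : IsHenkinLeitererDomain n D r)
    (he : e ∈ HolCharts n X) {x : X} (hx : x ∈ closure D) (hxe : x ∈ e.source) :
    HasLocalData (inChart e r) (e x) := by
  have hu := e.map_source hxe
  have hrx : inChart e r (e x) = ((r x : ℝ) : ℂ) := by simp [inChart, e.left_inv hxe]
  rcases (hD.nonpos_of_mem_closure hx).lt_or_eq with h | h
  · refine hasLocalData_of_neg (contDiffAt_inChart he hD.smooth hu) ?_
    rw [hrx]; exact h
  · have hfr : x ∈ frontier D := by rw [hD.frontier_eq]; exact h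
    obtain ⟨U, -, hU, hpos, -⟩ := hD.near_boundary
    exact hasLocalData_of_levi_pos (conj_inChart e r)
      (eventually_contDiffAt_inChart he hD.smooth hu)
      (hess11_inChart_pos he hD.smooth hxe (hpos x (hU hfr)))

variable [RiemannianBundle (fun x : X => Tan n x)]
  [IsContMDiffRiemannianBundle 𝓘(ℝ, Cn n) ∞ (Cn n) (fun x : X => Tan n x)] [T2Space X]

theorem IsDistanceLike.nonneg (hρ : IsDistanceLike n ρ) (x y : X) : 0 ≤ ρ x y := by
  rcases eq_or_ne x y with rfl | h
  · exact (hρ.diag x).ge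
  · exact (hρ.pos x y h).le

theorem IsDistanceLike.exists_norm_sub_le (hρ : IsDistanceLike n ρ) (he : e ∈ HolCharts n X)
    {x₀ : X} (hx₀ : x₀ ∈ e.source) :
    ∃ C > 0, ∃ O ∈ 𝓝 x₀, ∀ x ∈ O, ∀ y ∈ O, ‖e x - e y‖ ≤ C * ρ x y := by
  obtain ⟨C, hC, O, hO, hb⟩ := exists_riemannianEDist_ge he hx₀
  obtain ⟨V, hV, hdiag, hV'⟩ := hρ.eq_geodesic
  have h1 : V ∈ 𝓝 x₀ ×ˢ 𝓝 x₀ := by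
    rw [← nhds_prod_eq]; exact hV.mem_nhds (hdiag x₀)
  obtain ⟨O', hO', hsub⟩ := (Filter.mem_prod_same_iff).1 h1
  refine ⟨C, hC, O ∩ O', inter_mem hO hO', fun x hx y hy => ?_⟩
  have h2 := hb x hx.1 y hy.1
  have h3 := hV' (x, y) (hsub ⟨hx.2, hy.2⟩)
  simp only at h3
  rw [h3, enorm_eq_nnnorm, ← ENNReal.ofReal_coe_nnreal, ← ENNReal.ofReal_coe_nnreal,
    ← ENNReal.ofReal_mul C.coe_nonneg] at h2
  have h4 := (ENNReal.ofReal_le_ofReal_iff (mul_nonneg C.2 (hρ.nonneg x y))).1 h2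
  rw [norm_sub_rev]
  exact h4

theorem IsPatching.eventually_eq_one (hρ : IsDistanceLike n ρ) (hχ : IsPatching n ρ χ) (x₀ : X) :
    ∃ O ∈ 𝓝 x₀, ∀ x ∈ O, ∀ y ∈ O, χ x y = 1 := by
  obtain ⟨-, c, hc, h1, -⟩ := hχ
  have hcont := hρ.smooth_sq.continuous.tendsto (x₀, x₀)
  have h0 : ρ x₀ x₀ ^ 2 < c / 2 := by rw [hρ.diag]; simp; exact hc
  have h2 := hcont.eventually (gt_mem_nhds h0)
  rw [nhds_prod_eq] at h2
  obtain ⟨O, hO, hsub⟩ := (Filter.mem_prod_same_iff).1 h2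
  exact ⟨O, hO, fun x hx y hy => h1 x y (le_of_lt (hsub (⟨hx, hy⟩ : (x, y) ∈ O ×ˢ O)))⟩

theorem IsHenkinLeitererDomain.exists_preKernelData (hD : IsHenkinLeitererDomain n D r)
    (hρ : IsDistanceLike n ρ) (hχ : IsPatching n ρ χ) (he : e ∈ HolCharts n X) {x₀ : X}
    (hx₀ : x₀ ∈ closure D) (hxe : x₀ ∈ e.source) :
    ∃ C ≥ 1, ∃ C₀ > 0, ∃ ε₁ > 0, ∃ O ∈ 𝓝 x₀, O ⊆ e.source ∧
      (∀ x ∈ O, IsFrame x (coordTan e (e x)) C₀) ∧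
      ∀ ζ ∈ O, ∀ z ∈ O, ζ ≠ z → ¬ IsCrit n r ζ → ¬ IsCrit n r z → ∀ ε ∈ Ioo 0 ε₁,
        r ζ + ε ≤ 0 → r z + ε ≤ 0 →
        ∃ Φ, PreKernelData C (gam n r ζ) (gam n r z) (bigP n r ρ ε ζ z) (-(r ζ + ε)) (-(r z + ε)) Φ
            (gradV (inChart e r) (e ζ)) (gradV (inChart e r) (e z)) (e ζ - e z) ∧
          Φ ≤ C * ‖phi e r ρ χ ε ζ z‖ ∧ ‖phi e r ρ χ ε ζ z‖ ≤ C * Φ ∧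
          Φ ≤ C * ‖phi e r ρ χ ε z ζ‖ ∧ ‖phi e r ρ χ ε z ζ‖ ≤ C * Φ := by
  obtain ⟨C₀, hC₀, hframe⟩ := eventually_isFrame_coordTan he hxe
  obtain ⟨Cρ, hCρ, O₁, hO₁, hdist⟩ := hρ.exists_norm_sub_le he hxe
  obtain ⟨O₂, hO₂, hone⟩ := hχ.eventually_eq_one hρ x₀
  -- One constant for all comparisons: `C₀` for γ against the coordinate gradient, `Cρ ^ 2` for the
  -- squared coordinate distance against `ρ²`.
  set C₁ := 1 + C₀ + Cρ ^ 2 with hC₁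
  have hC₁1 : 1 ≤ C₁ := by have : 0 ≤ Cρ ^ 2 := by positivity
                           linarith
  have hC₀₁ : C₀ ≤ C₁ := by have : 0 ≤ Cρ ^ 2 := by positivity
                            linarith
  obtain ⟨C, hC, δ, hδ, ε₁, hε₁, hdata⟩ := hD.hasLocalData he hx₀ hxe C₁ hC₁1
  have hO₃ : e ⁻¹' Metric.ball (e x₀) δ ∈ 𝓝 x₀ :=
    (e.continuousAt hxe).preimage_mem_nhds (Metric.ball_mem_nhds _ hδ)
  refine ⟨C, hC, C₀, hC₀, ε₁, hε₁,
    O₁ ∩ O₂ ∩ e ⁻¹' Metric.ball (e x₀) δ ∩ {x | IsFrame x (coordTan e (e x)) C₀} ∩ e.source,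
    inter_mem (inter_mem (inter_mem (inter_mem hO₁ hO₂) hO₃) hframe)
      (e.open_source.mem_nhds hxe), inter_subset_right, fun x hx => hx.1.2, ?_⟩
  rintro ζ ⟨⟨⟨⟨hζ₁, hζ₂⟩, hζ₃⟩, hζ₄⟩, hζe⟩ z ⟨⟨⟨⟨hz₁, hz₂⟩, hz₃⟩, hz₄⟩, hze⟩ hne hcζ hcz ε hε hεζ hεz
  have hgr : ∀ x ∈ e.source, (inChart e r (e x)).re = r x := fun x hx => by
    simp [inChart, e.left_inv hx]
  have hG := gam_pos he hD.smooth hζe hC₀ hζ₄ hcζ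
  have hG' := gam_pos he hD.smooth hze hC₀ hz₄ hcz
  have hmul : ∀ a : ℝ, 0 ≤ a → C₀ * a ≤ C₁ * a := fun a ha => by gcongr
  -- Both values of `r_ε` are nonpositive, so the second summand of `P_ε` is nonnegative and `P_ε ≥
  -- ρ²`.
  have hterm : 0 ≤ 2 * (r ζ + ε) / gam n r ζ * ((r z + ε) / gam n r z) := by
    have h1 : (r ζ + ε) / gam n r ζ ≤ 0 := div_nonpos_of_nonpos_of_nonneg hεζ hG.le
    have h2 : (r z + ε) / gam n r z ≤ 0 := div_nonpos_of_nonpos_of_nonneg hεz hG'.le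
    have h3 := mul_nonneg_of_nonpos_of_nonpos h1 h2
    have : 2 * (r ζ + ε) / gam n r ζ * ((r z + ε) / gam n r z) =
      2 * ((r ζ + ε) / gam n r ζ * ((r z + ε) / gam n r z)) := by ring
    rw [this]; positivity
  have hPeq : bigP n r ρ ε ζ z =
      ρ ζ z ^ 2 + 2 * (r ζ + ε) / gam n r ζ * ((r z + ε) / gam n r z) := by
    unfold bigP; ring
  have hρ0 := hρ.pos ζ z hne
  have hρsq : 0 < ρ ζ z ^ 2 := by positivity
  have hP : 0 < bigP n r ρ ε ζ z := by rw [hPeq]; linarith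
  have key := hdata (e ζ) hζ₃ (e z) hz₃ (fun h => hne (e.injOn hζe hze h)) ε hε
    (by rw [hgr ζ hζe]; exact hεζ) (by rw [hgr z hze]; exact hεz) _ _ _ hG hG' hP
    ((gam_le he hD.smooth hζe hC₀.le hζ₄).trans (hmul _ (norm_nonneg _)))
    ((norm_gradV_le he hD.smooth hζe hC₀ hζ₄).trans (hmul _ hG.le))
    ((gam_le he hD.smooth hze hC₀.le hz₄).trans (hmul _ (norm_nonneg _)))
    (by
      calc ‖e ζ - e z‖ ^ 2 ≤ (Cρ * ρ ζ z) ^ 2 :=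
            pow_le_pow_left₀ (norm_nonneg _) (hdist ζ hζ₁ z hz₁) 2
        _ = Cρ ^ 2 * ρ ζ z ^ 2 := by ring
        _ ≤ C₁ * bigP n r ρ ε ζ z := by
          have h1 : Cρ ^ 2 ≤ C₁ := by linarith
          have h2 : ρ ζ z ^ 2 ≤ bigP n r ρ ε ζ z := by rw [hPeq]; linarith
          gcongr)
    (by rw [hgr ζ hζe, hgr z hze, hPeq]; linarith)
  rw [hgr ζ hζe, hgr z hze] at key
  have hphi : ∀ x ∈ O₂, ∀ y ∈ O₂, phi e r ρ χ ε x y =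
      leviPoly (inChart e r) (e x) (e y) - ((r x + ε : ℝ) : ℂ) := fun x hx y hy => by
    unfold phi
    rw [hone x hx y hy, leviPolynomial_eq]
    push_cast; ring
  rw [hphi ζ hζ₂ z hz₂, hphi z hz₂ ζ hζ₂]
  exact key

end LocalDataManifold

/-! ### The pointwise bound of an admissible family, uniform in ε. -/

section LocalBound

variable {n : ℕ} {X : Type*} [TopologicalSpace X] [ChartedSpace (Cn n) X]
  {e : OpenPartialHomeomorph X (Cn n)} {r : X → ℝ}
  {D : Set X} {ρ χ : X → X → ℝ} [RiemannianBundle (fun x : X => Tan n x)]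

theorem formNorm_conjForm {l : ℕ} (x : X) (f : Form n l) : formNorm x (conjForm f) = formNorm x f := by
  have : ∀ v : Fin l → Cn n, ‖conjForm f v‖ = ‖f v‖ := fun v => RCLike.norm_conj (f v)
  rw [formNorm_eq, formNorm_eq]
  simp only [this]

theorem dformNorm_conjDForm {k l : ℕ} (ζ z : X) (A : DForm n k l) :
    dformNorm ζ z (conjDForm A) = dformNorm ζ z A := by
  have : ∀ v : Fin k → Cn n, conjDForm A v = conjForm (A v) := fun v => rfl
  rw [dformNorm_eq, dformNorm_eq]
  simp only [this, formNorm_conjForm]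

theorem norm_smul_dform_le {k l : ℕ} (c : ℂ) (A : DForm n k l) : ‖c • A‖ ≤ ‖c‖ * ‖A‖ := by
  refine ContinuousAlternatingMap.opNorm_le_bound _ (by positivity) fun v => ?_
  have : (c • A) v = c • A v := rfl
  rw [this, mul_assoc]
  have h2 : ‖c • A v‖ ≤ ‖c‖ * ‖A v‖ := by
    refine ContinuousAlternatingMap.opNorm_le_bound _ (by positivity) fun w => ?_
    have : (c • A v) w = c * A v w := rfl
    rw [this, norm_mul, mul_assoc]
    gcongr
    exact (A v).le_opNorm w
  refine h2.trans ?_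
  gcongr
  exact A.le_opNorm v

/-- Two-sided comparability is required because the exponents `t₁, …, t₄` may have either sign. -/
theorem zpow_le_of_comparable {C f Φ : ℝ} (hC : 1 ≤ C) (hΦ : 0 < Φ) (h1 : Φ ≤ C * f)
    (h2 : f ≤ C * Φ) (i : ℤ) : f ^ i ≤ C ^ i.natAbs * Φ ^ i := by
  have hC0 : 0 < C := by linarith
  have hf : 0 < f := pos_of_mul_pos_right (hΦ.trans_le h1) hC0.le
  rcases Int.natAbs_eq i with hi | hi
  · rw [hi, zpow_natCast, zpow_natCast, Int.natAbs_natCast, ← mul_pow]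
    exact pow_le_pow_left₀ hf.le h2 _
  · have h3 : f⁻¹ ≤ C * Φ⁻¹ := by
      rw [← div_eq_mul_inv, le_div_iff₀ hΦ, inv_mul_le_iff₀ hf]
      linarith
    rw [hi, zpow_neg, zpow_neg, zpow_natCast, zpow_natCast, Int.natAbs_neg, Int.natAbs_natCast,
      ← inv_pow, ← inv_pow, ← mul_pow]
    exact pow_le_pow_left₀ (by positivity) h3 _

/-- The order zero case of the weight condition turns `|ξ|` into the power `γ^k`. -/
theorem IsClassE.exists_bound {V : Type*} [NormedAddCommGroup V] [NormedSpace ℝ V]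
    {U : Set X} {ε₀ : ℝ} {j : ℕ} {k : ℤ} {a : ℝ → X → X → V} (hU : U ⊆ e.source)
    (hDr : D = {x | r x < 0}) (h : IsClassE e U D r ε₀ j k a) :
    ∃ C, 0 ≤ C ∧ ∀ ε ∈ Ioo 0 ε₀, ∀ ζ ∈ U, ∀ z ∈ U, r ζ + ε < 0 → r z + ε < 0 → ¬ IsCrit n r ζ →
      ¬ IsCrit n r z → ‖a ε ζ z‖ ≤ C * gam n r ζ ^ k * ‖e ζ - e z‖ ^ j := by
  obtain ⟨ξ, ⟨-, hξ⟩, C, hC⟩ := h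
  obtain ⟨C', hC'⟩ := hξ 0
  refine ⟨|C| * |C'|, by positivity, fun ε hε ζ hζ z hz hεζ hεz hcζ hcz => ?_⟩
  have hζD : ζ ∈ D := by
    rw [hDr]
    have := hε.1
    show r ζ < 0
    linarith
  have h1 := (hC ε hε).2 ζ ⟨⟨hζ, subset_closure hεζ⟩, hcζ⟩ z ⟨⟨hz, subset_closure hεz⟩, hcz⟩
  have h2 := hC' ζ ⟨hζ, hζD⟩ hcζ
  rw [pow_zero, one_mul, norm_iteratedFDeriv_zero, e.left_inv (hU hζ), Real.norm_eq_abs] at h2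
  have hg : 0 ≤ gam n r ζ ^ k := by
    refine zpow_nonneg (Real.sSup_nonneg ?_) k
    rintro a ⟨v, hv, rfl⟩
    exact norm_nonneg _
  calc ‖a ε ζ z‖ ≤ C * |ξ ζ| * ‖e ζ - e z‖ ^ j := h1
    _ ≤ |C| * (|C'| * gam n r ζ ^ k) * ‖e ζ - e z‖ ^ j := by
      gcongr
      · exact le_abs_self C
      · exact h2.trans (by gcongr; exact le_abs_self _)
    _ = _ := by ring

theorem norm_kernelFactor (e : OpenPartialHomeomorph X (Cn n)) (r : X → ℝ) (ρ χ : X → X → ℝ)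
    (q : Exponents) (cN : (Fin q.N → Fin n × Fin 2) → ℂ) (cM : (Fin q.M → Fin n × Fin 2) → ℂ)
    (ε : ℝ) (ζ z : X) (hφ : phi e r ρ χ ε ζ z ≠ 0) (hφ' : phi e r ρ χ ε z ζ ≠ 0) :
    ‖kernelFactor e r ρ χ q cN cM ε ζ z‖ =
      ‖derivProd e r cN ζ‖ * ‖derivProd e r cM z‖ * |bigP n r ρ ε ζ z|⁻¹ ^ q.t₀ *
        (‖phi e r ρ χ ε ζ z‖ ^ (q.t₁ + q.t₂) * ‖phi e r ρ χ ε z ζ‖ ^ (q.t₃ + q.t₄)) *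
        |r ζ + ε| ^ q.l * |r z + ε| ^ q.m := by
  unfold kernelFactor
  simp only [norm_mul, norm_zpow, Complex.norm_real, Real.norm_eq_abs, abs_pow, abs_inv,
    RCLike.norm_conj]
  rw [zpow_add₀ (norm_ne_zero_iff.2 hφ), zpow_add₀ (norm_ne_zero_iff.2 hφ')]
  ring

variable [IsManifold 𝓘(ℂ, Cn n) ω X]
  [IsContMDiffRiemannianBundle 𝓘(ℝ, Cn n) ∞ (Cn n) (fun x : X => Tan n x)] [T2Space X]

/-- In a local representation `φ_ε` and its variants are replaced by `Φ` and every coefficient by a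
power of γ or of the distance; `exists_kernel_bound` then applies. Both versions, with the gradient
at ζ and at z, come from the same `Φ`. -/
theorem IsHenkinLeitererDomain.exists_family_bound (hD : IsHenkinLeitererDomain n D r)
    (hρ : IsDistanceLike n ρ) (hχ : IsPatching n ρ χ) {k l : ℕ} {ε₀ : ℝ} (hε₀ : 0 < ε₀) {τ : ℤ}
    {F : ℝ → X → X → DForm n k l} {x₀ : X} (hx₀ : x₀ ∈ closure D)
    (hF : HasLocalRep D r ρ χ ε₀ τ F x₀) :
    ∃ e ∈ HolCharts n X, ∃ C > 0, ∃ ε₁ > 0, ∃ O ∈ 𝓝 x₀, O ⊆ e.source ∧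
      (∀ x ∈ O, IsFrame x (coordTan e (e x)) C) ∧
      ∀ ζ ∈ O, ∀ z ∈ O, ζ ≠ z → ¬ IsCrit n r ζ → ¬ IsCrit n r z →
        ‖e ζ - e z‖ ≤ C ∧ ∀ ε ∈ Ioo 0 ε₁, r ζ + ε < 0 → r z + ε < 0 →
        dformNorm ζ z (F ε ζ z) ≤ C * (1 + ‖e ζ - e z‖ ^ (τ - 2 * n + 2) *
          anisotropic (gradV (inChart e r) (e ζ)) (e ζ - e z) ^ (-2 : ℤ)) ∧
        dformNorm ζ z (F ε ζ z) ≤ C * (1 + ‖e ζ - e z‖ ^ (τ - 2 * n + 2) *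
          anisotropic (gradV (inChart e r) (e z)) (e ζ - e z) ^ (-2 : ℤ)) := by
  obtain ⟨e, he, U, hU, hxU, hUe, q, hq, cN, cM, d, a, b, ha, hb, B, hB, hrep⟩ := hF
  obtain ⟨C, hC, C₀, hC₀, ε₁, hε₁, O, hO, hOe, hframe, hdata⟩ :=
    hD.exists_preKernelData hρ hχ he hx₀ (hUe hxU)
  have hC0 : 0 < C := zero_lt_one.trans_le hC
  have hK1 : 1 ≤ 8 * C ^ 4 := by
    have : 1 ≤ C ^ 4 := one_le_pow₀ hC
    linarith
  -- The products of derivatives combined with the weights give the powers `N + α` and `M + β` of γ,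
  -- nonnegative by the conditions on the exponents; negative weights never act alone.
  obtain ⟨N', hN'⟩ : ∃ N' : ℕ, (q.N : ℤ) + q.α = N' := ⟨_, (Int.toNat_of_nonneg q.weight_left).symm⟩
  obtain ⟨M', hM'⟩ : ∃ M' : ℕ, (q.M : ℤ) + q.β = M' :=
    ⟨_, (Int.toNat_of_nonneg q.weight_right).symm⟩
  obtain ⟨S, hS, hker⟩ := exists_kernel_bound hK1 n τ q.t N' M' q.j q.t₀ q.l q.m (by
    refine hq.trans (le_of_eq ?_)
    unfold Exponents.type Exponents.smoothType
    rw [← hN', ← hM']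
    have : (2 - (q.N : ℤ) - q.M - q.α - q.β) = 2 - (q.N + q.α) - (q.M + q.β) := by ring
    rw [this])
  obtain ⟨KN, hKN, hdN⟩ := norm_derivProd_le he hD.smooth hC₀ cN
  obtain ⟨KM, hKM, hdM⟩ := norm_derivProd_le he hD.smooth hC₀ cM
  choose Ca hCa0 hCa using fun i => (ha i).exists_bound hUe hD.eq_neg
  choose Cb hCb0 hCb using fun i => (hb i).exists_bound hUe hD.eq_neg
  obtain ⟨T, hT⟩ : ∃ T, T = KN * KM * (C ^ (q.t₁ + q.t₂).natAbs * C ^ (q.t₃ + q.t₄).natAbs) *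
    ((∑ i, Ca i * Cb i) * C ^ q.k) := ⟨_, rfl⟩
  have hT0 : 0 ≤ T := by
    rw [hT]
    have : 0 ≤ ∑ i, Ca i * Cb i := Finset.sum_nonneg fun i _ => mul_nonneg (hCa0 i) (hCb0 i)
    positivity
  obtain ⟨Q, hQ⟩ : ∃ Q, Q = frameConst n k C₀ * (frameConst n l C₀ * (T * S)) := ⟨_, rfl⟩
  have hfk := frameConst_nonneg (n := n) (k := k) hC₀.le
  have hfl := frameConst_nonneg (n := n) (k := l) hC₀.le
  have hQ0 : 0 ≤ Q := by rw [hQ]; positivity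
  refine ⟨e, he, C + C₀ + Q, by linarith, min ε₀ ε₁, lt_min hε₀ hε₁,
    O ∩ U ∩ e ⁻¹' Metric.ball (e x₀) (1 / 2),
    inter_mem (inter_mem hO (hU.mem_nhds hxU))
      ((e.continuousAt (hUe hxU)).preimage_mem_nhds (Metric.ball_mem_nhds _ (by norm_num))),
    (inter_subset_left.trans inter_subset_left).trans hOe,
    fun x hx => (hframe x hx.1.1).mono (by linarith), ?_⟩
  rintro ζ ⟨⟨hζO, hζU⟩, hζb⟩ z ⟨⟨hzO, hzU⟩, hzb⟩ hne hcζ hcz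
  have hne' : e ζ - e z ≠ 0 := sub_ne_zero.2 fun h => hne (e.injOn (hUe hζU) (hUe hzU) h)
  have hhC : ‖e ζ - e z‖ ≤ C := by
    have h1 := Metric.mem_ball.1 hζb
    have h2 := Metric.mem_ball.1 hzb
    have := dist_triangle_right (e ζ) (e z) (e x₀)
    rw [← dist_eq_norm]; linarith
  refine ⟨hhC.trans (by linarith), fun ε hε hεζ hεz => ?_⟩
  have hε' : ε ∈ Ioo 0 ε₀ := ⟨hε.1, hε.2.trans_le (min_le_left _ _)⟩
  obtain ⟨Φ, H, p1, p2, p3, p4⟩ := hdata ζ hζO z hzO hne hcζ hcz ε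
    ⟨hε.1, hε.2.trans_le (min_le_right _ _)⟩ hεζ.le hεz.le
  have hΦ := H.Φ_pos
  have hG := H.G_pos
  have hG' := H.G'_pos
  have hP := H.P_pos
  have hh0 : 0 < ‖e ζ - e z‖ := norm_pos_iff.2 hne'
  have φ1 : phi e r ρ χ ε ζ z ≠ 0 := by
    rintro h
    rw [h, norm_zero, mul_zero] at p1
    linarith
  have φ2 : phi e r ρ χ ε z ζ ≠ 0 := by
    rintro h
    rw [h, norm_zero, mul_zero] at p3
    linarith
  have hx : |r ζ + ε| = -(r ζ + ε) := abs_of_neg hεζ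
  have hy : |r z + ε| = -(r z + ε) := abs_of_neg hεz
  have hz1 := zpow_le_of_comparable hC hΦ p1 p2 (q.t₁ + q.t₂)
  have hz2 := zpow_le_of_comparable hC hΦ p3 p4 (q.t₃ + q.t₄)
  have hsum : ‖∑ i, a i ε ζ z • b i ε z ζ‖ ≤ (∑ i, Ca i * Cb i) * C ^ q.k *
      (gam n r ζ ^ q.α * gam n r z ^ q.β * ‖e ζ - e z‖ ^ q.j) := by
    rw [Finset.sum_mul, Finset.sum_mul]
    refine (norm_sum_le (E := DForm n k l) _ _).trans (Finset.sum_le_sum fun i _ => ?_)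
    refine (norm_smul_dform_le _ _).trans ?_
    have h1 := hCa i ε hε' ζ hζU z hzU hεζ hεz hcζ hcz
    have h2 := hCb i ε hε' z hzU ζ hζU hεz hεζ hcz hcζ
    rw [norm_sub_rev] at h2
    -- The distance power of the second coefficient class does not enter the type and is simply
    -- bounded.
    have h3 : ‖e ζ - e z‖ ^ q.k ≤ C ^ q.k := pow_le_pow_left₀ hh0.le hhC _
    have := hCa0 i
    have := hCb0 i
    calc ‖a i ε ζ z‖ * ‖b i ε z ζ‖ ≤ (Ca i * gam n r ζ ^ q.α * ‖e ζ - e z‖ ^ q.j) *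
          (Cb i * gam n r z ^ q.β * C ^ q.k) := by
          refine mul_le_mul h1 (h2.trans ?_) (norm_nonneg (E := DForm n k l) _) (by positivity)
          gcongr
      _ = _ := by ring
  have hcoord : coordDForm e e (B ε) (e ζ) (e z) =
      kernelFactor e r ρ χ q cN cM ε ζ z • ∑ i, a i ε ζ z • b i ε z ζ :=
    hrep ε hε' ζ ⟨hζU, subset_closure hεζ⟩ z ⟨hzU, subset_closure hεz⟩ hne hcζ hcz
  have hnorm : ‖coordDForm e e (B ε) (e ζ) (e z)‖ ≤
      T * (gam n r ζ ^ N' * gam n r z ^ M' * (‖e ζ - e z‖ ^ q.j * (bigP n r ρ ε ζ z)⁻¹ ^ q.t₀) *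
        (Φ ^ (-q.t) * (-(r ζ + ε)) ^ q.l * (-(r z + ε)) ^ q.m)) := by
    have e1 : gam n r ζ ^ N' = gam n r ζ ^ q.N * gam n r ζ ^ q.α := by
      rw [← zpow_natCast, ← hN', zpow_add₀ hG.ne', zpow_natCast]
    have e2 : gam n r z ^ M' = gam n r z ^ q.M * gam n r z ^ q.β := by
      rw [← zpow_natCast, ← hM', zpow_add₀ hG'.ne', zpow_natCast]
    have e3 : Φ ^ (-q.t) = Φ ^ (q.t₁ + q.t₂) * Φ ^ (q.t₃ + q.t₄) := by
      rw [← zpow_add₀ hΦ.ne']; congr 1; unfold Exponents.t; ring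
    have hx0 := H.x_nonneg
    have hy0 := H.y_nonneg
    rw [hcoord]
    refine (norm_smul_dform_le _ _).trans ?_
    rw [norm_kernelFactor e r ρ χ q cN cM ε ζ z φ1 φ2, hx, hy, abs_of_pos hP]
    have h1 := hdN ζ (hUe hζU) (hframe ζ hζO)
    have h2 := hdM z (hUe hzU) (hframe z hzO)
    calc _ ≤ ((KN * gam n r ζ ^ q.N) * (KM * gam n r z ^ q.M) * (bigP n r ρ ε ζ z)⁻¹ ^ q.t₀ *
          ((C ^ (q.t₁ + q.t₂).natAbs * Φ ^ (q.t₁ + q.t₂)) *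
            (C ^ (q.t₃ + q.t₄).natAbs * Φ ^ (q.t₃ + q.t₄))) *
          (-(r ζ + ε)) ^ q.l * (-(r z + ε)) ^ q.m) *
          ((∑ i, Ca i * Cb i) * C ^ q.k *
            (gam n r ζ ^ q.α * gam n r z ^ q.β * ‖e ζ - e z‖ ^ q.j)) := by
          refine mul_le_mul ?_ hsum (norm_nonneg (E := DForm n k l) _) (by positivity)
          gcongr
      _ = _ := by rw [e1, e2, e3, hT]; ring
  have hfin : ∀ Ψ, KernelData (8 * C ^ 4) (gam n r ζ) (gam n r z) ‖e ζ - e z‖ Φ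
      (bigP n r ρ ε ζ z) (-(r ζ + ε)) (-(r z + ε)) Ψ →
      dformNorm ζ z (F ε ζ z) ≤ (C + C₀ + Q) *
        (1 + ‖e ζ - e z‖ ^ (τ - 2 * n + 2) * Ψ ^ (-2 : ℤ)) := by
    intro Ψ HΨ
    have h1 := hker _ _ _ _ _ _ _ _ HΨ
    have h2 : dformNorm ζ z (F ε ζ z) = dformNorm ζ z (B ε ζ z) := by
      rcases hB with h | h
      · rw [h]
      · rw [h, dformNorm_conjDForm]
    have h3 : coordDForm e e (B ε) (e ζ) (e z) =
        pullD (coordTan e (e ζ)) (coordTan e (e z)) (B ε ζ z) := by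
      have : coordDForm e e (B ε) (e ζ) (e z) = pullD (coordTan e (e ζ)) (coordTan e (e z))
        (B ε (e.symm (e ζ)) (e.symm (e z))) := rfl
      rw [this, e.left_inv (hUe hζU), e.left_inv (hUe hzU)]
    have h4 := IsFrame.dformNorm_le hC₀.le (hframe ζ hζO) (hframe z hzO) (B ε ζ z)
    rw [← h3] at h4
    have hΨ := HΨ.Ψ_pos
    have h5 : 0 ≤ 1 + ‖e ζ - e z‖ ^ (τ - 2 * n + 2) * Ψ ^ (-2 : ℤ) := by positivity
    rw [h2]
    refine h4.trans ?_
    calc frameConst n k C₀ * (frameConst n l C₀ * ‖coordDForm e e (B ε) (e ζ) (e z)‖)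
        ≤ frameConst n k C₀ * (frameConst n l C₀ * (T * (S *
          (1 + ‖e ζ - e z‖ ^ (τ - 2 * n + 2) * Ψ ^ (-2 : ℤ))))) := by
          gcongr
          refine hnorm.trans ?_
          gcongr
      _ = Q * (1 + ‖e ζ - e z‖ ^ (τ - 2 * n + 2) * Ψ ^ (-2 : ℤ)) := by rw [hQ]; ring
      _ ≤ _ := by
          gcongr
          linarith
  exact ⟨hfin _ H.kernelData_left, hfin _ H.kernelData_right⟩

end LocalBound

/-! ### Passage to the limit ε → 0. -/

section KernelBound

variable {n : ℕ} {X : Type*} [TopologicalSpace X] [ChartedSpace (Cn n) X]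
  {r : X → ℝ} {D : Set X} {ρ χ : X → X → ℝ} [RiemannianBundle (fun x : X => Tan n x)]

theorem continuous_formNorm {l : ℕ} (x : X) : Continuous fun f : Form n l => formNorm x f := by
  simp only [formNorm_eq]
  refine Real.continuous_sqrt.comp (continuous_const.mul (continuous_finsetSum _ fun σ _ => ?_))
  exact ((ContinuousAlternatingMap.apply ℝ (Cn n) ℂ _).continuous).norm.pow 2

theorem continuous_dformNorm {k l : ℕ} (ζ z : X) :
    Continuous fun A : DForm n k l => dformNorm ζ z A := by
  simp only [dformNorm_eq]
  refine Real.continuous_sqrt.comp (continuous_const.mul (continuous_finsetSum _ fun σ _ => ?_))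
  exact ((continuous_formNorm z).comp
    (ContinuousAlternatingMap.apply ℝ (Cn n) (Form n l) _).continuous).pow 2

theorem eventually_add_neg {x : X} (hx : r x < 0) {ε₁ : ℝ} (hε₁ : 0 < ε₁) :
    ∀ᶠ ε in 𝓝[>] (0 : ℝ), ε ∈ Ioo 0 ε₁ ∧ r x + ε < 0 := by
  have h1 : Ioo 0 (min ε₁ (-r x)) ∈ 𝓝[>] (0 : ℝ) := Ioo_mem_nhdsGT (lt_min hε₁ (by linarith))
  filter_upwards [h1] with ε hε
  refine ⟨⟨hε.1, hε.2.trans_le (min_le_left _ _)⟩, ?_⟩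
  have := hε.2.trans_le (min_le_right _ _)
  linarith

variable {k l : ℕ} {τ : ℤ} {A : X → X → DForm n k l}

/-- A fixed pair of points of `D` lies in `D_ε` for all small ε, so the uniform bound passes to the
pointwise limit. -/
theorem IsKernelOfType.exists_off_diagonal_bound (hDr : D = {x | r x < 0})
    (hA : IsKernelOfType D r ρ χ τ A) {x₀ y₀ : X} (hx₀ : x₀ ∈ closure D) (hy₀ : y₀ ∈ closure D)
    (hne : x₀ ≠ y₀) :
    ∃ U ∈ 𝓝 x₀, ∃ V ∈ 𝓝 y₀, ∃ C : ℝ, ∀ ζ ∈ U ∩ D, ∀ z ∈ V ∩ D, ζ ≠ z →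
      dformNorm ζ z (A ζ z) ≤ C := by
  obtain ⟨ε₀, F, hF, hlim⟩ := hA
  obtain ⟨U, hU, V, hV, C, hC⟩ := hF.bounded x₀ hx₀ y₀ hy₀ hne
  refine ⟨U, hU, V, hV, C, fun ζ hζ z hz hζz => ?_⟩
  refine le_of_tendsto (((continuous_dformNorm ζ z).tendsto _).comp (hlim ζ hζ.2 z hz.2 hζz)) ?_
  have h1 : r ζ < 0 := by have := hζ.2; rwa [hDr] at this
  have h2 : r z < 0 := by have := hz.2; rwa [hDr] at this
  filter_upwards [eventually_add_neg h1 hF.pos, eventually_add_neg h2 hF.pos] with ε he he'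
  exact hC ε he.1 ζ ⟨hζ.1, subset_closure he.2⟩ z ⟨hz.1, subset_closure he'.2⟩

variable [IsManifold 𝓘(ℂ, Cn n) ω X]
  [IsContMDiffRiemannianBundle 𝓘(ℝ, Cn n) ∞ (Cn n) (fun x : X => Tan n x)] [T2Space X]

/-- Both choices of the gradient are kept in the limit: integration in one variable requires the
direction to be frozen at the other. -/
theorem IsKernelOfType.exists_diagonal_bound (hA : IsKernelOfType D r ρ χ τ A)
    (hD : IsHenkinLeitererDomain n D r) (hρ : IsDistanceLike n ρ) (hχ : IsPatching n ρ χ) {x₀ : X}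
    (hx₀ : x₀ ∈ closure D) :
    ∃ e ∈ HolCharts n X, ∃ C > 0, ∃ O ∈ 𝓝 x₀, O ⊆ e.source ∧
      ∀ ζ ∈ O ∩ D, ∀ z ∈ O ∩ D, ζ ≠ z → ¬ IsCrit n r ζ → ¬ IsCrit n r z →
        gradV (inChart e r) (e ζ) ≠ 0 ∧ gradV (inChart e r) (e z) ≠ 0 ∧ ‖e ζ - e z‖ ≤ C ∧
        dformNorm ζ z (A ζ z) ≤ C * (1 + ‖e ζ - e z‖ ^ (τ - 2 * n + 2) *
          anisotropic (gradV (inChart e r) (e ζ)) (e ζ - e z) ^ (-2 : ℤ)) ∧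
        dformNorm ζ z (A ζ z) ≤ C * (1 + ‖e ζ - e z‖ ^ (τ - 2 * n + 2) *
          anisotropic (gradV (inChart e r) (e z)) (e ζ - e z) ^ (-2 : ℤ)) := by
  obtain ⟨ε₀, F, hF, hlim⟩ := hA
  obtain ⟨e, he, C, hC, ε₁, hε₁, O, hO, hOe, -, hb⟩ :=
    hD.exists_family_bound hρ hχ hF.pos hx₀ (hF.rep x₀ hx₀)
  refine ⟨e, he, C, hC, O, hO, hOe, fun ζ hζ z hz hζz hcζ hcz => ?_⟩
  obtain ⟨h1, h2⟩ := hb ζ hζ.1 z hz.1 hζz hcζ hcz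
  have a1 : r ζ < 0 := by have := hζ.2; rwa [hD.eq_neg] at this
  have a2 : r z < 0 := by have := hz.2; rwa [hD.eq_neg] at this
  have ev := (eventually_add_neg a1 hε₁).and (eventually_add_neg a2 hε₁)
  have lim := ((continuous_dformNorm ζ z).tendsto _).comp (hlim ζ hζ.2 z hz.2 hζz)
  refine ⟨fun h => hcζ (isCrit_of_gradV_eq_zero he hD.smooth (hOe hζ.1) h),
    fun h => hcz (isCrit_of_gradV_eq_zero he hD.smooth (hOe hz.1) h), h1,
    le_of_tendsto lim (ev.mono fun ε hε => (h2 ε hε.1.1 hε.1.2 hε.2.2).1),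
    le_of_tendsto lim (ev.mono fun ε hε => (h2 ε hε.1.1 hε.1.2 hε.2.2).2)⟩

end KernelBound

/-! ### Integrability of the anisotropic bound, uniformly in the direction. -/

section AnisotropicIntegral

variable {n : ℕ}

/-- The product kernel `∏ |h_i|^{-κ}` on a polydisc. -/
def polydiscKernel (n : ℕ) (κ R : ℝ) (h : Cn n) : ℝ :=
  ∏ i, (Metric.ball (0 : ℂ) R).indicator (fun t => ‖t‖ ^ (-κ)) (h i)

theorem integrable_indicator_rpow {κ : ℝ} (hκ : κ < 2) (R : ℝ) :
    Integrable ((Metric.ball (0 : ℂ) R).indicator fun t : ℂ => ‖t‖ ^ (-κ)) := by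
  rw [integrable_indicator_iff Metric.isOpen_ball.measurableSet]
  refine integrableOn_ball_of_norm_le_rpow (C := 1) (α := κ) ?_ ?_ ?_ ?_
  · rw [Complex.finrank_real_complex]; norm_num
  · rw [Complex.finrank_real_complex]; exact_mod_cast hκ
  · refine ae_of_all _ fun t => ?_
    rw [one_mul, Real.norm_eq_abs, abs_of_nonneg (by positivity)]
  · exact (measurable_norm.pow_const _).aestronglyMeasurable

theorem integrable_polydiscKernel {κ : ℝ} (hκ : κ < 2) (R : ℝ) :
    Integrable (polydiscKernel n κ R) := by
  have h1 : Integrable (fun x : Fin n → ℂ => ∏ i,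
      (Metric.ball (0 : ℂ) R).indicator (fun t : ℂ => ‖t‖ ^ (-κ)) (x i)) :=
    Integrable.fintype_prod fun _ => integrable_indicator_rpow hκ R
  let L : Cn n ≃L[ℝ] (Fin n → ℂ) :=
    (PiLp.continuousLinearEquiv 2 ℝ fun _ : Fin n => ℂ)
  -- Both measures are translation invariant, so they agree up to a finite factor whose value is
  -- immaterial.
  have h2 : (volume : Measure (Cn n)).map L =
      (Measure.addHaarScalarFactor ((volume : Measure (Cn n)).map L) volume) •
        (volume : Measure (Fin n → ℂ)) := Measure.isAddLeftInvariant_eq_smul _ _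
  have h3 : Integrable (fun x : Fin n → ℂ => ∏ i,
      (Metric.ball (0 : ℂ) R).indicator (fun t : ℂ => ‖t‖ ^ (-κ)) (x i))
      ((volume : Measure (Cn n)).map L) := by
    rw [h2]; exact h1.smul_measure_nnreal
  have h4 := (integrable_map_equiv L.toHomeomorph.toMeasurableEquiv _).1 h3
  exact h4

/-- A complex orthonormal basis, as a real linear isometry. -/
def realRepr (b : OrthonormalBasis (Fin n) ℂ (Cn n)) : Cn n ≃ₗᵢ[ℝ] Cn n :=
  ⟨b.repr.toLinearEquiv.restrictScalars ℝ, b.repr.norm_map⟩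

theorem realRepr_apply (b : OrthonormalBasis (Fin n) ℂ (Cn n)) (h : Cn n) (i : Fin n) :
    realRepr b h i = inner ℂ (b i) h := b.repr_apply_apply h i

/-- Unitary maps preserve Lebesgue measure; this makes the final constant independent of the
direction of the gradient. -/
theorem lintegral_polydiscKernel_comp {κ : ℝ} (R : ℝ)
    (b : OrthonormalBasis (Fin n) ℂ (Cn n)) :
    ∫⁻ h, ENNReal.ofReal (polydiscKernel n κ R (realRepr b h)) =
      ∫⁻ h, ENNReal.ofReal (polydiscKernel n κ R h) := by
  refine (realRepr b).measurePreserving.lintegral_comp_emb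
    (realRepr b).toHomeomorph.measurableEmbedding
    (fun h => ENNReal.ofReal (polydiscKernel n κ R h))

theorem ae_inner_ne_zero {v : Cn n} (hv : v ≠ 0) : ∀ᵐ h : Cn n, (inner ℂ v h : ℂ) ≠ 0 := by
  have h1 : (volume : Measure (Cn n)) (LinearMap.ker (((innerSL ℂ v).restrictScalars ℝ :
      Cn n →L[ℝ] ℂ) : Cn n →ₗ[ℝ] ℂ) : Set (Cn n)) = 0 := by
    refine Measure.addHaar_submodule _ _ fun htop => ?_
    have : v ∈ LinearMap.ker (((innerSL ℂ v).restrictScalars ℝ :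
      Cn n →L[ℝ] ℂ) : Cn n →ₗ[ℝ] ℂ) := htop ▸ Submodule.mem_top
    rw [LinearMap.mem_ker] at this
    exact hv (inner_self_eq_zero.1 (show (inner ℂ v v : ℂ) = 0 from this))
  rw [ae_iff]
  convert h1 using 2
  ext h
  simp

theorem exists_orthonormalBasis {v : Cn n} (hv : v ≠ 0) :
    ∃ (b : OrthonormalBasis (Fin n) ℂ (Cn n)) (i₀ : Fin n),
      ∀ h, ‖(inner ℂ (b i₀) h : ℂ)‖ = ‖(inner ℂ v h : ℂ)‖ * ‖v‖⁻¹ := by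
  obtain ⟨i₀, -⟩ : ∃ i, v i ≠ 0 := by
    by_contra! h
    exact hv (PiLp.ext h)
  have hv0 := norm_pos_iff.2 hv
  have horth : Orthonormal ℂ (({i₀} : Set (Fin n)).domRestrict fun _ => ((‖v‖ : ℂ)⁻¹ • v)) := by
    refine ⟨fun i => ?_, fun i j hij => absurd (Subsingleton.elim i j) hij⟩
    change ‖((‖v‖ : ℂ)⁻¹ • v)‖ = 1
    rw [norm_smul]
    simp [hv0.ne']
  obtain ⟨b, hb⟩ := horth.exists_orthonormalBasis_extension_of_card_eq (by simp)
  refine ⟨b, i₀, fun h => ?_⟩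
  rw [hb i₀ rfl, inner_smul_left, norm_mul, mul_comm]
  simp

/-- With `τ' = min τ (2 * n + 2)`, one coordinate is bounded by `Ψ` and the remaining `n - 1` by
`‖h‖`, so the product is at most `Ψ^θ ‖h‖^((n-1)θ)`. From `‖h‖² ≤ Ψ` one has `Ψ^(θ-2) ≤
‖h‖^(-2(2-θ))`, and the total power of `‖h‖` is `(n+1)θ - (2n+2) + τ = τ - τ' ≥ 0`. The truncation
of `τ` keeps `θ` nonnegative. -/
theorem exists_prod_rpow_mul_le (hn : 0 < n) {τ : ℤ} (hτ : 0 ≤ τ) {R : ℝ} (hR : 1 ≤ R) :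
    ∃ C, 0 ≤ C ∧ ∀ (b : OrthonormalBasis (Fin n) ℂ (Cn n)) (i₀ : Fin n) (h : Cn n) (Ψ : ℝ), h ≠ 0 →
      ‖h‖ ≤ R → ‖(inner ℂ (b i₀) h : ℂ)‖ ≤ Ψ → ‖h‖ ^ 2 ≤ Ψ →
      (∏ i, ‖(inner ℂ (b i) h : ℂ)‖ ^ (2 - (min τ (2 * n + 2) : ℝ) / (n + 1))) *
        (1 + ‖h‖ ^ (τ - 2 * n + 2) * Ψ ^ (-2 : ℤ)) ≤ C := by
  obtain ⟨τ', hτ'⟩ : ∃ τ' : ℝ, τ' = min (τ : ℝ) (2 * n + 2) := ⟨_, rfl⟩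
  obtain ⟨θ, hθ⟩ : ∃ θ : ℝ, θ = 2 - τ' / (n + 1) := ⟨_, rfl⟩
  have hn0 : (0 : ℝ) < n + 1 := by positivity
  have hτ'0 : 0 ≤ τ' := by
    rw [hτ']; exact le_min (by exact_mod_cast hτ) (by positivity)
  have hτ'1 : τ' ≤ 2 * n + 2 := hτ' ▸ min_le_right _ _
  have hτ'2 : τ' ≤ τ := hτ' ▸ min_le_left _ _
  have hθ0 : 0 ≤ θ := by
    have : τ' / (n + 1) ≤ 2 := by rw [div_le_iff₀ hn0]; linarith
    linarith
  have hθ2 : θ ≤ 2 := by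
    have : 0 ≤ τ' / (n + 1) := by positivity
    linarith
  have hθn : (n + 1) * θ = 2 * n + 2 - τ' := by rw [hθ]; field_simp
  rw [← hτ', ← hθ]
  refine ⟨R ^ (n * θ) + R ^ (τ - τ'), by positivity, fun b i₀ h Ψ hh hhR h1 h2 => ?_⟩
  have hh0 := norm_pos_iff.2 hh
  have hΨ : 0 < Ψ := lt_of_lt_of_le (by positivity) h2
  have hi : ∀ i, ‖(inner ℂ (b i) h : ℂ)‖ ≤ ‖h‖ := fun i => by
    have := norm_inner_le_norm (𝕜 := ℂ) (b i) h
    rwa [b.norm_eq_one, one_mul] at this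
  rw [mul_add, mul_one]
  refine add_le_add ?_ ?_
  · calc ∏ i, ‖(inner ℂ (b i) h : ℂ)‖ ^ θ ≤ ∏ _i : Fin n, R ^ θ :=
        Finset.prod_le_prod (fun i _ => by positivity) fun i _ =>
          Real.rpow_le_rpow (norm_nonneg _) ((hi i).trans hhR) hθ0
      _ = R ^ (n * θ) := by
        rw [Finset.prod_const, Finset.card_univ, Fintype.card_fin, mul_comm, Real.rpow_mul_natCast]
        positivity
  · have e1 : ∏ i, ‖(inner ℂ (b i) h : ℂ)‖ ^ θ ≤ Ψ ^ θ * ‖h‖ ^ ((n - 1) * θ) := by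
      rw [← Finset.mul_prod_erase _ _ (Finset.mem_univ i₀)]
      refine mul_le_mul (Real.rpow_le_rpow (norm_nonneg _) h1 hθ0) ?_
        (Finset.prod_nonneg fun i _ => by positivity) (by positivity)
      calc ∏ i ∈ Finset.univ.erase i₀, ‖(inner ℂ (b i) h : ℂ)‖ ^ θ
          ≤ ∏ _i ∈ Finset.univ.erase i₀, ‖h‖ ^ θ :=
            Finset.prod_le_prod (fun i _ => by positivity) fun i _ =>
              Real.rpow_le_rpow (norm_nonneg _) (hi i) hθ0
        _ = ‖h‖ ^ ((n - 1) * θ) := by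
          rw [Finset.prod_const, Finset.card_erase_of_mem (Finset.mem_univ _), Finset.card_univ,
            Fintype.card_fin, mul_comm, ← Real.rpow_mul_natCast hh0.le, Nat.cast_sub hn]
          simp
    have e2 : Ψ ^ θ * Ψ ^ (-2 : ℤ) ≤ ‖h‖ ^ (-(2 * (2 - θ))) := by
      have a1 : Ψ ^ θ * Ψ ^ (-2 : ℤ) = (Ψ ^ (2 - θ))⁻¹ := by
        rw [← Real.rpow_intCast, ← Real.rpow_add hΨ, ← Real.rpow_neg hΨ.le]
        congr 1; push_cast; ring
      rw [a1, Real.rpow_neg hh0.le]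
      have a2 : ‖h‖ ^ (2 * (2 - θ)) ≤ Ψ ^ (2 - θ) := by
        rw [Real.rpow_mul hh0.le]
        refine Real.rpow_le_rpow (by positivity) ?_ (by linarith)
        exact_mod_cast h2
      exact inv_anti₀ (by positivity) a2
    calc (∏ i, ‖(inner ℂ (b i) h : ℂ)‖ ^ θ) * (‖h‖ ^ (τ - 2 * n + 2) * Ψ ^ (-2 : ℤ))
        ≤ (Ψ ^ θ * ‖h‖ ^ ((n - 1) * θ)) * (‖h‖ ^ (τ - 2 * n + 2) * Ψ ^ (-2 : ℤ)) := by gcongr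
      _ = (Ψ ^ θ * Ψ ^ (-2 : ℤ)) * (‖h‖ ^ ((n - 1) * θ) * ‖h‖ ^ (τ - 2 * n + 2)) := by ring
      _ ≤ ‖h‖ ^ (-(2 * (2 - θ))) * (‖h‖ ^ ((n - 1) * θ) * ‖h‖ ^ (τ - 2 * n + 2)) := by gcongr
      _ = ‖h‖ ^ (τ - τ') := by
        rw [← Real.rpow_intCast, ← Real.rpow_add hh0, ← Real.rpow_add hh0]
        congr 1; push_cast; linear_combination hθn
      _ ≤ R ^ (τ - τ') := Real.rpow_le_rpow hh0.le hhR (by linarith)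

/-- In a unitary basis containing `v / ‖v‖` the integrand is dominated by a polydisc kernel with
exponent `s * θ < 2`, whose integral does not see the basis. -/
theorem exists_lintegral_anisotropic_le (hn : 0 < n) {τ : ℤ} (hτ : 0 ≤ τ) {R : ℝ} (hR : 1 ≤ R)
    {s : ℝ} (hs : 0 ≤ s) (hsτ : s * (2 - (min τ (2 * n + 2) : ℝ) / (n + 1)) < 2) :
    ∃ C : ℝ≥0∞, C < ⊤ ∧ ∀ v : Cn n, v ≠ 0 →
      ∫⁻ h in Metric.closedBall (0 : Cn n) R, ENNReal.ofReal
        ((1 + ‖h‖ ^ (τ - 2 * n + 2) * anisotropic v h ^ (-2 : ℤ)) ^ s) ≤ C := by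
  obtain ⟨θ, hθ⟩ : ∃ θ : ℝ, θ = 2 - (min τ (2 * n + 2) : ℝ) / (n + 1) := ⟨_, rfl⟩
  obtain ⟨C, hC, hb⟩ := exists_prod_rpow_mul_le hn hτ hR
  rw [← hθ] at hb hsτ
  refine ⟨ENNReal.ofReal (C ^ s) * ∫⁻ h, ENNReal.ofReal (polydiscKernel n (s * θ) (R + 1) h),
    ENNReal.mul_lt_top ENNReal.ofReal_lt_top
      (integrable_polydiscKernel hsτ (R + 1)).lintegral_lt_top, fun v hv => ?_⟩
  obtain ⟨b, i₀, hbv⟩ := exists_orthonormalBasis hv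
  rw [← lintegral_polydiscKernel_comp (R + 1) b, ← lintegral_const_mul' _ _ ENNReal.ofReal_ne_top]
  refine (setLIntegral_mono_ae' Metric.isClosed_closedBall.measurableSet ?_).trans
    (setLIntegral_le_lintegral _ _)
  -- Off finitely many complex hyperplanes the product of coordinates is nonzero and may be moved to
  -- the other side.
  have hae : ∀ᵐ h : Cn n, ∀ i, (inner ℂ (b i) h : ℂ) ≠ 0 :=
    ae_all_iff.2 fun i => ae_inner_ne_zero (b.orthonormal.ne_zero i)
  filter_upwards [hae] with h hh hhR
  rw [mem_closedBall_zero_iff] at hhR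
  have hh0 : h ≠ 0 := by
    rintro rfl
    exact hh i₀ (inner_zero_right _)
  have hn0 := norm_pos_iff.2 hh0
  have hΨ : ‖(inner ℂ (b i₀) h : ℂ)‖ ≤ anisotropic v h := by
    rw [hbv]; unfold anisotropic; linarith [sq_nonneg ‖h‖]
  have hΨ2 : ‖h‖ ^ 2 ≤ anisotropic v h := by
    unfold anisotropic
    have : 0 ≤ ‖(inner ℂ v h : ℂ)‖ * ‖v‖⁻¹ := by positivity
    linarith
  have hΨ0 : 0 < anisotropic v h := lt_of_lt_of_le (by positivity) hΨ2
  have key := hb b i₀ h _ hh0 hhR hΨ hΨ2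
  rw [← ENNReal.ofReal_mul (by positivity)]
  refine ENNReal.ofReal_le_ofReal ?_
  have hprod : polydiscKernel n (s * θ) (R + 1) (realRepr b h) =
      ((∏ i, ‖(inner ℂ (b i) h : ℂ)‖ ^ θ) ^ s)⁻¹ := by
    rw [← Real.finsetProd_rpow _ _ fun i _ => by positivity, ← Finset.prod_inv_distrib]
    refine Finset.prod_congr rfl fun i _ => ?_
    have h1 : ‖(inner ℂ (b i) h : ℂ)‖ ≤ ‖h‖ := by
      have := norm_inner_le_norm (𝕜 := ℂ) (b i) h
      rwa [b.norm_eq_one, one_mul] at this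
    rw [realRepr_apply, indicator_of_mem (by rw [mem_ball_zero_iff]; linarith),
      Real.rpow_neg (norm_nonneg _), mul_comm s, Real.rpow_mul (norm_nonneg _)]
  have hpos : 0 < ∏ i, ‖(inner ℂ (b i) h : ℂ)‖ ^ θ :=
    Finset.prod_pos fun i _ => Real.rpow_pos_of_pos (norm_pos_iff.2 (hh i)) _
  rw [hprod, ← div_eq_mul_inv, le_div_iff₀ (by positivity), ← Real.mul_rpow (by positivity) hpos.le]
  refine Real.rpow_le_rpow (by positivity) ?_ hs
  rw [mul_comm]; exact key

end AnisotropicIntegral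

/-! ### Finiteness of the critical set. -/

section CriticalPoints

variable {n : ℕ} {X : Type*} [TopologicalSpace X] [ChartedSpace (Cn n) X]
  [IsManifold 𝓘(ℂ, Cn n) ω X] {e : OpenPartialHomeomorph X (Cn n)} {r : X → ℝ} {D : Set X}

theorem isCrit_iff_fderiv (he : e ∈ HolCharts n X) (hr : ContMDiff 𝓘(ℝ, Cn n) 𝓘(ℝ, ℝ) ∞ r) {x : X}
    (hx : x ∈ e.source) :
    IsCrit n r x ↔ fderiv ℝ (fun u => r (e.symm u)) (e x) = 0 := by
  have key : ∀ {e e' : OpenPartialHomeomorph X (Cn n)}, e ∈ HolCharts n X → e' ∈ HolCharts n X →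
      x ∈ e.source → x ∈ e'.source → fderiv ℝ (fun u => r (e.symm u)) (e x) = 0 →
      fderiv ℝ (fun u => r (e'.symm u)) (e' x) = 0 := by
    intro e e' he he' hx hx' h
    have h1 : ∀ v, delPart (inChart e r) (e x) v = 0 := fun v => by
      rw [delPart_eq, fderiv_inChart he hr (e.map_source hx), fderiv_inChart he hr (e.map_source hx),
        h]
      simp
    refine ContinuousLinearMap.ext fun v => ?_
    rw [fderiv_eq_re_delPart he' hr (e'.map_source hx'), ← delR_coordTan he' hr hx']
    obtain ⟨w, hw⟩ := (coordTan_bijective he (e.map_source hx)).2 (coordTan e' (e' x) v)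
    have h2 : delR r x (coordTan e' (e' x) v) = 0 := by
      have := delR_coordTan he hr hx w
      rw [h1] at this
      rw [← this]; congr 1; exact hw.symm
    rw [h2]; simp
  exact ⟨key (chartAt_mem_holCharts x) he (mem_chart_source _ x) hx,
    key he (chartAt_mem_holCharts x) hx (mem_chart_source _ x)⟩

/-- At a nondegenerate critical point the derivative of `dr` is injective, hence bounded below in
finite dimension, so `dr` has no further zero nearby. -/
theorem IsHenkinLeitererDomain.eventually_not_isCrit (hD : IsHenkinLeitererDomain n D r) {x : X}
    (hx : x ∈ closure D) : ∀ᶠ y in 𝓝 x, y ≠ x → ¬ IsCrit n r y := by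
  set c := chartAt (Cn n) x
  have hc : c ∈ HolCharts n X := chartAt_mem_holCharts x
  have hxc : x ∈ c.source := mem_chart_source _ x
  set f : Cn n → ℝ := fun u => r (c.symm u) with hf
  have hs : ContDiffAt ℝ ∞ f (c x) := contDiffAt_comp_symm hc hD.smooth (c.map_source hxc)
  have hs1 : ContDiffAt ℝ ∞ (fderiv ℝ f) (c x) := hs.fderiv_right (by simp)
  have hev : ∀ᶠ u in 𝓝[≠] (c x), fderiv ℝ f u ≠ 0 := by
    by_cases hcr : IsCrit n r x
    · have hnd := hD.morse x hx hcr
      have hinj : Function.Injective (fderiv ℝ (fderiv ℝ f) (c x)) := by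
        rw [injective_iff_map_eq_zero]
        intro v hv
        exact hnd v fun w => by
          change fderiv ℝ (fderiv ℝ f) (c x) v w = 0
          rw [hv]; rfl
      obtain ⟨K, hK, hanti⟩ := LinearMap.exists_antilipschitzWith
        (fderiv ℝ (fderiv ℝ f) (c x) : Cn n →ₗ[ℝ] (Cn n →L[ℝ] ℝ))
        (LinearMap.ker_eq_bot.2 hinj)
      refine (hs1.differentiableAt (by simp)).hasFDerivAt.eventually_ne ⟨K, hanti⟩
    · have h0 : fderiv ℝ f (c x) ≠ 0 := hcr
      exact (hs1.continuousAt.eventually_ne h0).filter_mono nhdsWithin_le_nhds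
  rw [eventually_nhdsWithin_iff] at hev
  filter_upwards [(c.continuousAt hxc).eventually hev, c.open_source.mem_nhds hxc] with y hy hyc hyx
  rw [isCrit_iff_fderiv hc hD.smooth hyc]
  exact hy fun h => hyx (c.injOn hyc hxc h)

theorem IsHenkinLeitererDomain.finite_crit (hD : IsHenkinLeitererDomain n D r) :
    {x | x ∈ closure D ∧ IsCrit n r x}.Finite := by
  have : (closure D ∩ {x | IsCrit n r x}).Finite := by
    refine hD.isCompact_closure.induction_on (p := fun S => (S ∩ {x | IsCrit n r x}).Finite)
      (by simp) (fun s t hst ht => ht.subset (inter_subset_inter_left _ hst))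
      (fun s t hs ht => by rw [union_inter_distrib_right]; exact hs.union ht) fun x hx => ?_
    refine ⟨_, mem_nhdsWithin_of_mem_nhds (hD.eventually_not_isCrit hx), ?_⟩
    refine (finite_singleton x).subset ?_
    rintro y ⟨hy, hyc⟩
    by_contra h
    exact hy h hyc
  exact this

end CriticalPoints

/-! ### From local to global integral bounds. -/

section CompactBound

variable {X : Type*} [TopologicalSpace X] [MeasurableSpace X] {μ : Measure X}

/-- Compactness is used twice: for a fixed `x` the neighbourhoods in the integration variable are
summed over a finite cover while the neighbourhood of `x` shrinks, and then `x` runs over a finite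
cover. -/
theorem exists_lintegral_le_of_local {K : X → X → ℝ≥0∞} {D G : Set X}
    (hc : IsCompact (closure D))
    (hloc : ∀ x ∈ closure D, ∀ y ∈ closure D, ∃ U ∈ 𝓝 x, ∃ V ∈ 𝓝 y, ∃ C : ℝ≥0∞, C < ⊤ ∧
      ∀ z ∈ U ∩ G, ∫⁻ ζ in V ∩ D, K ζ z ∂μ ≤ C) :
    ∃ C : ℝ≥0∞, C < ⊤ ∧ ∀ z ∈ closure D ∩ G, ∫⁻ ζ in D, K ζ z ∂μ ≤ C := by
  refine hc.induction_on (p := fun T => ∃ C : ℝ≥0∞, C < ⊤ ∧ ∀ z ∈ T ∩ G, ∫⁻ ζ in D, K ζ z ∂μ ≤ C)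
    ⟨0, by simp, by simp⟩ (fun s t hst ⟨C, hC, h⟩ => ⟨C, hC, fun z hz => h z ⟨hst hz.1, hz.2⟩⟩)
    (fun s t ⟨C, hC, h⟩ ⟨C', hC', h'⟩ => ⟨C + C', ENNReal.add_lt_top.2 ⟨hC, hC'⟩, ?_⟩) fun x hx => ?_
  · rintro z ⟨hz | hz, hzG⟩
    · exact (h z ⟨hz, hzG⟩).trans le_self_add
    · exact (h' z ⟨hz, hzG⟩).trans le_add_self
  have : ∃ U ∈ 𝓝 x, ∃ C : ℝ≥0∞, C < ⊤ ∧ ∀ z ∈ U ∩ G, ∫⁻ ζ in closure D ∩ D, K ζ z ∂μ ≤ C := by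
    refine hc.induction_on (p := fun T => ∃ U ∈ 𝓝 x, ∃ C : ℝ≥0∞, C < ⊤ ∧
      ∀ z ∈ U ∩ G, ∫⁻ ζ in T ∩ D, K ζ z ∂μ ≤ C) ⟨univ, univ_mem, 0, by simp, by simp⟩
      (fun s t hst ⟨U, hU, C, hC, h⟩ => ⟨U, hU, C, hC, fun z hz => (lintegral_mono_set
        (inter_subset_inter_left _ hst)).trans (h z hz)⟩)
      (fun s t ⟨U, hU, C, hC, h⟩ ⟨U', hU', C', hC', h'⟩ => ⟨U ∩ U', inter_mem hU hU', C + C',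
        ENNReal.add_lt_top.2 ⟨hC, hC'⟩, fun z hz => ?_⟩) fun y hy => ?_
    · rw [union_inter_distrib_right]
      exact (lintegral_union_le _ _ _).trans (add_le_add (h z ⟨hz.1.1, hz.2⟩) (h' z ⟨hz.1.2, hz.2⟩))
    · obtain ⟨U, hU, V, hV, C, hC, h⟩ := hloc x hx y hy
      exact ⟨V, mem_nhdsWithin_of_mem_nhds hV, U, hU, C, hC, h⟩
  obtain ⟨U, hU, C, hC, h⟩ := this
  rw [inter_eq_right.2 subset_closure] at h
  exact ⟨U, mem_nhdsWithin_of_mem_nhds hU, C, hC, h⟩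

end CompactBound

/-! ### Uniform integrals of powers of the kernel, and its boundedness for large type. -/

section KernelIntegral

variable {n : ℕ} {X : Type*} [TopologicalSpace X] [ChartedSpace (Cn n) X]
  {r : X → ℝ} {D : Set X} {ρ χ : X → X → ℝ} [RiemannianBundle (fun x : X => Tan n x)]
  [IsManifold 𝓘(ℂ, Cn n) ω X]
  [IsContMDiffRiemannianBundle 𝓘(ℝ, Cn n) ∞ (Cn n) (fun x : X => Tan n x)] [T2Space X]
  [MeasurableSpace X] [BorelSpace X]

theorem anisotropic_neg (v h : Cn n) : anisotropic v (-h) = anisotropic v h := by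
  unfold anisotropic; rw [inner_neg_right, norm_neg, norm_neg]

theorem anisotropic_pos (v : Cn n) {h : Cn n} (hh : h ≠ 0) : 0 < anisotropic v h := by
  have := norm_pos_iff.2 hh
  unfold anisotropic; positivity

/-- Translation of the anisotropic integral to a chart, integrated over a small set. -/
theorem lintegral_chart_le {e : OpenPartialHomeomorph X (Cn n)} {S : Set X} {V : X → ℝ≥0∞}
    {g : Cn n → ℝ≥0∞} {z : X} {R : ℝ}
    (hS : MeasurableSet (e.target ∩ e.symm ⁻¹' S))
    (hSe : ∀ ζ ∈ S, ζ ∈ e.source → ‖e ζ - e z‖ ≤ R ∧ V ζ ≤ g (e ζ - e z)) :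
    ∫⁻ u in e.target ∩ e.symm ⁻¹' S, V (e.symm u) ≤ ∫⁻ h in Metric.closedBall (0 : Cn n) R, g h := by
  have hmp : MeasurePreserving (fun u : Cn n => u - e z) volume volume :=
    measurePreserving_sub_right volume (e z)
  have hemb : MeasurableEmbedding (fun u : Cn n => u - e z) :=
    (Homeomorph.subRight (e z)).measurableEmbedding
  rw [← hmp.setLIntegral_comp_preimage_emb hemb g (Metric.closedBall 0 R)]
  calc ∫⁻ u in e.target ∩ e.symm ⁻¹' S, V (e.symm u)
      ≤ ∫⁻ u in e.target ∩ e.symm ⁻¹' S, g (u - e z) := by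
        refine setLIntegral_mono' hS fun u hu => ?_
        have := (hSe (e.symm u) hu.2 (e.map_target hu.1)).2
        rwa [e.right_inv hu.1] at this
    _ ≤ _ := lintegral_mono_set fun u hu => by
        have := (hSe (e.symm u) hu.2 (e.map_target hu.1)).1
        rw [e.right_inv hu.1] at this
        simpa using this

variable {k l : ℕ} {τ : ℤ} {A : X → X → DForm n k l}

theorem riemVolume_crit (hn : 0 < n) (hD : IsHenkinLeitererDomain n D r) :
    riemVolume n X {x | x ∈ closure D ∧ IsCrit n r x} = 0 := by
  have := hD.finite_crit.countable
  rw [← biUnion_of_singleton {x | x ∈ closure D ∧ IsCrit n r x}]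
  exact (measure_biUnion_null_iff this).2 fun x _ => riemVolume_singleton hn x

/-- A symmetric formulation of the integral estimates of a kernel in one of its variables. -/
theorem exists_lintegral_rpow_le (hn : 0 < n) (hD : IsHenkinLeitererDomain n D r) (hτ : 0 ≤ τ)
    {s : ℝ} (hs : 0 ≤ s) (hsτ : s * (2 - (min τ (2 * n + 2) : ℝ) / (n + 1)) < 2)
    {N : X → X → ℝ}
    (hoff : ∀ x ∈ closure D, ∀ y ∈ closure D, x ≠ y → ∃ U ∈ 𝓝 x, ∃ V ∈ 𝓝 y, ∃ C : ℝ,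
      ∀ ζ ∈ U ∩ D, ∀ z ∈ V ∩ D, ζ ≠ z → N ζ z ≤ C)
    (hdiag : ∀ x ∈ closure D, ∃ e ∈ HolCharts n X, ∃ C > 0, ∃ O ∈ 𝓝 x, O ⊆ e.source ∧
      ∀ ζ ∈ O ∩ D, ∀ z ∈ O ∩ D, ζ ≠ z → ¬ IsCrit n r ζ → ¬ IsCrit n r z →
        gradV (inChart e r) (e z) ≠ 0 ∧ ‖e ζ - e z‖ ≤ C ∧
        N ζ z ≤ C * (1 + ‖e ζ - e z‖ ^ (τ - 2 * n + 2) *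
          anisotropic (gradV (inChart e r) (e z)) (e ζ - e z) ^ (-2 : ℤ))) :
    ∃ C : ℝ≥0∞, C < ⊤ ∧ ∀ z ∈ D, ¬ IsCrit n r z →
      ∫⁻ ζ in D, ENNReal.ofReal (N ζ z) ^ s ∂(riemVolume n X) ≤ C := by
  suffices h : ∃ C : ℝ≥0∞, C < ⊤ ∧ ∀ z ∈ closure D ∩ {z | z ∈ D ∧ ¬ IsCrit n r z},
      ∫⁻ ζ in D, ENNReal.ofReal (N ζ z) ^ s ∂(riemVolume n X) ≤ C by
    obtain ⟨C, hC, h⟩ := h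
    exact ⟨C, hC, fun z hz hcz => h z ⟨subset_closure hz, hz, hcz⟩⟩
  have hDo := hD.isOpen
  -- good points
  have hcrit := riemVolume_crit hn hD
  have hae : ∀ z : X, ∀ᵐ ζ ∂(riemVolume n X), ζ ∈ D → ¬ IsCrit n r ζ ∧ ζ ≠ z := by
    intro z
    have h1 : ∀ᵐ ζ ∂(riemVolume n X), ¬ (ζ ∈ closure D ∧ IsCrit n r ζ) := by
      rw [ae_iff]; simpa using hcrit
    have h2 : ∀ᵐ ζ ∂(riemVolume n X), ζ ≠ z := by
      rw [ae_iff]; simpa using riemVolume_singleton hn z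
    filter_upwards [h1, h2] with ζ a b hζ using ⟨fun h => a ⟨subset_closure hζ, h⟩, b⟩
  refine exists_lintegral_le_of_local hD.isCompact_closure fun x hx y hy => ?_
  rcases ne_or_eq y x with hne | rfl
  · obtain ⟨V, hV, U, hU, C, hb⟩ := hoff y hy x hx hne
    obtain ⟨W, hW, hWo, hyW⟩ := mem_nhds_iff.1 hV
    obtain ⟨W', hW', hWfin⟩ := (riemVolume n X).finiteAt_nhds y
    obtain ⟨W'', hW'', hWo'', hyW''⟩ := mem_nhds_iff.1 hW'
    refine ⟨U, hU, W ∩ W'', inter_mem (hWo.mem_nhds hyW) (hWo''.mem_nhds hyW''),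
      ENNReal.ofReal C ^ s * riemVolume n X W', ENNReal.mul_lt_top
        (ENNReal.rpow_lt_top_of_nonneg hs ENNReal.ofReal_ne_top) hWfin, fun z hz => ?_⟩
    calc ∫⁻ ζ in (W ∩ W'') ∩ D, ENNReal.ofReal (N ζ z) ^ s ∂(riemVolume n X)
        ≤ ∫⁻ ζ in (W ∩ W'') ∩ D, ENNReal.ofReal C ^ s ∂(riemVolume n X) := by
          refine setLIntegral_mono_ae' ((hWo.inter hWo'').inter hDo).measurableSet ?_
          filter_upwards [hae z] with ζ hζ hζm
          have := hb ζ ⟨hW hζm.1.1, hζm.2⟩ z ⟨hz.1, hz.2.1⟩ (hζ hζm.2).2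
          gcongr
      _ ≤ _ := by
          rw [setLIntegral_const]
          gcongr
          exact (inter_subset_left.trans inter_subset_right).trans hW''
  · obtain ⟨e, he, C, hC, O, hO, hOe, hb⟩ := hdiag y hx
    have hye : y ∈ e.source := hOe (mem_of_mem_nhds hO)
    obtain ⟨C', O', hO', hyO', hO'e, hvol⟩ := exists_riemVolume_le he hye
    obtain ⟨W, hW, hWo, hyW⟩ := mem_nhds_iff.1 hO
    obtain ⟨I, hI, hint⟩ := exists_lintegral_anisotropic_le hn hτ (le_max_right C 1) hs hsτ
    refine ⟨O' ∩ W, inter_mem (hO'.mem_nhds hyO') (hWo.mem_nhds hyW), O' ∩ W,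
      inter_mem (hO'.mem_nhds hyO') (hWo.mem_nhds hyW), C' * (ENNReal.ofReal (C ^ s) * I),
      ENNReal.mul_lt_top ENNReal.coe_lt_top (ENNReal.mul_lt_top ENNReal.ofReal_lt_top hI),
      fun z hz => ?_⟩
    obtain ⟨⟨hzO', hzW⟩, hzD, hzc⟩ := hz
    -- Removing this finite, hence null, set leaves only points at which the pointwise bound is
    -- valid.
    set T : Set X := {x | x ∈ closure D ∧ IsCrit n r x} ∪ {z} with hT
    have hTm : MeasurableSet T := (hD.finite_crit.union (finite_singleton z)).measurableSet
    have hT0 : riemVolume n X T = 0 :=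
      measure_union_null hcrit (riemVolume_singleton hn z)
    set B := ((O' ∩ W) ∩ D) \ T with hB
    have hBm : MeasurableSet B := (((hO'.inter hWo).inter hDo).measurableSet).diff hTm
    have hBg : ∀ ζ ∈ B, ζ ∈ W ∧ ζ ∈ D ∧ ζ ≠ z ∧ ¬ IsCrit n r ζ := by
      rintro ζ ⟨⟨⟨-, h1⟩, h2⟩, h3⟩
      exact ⟨h1, h2, fun h => h3 (Or.inr h), fun h => h3 (Or.inl ⟨subset_closure h2, h⟩)⟩
    have e1 : ∫⁻ ζ in (O' ∩ W) ∩ D, ENNReal.ofReal (N ζ z) ^ s ∂(riemVolume n X) =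
        ∫⁻ ζ in B, ENNReal.ofReal (N ζ z) ^ s ∂(riemVolume n X) := by
      refine setLIntegral_congr (sdiff_null_ae_eq_self hT0).symm
    rw [e1]
    refine (hvol B (fun ζ hζ => hζ.1.1.1) hBm _).trans ?_
    refine mul_le_mul_right ?_ _
    -- If `B` is nonempty, any of its points yields through `hb` that the gradient at `z` is
    -- nonzero.
    by_cases hBe : B = ∅
    · rw [hBe]; simp
    obtain ⟨ζ₁, hζ₁⟩ := nonempty_iff_ne_empty.2 hBe
    have hv : gradV (inChart e r) (e z) ≠ 0 := by
      obtain ⟨a, b, c, d⟩ := hBg ζ₁ hζ₁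
      exact (hb ζ₁ ⟨hW a, b⟩ z ⟨hW hzW, hzD⟩ c d hzc).1
    calc ∫⁻ u in e.target ∩ e.symm ⁻¹' B, ENNReal.ofReal (N (e.symm u) z) ^ s
        ≤ ∫⁻ h in Metric.closedBall (0 : Cn n) (max C 1), ENNReal.ofReal (C ^ s) *
            ENNReal.ofReal ((1 + ‖h‖ ^ (τ - 2 * n + 2) *
              anisotropic (gradV (inChart e r) (e z)) h ^ (-2 : ℤ)) ^ s) := by
          refine lintegral_chart_le (V := fun ζ => ENNReal.ofReal (N ζ z) ^ s) (z := z)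
            (measurableSet_target_inter_preimage e hBm) ?_
          intro ζ hζ hζe
          obtain ⟨a, b, c, d⟩ := hBg ζ hζ
          obtain ⟨-, h2, h3⟩ := hb ζ ⟨hW a, b⟩ z ⟨hW hzW, hzD⟩ c d hzc
          refine ⟨h2.trans (le_max_left _ _), ?_⟩
          have hne : e ζ - e z ≠ 0 := sub_ne_zero.2 fun h =>
            c (e.injOn hζe (hOe (hW hzW)) h)
          have hΨ := anisotropic_pos (gradV (inChart e r) (e z)) hne
          have hpos : 0 ≤ 1 + ‖e ζ - e z‖ ^ (τ - 2 * n + 2) *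
            anisotropic (gradV (inChart e r) (e z)) (e ζ - e z) ^ (-2 : ℤ) := by positivity
          rw [← ENNReal.ofReal_mul (by positivity), ← Real.mul_rpow hC.le hpos,
            ← ENNReal.ofReal_rpow_of_nonneg (by positivity) hs]
          gcongr
      _ = ENNReal.ofReal (C ^ s) * ∫⁻ h in Metric.closedBall (0 : Cn n) (max C 1),
            ENNReal.ofReal ((1 + ‖h‖ ^ (τ - 2 * n + 2) *
              anisotropic (gradV (inChart e r) (e z)) h ^ (-2 : ℤ)) ^ s) :=
          lintegral_const_mul' _ _ ENNReal.ofReal_ne_top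
      _ ≤ _ := mul_le_mul_right (hint _ hv) _

theorem IsKernelOfType.exists_lintegral_left_le (hn : 0 < n) (hA : IsKernelOfType D r ρ χ τ A)
    (hD : IsHenkinLeitererDomain n D r) (hρ : IsDistanceLike n ρ) (hχ : IsPatching n ρ χ)
    (hτ : 0 ≤ τ) {s : ℝ} (hs : 0 ≤ s) (hsτ : s * (2 - (min τ (2 * n + 2) : ℝ) / (n + 1)) < 2) :
    ∃ C : ℝ≥0∞, C < ⊤ ∧ ∀ z ∈ D, ¬ IsCrit n r z →
      ∫⁻ ζ in D, ENNReal.ofReal (dformNorm ζ z (A ζ z)) ^ s ∂(riemVolume n X) ≤ C := by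
  refine exists_lintegral_rpow_le hn hD hτ hs hsτ (N := fun ζ z => dformNorm ζ z (A ζ z))
    (fun x hx y hy hne => hA.exists_off_diagonal_bound hD.eq_neg hx hy hne) fun x hx => ?_
  obtain ⟨e, he, C, hC, O, hO, hOe, hb⟩ := hA.exists_diagonal_bound hD hρ hχ hx
  refine ⟨e, he, C, hC, O, hO, hOe, fun ζ hζ z hz hne hcζ hcz => ?_⟩
  obtain ⟨-, h2, h3, -, h5⟩ := hb ζ hζ z hz hne hcζ hcz
  exact ⟨h2, h3, h5⟩

/-- The roles of the variables are exchanged: the gradient is frozen at ζ, and the sign of the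
difference is irrelevant because `anisotropic` is even. -/
theorem IsKernelOfType.exists_lintegral_right_le (hn : 0 < n) (hA : IsKernelOfType D r ρ χ τ A)
    (hD : IsHenkinLeitererDomain n D r) (hρ : IsDistanceLike n ρ) (hχ : IsPatching n ρ χ)
    (hτ : 0 ≤ τ) {s : ℝ} (hs : 0 ≤ s) (hsτ : s * (2 - (min τ (2 * n + 2) : ℝ) / (n + 1)) < 2) :
    ∃ C : ℝ≥0∞, C < ⊤ ∧ ∀ ζ ∈ D, ¬ IsCrit n r ζ →
      ∫⁻ z in D, ENNReal.ofReal (dformNorm ζ z (A ζ z)) ^ s ∂(riemVolume n X) ≤ C := by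
  refine exists_lintegral_rpow_le hn hD hτ hs hsτ (N := fun z ζ => dformNorm ζ z (A ζ z))
    (fun x hx y hy hne => ?_) fun x hx => ?_
  · obtain ⟨U, hU, V, hV, C, hb⟩ := hA.exists_off_diagonal_bound hD.eq_neg hy hx hne.symm
    exact ⟨V, hV, U, hU, C, fun z hz ζ hζ hne => hb ζ hζ z hz hne.symm⟩
  · obtain ⟨e, he, C, hC, O, hO, hOe, hb⟩ := hA.exists_diagonal_bound hD hρ hχ hx
    refine ⟨e, he, C, hC, O, hO, hOe, fun z hz ζ hζ hne hcz hcζ => ?_⟩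
    obtain ⟨h2, -, h3, h5, -⟩ := hb ζ hζ z hz hne.symm hcζ hcz
    rw [← neg_sub (e ζ) (e z), norm_neg, anisotropic_neg]
    exact ⟨h2, h3, h5⟩

/-- For `τ ≥ 2n + 2` the exponent in `exists_prod_rpow_mul_le` is zero, the product of coordinates
equals one, and the weighted estimate becomes plain boundedness. -/
theorem IsKernelOfType.exists_bound (hn : 0 < n) (hA : IsKernelOfType D r ρ χ τ A)
    (hD : IsHenkinLeitererDomain n D r) (hρ : IsDistanceLike n ρ) (hχ : IsPatching n ρ χ)
    (hτ : 2 * n + 2 ≤ τ) :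
    ∃ C : ℝ, ∀ ζ ∈ D, ∀ z ∈ D, ζ ≠ z → ¬ IsCrit n r ζ → ¬ IsCrit n r z →
      dformNorm ζ z (A ζ z) ≤ C := by
  have hc : IsCompact (closure D ×ˢ closure D) := hD.isCompact_closure.prod hD.isCompact_closure
  suffices h : ∃ C : ℝ, ∀ p ∈ closure D ×ˢ closure D, p.1 ∈ D → p.2 ∈ D → p.1 ≠ p.2 →
      ¬ IsCrit n r p.1 → ¬ IsCrit n r p.2 → dformNorm p.1 p.2 (A p.1 p.2) ≤ C by
    obtain ⟨C, h⟩ := h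
    exact ⟨C, fun ζ hζ z hz => h (ζ, z) ⟨subset_closure hζ, subset_closure hz⟩ hζ hz⟩
  refine hc.induction_on (p := fun S => ∃ C : ℝ, ∀ p ∈ S, p.1 ∈ D → p.2 ∈ D → p.1 ≠ p.2 →
      ¬ IsCrit n r p.1 → ¬ IsCrit n r p.2 → dformNorm p.1 p.2 (A p.1 p.2) ≤ C)
    ⟨0, by simp⟩ (fun s t hst ⟨C, h⟩ => ⟨C, fun p hp => h p (hst hp)⟩)
    (fun s t ⟨C, h⟩ ⟨C', h'⟩ => ⟨max C C', ?_⟩) ?_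
  · rintro p (hp | hp) a b c d e
    · exact (h p hp a b c d e).trans (le_max_left _ _)
    · exact (h' p hp a b c d e).trans (le_max_right _ _)
  · rintro ⟨x, y⟩ ⟨hx, hy⟩
    rcases ne_or_eq x y with hne | rfl
    · obtain ⟨U, hU, V, hV, C, hb⟩ := hA.exists_off_diagonal_bound hD.eq_neg hx hy hne
      exact ⟨U ×ˢ V, mem_nhdsWithin_of_mem_nhds (prod_mem_nhds hU hV), C,
        fun p hp a b c _ _ => hb p.1 ⟨hp.1, a⟩ p.2 ⟨hp.2, b⟩ c⟩
    · obtain ⟨e, he, C, hC, O, hO, hOe, hb⟩ := hA.exists_diagonal_bound hD hρ hχ hx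
      obtain ⟨K, hK, hprod⟩ := exists_prod_rpow_mul_le hn (show 0 ≤ τ by omega) (le_max_right C 1)
      refine ⟨O ×ˢ O, mem_nhdsWithin_of_mem_nhds (prod_mem_nhds hO hO), C * K,
        fun p hp a b c d f => ?_⟩
      obtain ⟨h1, -, h3, h4, -⟩ := hb p.1 ⟨hp.1, a⟩ p.2 ⟨hp.2, b⟩ c d f
      refine h4.trans ?_
      gcongr
      obtain ⟨b, i₀, hbv⟩ := exists_orthonormalBasis h1
      have hne : e p.1 - e p.2 ≠ 0 := sub_ne_zero.2 fun h => c (e.injOn (hOe hp.1) (hOe hp.2) h)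
      have := hprod b i₀ _ (anisotropic (gradV (inChart e r) (e p.1)) (e p.1 - e p.2)) hne
        (h3.trans (le_max_left _ _)) (by
          rw [hbv]; unfold anisotropic; linarith [sq_nonneg ‖e p.1 - e p.2‖]) (by
          unfold anisotropic
          have : 0 ≤ ‖(inner ℂ (gradV (inChart e r) (e p.1)) (e p.1 - e p.2) : ℂ)‖ *
            ‖gradV (inChart e r) (e p.1)‖⁻¹ := by positivity
          linarith)
      have hmin : (min τ (2 * n + 2) : ℝ) = 2 * n + 2 := min_eq_right (by exact_mod_cast hτ)
      have h0 : (2 - (min τ (2 * n + 2) : ℝ) / (n + 1)) = 0 := by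
        rw [hmin]; field_simp; ring
      rw [h0] at this
      simpa using this

end KernelIntegral

/-! ### Young's inequality for kernels with two-sided integral bounds. -/

section Schur

variable {X : Type*} [MeasurableSpace X] {μ : Measure X} {k : X → X → ℝ≥0∞}

theorem aemeasurable_schur [SFinite μ] (hk : Measurable (Function.uncurry k)) {f : X → ℝ≥0∞}
    (hf : AEMeasurable f μ) :
    AEMeasurable (fun q : X × X => k q.1 q.2 * f q.1) (μ.prod μ) :=
  hk.aemeasurable.mul hf.comp_fst

theorem aemeasurable_lintegral_schur [SFinite μ] (hk : Measurable (Function.uncurry k))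
    {f : X → ℝ≥0∞} (hf : AEMeasurable f μ) :
    AEMeasurable (fun z => ∫⁻ ζ, k ζ z * f ζ ∂μ) μ :=
  (aemeasurable_schur hk hf).lintegral_prod_left'

/-- Hölder's inequality behind Young's inequality for kernel operators. -/
theorem lintegral_mul_le_young (hk : Measurable (Function.uncurry k)) {p s : ℝ} (hp : 1 ≤ p)
    (hps : p ≤ s) {f : X → ℝ≥0∞} (hf : AEMeasurable f μ) (z : X) :
    ∫⁻ ζ, k ζ z * f ζ ∂μ ≤
      (∫⁻ ζ, k ζ z ^ (1 - (1 / p - 1 / s))⁻¹ * f ζ ^ p ∂μ) ^ (1 / s) *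
        (∫⁻ ζ, k ζ z ^ (1 - (1 / p - 1 / s))⁻¹ ∂μ) ^ (1 - 1 / p) *
          (∫⁻ ζ, f ζ ^ p ∂μ) ^ (1 / p - 1 / s) := by
  have hp0 : 0 < p := by linarith
  have hs0 : 0 < s := by linarith
  have i1 : 0 ≤ 1 / s := by positivity
  have i2 : 0 ≤ 1 - 1 / p := by
    have : 1 / p ≤ 1 := by rw [div_le_one hp0]; exact hp
    linarith
  have i3 : 0 ≤ 1 / p - 1 / s := by
    have := one_div_le_one_div_of_le hp0 hps
    linarith
  have i4 : 0 < 1 - (1 / p - 1 / s) := by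
    have : 0 < 1 / s := by positivity
    linarith
  set lam := (1 - (1 / p - 1 / s))⁻¹ with hlam
  have hlam0 : 0 < lam := inv_pos.2 i4
  have hlam1 : lam * (1 - (1 / p - 1 / s)) = 1 := inv_mul_cancel₀ i4.ne'
  have hkz : AEMeasurable (fun ζ => k ζ z) μ :=
    (hk.comp (measurable_id.prodMk measurable_const)).aemeasurable
  let F : Fin 3 → X → ℝ≥0∞ := ![fun ζ => k ζ z ^ lam * f ζ ^ p, fun ζ => k ζ z ^ lam,
    fun ζ => f ζ ^ p]
  let q : Fin 3 → ℝ := ![1 / s, 1 - 1 / p, 1 / p - 1 / s]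
  -- Hölder with weights `1/s`, `1 - 1/p`, `1/p - 1/s`, whose sum is one. The exponent `lam` is
  -- chosen so that `k`, present in the first two factors only, appears with total power one.
  have h := ENNReal.lintegral_prod_norm_pow_le (μ := μ) (Finset.univ : Finset (Fin 3)) (f := F)
    (p := q) (by
      intro i _
      fin_cases i
      · exact (hkz.pow_const _).mul (hf.pow_const _)
      · exact hkz.pow_const _
      · exact hf.pow_const _)
    (by simp [q, Fin.sum_univ_three]; ring)
    (by
      intro i _
      fin_cases i
      · exact i1
      · exact i2
      · exact i3)
  simp only [Fin.prod_univ_three, F, q, Matrix.cons_val_zero, Matrix.cons_val_one,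
    Matrix.cons_val] at h
  refine le_trans (le_of_eq (lintegral_congr fun ζ => ?_)) h
  rw [ENNReal.mul_rpow_of_nonneg _ _ i1, ← ENNReal.rpow_mul, ← ENNReal.rpow_mul,
    ← ENNReal.rpow_mul, ← ENNReal.rpow_mul]
  have e1 : k ζ z ^ (lam * (1 / s)) * k ζ z ^ (lam * (1 - 1 / p)) = k ζ z := by
    rw [← ENNReal.rpow_add_of_nonneg _ _ (by positivity) (by positivity), ← mul_add]
    have : 1 / s + (1 - 1 / p) = 1 - (1 / p - 1 / s) := by ring
    rw [this, hlam1, ENNReal.rpow_one]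
  have e2 : f ζ ^ (p * (1 / s)) * f ζ ^ (p * (1 / p - 1 / s)) = f ζ := by
    rw [← ENNReal.rpow_add_of_nonneg _ _ (by positivity) (by positivity), ← mul_add]
    have : p * (1 / s + (1 / p - 1 / s)) = 1 := by field_simp; ring
    rw [this, ENNReal.rpow_one]
  calc k ζ z * f ζ = (k ζ z ^ (lam * (1 / s)) * k ζ z ^ (lam * (1 - 1 / p))) *
        (f ζ ^ (p * (1 / s)) * f ζ ^ (p * (1 / p - 1 / s))) := by rw [e1, e2]
    _ = _ := by ring

/-- In the Young inequality raised to the power `s`, the bound in the first variable controls the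
middle factor; after integration in `z` and an exchange of integrals, the bound in the second
variable controls the mixed factor. -/
theorem lintegral_rpow_schur_le [SFinite μ] (hk : Measurable (Function.uncurry k)) {p s : ℝ}
    (hp : 1 ≤ p) (hps : p ≤ s) {C : ℝ≥0∞}
    (hl : ∀ᵐ z ∂μ, ∫⁻ ζ, k ζ z ^ (1 - (1 / p - 1 / s))⁻¹ ∂μ ≤ C)
    (hr : ∀ᵐ ζ ∂μ, ∫⁻ z, k ζ z ^ (1 - (1 / p - 1 / s))⁻¹ ∂μ ≤ C)
    {f : X → ℝ≥0∞} (hf : AEMeasurable f μ) :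
    (∫⁻ z, (∫⁻ ζ, k ζ z * f ζ ∂μ) ^ s ∂μ) ^ (1 / s) ≤
      (C ^ (1 - 1 / p) * C ^ (1 / s)) * (∫⁻ ζ, f ζ ^ p ∂μ) ^ (1 / p) := by
  have hp0 : 0 < p := by linarith
  have hs0 : 0 < s := by linarith
  have i1 : 0 ≤ 1 / s := by positivity
  have i2 : 0 ≤ 1 - 1 / p := by
    have : 1 / p ≤ 1 := by rw [div_le_one hp0]; exact hp
    linarith
  have i3 : 0 ≤ 1 / p - 1 / s := by
    have := one_div_le_one_div_of_le hp0 hps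
    linarith
  set lam := (1 - (1 / p - 1 / s))⁻¹ with hlam
  set J := ∫⁻ ζ, f ζ ^ p ∂μ with hJ
  have key : ∀ᵐ z ∂μ, (∫⁻ ζ, k ζ z * f ζ ∂μ) ^ s ≤
      (C ^ (1 - 1 / p) * J ^ (1 / p - 1 / s)) ^ s * ∫⁻ ζ, k ζ z ^ lam * f ζ ^ p ∂μ := by
    filter_upwards [hl] with z hz
    have h1 := lintegral_mul_le_young hk hp hps hf z
    calc (∫⁻ ζ, k ζ z * f ζ ∂μ) ^ s
        ≤ ((∫⁻ ζ, k ζ z ^ lam * f ζ ^ p ∂μ) ^ (1 / s) * C ^ (1 - 1 / p) *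
            J ^ (1 / p - 1 / s)) ^ s := by
          refine ENNReal.rpow_le_rpow (h1.trans ?_) hs0.le
          gcongr
      _ = ((∫⁻ ζ, k ζ z ^ lam * f ζ ^ p ∂μ) ^ (1 / s) * (C ^ (1 - 1 / p) *
            J ^ (1 / p - 1 / s))) ^ s := by rw [mul_assoc]
      _ = _ := by
          rw [ENNReal.mul_rpow_of_nonneg _ _ hs0.le, ← ENNReal.rpow_mul,
            one_div_mul_cancel hs0.ne', ENNReal.rpow_one, mul_comm]
  have hmeas : AEMeasurable (fun q : X × X => k q.1 q.2 ^ lam * f q.1 ^ p) (μ.prod μ) :=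
    (hk.pow_const _).aemeasurable.mul (hf.pow_const _).comp_fst
  have hswap : ∫⁻ z, ∫⁻ ζ, k ζ z ^ lam * f ζ ^ p ∂μ ∂μ ≤ C * J := by
    rw [← lintegral_lintegral_swap (f := fun ζ z => k ζ z ^ lam * f ζ ^ p) hmeas]
    rw [hJ, ← lintegral_const_mul'' _ (hf.pow_const _)]
    refine lintegral_mono_ae ?_
    filter_upwards [hr] with ζ hζ
    rw [lintegral_mul_const _ (by
      exact (hk.comp (measurable_const.prodMk measurable_id)).pow_const _)]
    gcongr
  calc (∫⁻ z, (∫⁻ ζ, k ζ z * f ζ ∂μ) ^ s ∂μ) ^ (1 / s)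
      ≤ ((C ^ (1 - 1 / p) * J ^ (1 / p - 1 / s)) ^ s * (C * J)) ^ (1 / s) := by
        refine ENNReal.rpow_le_rpow ((lintegral_mono_ae key).trans ?_) i1
        rw [lintegral_const_mul'' _ hmeas.lintegral_prod_left']
        gcongr
    _ = (C ^ (1 - 1 / p) * J ^ (1 / p - 1 / s)) * (C ^ (1 / s) * J ^ (1 / s)) := by
        rw [ENNReal.mul_rpow_of_nonneg _ _ i1, ← ENNReal.rpow_mul, mul_one_div_cancel hs0.ne',
          ENNReal.rpow_one, ENNReal.mul_rpow_of_nonneg _ _ i1]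
    _ = (C ^ (1 - 1 / p) * C ^ (1 / s)) * (J ^ (1 / p - 1 / s) * J ^ (1 / s)) := by ring
    _ = _ := by
        rw [← ENNReal.rpow_add_of_nonneg _ _ i3 i1, sub_add_cancel]

/-- Mapping properties of a kernel operator between Lebesgue spaces over a finite measure. -/
theorem exists_eLpNorm_schur_le [IsFiniteMeasure μ] (hk : Measurable (Function.uncurry k)) {a : ℝ}
    (ha : 0 < a)
    (hint : ∀ q : ℝ, 0 ≤ q → q * (1 - min a 1) < 1 → ∃ C : ℝ≥0∞, C < ⊤ ∧
      (∀ᵐ z ∂μ, ∫⁻ ζ, k ζ z ^ q ∂μ ≤ C) ∧ ∀ᵐ ζ ∂μ, ∫⁻ z, k ζ z ^ q ∂μ ≤ C)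
    (hbdd : 1 ≤ a → ∃ C : ℝ≥0∞, C < ⊤ ∧ ∀ᵐ z ∂μ, ∀ᵐ ζ ∂μ, k ζ z ≤ C)
    {p s : ℝ≥0∞} (hp : 1 ≤ p) (hs : 1 ≤ s) (hps : (p⁻¹).toReal - a < (s⁻¹).toReal) :
    ∃ C : ℝ≥0∞, C < ⊤ ∧ ∀ f : X → ℝ≥0∞, AEMeasurable f μ →
      eLpNorm (fun z => ∫⁻ ζ, k ζ z * f ζ ∂μ) s μ ≤ C * eLpNorm f p μ := by
  have ha' : 0 < min a 1 := lt_min ha one_pos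
  -- it suffices to treat `p ≤ s`
  suffices main : ∀ {p s : ℝ≥0∞}, 1 ≤ p → p ≤ s → (p⁻¹).toReal - a < (s⁻¹).toReal →
      ∃ C : ℝ≥0∞, C < ⊤ ∧ ∀ f : X → ℝ≥0∞, AEMeasurable f μ →
        eLpNorm (fun z => ∫⁻ ζ, k ζ z * f ζ ∂μ) s μ ≤ C * eLpNorm f p μ by
    rcases le_total p s with h | h
    · exact main hp h hps
    -- The pair `(p, p)` is admissible because `0 < a`, and over a finite measure `L^p` embeds in
    -- `L^s`.
    · obtain ⟨C, hC, hb⟩ := main (p := p) (s := p) hp le_rfl (by linarith)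
      refine ⟨μ univ ^ (1 / s.toReal - 1 / p.toReal) * C, ENNReal.mul_lt_top ?_ hC, fun f hf => ?_⟩
      · refine ENNReal.rpow_lt_top_of_nonneg ?_ (measure_ne_top μ _)
        have hs0 : 0 < s := zero_lt_one.trans_le hs
        rcases eq_or_ne p ⊤ with rfl | hpt
        · simp
        · have hst : s ≠ ⊤ := ne_top_of_le_ne_top hpt h
          have := one_div_le_one_div_of_le (ENNReal.toReal_pos hs0.ne' hst)
            (ENNReal.toReal_mono hpt h)
          linarith
      · refine (eLpNorm_le_eLpNorm_mul_rpow_measure_univ h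
          (aemeasurable_lintegral_schur hk hf).aestronglyMeasurable).trans ?_
        rw [mul_comm, mul_assoc]
        gcongr
        exact hb f hf
  intro p s hp hps' hlt
  rcases eq_or_ne s ⊤ with rfl | hst
  · -- the case `s = ∞`
    rcases eq_or_ne p ⊤ with rfl | hpt
    · obtain ⟨C, hC, h1, -⟩ := hint 1 zero_le_one (by linarith)
      refine ⟨C, hC, fun f hf => ?_⟩
      rw [eLpNorm_exponent_top, eLpNorm_exponent_top]
      refine eLpNormEssSup_le_of_ae_enorm_bound ?_
      filter_upwards [h1] with z hz
      have hfe : ∀ᵐ ζ ∂μ, f ζ ≤ eLpNormEssSup f μ := enorm_ae_le_eLpNormEssSup f μ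
      calc ∫⁻ ζ, k ζ z * f ζ ∂μ ≤ ∫⁻ ζ, k ζ z * eLpNormEssSup f μ ∂μ := by
            refine lintegral_mono_ae ?_
            filter_upwards [hfe] with ζ hζ
            gcongr
        _ = (∫⁻ ζ, k ζ z ∂μ) * eLpNormEssSup f μ :=
            lintegral_mul_const _ (hk.comp (measurable_id.prodMk measurable_const))
        _ ≤ _ := by
            gcongr
            simpa using hz
    · have hp0 : p ≠ 0 := (zero_lt_one.trans_le hp).ne'
      have hpr1 : 1 ≤ p.toReal := by
        have := ENNReal.toReal_mono hpt hp
        simpa using this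
      rw [ENNReal.inv_top, ENNReal.toReal_zero, ENNReal.toReal_inv] at hlt
      rcases hpr1.eq_or_lt with h1 | h1
      · -- the case `p = 1`
        rw [← h1, inv_one] at hlt
        -- For `p = 1` and `s = ∞` the hypothesis forces `1 < a`; the estimate then rests on
        -- boundedness of the kernel rather than on Hölder.
        obtain ⟨C, hC, hb⟩ := hbdd (by linarith)
        refine ⟨C, hC, fun f hf => ?_⟩
        rw [eLpNorm_exponent_top, eLpNorm_eq_lintegral_rpow_enorm_toReal hp0 hpt, ← h1]
        refine eLpNormEssSup_le_of_ae_enorm_bound ?_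
        filter_upwards [hb] with z hz
        simp only [ENNReal.rpow_one, div_one, enorm_eq_self]
        rw [← lintegral_const_mul'' _ hf]
        refine lintegral_mono_ae ?_
        filter_upwards [hz] with ζ hζ
        gcongr
      · have hconj : p.toReal.HolderConjugate (1 - p.toReal⁻¹)⁻¹ := by
          rw [Real.holderConjugate_iff]
          exact ⟨h1, by rw [inv_inv]; ring⟩
        have hpi : p.toReal⁻¹ < 1 := inv_lt_one_of_one_lt₀ h1
        obtain ⟨C, hC, hb, -⟩ := hint (1 - p.toReal⁻¹)⁻¹ (by
            rw [inv_nonneg]; linarith) (by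
          rw [inv_mul_lt_iff₀ (by linarith), mul_one]
          have : p.toReal⁻¹ < min a 1 := lt_min (by linarith) hpi
          linarith)
        refine ⟨C ^ (1 - p.toReal⁻¹), ENNReal.rpow_lt_top_of_nonneg (by linarith) hC.ne,
          fun f hf => ?_⟩
        rw [eLpNorm_exponent_top, eLpNorm_eq_lintegral_rpow_enorm_toReal hp0 hpt]
        refine eLpNormEssSup_le_of_ae_enorm_bound ?_
        filter_upwards [hb] with z hz
        have hkz : AEMeasurable (fun ζ => k ζ z) μ :=
          (hk.comp (measurable_id.prodMk measurable_const)).aemeasurable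
        have := ENNReal.lintegral_mul_le_Lp_mul_Lq μ hconj.symm hkz hf
        refine le_trans this ?_
        simp only [enorm_eq_self]
        gcongr
        rw [one_div, inv_inv]
        exact ENNReal.rpow_le_rpow hz (by linarith)
  · have hpt : p ≠ ⊤ := ne_top_of_le_ne_top hst hps'
    have hp0 : p ≠ 0 := (zero_lt_one.trans_le hp).ne'
    have hs0 : s ≠ 0 := (zero_lt_one.trans_le (hp.trans hps')).ne'
    have hpr1 : 1 ≤ p.toReal := by
      have := ENNReal.toReal_mono hpt hp
      simpa using this
    have hpsr : p.toReal ≤ s.toReal := ENNReal.toReal_mono hst hps'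
    rw [ENNReal.toReal_inv, ENNReal.toReal_inv, inv_eq_one_div, inv_eq_one_div] at hlt
    have hsr : 0 < s.toReal := by linarith
    have i0 : 0 < 1 / s.toReal := by positivity
    have i1 : 1 / p.toReal ≤ 1 := by rw [div_le_one (by linarith)]; exact hpr1
    have i2 : 0 < 1 - (1 / p.toReal - 1 / s.toReal) := by linarith
    obtain ⟨C, hC, h1, h2⟩ := hint (1 - (1 / p.toReal - 1 / s.toReal))⁻¹ (by positivity) (by
      rw [inv_mul_lt_iff₀ i2, mul_one]
      -- The difference is below one because `s` is finite.
      have : 1 / p.toReal - 1 / s.toReal < min a 1 := lt_min (by linarith) (by linarith)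
      linarith)
    refine ⟨C ^ (1 - 1 / p.toReal) * C ^ (1 / s.toReal), ENNReal.mul_lt_top
      (ENNReal.rpow_lt_top_of_nonneg (by linarith) hC.ne)
      (ENNReal.rpow_lt_top_of_nonneg i0.le hC.ne), fun f hf => ?_⟩
    rw [eLpNorm_eq_lintegral_rpow_enorm_toReal hs0 hst,
      eLpNorm_eq_lintegral_rpow_enorm_toReal hp0 hpt]
    exact lintegral_rpow_schur_le hk hpr1 hpsr h1 h2 hf

end Schur

/-! ### Gluing measurable functions along a countable index. -/

section GeneralMeasurability

variable {α V : Type*} [MeasurableSpace α] [TopologicalSpace V]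

theorem aestronglyMeasurable_of_index [TopologicalSpace.PseudoMetrizableSpace V] {μ : Measure α}
    {idx : α → ℕ} (hidx : Measurable idx) {f : ℕ → α → V}
    (h : ∀ i, AEStronglyMeasurable (f i) (μ.restrict (idx ⁻¹' {i}))) :
    AEStronglyMeasurable (fun a => f (idx a) a) μ := by
  have hu : (⋃ i, idx ⁻¹' {i}) = univ := by ext x; simp
  rw [← Measure.restrict_univ (μ := μ), ← hu, aestronglyMeasurable_iUnion_iff]
  intro i
  refine (h i).congr ?_
  filter_upwards [ae_restrict_mem (hidx (measurableSet_singleton i))] with a ha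
  rw [show idx a = i from ha]

theorem measurable_of_index {idx : α → ℕ} (hidx : Measurable idx) {f : ℕ → α → ℝ≥0∞}
    (h : ∀ i, Measurable (f i)) : Measurable (fun a => f (idx a) a) := by
  have h1 : Measurable fun p : ℕ × α => f p.1 p.2 := measurable_from_prod_countable_right h
  exact h1.comp (hidx.prodMk measurable_id)

theorem ContinuousOn.stronglyMeasurable_indicator [TopologicalSpace α] [OpensMeasurableSpace α]
    [SecondCountableTopology α] [Zero V] [TopologicalSpace.PseudoMetrizableSpace V]
    {f : α → V} {S : Set α} (hf : ContinuousOn f S) (hS : MeasurableSet S) :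
    StronglyMeasurable (S.indicator f) := by
  have h1 : StronglyMeasurable (S.domRestrict f) := hf.domRestrict.stronglyMeasurable
  have h2 := (MeasurableEmbedding.subtype_coe hS).stronglyMeasurable_extend h1
    (stronglyMeasurable_const (b := (0 : V)))
  convert h2 using 1
  ext1 x
  by_cases hx : x ∈ S
  · rw [indicator_of_mem hx]
    exact (Subtype.val_injective.extend_apply (S.domRestrict f) (fun _ => (0 : V)) ⟨x, hx⟩).symm
  · rw [indicator_of_notMem hx, Function.extend_apply']
    rintro ⟨y, rfl⟩
    exact hx y.2

end GeneralMeasurability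

/-! ### Measurability of kernels and a measurable choice of frames. -/

section KernelMeasurability

variable {n : ℕ} {X : Type*} [TopologicalSpace X] [ChartedSpace (Cn n) X]
  {r : X → ℝ} {D : Set X} {ρ χ : X → X → ℝ} {k l : ℕ} {τ : ℤ} {A : X → X → DForm n k l}

instance : TopologicalSpace.PseudoMetrizableSpace (DForm n k l) :=
  @PseudoEMetricSpace.pseudoMetrizableSpace (DForm n k l) _

theorem continuous_pullD (L L' : Cn n →L[ℝ] Cn n) :
    Continuous (pullD L L' : DForm n k l → DForm n k l) := by
  have h1 : Continuous fun A : DForm n k l => A.compContinuousLinearMap L :=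
    (ContinuousAlternatingMap.compContinuousLinearMapCLM L :
      DForm n k l →L[ℝ] DForm n k l).continuous
  exact (ContinuousLinearMap.compContinuousAlternatingMapCLM ℝ (Cn n) (Form n l) (Form n l) (Fin k)
    (ContinuousAlternatingMap.compContinuousLinearMapCLM L'
      : Form n l →L[ℝ] Form n l)).continuous.comp h1

/-- The frame of coordinate vectors at `x` of the preferred chart at `c`. -/
def tanFrame (c x : X) : Cn n →L[ℝ] Cn n := coordTan (chartAt (Cn n) c) (chartAt (Cn n) c x)

theorem coordDForm_chartAt (A : X → X → DForm n k l) {c c' ζ z : X}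
    (hζ : ζ ∈ (chartAt (Cn n) c).source) (hz : z ∈ (chartAt (Cn n) c').source) :
    coordDForm (chartAt (Cn n) c) (chartAt (Cn n) c') A (chartAt (Cn n) c ζ) (chartAt (Cn n) c' z) =
      pullD (tanFrame c ζ) (tanFrame c' z) (A ζ z) := by
  have h1 := (chartAt (Cn n) c).left_inv hζ
  have h2 := (chartAt (Cn n) c').left_inv hz
  change pullD _ _ (A _ _) = _
  rw [h1, h2]
  rfl

/-- The pairs of distinct points of `D` in the domains of a pair of preferred charts. -/
def chartPairs (n : ℕ) {X : Type*} [TopologicalSpace X] [ChartedSpace (Cn n) X] (D : Set X)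
    (c c' : X) : Set (X × X) :=
  {p | p.1 ∈ D ∧ p.2 ∈ D ∧ p.1 ∈ (chartAt (Cn n) c).source ∧ p.2 ∈ (chartAt (Cn n) c').source ∧
    p.1 ≠ p.2}

theorem isOpen_chartPairs [T2Space X] (hD : IsOpen D) (c c' : X) :
    IsOpen (chartPairs n D c c') := by
  have h1 := hD.preimage (continuous_fst (X := X) (Y := X))
  have h2 := hD.preimage (continuous_snd (X := X) (Y := X))
  have h3 := (chartAt (Cn n) c).open_source.preimage (continuous_fst (X := X) (Y := X))
  have h4 := (chartAt (Cn n) c').open_source.preimage (continuous_snd (X := X) (Y := X))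
  have h5 : IsOpen {p : X × X | p.1 ≠ p.2} := isOpen_ne_fun continuous_fst continuous_snd
  exact h1.inter (h2.inter (h3.inter (h4.inter h5)))

variable [RiemannianBundle (fun x : X => Tan n x)]

/-- For fixed ε the coordinate expression is continuous on an open set of pairs, so its extension by
zero is measurable. Along a sequence ε → 0 these extensions converge at every pair, since each pair
of points of `D` eventually lies in `D_ε`. -/
theorem IsKernelOfType.stronglyMeasurable_pullD [T2Space X] [SecondCountableTopology X]
    [MeasurableSpace X] [BorelSpace X] (hA : IsKernelOfType D r ρ χ τ A)
    (hD : IsHenkinLeitererDomain n D r) (c c' : X) :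
    StronglyMeasurable ((chartPairs n D c c').indicator fun p : X × X =>
      pullD (tanFrame c p.1) (tanFrame c' p.2) (A p.1 p.2)) := by
  obtain ⟨ε₀, F, hF, hlim⟩ := hA
  obtain ⟨ε, -, hε, hεlim⟩ := exists_seq_strictAnti_tendsto' hF.pos
  have hr : Continuous r := hD.smooth.continuous
  have hop : ∀ m, IsOpen (subDomain r (ε m)) := fun m =>
    isOpen_lt (hr.add continuous_const) continuous_const
  refine stronglyMeasurable_of_tendsto atTop
    (f := fun m => (chartPairs n (subDomain r (ε m)) c c').indicator fun p : X × X =>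
      pullD (tanFrame c p.1) (tanFrame c' p.2) (F (ε m) p.1 p.2)) (fun m => ?_) ?_
  · refine ContinuousOn.stronglyMeasurable_indicator ?_ (isOpen_chartPairs (hop m) c c').measurableSet
    have h1 := (hF.smooth (ε m) (hε m) c c').continuousOn
    have h2 : ContinuousOn (fun p : X × X => (chartAt (Cn n) c p.1, chartAt (Cn n) c' p.2))
        (chartPairs n (subDomain r (ε m)) c c') := by
      refine ContinuousOn.prodMk ?_ ?_
      · exact (chartAt (Cn n) c).continuousOn.comp continuousOn_fst fun p hp => hp.2.2.1
      · exact (chartAt (Cn n) c').continuousOn.comp continuousOn_snd fun p hp => hp.2.2.2.1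
    refine (h1.comp h2 ?_).congr fun p hp => (coordDForm_chartAt _ hp.2.2.1 hp.2.2.2.1).symm
    rintro p ⟨ha, hb, hc, hd, hne⟩
    have e1 := (chartAt (Cn n) c).left_inv hc
    have e2 := (chartAt (Cn n) c').left_inv hd
    refine ⟨(chartAt (Cn n) c).map_source hc, (chartAt (Cn n) c').map_source hd, ?_, ?_, ?_⟩
    · change (chartAt (Cn n) c).symm (chartAt (Cn n) c p.1) ∈ _
      rw [e1]; exact subset_closure ha
    · change (chartAt (Cn n) c').symm (chartAt (Cn n) c' p.2) ∈ _
      rw [e2]; exact subset_closure hb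
    · change (chartAt (Cn n) c).symm (chartAt (Cn n) c p.1) ≠
        (chartAt (Cn n) c').symm (chartAt (Cn n) c' p.2)
      rwa [e1, e2]
  · rw [tendsto_pi_nhds]
    intro p
    have hε' : Tendsto ε atTop (𝓝[>] 0) :=
      tendsto_nhdsWithin_iff.2 ⟨hεlim, Eventually.of_forall fun m => (hε m).1⟩
    by_cases hp : p ∈ chartPairs n D c c'
    · rw [indicator_of_mem hp]
      obtain ⟨ha, hb, hc, hd, hne⟩ := hp
      have h1 : r p.1 < 0 := by have := ha; rwa [hD.eq_neg] at this
      have h2 : r p.2 < 0 := by have := hb; rwa [hD.eq_neg] at this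
      have h3 := ((continuous_pullD (tanFrame c p.1) (tanFrame c' p.2)).tendsto _).comp
        ((hlim p.1 ha p.2 hb hne).comp hε')
      refine h3.congr' ?_
      filter_upwards [hε'.eventually (eventually_add_neg h1 hF.pos),
        hε'.eventually (eventually_add_neg h2 hF.pos)] with m hm hm'
      rw [indicator_of_mem]
      · rfl
      · exact ⟨hm.2, hm'.2, hc, hd, hne⟩
    -- As `D_ε ⊆ D`, a pair outside the limit set is outside all the approximating sets.
    · rw [indicator_of_notMem hp]
      refine tendsto_const_nhds.congr fun m => ?_
      rw [indicator_of_notMem]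
      intro hq
      refine hp ⟨?_, ?_, hq.2.2.1, hq.2.2.2.1, hq.2.2.2.2⟩
      · have : r p.1 + ε m < 0 := hq.1
        rw [hD.eq_neg]; have := (hε m).1; change r p.1 < 0; linarith
      · have : r p.2 + ε m < 0 := hq.2.1
        rw [hD.eq_neg]; have := (hε m).1; change r p.2 < 0; linarith

variable [IsManifold 𝓘(ℂ, Cn n) ω X]
  [IsContMDiffRiemannianBundle 𝓘(ℝ, Cn n) ∞ (Cn n) (fun x : X => Tan n x)]

variable (n) in
/-- A measurable choice of charts whose frames are uniformly comparable to the metric. -/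
structure IsFrameChoice (D : Set X) (c : ℕ → X) (idx : X → ℕ) (C : ℝ) : Prop where
  nonneg : 0 ≤ C
  mem_source : ∀ x ∈ D, x ∈ (chartAt (Cn n) (c (idx x))).source
  isFrame : ∀ x ∈ D, IsFrame x (tanFrame (n := n) (c (idx x)) x) C

/-- Finitely many charts cover the closure of `D`; each point of `D` takes the first suitable chart
in an enumeration, and the sum of the frame constants works for all. -/
theorem exists_isFrameChoice [MeasurableSpace X] [BorelSpace X] (hc : IsCompact (closure D))
    (hD : IsOpen D) (hne : D.Nonempty) :
    ∃ (c : ℕ → X) (idx : X → ℕ) (C : ℝ), Measurable idx ∧ IsFrameChoice n D c idx C := by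
  classical
  have h1 : ∀ x : X, ∃ C > 0, ∃ O : Set X, IsOpen O ∧ x ∈ O ∧ O ⊆ (chartAt (Cn n) x).source ∧
      ∀ y ∈ O, IsFrame y (tanFrame (n := n) x y) C := by
    intro x
    obtain ⟨C, hC, h⟩ := eventually_isFrame_coordTan (chartAt_mem_holCharts (n := n) x)
      (mem_chart_source (Cn n) x)
    obtain ⟨O, hO, hOo, hxO⟩ := mem_nhds_iff.1
      (h.and ((chartAt (Cn n) x).open_source.mem_nhds (mem_chart_source (Cn n) x)))
    exact ⟨C, hC, O, hOo, hxO, fun y hy => (hO hy).2, fun y hy => (hO hy).1⟩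
  choose C hC O hO hxO hOs hfr using h1
  obtain ⟨t, ht, hcov⟩ := hc.elim_nhds_subcover O fun x _ => (hO x).mem_nhds (hxO x)
  have htne : (t : Set X).Nonempty := by
    obtain ⟨x, hx⟩ := hne
    have := hcov (subset_closure hx)
    simp only [mem_iUnion] at this
    obtain ⟨y, hy, -⟩ := this
    exact ⟨y, hy⟩
  obtain ⟨c, hcr⟩ := t.countable_toSet.exists_eq_range htne
  -- The second alternative makes the search succeed at every point of `X`, so that the index is
  -- defined everywhere.
  have hp : ∀ x, ∃ N, x ∈ O (c N) ∨ x ∉ D := by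
    intro x
    by_cases hx : x ∈ D
    · have := hcov (subset_closure hx)
      simp only [mem_iUnion] at this
      obtain ⟨y, hy, hxy⟩ := this
      have : y ∈ range c := hcr ▸ (hy : y ∈ (t : Set X))
      obtain ⟨N, rfl⟩ := this
      exact ⟨N, Or.inl hxy⟩
    · exact ⟨0, Or.inr hx⟩
  refine ⟨c, fun x => Nat.find (hp x), ∑ y ∈ t, C y, measurable_find hp fun N => ?_, ?_, ?_, ?_⟩
  · exact ((hO (c N)).measurableSet).union hD.measurableSet.compl
  · exact Finset.sum_nonneg fun y _ => (hC y).le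
  · exact fun x hx => hOs _ ((Nat.find_spec (hp x)).resolve_right (not_not_intro hx))
  · intro x hx
    have h2 := hfr _ x ((Nat.find_spec (hp x)).resolve_right (not_not_intro hx))
    refine h2.mono ?_
    have : c (Nat.find (hp x)) ∈ t := by
      have : c (Nat.find (hp x)) ∈ (t : Set X) := hcr ▸ mem_range_self _
      exact this
    exact Finset.single_le_sum (f := C) (fun y _ => (hC y).le) this

end KernelMeasurability

/-! ### Joint measurability of the pairing and the positive kernel that dominates it. -/

section PairingMeasurability

variable {n : ℕ} {X : Type*} [TopologicalSpace X] [ChartedSpace (Cn n) X]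
  {r : X → ℝ} {D : Set X} {ρ χ : X → X → ℝ} {k l : ℕ} {τ : ℤ} {A : X → X → DForm n k l}

theorem norm_dform_zero : ‖(0 : DForm n k l)‖ = 0 :=
  @_root_.norm_zero (DForm n k l) _

theorem continuous_norm_dform : Continuous fun A : DForm n k l => ‖A‖ :=
  @_root_.continuous_norm (DForm n k l) _

theorem continuous_conjForm : Continuous (conjForm : Form n l → Form n l) :=
  (ContinuousLinearMap.compContinuousAlternatingMapCLM ℝ (Cn n) ℂ ℂ (Fin l)
    (Complex.conjCLE : ℂ →L[ℝ] ℂ)).continuous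

variable [RiemannianBundle (fun x : X => Tan n x)] [IsManifold 𝓘(ℂ, Cn n) ω X]
  [IsContMDiffRiemannianBundle 𝓘(ℝ, Cn n) ∞ (Cn n) (fun x : X => Tan n x)]

theorem tanFrame_bijective {c x : X} (hx : x ∈ (chartAt (Cn n) c).source) :
    Function.Bijective (tanFrame (n := n) c x) :=
  coordTan_bijective (chartAt_mem_holCharts c) ((chartAt (Cn n) c).map_source hx)

theorem continuousOn_gramMatrix_inv (c : X) :
    ContinuousOn (fun x => (gramMatrix (n := n) x (tanFrame c x))⁻¹) (chartAt (Cn n) c).source := by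
  set e := chartAt (Cn n) c with he
  have h1 : ContinuousOn (fun u => gramMatrix (e.symm u) (coordTan e u)) e.target :=
    continuousOn_pi.2 fun a => continuousOn_pi.2 fun b =>
      (continuousOn_inner_coordTan (chartAt_mem_holCharts c)).comp
        (f := fun u : Cn n => (u, realDir a, realDir b)) (by fun_prop) fun u hu => ⟨hu, trivial⟩
  have h2 : ContinuousOn (fun x => gramMatrix (n := n) x (tanFrame c x)) e.source := by
    refine (h1.comp e.continuousOn e.mapsTo).congr fun x hx => ?_
    change _ = gramMatrix (e.symm (e x)) (coordTan e (e x))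
    rw [e.left_inv hx]
    rfl
  intro x hx
  have h3 : (gramMatrix (n := n) x (tanFrame c x)).det ≠ 0 :=
    (det_gramMatrix_pos x (tanFrame_bijective hx).1).ne'
  refine ContinuousAt.comp_continuousWithinAt (g := Inv.inv) ?_ (h2 x hx)
  refine continuousAt_matrix_inv _ ?_
  rw [Ring.inverse_eq_inv']
  exact continuousAt_inv₀ h3

variable [MeasurableSpace X] [BorelSpace X] {c : ℕ → X} {idx : X → ℕ} {C : ℝ}

theorem IsFrameChoice.restrict_le (hc : IsFrameChoice n D c idx C) (hidx : Measurable idx)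
    (i : ℕ) :
    ((riemVolume n X).restrict D).restrict (idx ⁻¹' {i}) ≤
      (riemVolume n X).restrict (D ∩ (chartAt (Cn n) (c i)).source) := by
  rw [Measure.restrict_restrict (hidx (measurableSet_singleton i))]
  refine Measure.restrict_mono ?_ le_rfl
  rintro x ⟨hx, hxD⟩
  have := hc.mem_source x hxD
  rw [show idx x = i from hx] at this
  exact ⟨hxD, this⟩

theorem MeasurableForm.aestronglyMeasurable_tanFrame [T2Space X] [SecondCountableTopology X]
    {f : X → Form n k} (hf : MeasurableForm D f) (hD : MeasurableSet D) (c : X) :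
    AEStronglyMeasurable (fun x => (f x).compContinuousLinearMap (tanFrame c x))
      ((riemVolume n X).restrict (D ∩ (chartAt (Cn n) c).source)) := by
  refine (aestronglyMeasurable_comp_chart (chartAt_mem_holCharts c) hD (hf c)).congr ?_
  filter_upwards [ae_restrict_mem (hD.inter (chartAt (Cn n) c).open_source.measurableSet)] with x hx
  change (f ((chartAt (Cn n) c).symm (chartAt (Cn n) c x))).compContinuousLinearMap _ = _
  rw [(chartAt (Cn n) c).left_inv hx.2]
  rfl

theorem IsFrameChoice.aestronglyMeasurable_form [T2Space X] [SecondCountableTopology X]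
    (hc : IsFrameChoice n D c idx C)
    (hidx : Measurable idx) (hD : MeasurableSet D) {f : X → Form n k} (hf : MeasurableForm D f) :
    AEStronglyMeasurable (fun x => (f x).compContinuousLinearMap (tanFrame (c (idx x)) x))
      ((riemVolume n X).restrict D) :=
  aestronglyMeasurable_of_index hidx (f := fun i x => (f x).compContinuousLinearMap
    (tanFrame (c i) x)) fun i =>
      (hf.aestronglyMeasurable_tanFrame hD (c i)).mono_measure (hc.restrict_le hidx i)

theorem IsFrameChoice.aestronglyMeasurable_gramMatrix_inv [T2Space X] [SecondCountableTopology X]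
    (hc : IsFrameChoice n D c idx C) (hidx : Measurable idx) (hD : MeasurableSet D)
    (a b : Fin n × Fin 2) :
    AEStronglyMeasurable (fun x => (gramMatrix (n := n) x (tanFrame (c (idx x)) x))⁻¹ a b)
      ((riemVolume n X).restrict D) := by
  refine aestronglyMeasurable_of_index hidx (f := fun i x =>
    (gramMatrix (n := n) x (tanFrame (c i) x))⁻¹ a b) fun i => ?_
  refine AEStronglyMeasurable.mono_measure ?_ (hc.restrict_le hidx i)
  have hS := (chartAt (Cn n) (c i)).open_source.measurableSet
  refine ContinuousOn.aestronglyMeasurable ?_ (hD.inter hS)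
  exact (continuousOn_pi.1 (continuousOn_pi.1 (continuousOn_gramMatrix_inv (c i)) a) b).mono
    inter_subset_right

theorem ae_fst_ne_snd [T2Space X] [SecondCountableTopology X] (hn : 0 < n) {μ ν : Measure X}
    [SFinite ν] (hν : ν ≤ riemVolume n X) : ∀ᵐ p ∂(μ.prod ν), p.1 ≠ p.2 := by
  have hm : MeasurableSet {p : X × X | ¬ p.1 ≠ p.2} := by
    simpa using (isClosed_eq (continuous_fst (X := X) (Y := X)) continuous_snd).measurableSet
  rw [ae_iff]
  refine Measure.measure_prod_null_of_ae_null hm (Eventually.of_forall fun x => ?_)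
  refine measure_mono_null (t := {x}) (fun y hy => ?_)
    (le_antisymm ((hν _).trans (riemVolume_singleton hn x).le) zero_le)
  exact (not_not.1 hy).symm

/-- By `pairing_comp_eq` the pairing is a finite sum of products of entries of the inverse Gram
matrix, coefficients of `f` and coefficients of the kernel, each of which is measurable. -/
theorem IsFrameChoice.aestronglyMeasurable_pairing [T2Space X] [SecondCountableTopology X]
    (hn : 0 < n)
    (hc : IsFrameChoice n D c idx C) (hidx : Measurable idx) (hA : IsKernelOfType D r ρ χ τ A)
    (hD : IsHenkinLeitererDomain n D r) {f : X → Form n k} (hf : MeasurableForm D f) (c' : X) :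
    AEStronglyMeasurable (fun p : X × X =>
        (pairing p.1 (f p.1) (A p.1 p.2)).compContinuousLinearMap (tanFrame c' p.2))
      (((riemVolume n X).restrict D).prod
        ((riemVolume n X).restrict (D ∩ (chartAt (Cn n) c').source))) := by
  have hDm : MeasurableSet D := hD.isOpen.measurableSet
  have hS := hDm.inter (chartAt (Cn n) c').open_source.measurableSet
  set μ := (riemVolume n X).restrict D
  set ν := (riemVolume n X).restrict (D ∩ (chartAt (Cn n) c').source) with hν
  -- In the integration variable the frame is the measurable choice; in the other one the chart is
  -- fixed, because measurability of the resulting form is tested chart by chart.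
  let G : X × X → DForm n k l := fun p => (chartPairs n D (c (idx p.1)) c').indicator
    (fun q : X × X => pullD (tanFrame (c (idx p.1)) q.1) (tanFrame c' q.2) (A q.1 q.2)) p
  have hG : AEStronglyMeasurable G (μ.prod ν) := by
    have := aestronglyMeasurable_of_index (μ := μ.prod ν) (hidx.comp measurable_fst)
      (f := fun i => (chartPairs n D (c i) c').indicator
        (fun p : X × X => pullD (tanFrame (c i) p.1) (tanFrame c' p.2) (A p.1 p.2)))
      fun i => (hA.stronglyMeasurable_pullD hD (c i) c').aestronglyMeasurable
    refine this.congr (Eventually.of_forall fun p => ?_)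
    by_cases hp : p ∈ chartPairs n D (c (idx p.1)) c'
    · have h1 : G p = _ := indicator_of_mem hp _
      rw [h1]
      exact indicator_of_mem hp _
    · have h1 : G p = _ := indicator_of_notMem hp _
      rw [h1]
      exact indicator_of_notMem hp _
  have hF := hc.aestronglyMeasurable_form hidx hDm hf
  have key : AEStronglyMeasurable (fun p : X × X =>
      ((k.factorial : ℂ))⁻¹ • ∑ σ : Fin k → Fin n × Fin 2, ∑ σ' : Fin k → Fin n × Fin 2,
        (∏ i, (gramMatrix p.1 (tanFrame (c (idx p.1)) p.1))⁻¹ (σ i) (σ' i)) •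
          (((f p.1).compContinuousLinearMap (tanFrame (c (idx p.1)) p.1)) (fun i => realDir (σ i)) •
            conjForm (G p (fun i => realDir (σ' i))))) (μ.prod ν) := by
    refine AEStronglyMeasurable.fun_const_smul ?_ _
    refine Finset.aestronglyMeasurable_fun_sum _ fun σ _ => ?_
    refine Finset.aestronglyMeasurable_fun_sum _ fun σ' _ => ?_
    refine AEStronglyMeasurable.fun_smul ?_ (AEStronglyMeasurable.fun_smul ?_ ?_)
    · refine Finset.aestronglyMeasurable_fun_prod _ fun i _ => ?_
      exact (hc.aestronglyMeasurable_gramMatrix_inv hidx hDm (σ i) (σ' i)).comp_fst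
    · exact ((ContinuousAlternatingMap.apply ℝ (Cn n) ℂ
        (fun i => realDir (σ i))).continuous.comp_aestronglyMeasurable hF).comp_fst
    · exact (continuous_conjForm.comp (ContinuousAlternatingMap.apply ℝ (Cn n) (Form n l)
        (fun i => realDir (σ' i))).continuous).comp_aestronglyMeasurable hG
  refine key.congr ?_
  have h1 : ∀ᵐ p ∂(μ.prod ν), p.1 ∈ D := Measure.quasiMeasurePreserving_fst.ae (ae_restrict_mem hDm)
  have h2 : ∀ᵐ p ∂(μ.prod ν), p.2 ∈ D ∩ (chartAt (Cn n) c').source :=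
    Measure.quasiMeasurePreserving_snd.ae (ae_restrict_mem hS)
  filter_upwards [h1, h2, ae_fst_ne_snd hn (μ := μ) (ν := ν) Measure.restrict_le_self]
    with p hp1 hp2 hne
  have hs := hc.mem_source _ hp1
  have hp : p ∈ chartPairs n D (c (idx p.1)) c' := ⟨hp1, hp2.1, hs, hp2.2, hne⟩
  have hGp : G p = pullD (tanFrame (c (idx p.1)) p.1) (tanFrame c' p.2) (A p.1 p.2) :=
    indicator_of_mem hp _
  rw [pairing_comp_eq (tanFrame_bijective hs), hGp]

/-- The norm of the coordinate expression of a kernel in a choice of frames. -/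
def frameKernel (D : Set X) (c : ℕ → X) (idx : X → ℕ) (A : X → X → DForm n k l) (ζ z : X) : ℝ≥0∞ :=
  ENNReal.ofReal ‖(chartPairs n D (c (idx ζ)) (c (idx z))).indicator (fun p : X × X =>
    pullD (tanFrame (c (idx ζ)) p.1) (tanFrame (c (idx z)) p.2) (A p.1 p.2)) (ζ, z)‖

theorem IsKernelOfType.measurable_frameKernel [T2Space X] [SecondCountableTopology X]
    (hA : IsKernelOfType D r ρ χ τ A) (hD : IsHenkinLeitererDomain n D r) (hidx : Measurable idx) :
    Measurable (Function.uncurry (frameKernel D c idx A)) := by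
  have h1 : ∀ i, Measurable fun p : X × X => ENNReal.ofReal ‖(chartPairs n D (c (idx p.1)) (c i)).indicator
      (fun q : X × X => pullD (tanFrame (c (idx p.1)) q.1) (tanFrame (c i) q.2) (A q.1 q.2)) p‖ :=
    fun i => measurable_of_index (hidx.comp measurable_fst) (f := fun i' p =>
      ENNReal.ofReal ‖(chartPairs n D (c i') (c i)).indicator
        (fun q : X × X => pullD (tanFrame (c i') q.1) (tanFrame (c i) q.2) (A q.1 q.2)) p‖)
      fun i' => (continuous_norm_dform.comp_stronglyMeasurable
        (hA.stronglyMeasurable_pullD hD (c i') (c i))).measurable.ennreal_ofReal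
  exact measurable_of_index (hidx.comp measurable_snd) h1

theorem IsFrameChoice.frameKernel_le (hc : IsFrameChoice n D c idx C) (ζ z : X) :
    frameKernel D c idx A ζ z ≤ ENNReal.ofReal (frameConst n k C * frameConst n l C) *
      ENNReal.ofReal (dformNorm ζ z (A ζ z)) := by
  unfold frameKernel
  by_cases h : (ζ, z) ∈ chartPairs n D (c (idx ζ)) (c (idx z))
  · rw [indicator_of_mem h,
      ← ENNReal.ofReal_mul (mul_nonneg (frameConst_nonneg hc.nonneg) (frameConst_nonneg hc.nonneg)),
      mul_assoc]
    exact ENNReal.ofReal_le_ofReal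
      ((hc.isFrame ζ h.1).norm_pullD_le hc.nonneg (hc.isFrame z h.2.1) _)
  · rw [indicator_of_notMem h, norm_dform_zero, ENNReal.ofReal_zero]; exact zero_le

theorem frameKernel_eq_zero {ζ z : X} (h : ζ = z) :
    frameKernel D c idx A ζ z = 0 := by
  unfold frameKernel
  rw [indicator_of_notMem, norm_dform_zero, ENNReal.ofReal_zero]
  exact fun h' => h'.2.2.2.2 h

/-- The pairing is bounded by the product of the coordinate expressions of the form and the
kernel. -/
theorem IsFrameChoice.enorm_pairing_le (hc : IsFrameChoice n D c idx C) (f : X → Form n k)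
    {ζ z : X} (hζ : ζ ∈ D) (hz : z ∈ D) (hne : ζ ≠ z) :
    ‖(pairing ζ (f ζ) (A ζ z)).compContinuousLinearMap (tanFrame (c (idx z)) z)‖ₑ ≤
      ENNReal.ofReal (((2 * n : ℕ) : ℝ) ^ k * (C ^ k * C ^ k)) *
        (frameKernel D c idx A ζ z *
          ‖(f ζ).compContinuousLinearMap (tanFrame (c (idx ζ)) ζ)‖ₑ) := by
  have hm : (ζ, z) ∈ chartPairs n D (c (idx ζ)) (c (idx z)) :=
    ⟨hζ, hz, hc.mem_source ζ hζ, hc.mem_source z hz, hne⟩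
  have h := (hc.isFrame ζ hζ).norm_pairing_comp_le hc.nonneg (tanFrame (c (idx z)) z) (f ζ) (A ζ z)
  have hC := hc.nonneg
  unfold frameKernel
  rw [indicator_of_mem hm, mul_comm (ENNReal.ofReal _) ‖_‖ₑ, ← ofReal_norm, ← ofReal_norm,
    ← ENNReal.ofReal_mul (norm_nonneg _), ← ENNReal.ofReal_mul (by positivity)]
  exact ENNReal.ofReal_le_ofReal h

end PairingMeasurability

/-! ### The kernel operator on forms. -/

section KernelOperator

variable {n : ℕ} {X : Type*} [TopologicalSpace X] [ChartedSpace (Cn n) X]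
  {r : X → ℝ} {D : Set X} {ρ χ : X → X → ℝ} {k l : ℕ} {τ : ℤ} {A : X → X → DForm n k l}
  [RiemannianBundle (fun x : X => Tan n x)] [IsManifold 𝓘(ℂ, Cn n) ω X]
  [IsContMDiffRiemannianBundle 𝓘(ℝ, Cn n) ∞ (Cn n) (fun x : X => Tan n x)]
  [MeasurableSpace X] [BorelSpace X] {c : ℕ → X} {idx : X → ℕ} {C : ℝ} [T2Space X]

theorem IsHenkinLeitererDomain.isFiniteMeasure (hD : IsHenkinLeitererDomain n D r) :
    IsFiniteMeasure ((riemVolume n X).restrict D) :=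
  ⟨by
    rw [Measure.restrict_apply_univ]
    exact (measure_mono subset_closure).trans_lt hD.isCompact_closure.measure_lt_top⟩

theorem IsHenkinLeitererDomain.ae_not_isCrit (hn : 0 < n) (hD : IsHenkinLeitererDomain n D r) :
    ∀ᵐ z ∂((riemVolume n X).restrict D), z ∈ D ∧ ¬ IsCrit n r z := by
  have h1 : ∀ᵐ z ∂((riemVolume n X).restrict D), z ∉ {x | x ∈ closure D ∧ IsCrit n r x} :=
    ae_restrict_of_ae (measure_eq_zero_iff_ae_notMem.1 (riemVolume_crit hn hD))
  filter_upwards [h1, ae_restrict_mem hD.isOpen.measurableSet] with z hz hzD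
  exact ⟨hzD, fun h => hz ⟨subset_closure hzD, h⟩⟩

/-- The `L^p`-`L^s` bound for the positive operator dominating a kernel operator. -/
theorem IsFrameChoice.exists_eLpNorm_frameKernel_le [SecondCountableTopology X] (hn : 0 < n)
    (hc : IsFrameChoice n D c idx C) (hidx : Measurable idx) (hA : IsKernelOfType D r ρ χ τ A)
    (hD : IsHenkinLeitererDomain n D r) (hρ : IsDistanceLike n ρ) (hχ : IsPatching n ρ χ)
    (hτ : 1 ≤ τ) {p s : ℝ≥0∞} (hp : 1 ≤ p) (hs : 1 ≤ s)
    (hps : (p⁻¹).toReal - (τ : ℝ) / (2 * (n : ℝ) + 2) < (s⁻¹).toReal) :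
    ∃ B : ℝ≥0∞, B < ⊤ ∧ ∀ F : X → ℝ≥0∞, AEMeasurable F ((riemVolume n X).restrict D) →
      eLpNorm (fun z => ∫⁻ ζ in D, frameKernel D c idx A ζ z * F ζ ∂(riemVolume n X)) s
        ((riemVolume n X).restrict D) ≤ B * eLpNorm F p ((riemVolume n X).restrict D) := by
  have := hD.isFiniteMeasure
  have hτ1 : (1 : ℝ) ≤ τ := by exact_mod_cast hτ
  have hM : (0 : ℝ) < 2 * n + 2 := by positivity
  set K := ENNReal.ofReal (frameConst n k C * frameConst n l C)
  have hae := hD.ae_not_isCrit hn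
  refine exists_eLpNorm_schur_le (hA.measurable_frameKernel hD hidx)
    (a := (τ : ℝ) / (2 * (n : ℝ) + 2)) (by positivity) ?_ ?_ hp hs hps
  · intro q hq hq1
    -- Twice the condition `q * (1 - min a 1) < 1` for `a = τ / (2n + 2)`.
    have hq2 : q * (2 - (min τ (2 * n + 2) : ℝ) / (n + 1)) < 2 := by
      have e : (min τ (2 * n + 2) : ℝ) / (n + 1) = 2 * min ((τ : ℝ) / (2 * n + 2)) 1 := by
        have := min_div_div_right hM.le (τ : ℝ) (2 * n + 2)
        rw [div_self hM.ne'] at this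
        rw [this]
        field_simp
      rw [e]
      linarith
    obtain ⟨C₁, hC₁, h₁⟩ := hA.exists_lintegral_left_le hn hD hρ hχ (by lia) hq hq2
    obtain ⟨C₂, hC₂, h₂⟩ := hA.exists_lintegral_right_le hn hD hρ hχ (by lia) hq hq2
    have hKt : K ^ q ≠ ⊤ := ENNReal.rpow_ne_top_of_nonneg hq ENNReal.ofReal_ne_top
    have hle : ∀ ζ z, frameKernel D c idx A ζ z ^ q ≤
        K ^ q * ENNReal.ofReal (dformNorm ζ z (A ζ z)) ^ q := fun ζ z => by
      rw [← ENNReal.mul_rpow_of_nonneg _ _ hq]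
      exact ENNReal.rpow_le_rpow (hc.frameKernel_le ζ z) hq
    refine ⟨K ^ q * (C₁ + C₂),
      ENNReal.mul_lt_top hKt.lt_top (ENNReal.add_lt_top.2 ⟨hC₁, hC₂⟩), ?_, ?_⟩
    · filter_upwards [hae] with z hz
      refine (lintegral_mono fun ζ => hle ζ z).trans ?_
      rw [lintegral_const_mul' _ _ hKt]
      exact mul_le_mul_right ((h₁ z hz.1 hz.2).trans le_self_add) _
    · filter_upwards [hae] with ζ hζ
      refine (lintegral_mono fun z => hle ζ z).trans ?_
      rw [lintegral_const_mul' _ _ hKt]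
      exact mul_le_mul_right ((h₂ ζ hζ.1 hζ.2).trans le_add_self) _
  · intro ha
    rw [one_le_div hM] at ha
    obtain ⟨B, hB⟩ := hA.exists_bound hn hD hρ hχ (by exact_mod_cast ha)
    refine ⟨K * ENNReal.ofReal B, ENNReal.mul_lt_top ENNReal.ofReal_lt_top ENNReal.ofReal_lt_top, ?_⟩
    filter_upwards [hae] with z hz
    filter_upwards [hae] with ζ hζ
    by_cases h : ζ = z
    · rw [frameKernel_eq_zero h]; exact zero_le
    · exact (hc.frameKernel_le ζ z).trans
        (mul_le_mul_right (ENNReal.ofReal_le_ofReal (hB ζ hζ.1 z hz.1 h hζ.2 hz.2)) _)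

theorem IsFrameChoice.lintegral_enorm_pairing_le (hn : 0 < n) (hc : IsFrameChoice n D c idx C)
    (hD : MeasurableSet D) (f : X → Form n k) {z : X} (hz : z ∈ D) :
    ∫⁻ ζ in D, ‖(pairing ζ (f ζ) (A ζ z)).compContinuousLinearMap (tanFrame (c (idx z)) z)‖ₑ
        ∂(riemVolume n X) ≤
      ENNReal.ofReal (((2 * n : ℕ) : ℝ) ^ k * (C ^ k * C ^ k)) *
        ∫⁻ ζ in D, frameKernel D c idx A ζ z *
          ‖(f ζ).compContinuousLinearMap (tanFrame (c (idx ζ)) ζ)‖ₑ ∂(riemVolume n X) := by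
  rw [← lintegral_const_mul' _ _ ENNReal.ofReal_ne_top]
  have h1 : ∀ᵐ ζ ∂((riemVolume n X).restrict D), ζ ∉ ({z} : Set X) :=
    ae_restrict_of_ae (measure_eq_zero_iff_ae_notMem.1 (riemVolume_singleton hn z))
  refine lintegral_mono_ae ?_
  filter_upwards [h1, ae_restrict_mem hD] with ζ hne hζ
  exact hc.enorm_pairing_le f hζ hz hne

/-- The kernel operator is defined almost everywhere as an absolutely convergent integral. -/
theorem IsFrameChoice.ae_integrableOn_pairing [SecondCountableTopology X] (hn : 0 < n)
    (hc : IsFrameChoice n D c idx C) (hidx : Measurable idx) (hA : IsKernelOfType D r ρ χ τ A)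
    (hD : IsHenkinLeitererDomain n D r) {f : X → Form n k} (hf : MeasurableForm D f)
    (hfin : ∀ᵐ z ∂((riemVolume n X).restrict D), ∫⁻ ζ in D, frameKernel D c idx A ζ z *
          ‖(f ζ).compContinuousLinearMap (tanFrame (c (idx ζ)) ζ)‖ₑ ∂(riemVolume n X) < ⊤) :
    ∀ᵐ z ∂((riemVolume n X).restrict D),
      IntegrableOn (fun ζ => pairing ζ (f ζ) (A ζ z)) D (riemVolume n X) := by
  have := hD.isFiniteMeasure
  have hDm : MeasurableSet D := hD.isOpen.measurableSet
  -- The chart used at `z` depends on `z`; with countably many indices one null set serves all of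
  -- them.
  have h1 : ∀ᵐ z ∂(riemVolume n X), ∀ i, z ∈ D ∩ (chartAt (Cn n) (c i)).source →
      AEStronglyMeasurable (fun ζ => (pairing ζ (f ζ) (A ζ z)).compContinuousLinearMap
        (tanFrame (c i) z)) ((riemVolume n X).restrict D) := by
    refine ae_all_iff.2 fun i => ?_
    rw [← ae_restrict_iff' (hDm.inter (chartAt (Cn n) (c i)).open_source.measurableSet)]
    exact (hc.aestronglyMeasurable_pairing hn hidx hA hD hf (c i)).prodMk_right
  filter_upwards [ae_restrict_of_ae h1, ae_restrict_mem hDm, hfin] with z hz hzD hzf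
  have hs := hc.mem_source z hzD
  have h2 : Integrable (fun ζ => (pairing ζ (f ζ) (A ζ z)).compContinuousLinearMap
      (tanFrame (c (idx z)) z)) ((riemVolume n X).restrict D) :=
    ⟨hz (idx z) ⟨hzD, hs⟩, (hc.lintegral_enorm_pairing_le hn hDm f hzD).trans_lt
      (ENNReal.mul_lt_top ENNReal.ofReal_lt_top hzf)⟩
  -- Integrability is known for the pullback by the frame at `z`; composing with the inverse frame,
  -- a continuous linear operation on forms, recovers the pairing itself.
  let J : Cn n ≃L[ℝ] Cn n := (LinearEquiv.ofBijective (tanFrame (c (idx z)) z).toLinearMap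
    (tanFrame_bijective hs)).toContinuousLinearEquiv
  have hJ : ∀ v, tanFrame (c (idx z)) z (J.symm v) = v := fun v => J.apply_symm_apply v
  have h3 := ContinuousLinearMap.integrable_comp (ContinuousAlternatingMap.compContinuousLinearMapCLM
    (J.symm : Cn n →L[ℝ] Cn n) : Form n l →L[ℝ] Form n l) h2
  refine h3.congr (Eventually.of_forall fun ζ => ?_)
  ext v
  change (pairing ζ (f ζ) (A ζ z)) (fun i => tanFrame (c (idx z)) z (J.symm (v i))) = _
  simp only [hJ]

theorem kernelOp_comp {f : X → Form n k} {z : X}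
    (h : IntegrableOn (fun ζ => pairing ζ (f ζ) (A ζ z)) D (riemVolume n X))
    (L : Cn n →L[ℝ] Cn n) :
    (kernelOp D A f z).compContinuousLinearMap L =
      ∫ ζ in D, (pairing ζ (f ζ) (A ζ z)).compContinuousLinearMap L ∂(riemVolume n X) :=
  ((ContinuousAlternatingMap.compContinuousLinearMapCLM L :
    Form n l →L[ℝ] Form n l).integral_comp_comm h).symm

/-- In each preferred chart the result is a partial integral of a jointly measurable function, and
pullback commutes with the integral wherever the latter converges. -/
theorem IsFrameChoice.measurableForm_kernelOp [SecondCountableTopology X] (hn : 0 < n)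
    (hc : IsFrameChoice n D c idx C) (hidx : Measurable idx) (hA : IsKernelOfType D r ρ χ τ A)
    (hD : IsHenkinLeitererDomain n D r) {f : X → Form n k} (hf : MeasurableForm D f)
    (hint : ∀ᵐ z ∂((riemVolume n X).restrict D),
      IntegrableOn (fun ζ => pairing ζ (f ζ) (A ζ z)) D (riemVolume n X)) :
    MeasurableForm D (kernelOp D A f) := by
  intro x
  have := hD.isFiniteMeasure
  have hDm : MeasurableSet D := hD.isOpen.measurableSet
  set e := chartAt (Cn n) x with he
  have hS := hDm.inter e.open_source.measurableSet
  have h1 : AEStronglyMeasurable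
      (fun z => (kernelOp D A f z).compContinuousLinearMap (tanFrame x z))
      ((riemVolume n X).restrict (D ∩ e.source)) := by
    refine (hc.aestronglyMeasurable_pairing hn hidx hA hD hf x).prod_swap.integral_prod_right'.congr
      ?_
    filter_upwards [ae_restrict_of_ae_restrict_of_subset inter_subset_left hint] with z hz
    exact (kernelOp_comp hz (tanFrame x z)).symm
  have h2 := aestronglyMeasurable_comp_chart_symm x hS h1
  have h3 : e.target ∩ e.symm ⁻¹' (D ∩ e.source) = e.target ∩ e.symm ⁻¹' D := by
    ext u
    exact ⟨fun h => ⟨h.1, h.2.1⟩, fun h => ⟨h.1, h.2, e.map_target h.1⟩⟩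
  rw [← he, h3] at h2
  refine h2.congr ?_
  filter_upwards [ae_restrict_mem (measurableSet_target_inter_preimage e hDm)] with u hu
  change (kernelOp D A f (e.symm u)).compContinuousLinearMap (coordTan e (e (e.symm u))) = _
  rw [e.right_inv hu.1]
  rfl

theorem IsFrameChoice.enorm_formNorm_kernelOp_le (hn : 0 < n) (hc : IsFrameChoice n D c idx C)
    (hD : MeasurableSet D) {f : X → Form n k} {z : X} (hz : z ∈ D)
    (h : IntegrableOn (fun ζ => pairing ζ (f ζ) (A ζ z)) D (riemVolume n X)) :
    ‖formNorm z (kernelOp D A f z)‖ₑ ≤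
      ENNReal.ofReal (frameConst n l C) *
        (ENNReal.ofReal (((2 * n : ℕ) : ℝ) ^ k * (C ^ k * C ^ k)) *
          ∫⁻ ζ in D, frameKernel D c idx A ζ z *
            ‖(f ζ).compContinuousLinearMap (tanFrame (c (idx ζ)) ζ)‖ₑ ∂(riemVolume n X)) := by
  rw [Real.enorm_of_nonneg (formNorm_nonneg _ _)]
  refine (ENNReal.ofReal_le_ofReal ((hc.isFrame z hz).formNorm_le hc.nonneg _)).trans ?_
  rw [ENNReal.ofReal_mul (frameConst_nonneg hc.nonneg), ofReal_norm, kernelOp_comp h]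
  refine mul_le_mul_right ?_ _
  exact (enorm_integral_le_lintegral_enorm _).trans (hc.lintegral_enorm_pairing_le hn hD f hz)

/-- Operators with a kernel of positive type map `L^p` boundedly to `L^s`. -/
theorem IsKernelOfType.exists_lpNorm_kernelOp_le [SecondCountableTopology X] (hn : 0 < n)
    (hA : IsKernelOfType D r ρ χ τ A) (hD : IsHenkinLeitererDomain n D r)
    (hρ : IsDistanceLike n ρ) (hχ : IsPatching n ρ χ) (hτ : 1 ≤ τ) {p s : ℝ≥0∞} (hp : 1 ≤ p)
    (hs : 1 ≤ s) (hps : (p⁻¹).toReal - (τ : ℝ) / (2 * (n : ℝ) + 2) < (s⁻¹).toReal) :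
    ∃ C : ℝ, 0 ≤ C ∧ ∀ f : X → Form n k, MemLpForm D p f →
      (∀ᵐ z ∂((riemVolume n X).restrict D),
        IntegrableOn (fun ζ => pairing ζ (f ζ) (A ζ z)) D (riemVolume n X)) ∧
      MemLpForm D s (kernelOp D A f) ∧
      lpNorm D s (kernelOp D A f) ≤ ENNReal.ofReal C * lpNorm D p f := by
  rcases D.eq_empty_or_nonempty with rfl | hne
  · refine ⟨0, le_rfl, fun f _ => ⟨by simp, ⟨fun x => by simp, ?_⟩, ?_⟩⟩ <;> simp [lpNorm]
  have := hD.isFiniteMeasure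
  have hDm : MeasurableSet D := hD.isOpen.measurableSet
  obtain ⟨c, idx, C, hidx, hc⟩ := exists_isFrameChoice (n := n) hD.isCompact_closure hD.isOpen hne
  obtain ⟨B, hB, hBs⟩ := hc.exists_eLpNorm_frameKernel_le hn hidx hA hD hρ hχ hτ hp hs hps
  -- The pair `(p, 1)` is always admissible. Its `L^1` bound makes the dominating integral finite
  -- almost everywhere, which is the absolute convergence claimed.
  have hp1 : (p⁻¹).toReal - (τ : ℝ) / (2 * (n : ℝ) + 2) < ((1 : ℝ≥0∞)⁻¹).toReal := by
    have h1 : (p⁻¹).toReal ≤ 1 := by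
      have := ENNReal.toReal_mono ENNReal.one_ne_top (ENNReal.inv_le_one.2 hp)
      simpa using this
    have h2 : (0 : ℝ) < (τ : ℝ) / (2 * (n : ℝ) + 2) := by
      have : (0 : ℝ) < τ := by exact_mod_cast (zero_lt_one.trans_le hτ)
      positivity
    simp only [inv_one, ENNReal.toReal_one]
    linarith
  obtain ⟨B', hB', hB1⟩ := hc.exists_eLpNorm_frameKernel_le hn hidx hA hD hρ hχ hτ hp le_rfl hp1
  set μ := (riemVolume n X).restrict D with hμ
  set K := ENNReal.ofReal (frameConst n l C) *
    ENNReal.ofReal (((2 * n : ℕ) : ℝ) ^ k * (C ^ k * C ^ k)) with hK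
  have hKt : K < ⊤ := ENNReal.mul_lt_top ENNReal.ofReal_lt_top ENNReal.ofReal_lt_top
  set E := K * (B * ENNReal.ofReal (frameConst n k C)) with hE
  have hEt : E < ⊤ := ENNReal.mul_lt_top hKt (ENNReal.mul_lt_top hB ENNReal.ofReal_lt_top)
  refine ⟨E.toReal, ENNReal.toReal_nonneg, fun f hf => ?_⟩
  rw [ENNReal.ofReal_toReal hEt.ne]
  set F : X → ℝ≥0∞ := fun ζ => ‖(f ζ).compContinuousLinearMap (tanFrame (c (idx ζ)) ζ)‖ₑ with hF
  have hFm : AEMeasurable F μ := (hc.aestronglyMeasurable_form hidx hDm hf.1).enorm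
  have hFp : eLpNorm F p μ ≤ ENNReal.ofReal (frameConst n k C) * lpNorm D p f := by
    rw [hF, eLpNorm_enorm]
    refine eLpNorm_le_mul_eLpNorm_of_ae_le_mul ?_ p
    filter_upwards [ae_restrict_mem hDm] with ζ hζ
    rw [Real.norm_of_nonneg (formNorm_nonneg _ _)]
    exact (hc.isFrame ζ hζ).norm_comp_le_formNorm hc.nonneg _
  have hfin : ∀ᵐ z ∂μ, ∫⁻ ζ, frameKernel D c idx A ζ z * F ζ ∂μ < ⊤ := by
    refine ae_lt_top' (aemeasurable_lintegral_schur (hA.measurable_frameKernel hD hidx) hFm) ?_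
    have h1 := hB1 F hFm
    rw [eLpNorm_one_eq_lintegral_enorm] at h1
    simp only [enorm_eq_self] at h1
    refine (h1.trans_lt (ENNReal.mul_lt_top hB' (hFp.trans_lt ?_))).ne
    exact ENNReal.mul_lt_top ENNReal.ofReal_lt_top hf.2
  have hint := hc.ae_integrableOn_pairing hn hidx hA hD hf.1 hfin
  have hbound : lpNorm D s (kernelOp D A f) ≤ E * lpNorm D p f := by
    have h1 : eLpNorm (fun z => formNorm z (kernelOp D A f z)) s μ ≤
        (K.toNNReal : ℝ≥0∞) *
          eLpNorm (fun z => ∫⁻ ζ, frameKernel D c idx A ζ z * F ζ ∂μ) s μ := by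
      refine eLpNorm_le_mul_eLpNorm_of_ae_le_mul' ?_ s
      filter_upwards [hint, ae_restrict_mem hDm] with z hz hzD
      rw [ENNReal.coe_toNNReal hKt.ne, enorm_eq_self, hK, mul_assoc]
      exact hc.enorm_formNorm_kernelOp_le hn hDm hzD hz
    rw [ENNReal.coe_toNNReal hKt.ne] at h1
    refine h1.trans ?_
    rw [hE, mul_assoc K, mul_assoc B]
    exact mul_le_mul_right ((hBs F hFm).trans (mul_le_mul_right hFp _)) _
  exact ⟨hint, ⟨hc.measurableForm_kernelOp hn hidx hA hD hf.1 hint,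
    hbound.trans_lt (ENNReal.mul_lt_top hEt hf.2)⟩, hbound⟩

end KernelOperator

end HenkinLeiterer

end

theorem mainTheorem7 {n : ℕ} (hn : 0 < n)
    {X : Type*} [TopologicalSpace X] [T2Space X] [SecondCountableTopology X]
    [ChartedSpace (Cn n) X] [IsManifold 𝓘(ℂ, Cn n) ω X] [MeasurableSpace X] [BorelSpace X]
    [RiemannianBundle (fun x : X => Tan n x)]
    [IsContMDiffRiemannianBundle 𝓘(ℝ, Cn n) ∞ (Cn n) (fun x : X => Tan n x)]
    (D : Set X) (r : X → ℝ) (ρ χ : X → X → ℝ)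
    (hD : IsHenkinLeitererDomain n D r) (hg : IsLeviMetric n D r)
    (hρ : IsDistanceLike n ρ) (hχ : IsPatching n ρ χ)
    {k l : ℕ} (j : ℤ) (hj : 1 ≤ j) (A : X → X → DForm n k l)
    (hA : IsKernelOfType D r ρ χ j A)
    (p s : ℝ≥0∞) (hp : 1 ≤ p) (hs : 1 ≤ s)
    (hps : (p⁻¹).toReal - (j : ℝ) / (2 * (n : ℝ) + 2) < (s⁻¹).toReal) :
    ∃ C : ℝ, 0 ≤ C ∧ ∀ f : X → Form n k, MemLpForm D p f →
      (∀ᵐ z ∂((riemVolume n X).restrict D),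
        IntegrableOn (fun ζ => pairing ζ (f ζ) (A ζ z)) D (riemVolume n X)) ∧
      MemLpForm D s (kernelOp D A f) ∧
      lpNorm D s (kernelOp D A f) ≤ ENNReal.ofReal C * lpNorm D p f :=
  hA.exists_lpNorm_kernelOp_le hn hD hρ hχ hj hp hs hps
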